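/- Let $\mathcal A$ be a set. **Formulas** are generated by $F ::= a \mid a^\bot \mid \mathsf 1 \mid \bot \mid F\otimes F \mid F ⅋ F$ ($a\in\mathcal A$), and **linkings** by $L ::= \mathsf 1 \mid a\otimes a^\bot \mid a^\bot\otimes a \mid \bot\otimes L \mid L\otimes\bot \mid L ⅋ L$; both are regarded as binary trees with decorated leaves. Negation is defined by $(a)^\bot=a^\bot$, $(a^\bot)^\bot=a$, $\mathsf 1^\bot=\bot$, $\bot^\bot=\mathsf 1$, $(A\otimes B)^\bot=B^\bot ⅋ A^\bot$, $(A ⅋ B)^\bot=B^\bot\otimes A^\bot$. A sequent is a finite list of formulas; a sequent with cuts may also contain cuts $A⦶A^\bot$ (the order of the two sides is irrelevant). A **pre-proof graph** $P\rhd\Gamma$ is a linking $P$ and a sequent (with cuts) $\Gamma$ together with an identification of the leaves of $P$ with those of $\Gamma$ that respects decorations; it is viewed as a graph, a cut being treated as a $\otimes$-node. A *switching* omits, for each $⅋$-node, one of the two edges to its children; $P\rhd\Gamma$ is *correct* if all its switchings are connected and acyclic. Let $\sim$ be the smallest equivalence relation on pre-proof graphs such that, in every linking context $P\{\ \}$ and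 with $\Gamma$ fixed, $$Q⅋R\sim R⅋Q,\quad (Q⅋R)⅋S\sim Q⅋(R⅋S),\quad Q\otimes R\sim R\otimes Q,\quad \bot_i\otimes(Q\otimes\bot_j)\sim(\bot_i\otimes Q)\otimes\bot_j,$$ $$Q⅋(R\otimes\bot_i)\sim(Q⅋R)\otimes\bot_i,$$ the last one only if, in every graph obtained from a switching of the left-hand pre-proof graph $P\{Q⅋(R\otimes\bot_i)\}\rhd\Gamma$ by deleting the edge between $\bot_i$ and its parent in the linking, no node of $Q$ is connected to $\bot_i$. A **proof net** $[P\rhd\Gamma]$ is an equivalence class containing a correct element. **Cut reduction** on graphs replaces (the cut standing anywhere in the sequent) $(A⅋B)⦶(B^\bot\otimes A^\bot)$ by $A⦶A^\bot,\,B⦶B^\bot$ with the same linking; $P\{(a^\bot_h\otimes a_i)⅋(a^\bot_j\otimes a_k)\}\rhd a_i⦶a_j^\bot,\Gamma$ by $P\{a^\bot_h\otimes a_k\}\rhd\Gamma$; and $P\{(Q\otimes\bot_i)⅋\mathsf 1_j\}\rhd\bot_i⦶\mathsf 1_j,\Gamma$ by $P\{Q\}\rhd\Gamma$. A proof net reduces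 to another one if some correct representative of the first reduces to some correct representative of the second. Identity linkings are $I_a=I_{a^\bot}=a\otimes a^\bot$, $I_{\mathsf 1}=I_\bot=\bot\otimes\mathsf 1$, $I_{A\otimes B}=I_{A⅋B}=I_A⅋I_B$. **Proposition.** For every set $\mathcal A$: 1. There is a category $\mathbf{PN}(\mathcal A)$ whose objects are the formulas, whose arrows $A\to B$ are the cut-free proof nets $[P\rhd A^\bot,B]$, with identities $[I_A\rhd A^\bot,A]$, and in which the composite of $f=[P\rhd A^\bot,B]$ and $g=[Q\rhd B^\bot,C]$ is the result of cut elimination in $[P⅋Q\rhd A^\bot,B⦶B^\bot,C]$: for all representatives $P,Q$ this net has exactly one normal form, namely the cut-free net $g\circ f$. 2. $\mathbf{PN}(\mathcal A)$ is a strict $*$-autonomous category, that is, a symmetric monoidal category with a contravariant functor $(-)^\bot$, a natural isomorphism $A^{\bot\bot}\to A$ which is the identity for every $A$ (in particular $A^{\bot\bot}=A$), and a bijection $\mathrm{Hom}(A\otimes B,C)\cong\mathrm{Hom}(A,C⅋B^\bot)$ natural in $A,B,C$, where $A⅋B=(B^\bot\otimes A^\bot)^\bot$. The structure is given syntactically: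 the tensor of objects is $A\otimes B$, the unit is $\mathsf 1$, the dual of $A$ is the formula $A^\bot$, the derived object $(B^\bot\otimes A^\bot)^\bot$ is the formula $A⅋B$; for $f=[P\rhd A^\bot,B]$ and $g=[Q\rhd C^\bot,D]$, $f\otimes g=[P⅋Q\rhd C^\bot⅋A^\bot,B\otimes D]$ and $f^\bot=[P\rhd B,A^\bot]$; the structural isomorphisms are $$\alpha_{A,B,C}=[I_A⅋(I_B⅋I_C)\rhd (C^\bot⅋B^\bot)⅋A^\bot,(A\otimes B)\otimes C]:A\otimes(B\otimes C)\to(A\otimes B)\otimes C,$$ $$\rho_A=[\bot\otimes I_A\rhd\bot⅋A^\bot,A]:A\otimes\mathsf 1\to A,\qquad \lambda_A=[\bot\otimes I_A\rhd A^\bot⅋\bot,A]:\mathsf 1\otimes A\to A,$$ $$\sigma_{A,B}=[I_A⅋I_B\rhd B^\bot⅋A^\bot,B\otimes A]:A\otimes B\to B\otimes A,$$ with each leaf of $I_A$, $I_B$, $I_C$ identified with the evident leaf of the sequent; and the bijection is $[P\rhd B^\bot⅋A^\bot,C]\mapsto[P\rhd A^\bot,C⅋B^\bot]$. -/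

import Mathlib

universe u v w

open CategoryTheory

namespace MLL

/-! ### Formulas, occurrence trees, linkings -/

/-- Leaf decorations: `a`, `a^⊥`, `1`, `⊥`. -/
inductive Lit (𝒜 : Type u) : Type u
  | pos (a : 𝒜)
  | neg (a : 𝒜)
  | one
  | bot

def Lit.dual {𝒜 : Type u} : Lit 𝒜 → Lit 𝒜
  | pos a => neg a
  | neg a => pos a
  | one => bot
  | bot => one

/-- Formulas of multiplicative linear logic over the set of atoms `𝒜`. -/
inductive Formula (𝒜 : Type u) : Type u
  | lit (l : Lit 𝒜)
  | tens (A B : Formula 𝒜)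
  | par (A B : Formula 𝒜)

namespace Formula

/-- Linear negation; it inverts the order of the arguments. -/
def neg {𝒜 : Type u} : Formula 𝒜 → Formula 𝒜
  | lit l => lit l.dual
  | tens A B => par (neg B) (neg A)
  | par A B => tens (neg B) (neg A)

/-- The leaf occurrences of a formula. -/
def Leaf {𝒜 : Type u} : Formula 𝒜 → Type
  | lit _ => Unit
  | tens A B => Leaf A ⊕ Leaf B
  | par A B => Leaf A ⊕ Leaf B

/-- The leaf occurrence of `A^⊥` that corresponds to a leaf occurrence of `A`. -/
def dualLeaf {𝒜 : Type u} : (A : Formula 𝒜) → A.Leaf → A.neg.Leaf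
  | lit _ => fun _ => ()
  | tens A B => Sum.elim (fun x => Sum.inr (dualLeaf A x)) (fun y => Sum.inl (dualLeaf B y))
  | par A B => Sum.elim (fun x => Sum.inr (dualLeaf A x)) (fun y => Sum.inl (dualLeaf B y))

end Formula

/-- Binary trees with decorated leaves; each leaf also carries a name in `X`, which says which
occurrence it is. Equal names in a linking and in a sequent mean identified leaves. -/
inductive OTree (𝒜 : Type u) (X : Type v) : Type (max u v)
  | leaf (l : Lit 𝒜) (x : X)
  | tens (s t : OTree 𝒜 X)
  | par (s t : OTree 𝒜 X)

namespace OTree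

def map {𝒜 : Type u} {X : Type v} {Y : Type w} (e : X → Y) : OTree 𝒜 X → OTree 𝒜 Y
  | leaf l x => leaf l (e x)
  | tens s t => tens (map e s) (map e t)
  | par s t => par (map e s) (map e t)

/-- The formula underlying an occurrence tree. -/
def erase {𝒜 : Type u} {X : Type v} : OTree 𝒜 X → Formula 𝒜
  | leaf l _ => Formula.lit l
  | tens s t => Formula.tens (erase s) (erase t)
  | par s t => Formula.par (erase s) (erase t)

def leaves {𝒜 : Type u} {X : Type v} : OTree 𝒜 X → List (Lit 𝒜 × X)
  | leaf l x => [(l, x)]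
  | tens s t => leaves s ++ leaves t
  | par s t => leaves s ++ leaves t

/-- The inner nodes of a tree; `none` is the root. -/
def Inner {𝒜 : Type u} {X : Type v} : OTree 𝒜 X → Type
  | leaf _ _ => Empty
  | tens s t => Option (Inner s ⊕ Inner t)
  | par s t => Option (Inner s ⊕ Inner t)

/-- The root of a tree, as a leaf name or an inner node. -/
def root {𝒜 : Type u} {X : Type v} : (t : OTree 𝒜 X) → X ⊕ t.Inner
  | leaf _ x => Sum.inl x
  | tens _ _ => Sum.inr none
  | par _ _ => Sum.inr none

/-- The left (`b = false`) or right (`b = true`) child of an inner node. -/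
def child {𝒜 : Type u} {X : Type v} (b : Bool) : (t : OTree 𝒜 X) → t.Inner → X ⊕ t.Inner
  | leaf _ _, n => nomatch n
  | tens s t, none =>
      if b then Sum.map id (fun p => some (Sum.inr p)) t.root
      else Sum.map id (fun p => some (Sum.inl p)) s.root
  | tens s _, some (Sum.inl p) => Sum.map id (fun p => some (Sum.inl p)) (child b s p)
  | tens _ t, some (Sum.inr p) => Sum.map id (fun p => some (Sum.inr p)) (child b t p)
  | par s t, none =>
      if b then Sum.map id (fun p => some (Sum.inr p)) t.root
      else Sum.map id (fun p => some (Sum.inl p)) s.root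
  | par s _, some (Sum.inl p) => Sum.map id (fun p => some (Sum.inl p)) (child b s p)
  | par _ t, some (Sum.inr p) => Sum.map id (fun p => some (Sum.inr p)) (child b t p)

/-- Is the inner node decorated with `⅋`? -/
def IsPar {𝒜 : Type u} {X : Type v} : (t : OTree 𝒜 X) → t.Inner → Prop
  | leaf _ _, n => nomatch n
  | tens _ _, none => False
  | tens s _, some (Sum.inl p) => IsPar s p
  | tens _ t, some (Sum.inr p) => IsPar t p
  | par _ _, none => True
  | par s _, some (Sum.inl p) => IsPar s p
  | par _ t, some (Sum.inr p) => IsPar t p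

end OTree

/-- The occurrence tree of a formula, each leaf being named by itself. -/
def Formula.tree {𝒜 : Type u} : (A : Formula 𝒜) → OTree 𝒜 A.Leaf
  | lit l => OTree.leaf l ()
  | tens A B => OTree.tens ((tree A).map Sum.inl) ((tree B).map Sum.inr)
  | par A B => OTree.par ((tree A).map Sum.inl) ((tree B).map Sum.inr)

/-- Linkings, with named leaves:
`1_x`, `a_x ⊗ a^⊥_y`, `a^⊥_x ⊗ a_y`, `⊥_x ⊗ Q`, `Q ⊗ ⊥_x`, `Q ⅋ R`. -/
inductive Linking (𝒜 : Type u) (X : Type v) : Type (max u v)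
  | one (x : X)
  | ax (a : 𝒜) (x y : X)
  | xa (a : 𝒜) (x y : X)
  | botTens (x : X) (Q : Linking 𝒜 X)
  | tensBot (Q : Linking 𝒜 X) (x : X)
  | par (Q R : Linking 𝒜 X)

namespace Linking

def map {𝒜 : Type u} {X : Type v} {Y : Type w} (e : X → Y) : Linking 𝒜 X → Linking 𝒜 Y
  | one x => one (e x)
  | ax a x y => ax a (e x) (e y)
  | xa a x y => xa a (e x) (e y)
  | botTens x Q => botTens (e x) (map e Q)
  | tensBot Q x => tensBot (map e Q) (e x)
  | par Q R => par (map e Q) (map e R)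

/-- A linking seen as a decorated binary tree. -/
def toTree {𝒜 : Type u} {X : Type v} : Linking 𝒜 X → OTree 𝒜 X
  | one x => OTree.leaf Lit.one x
  | ax a x y => OTree.tens (OTree.leaf (Lit.pos a) x) (OTree.leaf (Lit.neg a) y)
  | xa a x y => OTree.tens (OTree.leaf (Lit.neg a) x) (OTree.leaf (Lit.pos a) y)
  | botTens x Q => OTree.tens (OTree.leaf Lit.bot x) (toTree Q)
  | tensBot Q x => OTree.tens (toTree Q) (OTree.leaf Lit.bot x)
  | par Q R => OTree.par (toTree Q) (toTree R)

end Linking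

/-- Linking contexts `P{ }`. -/
inductive Ctx (𝒜 : Type u) (X : Type v) : Type (max u v)
  | hole
  | botTens (x : X) (C : Ctx 𝒜 X)
  | tensBot (C : Ctx 𝒜 X) (x : X)
  | parL (C : Ctx 𝒜 X) (R : Linking 𝒜 X)
  | parR (Q : Linking 𝒜 X) (C : Ctx 𝒜 X)

namespace Ctx

def fill {𝒜 : Type u} {X : Type v} : Ctx 𝒜 X → Linking 𝒜 X → Linking 𝒜 X
  | hole, Q => Q
  | botTens x C, Q => Linking.botTens x (fill C Q)
  | tensBot C x, Q => Linking.tensBot (fill C Q) x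
  | parL C R, Q => Linking.par (fill C Q) R
  | parR S C, Q => Linking.par S (fill C Q)

/-- The inner nodes of the distinguished subtree `Q`, as inner nodes of `P{Q}`. -/
def emb {𝒜 : Type u} {X : Type v} :
    (C : Ctx 𝒜 X) → (Q : Linking 𝒜 X) → Q.toTree.Inner → (C.fill Q).toTree.Inner
  | hole, _, n => n
  | botTens _ C, Q, n => some (Sum.inr (emb C Q n))
  | tensBot C _, Q, n => some (Sum.inl (emb C Q n))
  | parL C _, Q, n => some (Sum.inl (emb C Q n))
  | parR _ C, Q, n => some (Sum.inr (emb C Q n))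

end Ctx

/-! ### Forests and switchings -/

namespace Forest

/-- The inner nodes of a forest. -/
def Inner {𝒜 : Type u} {X : Type v} : List (OTree 𝒜 X) → Type
  | [] => Empty
  | t :: F => t.Inner ⊕ Inner F

def child {𝒜 : Type u} {X : Type v} (b : Bool) : (F : List (OTree 𝒜 X)) → Inner F → X ⊕ Inner F
  | [], n => nomatch n
  | t :: _, Sum.inl p => Sum.map id Sum.inl (t.child b p)
  | _ :: F, Sum.inr p => Sum.map id Sum.inr (child b F p)

def IsPar {𝒜 : Type u} {X : Type v} : (F : List (OTree 𝒜 X)) → Inner F → Prop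
  | [], n => nomatch n
  | t :: _, Sum.inl p => t.IsPar p
  | _ :: F, Sum.inr p => IsPar F p

def leaves {𝒜 : Type u} {X : Type v} (F : List (OTree 𝒜 X)) : List (Lit 𝒜 × X) :=
  F.flatMap OTree.leaves

/-- The nodes of the graph of a forest in which leaves of the same name are identified: the names
that occur, and the inner nodes. -/
def nodes {𝒜 : Type u} {X : Type v} (F : List (OTree 𝒜 X)) : Set (X ⊕ Inner F) :=
  {n | ∀ x, n = Sum.inl x → x ∈ (leaves F).map Prod.snd}

/-- The switching given by `σ`: each inner node is joined to its two children, but a `⅋`-node `p`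
only to the child `σ p`. (The values of `σ` at the other nodes play no role.) -/
def switching {𝒜 : Type u} {X : Type v} (F : List (OTree 𝒜 X)) (σ : Inner F → Bool) :
    SimpleGraph (X ⊕ Inner F) :=
  SimpleGraph.fromRel fun m n =>
    ∃ (p : Inner F) (b : Bool), m = Sum.inr p ∧ n = child b F p ∧ (IsPar F p → σ p = b)

end Forest

/-! ### Sequents with cuts, pre-proof graphs, correctness -/

/-- A member of a sequent with cuts: a formula or a cut `A ⦶ A^⊥`. -/
inductive Item (𝒜 : Type u) (X : Type v) : Type (max u v)
  | formula (t : OTree 𝒜 X)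
  | cut (s t : OTree 𝒜 X)

namespace Item

def map {𝒜 : Type u} {X : Type v} {Y : Type w} (e : X → Y) : Item 𝒜 X → Item 𝒜 Y
  | formula t => formula (t.map e)
  | cut s t => cut (s.map e) (t.map e)

/-- Geometrically, a cut node is a `⊗`-node. -/
def toTree {𝒜 : Type u} {X : Type v} : Item 𝒜 X → OTree 𝒜 X
  | formula t => t
  | cut s t => OTree.tens s t

/-- The two sides of a cut are dual to each other. -/
def WellFormed {𝒜 : Type u} {X : Type v} : Item 𝒜 X → Prop
  | formula _ => True
  | cut s t => t.erase = s.erase.neg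

/-- The item is the cut between `s` and `t`, in one of the two orders. -/
def IsCut {𝒜 : Type u} {X : Type v} (i : Item 𝒜 X) (s t : OTree 𝒜 X) : Prop :=
  i = cut s t ∨ i = cut t s

end Item

/-- The forest consisting of a linking (in the first place) and a sequent. -/
def forest {𝒜 : Type u} {X : Type v} (P : Linking 𝒜 X) (Γ : List (Item 𝒜 X)) :
    List (OTree 𝒜 X) :=
  P.toTree :: Γ.map Item.toTree

/-- Pre-proof graphs (with cuts): a linking and a sequent with the same leaves. -/
structure PreGraph (𝒜 : Type u) (X : Type v) : Type (max u v) where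
  link : Linking 𝒜 X
  seq : List (Item 𝒜 X)
  wellFormed : ∀ i ∈ seq, i.WellFormed
  nodup : (link.toTree.leaves.map Prod.snd).Nodup
  leaves_perm : link.toTree.leaves.Perm (Forest.leaves (seq.map Item.toTree))

/-- All switchings are connected and acyclic. -/
def PreGraph.Correct {𝒜 : Type u} {X : Type v} (G : PreGraph 𝒜 X) : Prop :=
  ∀ σ : Forest.Inner (forest G.link G.seq) → Bool,
    let S := (Forest.switching (forest G.link G.seq) σ).induce
      (Forest.nodes (forest G.link G.seq))
    S.Connected ∧ S.IsAcyclic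

/-- The extended switching with respect to the leaf `i`: the edge between that leaf and its parent
in the linking tree is removed. -/
def extSwitching {𝒜 : Type u} {X : Type v} (P : Linking 𝒜 X) (Γ : List (Item 𝒜 X))
    (σ : Forest.Inner (forest P Γ) → Bool) (i : X) :
    SimpleGraph (X ⊕ Forest.Inner (forest P Γ)) :=
  (Forest.switching (forest P Γ) σ).deleteEdges
    {d | ∃ p : P.toTree.Inner, d = s(Sum.inl i, Sum.inr (Sum.inl p))}

/-- The side condition: in every extended switching of `C{Q ⅋ (R ⊗ ⊥_i)} ▷ Γ` with respect to
`⊥_i` no node of `Q`, be it a leaf or an inner node, is connected to `⊥_i`. -/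
def SideCondition {𝒜 : Type u} {X : Type v} (C : Ctx 𝒜 X) (Q R : Linking 𝒜 X) (i : X)
    (Γ : List (Item 𝒜 X)) : Prop :=
  ∀ σ : Forest.Inner (forest (C.fill (Linking.par Q (Linking.tensBot R i))) Γ) → Bool,
    (∀ x ∈ Q.toTree.leaves.map Prod.snd,
      ¬ (extSwitching _ Γ σ i).Reachable (Sum.inl i) (Sum.inl x)) ∧
    (∀ n : Q.toTree.Inner,
      ¬ (extSwitching _ Γ σ i).Reachable (Sum.inl i)
        (Sum.inr (Sum.inl (C.emb (Linking.par Q (Linking.tensBot R i)) (some (Sum.inl n))))))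

/-- The equations generating the equivalence of pre-proof graphs. Commutativity of `⊗` in
linkings takes the form of the two rules `axComm` and `botComm`. -/
inductive SimStep {𝒜 : Type u} {X : Type v} (G H : PreGraph 𝒜 X) : Prop
  | parComm (C : Ctx 𝒜 X) (Q R : Linking 𝒜 X) (hs : G.seq = H.seq)
      (hG : G.link = C.fill (Linking.par Q R))
      (hH : H.link = C.fill (Linking.par R Q))
  | parAssoc (C : Ctx 𝒜 X) (Q R S : Linking 𝒜 X) (hs : G.seq = H.seq)
      (hG : G.link = C.fill (Linking.par (Linking.par Q R) S))
      (hH : H.link = C.fill (Linking.par Q (Linking.par R S)))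
  | axComm (C : Ctx 𝒜 X) (a : 𝒜) (x y : X) (hs : G.seq = H.seq)
      (hG : G.link = C.fill (Linking.ax a x y))
      (hH : H.link = C.fill (Linking.xa a y x))
  | botComm (C : Ctx 𝒜 X) (Q : Linking 𝒜 X) (x : X) (hs : G.seq = H.seq)
      (hG : G.link = C.fill (Linking.botTens x Q))
      (hH : H.link = C.fill (Linking.tensBot Q x))
  | tensAssoc (C : Ctx 𝒜 X) (Q : Linking 𝒜 X) (i j : X) (hs : G.seq = H.seq)
      (hG : G.link = C.fill (Linking.botTens i (Linking.tensBot Q j)))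
      (hH : H.link = C.fill (Linking.tensBot (Linking.botTens i Q) j))
  | parTens (C : Ctx 𝒜 X) (Q R : Linking 𝒜 X) (i : X) (hs : G.seq = H.seq)
      (hG : G.link = C.fill (Linking.par Q (Linking.tensBot R i)))
      (hH : H.link = C.fill (Linking.tensBot (Linking.par Q R) i))
      (side : SideCondition C Q R i G.seq)

/-! ### Proof nets and cut elimination -/

/-- Pre-proof nets (with cuts): pre-proof graphs modulo the smallest equivalence relation that
contains `SimStep`. -/
def PreNet (𝒜 : Type u) (X : Type v) : Type (max u v) :=
  Quotient (Relation.EqvGen.setoid (SimStep (𝒜 := 𝒜) (X := X)))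

def PreGraph.toNet {𝒜 : Type u} {X : Type v} (G : PreGraph 𝒜 X) : PreNet 𝒜 X :=
  Quotient.mk _ G

namespace PreNet

/-- The pair of a linking `P` and a sequent `Γ` is a pre-proof graph that belongs to the
pre-proof net `N`, i.e. `N = [P ▷ Γ]`. -/
def Rep {𝒜 : Type u} {X : Type v} (N : PreNet 𝒜 X) (P : Linking 𝒜 X) (Γ : List (Item 𝒜 X)) :
    Prop :=
  ∃ G : PreGraph 𝒜 X, G.toNet = N ∧ G.link = P ∧ G.seq = Γ

/-- `N` is a proof net with sequent `Γ`. -/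
def IsProofNet {𝒜 : Type u} {X : Type v} (N : PreNet 𝒜 X) (Γ : List (Item 𝒜 X)) : Prop :=
  ∃ G : PreGraph 𝒜 X, G.toNet = N ∧ G.seq = Γ ∧ G.Correct

end PreNet

/-- One step of cut reduction. A cut may stand at any place of the sequent, and the order of its
two sides is irrelevant. -/
inductive CutStep {𝒜 : Type u} {X : Type v} :
    Linking 𝒜 X → List (Item 𝒜 X) → Linking 𝒜 X → List (Item 𝒜 X) → Prop
  | binary (P : Linking 𝒜 X) (Γ Δ : List (Item 𝒜 X)) (i : Item 𝒜 X) (s t s' t' : OTree 𝒜 X)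
      (hi : i.IsCut (OTree.par s t) (OTree.tens t' s')) :
      CutStep P (Γ ++ i :: Δ) P (Γ ++ Item.cut s s' :: Item.cut t t' :: Δ)
  | atom (C : Ctx 𝒜 X) (Γ Δ : List (Item 𝒜 X)) (c : Item 𝒜 X) (a : 𝒜) (h i j k : X)
      (hc : c.IsCut (OTree.leaf (Lit.pos a) i) (OTree.leaf (Lit.neg a) j)) :
      CutStep (C.fill (Linking.par (Linking.xa a h i) (Linking.xa a j k))) (Γ ++ c :: Δ)
        (C.fill (Linking.xa a h k)) (Γ ++ Δ)
  | unit (C : Ctx 𝒜 X) (Q : Linking 𝒜 X) (Γ Δ : List (Item 𝒜 X)) (c : Item 𝒜 X) (i j : X)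
      (hc : c.IsCut (OTree.leaf Lit.bot i) (OTree.leaf Lit.one j)) :
      CutStep (C.fill (Linking.par (Linking.tensBot Q i) (Linking.one j))) (Γ ++ c :: Δ)
        (C.fill Q) (Γ ++ Δ)

namespace PreNet

/-- Cut reduction on proof nets. -/
def Red {𝒜 : Type u} {X : Type v} (N M : PreNet 𝒜 X) : Prop :=
  ∃ G H : PreGraph 𝒜 X, G.toNet = N ∧ H.toNet = M ∧ G.Correct ∧ H.Correct ∧
    CutStep G.link G.seq H.link H.seq

/-- `M` is a normal form of `N` with respect to cut reduction. -/
def NormalForm {𝒜 : Type u} {X : Type v} (N M : PreNet 𝒜 X) : Prop :=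
  Relation.ReflTransGen Red N M ∧ ∀ M', ¬ Red M M'

end PreNet

/-! ### Arrows between formulas -/

/-- The sequent `A, B`. -/
def seq₂ {𝒜 : Type u} (A B : Formula 𝒜) : List (Item 𝒜 (A.Leaf ⊕ B.Leaf)) :=
  [Item.formula (A.tree.map Sum.inl), Item.formula (B.tree.map Sum.inr)]

/-- The arrows `A ⟶ B`: the cut-free proof nets with sequent `A^⊥, B`. -/
def Hom {𝒜 : Type u} (A B : Formula 𝒜) : Type u :=
  {N : PreNet 𝒜 (A.neg.Leaf ⊕ B.Leaf) // N.IsProofNet (seq₂ A.neg B)}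

/-- The arrow `f` is the proof net `[P ▷ A^⊥, B]`. -/
def Hom.Rep {𝒜 : Type u} {A B : Formula 𝒜} (f : Hom A B)
    (P : Linking 𝒜 (A.neg.Leaf ⊕ B.Leaf)) : Prop :=
  f.1.Rep P (seq₂ A.neg B)

/-- Variant of `Hom.Rep` for an arrow whose source and target are merely equal to `A` and `B`:
`A' = A`, `B' = B` and `f` is the proof net `[P ▷ A^⊥, B]`. -/
def IsNet {𝒜 : Type u} {A' B' : Formula 𝒜} (f : Hom A' B') (A B : Formula 𝒜)
    (P : Linking 𝒜 (A.neg.Leaf ⊕ B.Leaf)) : Prop :=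
  A' = A ∧ B' = B ∧ ∃ g : Hom A B, HEq f g ∧ g.Rep P

/-- The identity linking `I_A`, with the leaves of `A^⊥` and `A` renamed along `e` and `d`. -/
def idLink {𝒜 : Type u} {X : Type v} :
    (A : Formula 𝒜) → (A.neg.Leaf → X) → (A.Leaf → X) → Linking 𝒜 X
  | .lit (.pos a), e, d => Linking.ax a (d ()) (e ())
  | .lit (.neg a), e, d => Linking.ax a (e ()) (d ())
  | .lit .one, e, d => Linking.botTens (e ()) (Linking.one (d ()))
  | .lit .bot, e, d => Linking.botTens (d ()) (Linking.one (e ()))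
  | .tens A B, e, d =>
      Linking.par (idLink A (fun x => e (Sum.inr x)) (fun x => d (Sum.inl x)))
        (idLink B (fun x => e (Sum.inl x)) (fun x => d (Sum.inr x)))
  | .par A B, e, d =>
      Linking.par (idLink A (fun x => e (Sum.inr x)) (fun x => d (Sum.inl x)))
        (idLink B (fun x => e (Sum.inl x)) (fun x => d (Sum.inr x)))

/-- The names of the leaves of `A^⊥, B ⦶ B^⊥, C`. -/
abbrev CutLeaf {𝒜 : Type u} (A B C : Formula 𝒜) : Type :=
  (A.neg.Leaf ⊕ B.Leaf) ⊕ (B.neg.Leaf ⊕ C.Leaf)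

/-- The sequent `A^⊥, B ⦶ B^⊥, C`. -/
def cutSeq {𝒜 : Type u} (A B C : Formula 𝒜) : List (Item 𝒜 (CutLeaf A B C)) :=
  [Item.formula (A.neg.tree.map fun x => Sum.inl (Sum.inl x)),
    Item.cut (B.tree.map fun x => Sum.inl (Sum.inr x))
      (B.neg.tree.map fun x => Sum.inr (Sum.inl x)),
    Item.formula (C.tree.map fun x => Sum.inr (Sum.inr x))]

/-- The leaves of `A^⊥, C` as leaves of `A^⊥, B ⦶ B^⊥, C`. -/
def outer {𝒜 : Type u} (A B C : Formula 𝒜) : A.neg.Leaf ⊕ C.Leaf → CutLeaf A B C :=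
  Sum.map Sum.inl Sum.inr

/-- `h` is the result of cut elimination in `[P ⅋ Q ▷ A^⊥, B ⦶ B^⊥, C]`, whichever linkings `P` and
`Q` represent `f` and `g`: the normal form of this net exists, is unique, and is `h`
(up to the names of the leaves). -/
def IsComposite {𝒜 : Type u} {A B C : Formula 𝒜} (f : Hom A B) (g : Hom B C) (h : Hom A C) :
    Prop :=
  ∀ P Q, f.Rep P → g.Rep Q →
    ∃ N : PreNet 𝒜 (CutLeaf A B C),
      N.Rep (Linking.par (P.map Sum.inl) (Q.map Sum.inr)) (cutSeq A B C) ∧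
      ∀ M, N.NormalForm M ↔
        ∃ R, h.Rep R ∧ M.Rep (R.map (outer A B C)) ((seq₂ A.neg C).map (Item.map (outer A B C)))

/-- `P ⅋ Q` as a linking for `C^⊥ ⅋ A^⊥, B ⊗ D`. -/
def tensLink {𝒜 : Type u} {A B C D : Formula 𝒜} (P : Linking 𝒜 (A.neg.Leaf ⊕ B.Leaf))
    (Q : Linking 𝒜 (C.neg.Leaf ⊕ D.Leaf)) :
    Linking 𝒜 ((A.tens C).neg.Leaf ⊕ (B.tens D).Leaf) :=
  Linking.par (P.map (Sum.map Sum.inr Sum.inl)) (Q.map (Sum.map Sum.inl Sum.inr))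

/-- `I_A ⅋ (I_B ⅋ I_C)` as a linking for `(C^⊥ ⅋ B^⊥) ⅋ A^⊥, (A ⊗ B) ⊗ C`. -/
def assocLink {𝒜 : Type u} (A B C : Formula 𝒜) :
    Linking 𝒜 ((A.tens (B.tens C)).neg.Leaf ⊕ ((A.tens B).tens C).Leaf) :=
  Linking.par (idLink A (fun x => Sum.inl (Sum.inr x)) (fun x => Sum.inr (Sum.inl (Sum.inl x))))
    (Linking.par
      (idLink B (fun x => Sum.inl (Sum.inl (Sum.inr x)))
        (fun x => Sum.inr (Sum.inl (Sum.inr x))))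
      (idLink C (fun x => Sum.inl (Sum.inl (Sum.inl x))) (fun x => Sum.inr (Sum.inr x))))

/-- The unit formula `1`. -/
def unitObj {𝒜 : Type u} : Formula 𝒜 := Formula.lit Lit.one

/-- `⊥ ⊗ I_A` as a linking for `⊥ ⅋ A^⊥, A`. -/
def rightUnitLink {𝒜 : Type u} (A : Formula 𝒜) :
    Linking 𝒜 ((A.tens unitObj).neg.Leaf ⊕ A.Leaf) :=
  Linking.botTens (Sum.inl (Sum.inl ())) (idLink A (fun x => Sum.inl (Sum.inr x)) Sum.inr)

/-- `⊥ ⊗ I_A` as a linking for `A^⊥ ⅋ ⊥, A`. -/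
def leftUnitLink {𝒜 : Type u} (A : Formula 𝒜) :
    Linking 𝒜 ((unitObj.tens A).neg.Leaf ⊕ A.Leaf) :=
  Linking.botTens (Sum.inl (Sum.inr ())) (idLink A (fun x => Sum.inl (Sum.inl x)) Sum.inr)

/-- `I_A ⅋ I_B` as a linking for `B^⊥ ⅋ A^⊥, B ⊗ A`. -/
def symmLink {𝒜 : Type u} (A B : Formula 𝒜) :
    Linking 𝒜 ((A.tens B).neg.Leaf ⊕ (B.tens A).Leaf) :=
  Linking.par (idLink A (fun x => Sum.inl (Sum.inr x)) (fun x => Sum.inr (Sum.inr x)))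
    (idLink B (fun x => Sum.inl (Sum.inl x)) (fun x => Sum.inr (Sum.inl x)))

/-- A linking for `A^⊥, B` as a linking for `B, A^⊥` (where `B` is written as `B^⊥⊥`). -/
def negLink {𝒜 : Type u} {A B : Formula 𝒜} (P : Linking 𝒜 (A.neg.Leaf ⊕ B.Leaf)) :
    Linking 𝒜 (B.neg.neg.Leaf ⊕ A.neg.Leaf) :=
  P.map (Sum.elim Sum.inr fun x => Sum.inl (B.neg.dualLeaf (B.dualLeaf x)))

/-- A linking for `B^⊥ ⅋ A^⊥, C` as a linking for `A^⊥, C ⅋ B^⊥`. -/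
def curryLink {𝒜 : Type u} {A B C : Formula 𝒜}
    (P : Linking 𝒜 ((A.tens B).neg.Leaf ⊕ C.Leaf)) :
    Linking 𝒜 (A.neg.Leaf ⊕ (C.par B.neg).Leaf) :=
  P.map (Sum.elim (Sum.elim (fun y => Sum.inr (Sum.inr y)) (fun x => Sum.inl x))
    (fun z => Sum.inr (Sum.inl z)))

/-- Identities and a composition for the arrows `Hom`, satisfying the laws of a category. -/
structure CategoryOnNets (𝒜 : Type u) where
  id : ∀ A : Formula 𝒜, Hom A A
  comp : ∀ {A B C : Formula 𝒜}, Hom A B → Hom B C → Hom A C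
  id_comp : ∀ {A B : Formula 𝒜} (f : Hom A B), comp (id A) f = f
  comp_id : ∀ {A B : Formula 𝒜} (f : Hom A B), comp f (id B) = f
  assoc : ∀ {A B C D : Formula 𝒜} (f : Hom A B) (g : Hom B C) (h : Hom C D),
    comp (comp f g) h = comp f (comp g h)

@[reducible]
def CategoryOnNets.toCategory {𝒜 : Type u} (K : CategoryOnNets 𝒜) :
    Category.{u} (Formula 𝒜) where
  Hom := Hom
  id := K.id
  comp := K.comp
  id_comp := K.id_comp
  comp_id := K.comp_id
  assoc := K.assoc

end MLL

/-! ### *-autonomous categories -/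

open MonoidalCategory Opposite

/-- The object `A ⅋ B = (B^⊥ ⊗ A^⊥)^⊥` attached to a contravariant endofunctor. -/
def parObj {C : Type u} [Category.{v} C] [MonoidalCategory C] (neg : Cᵒᵖ ⥤ C) (A B : C) : C :=
  neg.obj (op (neg.obj (op B) ⊗ neg.obj (op A)))

/-- The action of `⅋` on arrows. -/
def parMap {C : Type u} [Category.{v} C] [MonoidalCategory C] (neg : Cᵒᵖ ⥤ C) {A A' B B' : C}
    (f : A ⟶ A') (g : B ⟶ B') : parObj neg A B ⟶ parObj neg A' B' :=
  neg.map (neg.map g.op ⊗ₘ neg.map f.op).op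

/-- The structure of a *-autonomous category on a symmetric monoidal category. -/
structure StarAutonomous (C : Type u) [Category.{v} C] [MonoidalCategory C]
    [SymmetricCategory C] where
  /-- the contravariant functor `(-)^⊥` -/
  neg : Cᵒᵖ ⥤ C
  /-- the natural isomorphism `A^⊥⊥ ≅ A` -/
  doubleNeg : neg.rightOp ⋙ neg ≅ 𝟭 C
  /-- the bijection between `Hom(A ⊗ B, D)` and `Hom(A, D ⅋ B^⊥)` -/
  curry : ∀ A B D : C, (A ⊗ B ⟶ D) ≃ (A ⟶ parObj neg D (neg.obj (op B)))
  curry_natural : ∀ {A A' B B' D D' : C} (h : A' ⟶ A) (m : B' ⟶ B) (l : D ⟶ D')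
    (f : A ⊗ B ⟶ D),
    curry A' B' D' ((h ⊗ₘ m) ≫ f ≫ l) = h ≫ curry A B D f ≫ parMap neg l (neg.map m.op)

/-- A *-autonomous category is strict if the isomorphisms `A^⊥⊥ → A` are identities. -/
def StarAutonomous.IsStrict {C : Type u} [Category.{v} C] [MonoidalCategory C]
    [SymmetricCategory C] (S : StarAutonomous C) : Prop :=
  ∀ A : C, ∃ h : S.neg.obj (op (S.neg.obj (op A))) = A, S.doubleNeg.hom.app A = eqToHom h

open MLL

namespace MLL

open scoped Classical
open Relation

section Trees

variable {X : Type v}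

/-- Connectedness of two vertices in the multigraph given by a list of edges. -/
def Conn (E : List (X × X)) : X → X → Prop :=
  EqvGen fun a b => (a, b) ∈ E

theorem Conn.refl (E : List (X × X)) (x : X) : Conn E x x := EqvGen.refl x

theorem Conn.symm {E : List (X × X)} {x y : X} (h : Conn E x y) : Conn E y x :=
  EqvGen.symm _ _ h

theorem Conn.trans {E : List (X × X)} {x y z : X} (h : Conn E x y) (h' : Conn E y z) :
    Conn E x z :=
  EqvGen.trans _ _ _ h h'

theorem Conn.of_mem {E : List (X × X)} {x y : X} (h : (x, y) ∈ E) : Conn E x y :=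
  EqvGen.rel _ _ h

/-- Connectedness is carried along any map under which edges stay connected. -/
theorem Conn.lift {Y : Type w} {E : List (X × X)} {F : List (Y × Y)} (f : X → Y)
    (hf : ∀ a b, (a, b) ∈ E → Conn F (f a) (f b)) {x y : X} (h : Conn E x y) :
    Conn F (f x) (f y) := by
  induction h with
  | rel a b hab => exact hf a b hab
  | refl a => exact Conn.refl _ _
  | symm a b _ ih => exact ih.symm
  | trans a b c _ _ ih ih' => exact ih.trans ih'

theorem Conn.of_le {E F : List (X × X)} (hf : ∀ a b, (a, b) ∈ E → Conn F a b) {x y : X}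
    (h : Conn E x y) : Conn F x y :=
  Conn.lift id hf h

theorem Conn.mono {E F : List (X × X)} (hf : E ⊆ F) {x y : X} (h : Conn E x y) : Conn F x y :=
  h.of_le fun _ _ hab => Conn.of_mem (hf hab)

theorem Conn.eq_of_nil {x y : X} (h : Conn [] x y) : x = y := by
  induction h with
  | rel a b hab => simp at hab
  | refl a => rfl
  | symm a b _ ih => exact ih.symm
  | trans a b c _ _ ih ih' => exact ih.trans ih'

/-- A list of edges connecting a set of vertices has at least one edge less than vertices. -/
theorem card_le_of_conn (E : List (X × X)) (V : Finset X)
    (h : ∀ x ∈ V, ∀ y ∈ V, Conn E x y) : V.card ≤ E.length + 1 := by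
  induction hn : E.length generalizing E V with
  | zero =>
    have hE := List.length_eq_zero_iff.1 hn
    subst hE
    simpa using Finset.card_le_one.2 fun x hx y hy => (h x hx y hy).eq_of_nil
  | succ n ih =>
    obtain ⟨⟨a, b⟩, E, rfl⟩ := List.exists_cons_of_length_eq_add_one hn
    let f : X → X := fun x => if x = b then a else x
    have key : ∀ x y, Conn ((a, b) :: E) x y →
        Conn (E.map (Prod.map f f)) (f x) (f y) := by
      intro x y hxy
      refine Conn.lift f (fun c d hcd => ?_) hxy
      rcases List.mem_cons.1 hcd with hcd | hcd
      · obtain ⟨rfl, rfl⟩ := Prod.mk.inj hcd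
        have : f c = f d := by simp [f]
        rw [this]; exact Conn.refl _ _
      · exact Conn.of_mem (List.mem_map.2 ⟨(c, d), hcd, rfl⟩)
    have h1 := ih (E.map (Prod.map f f)) (V.image f) (by
      intro x hx y hy
      obtain ⟨x, hx', rfl⟩ := Finset.mem_image.1 hx
      obtain ⟨y, hy', rfl⟩ := Finset.mem_image.1 hy
      exact key _ _ (h x hx' y hy')) (by simpa using hn)
    have h2 : (V.erase b).card ≤ (V.image f).card := by
      apply Finset.card_le_card
      intro x hx
      exact Finset.mem_image.2 ⟨x, Finset.mem_of_mem_erase hx, by simp [f, Finset.ne_of_mem_erase hx]⟩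
    have h3 := Finset.pred_card_le_card_erase (s := V) (a := b)
    omega

/-- The multigraph with vertices `V` and edges `E` is a tree. -/
def TreeOn (V : Finset X) (E : List (X × X)) : Prop :=
  (∀ x ∈ V, ∀ y ∈ V, Conn E x y) ∧ E.length + 1 = V.card

theorem TreeOn.of_le {V : Finset X} {E F : List (X × X)} (h : TreeOn V E)
    (hc : ∀ a b, (a, b) ∈ E → Conn F a b) (hl : F.length = E.length) : TreeOn V F :=
  ⟨fun x hx y hy => (h.1 x hx y hy).of_le hc, by rw [hl]; exact h.2⟩

theorem TreeOn.perm {V : Finset X} {E F : List (X × X)} (h : TreeOn V E) (hp : E.Perm F) :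
    TreeOn V F :=
  h.of_le (fun _ _ hab => Conn.of_mem (hp.subset hab)) hp.length_eq.symm

/-- Removing an edge of a tree disconnects its end points. -/
theorem TreeOn.not_conn {V : Finset X} {a b : X} {E : List (X × X)}
    (h : TreeOn V ((a, b) :: E)) : ¬ Conn E a b := by
  intro hab
  have := card_le_of_conn E V fun x hx y hy => (h.1 x hx y hy).of_le fun c d hcd => by
    rcases List.mem_cons.1 hcd with hcd | hcd
    · obtain ⟨rfl, rfl⟩ := Prod.mk.inj hcd
      exact hab
    · exact Conn.of_mem hcd
  have h2 := h.2
  simp only [List.length_cons] at h2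
  omega

/-- Exchanging an end point of an edge within its connected component. -/
theorem TreeOn.exchange {V : Finset X} {a b c : X} {E : List (X × X)}
    (h : TreeOn V ((a, b) :: E)) (hc : Conn E b c) : TreeOn V ((a, c) :: E) := by
  have hE : ∀ x y, Conn E x y → Conn ((a, c) :: E) x y := fun x y h' =>
    h'.mono (List.subset_cons_self _ _)
  refine h.of_le (fun x y hxy => ?_) (by simp)
  rcases List.mem_cons.1 hxy with hxy | hxy
  · obtain ⟨rfl, rfl⟩ := Prod.mk.inj hxy
    exact (Conn.of_mem (List.mem_cons_self)).trans (hE _ _ hc).symm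
  · exact hE _ _ (Conn.of_mem hxy)

/-- The edges from the vertices in `S` to `x`. -/
def star (S : List X) (x : X) : List (X × X) :=
  S.map fun s => (s, x)

@[simp] theorem star_nil (x : X) : star [] x = [] := rfl

@[simp] theorem star_cons (s : X) (S : List X) (x : X) : star (s :: S) x = (s, x) :: star S x :=
  rfl

@[simp] theorem length_star (S : List X) (x : X) : (star S x).length = S.length := by
  simp [star]

@[simp] theorem mem_star {S : List X} {x a b : X} : (a, b) ∈ star S x ↔ a ∈ S ∧ b = x := by
  simp only [star, List.mem_map, Prod.mk.injEq]
  constructor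
  · rintro ⟨s, hs, rfl, rfl⟩; exact ⟨hs, rfl⟩
  · rintro ⟨ha, rfl⟩; exact ⟨a, ha, rfl, rfl⟩

theorem conn_star_append {S : List X} {x y z : X} {B : List (X × X)}
    (h : Conn (star S x ++ B) y z) :
    Conn B y z ∨ (Conn B y x ∨ ∃ s ∈ S, Conn B y s) ∧ (Conn B z x ∨ ∃ s ∈ S, Conn B z s) := by
  induction h with
  | rel a b hab =>
    rcases List.mem_append.1 hab with hab | hab
    · obtain ⟨ha, rfl⟩ := mem_star.1 hab
      exact Or.inr ⟨Or.inr ⟨a, ha, Conn.refl _ _⟩, Or.inl (Conn.refl _ _)⟩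
    · exact Or.inl (Conn.of_mem hab)
  | refl a => exact Or.inl (Conn.refl _ _)
  | symm a b _ ih => exact ih.imp Conn.symm And.symm
  | trans a b c _ _ ih ih' =>
    have tr : ∀ p q, Conn B p q → (Conn B q x ∨ ∃ s ∈ S, Conn B q s) →
        (Conn B p x ∨ ∃ s ∈ S, Conn B p s) := fun p q hpq h =>
      h.imp hpq.trans fun ⟨s, hs, h⟩ => ⟨s, hs, hpq.trans h⟩
    rcases ih with ih | ⟨h1, h2⟩
    · rcases ih' with ih' | ⟨h3, h4⟩
      · exact Or.inl (ih.trans ih')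
      · exact Or.inr ⟨tr _ _ ih h3, h4⟩
    · rcases ih' with ih' | ⟨h3, h4⟩
      · exact Or.inr ⟨h1, tr _ _ ih'.symm h2⟩
      · exact Or.inr ⟨h1, h4⟩

/-- If a family of vertices can be attached to `x` as well as to `y` so as to give a tree, then
`x` and `y` are connected without them. -/
theorem conn_of_treeOn_star {V : Finset X} {S : List X} {x y : X} {B : List (X × X)}
    (hx : TreeOn V (star S x ++ B)) (hy : TreeOn V (star S y ++ B)) (hxV : x ∈ V) (hyV : y ∈ V) :
    Conn B x y := by
  rcases conn_star_append (hx.1 y hyV x hxV) with h | ⟨h | ⟨s, hs, h⟩, _⟩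
  · exact h.symm
  · exact h.symm
  · exfalso
    obtain ⟨S₁, S₂, rfl⟩ := List.append_of_mem hs
    have : TreeOn V ((s, y) :: (star S₁ y ++ star S₂ y ++ B)) := by
      refine hy.perm ?_
      simp only [star, List.map_append, List.map_cons, List.append_assoc, List.cons_append]
      exact List.perm_middle
    exact this.not_conn (h.symm.mono (by simp))

/-- Joining two disjoint trees by an edge. -/
theorem TreeOn.join {V W : Finset X} {E F : List (X × X)} (hV : TreeOn V E) (hW : TreeOn W F)
    (hd : Disjoint V W) {a b : X} (ha : a ∈ V) (hb : b ∈ W) :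
    TreeOn (V ∪ W) ((a, b) :: (E ++ F)) := by
  have h1 : ∀ x ∈ V ∪ W, Conn ((a, b) :: (E ++ F)) a x := by
    intro x hx
    rcases Finset.mem_union.1 hx with hx | hx
    · exact (hV.1 a ha x hx).mono (by intro e he; simp [he])
    · exact (Conn.of_mem List.mem_cons_self).trans
        ((hW.1 b hb x hx).mono (by intro e he; simp [he]))
  refine ⟨fun x hx y hy => (h1 x hx).symm.trans (h1 y hy), ?_⟩
  rw [Finset.card_union_of_disjoint hd, ← hV.2, ← hW.2]
  simp only [List.length_cons, List.length_append]
  omega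

theorem treeOn_singleton (x : X) : TreeOn {x} [] :=
  ⟨fun a ha b hb => by
    rw [Finset.mem_singleton.1 ha, Finset.mem_singleton.1 hb]; exact Conn.refl _ _, by simp⟩

theorem TreeOn.map {Y : Type w} {V : Finset X} {E : List (X × X)} (h : TreeOn V E) (f : X → Y)
    (hf : Set.InjOn f V) : TreeOn (V.image f) (E.map (Prod.map f f)) := by
  refine ⟨fun x hx y hy => ?_, by rw [Finset.card_image_of_injOn hf, List.length_map, h.2]⟩
  obtain ⟨x, hx', rfl⟩ := Finset.mem_image.1 hx
  obtain ⟨y, hy', rfl⟩ := Finset.mem_image.1 hy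
  exact Conn.lift f (fun c d hcd => Conn.of_mem (List.mem_map.2 ⟨(c, d), hcd, rfl⟩))
    (h.1 x hx' y hy')

end Trees


section ChildGraphs

variable {X : Type v} {N : Type w}

/-- The graph in which each node `p` is joined to those children `ch b p` for which `keep p b`. -/
def childGraph (ch : Bool → N → X ⊕ N) (keep : N → Bool → Prop) : SimpleGraph (X ⊕ N) :=
  SimpleGraph.fromRel fun m n => ∃ p b, m = Sum.inr p ∧ n = ch b p ∧ keep p b

theorem childGraph_adj {ch : Bool → N → X ⊕ N} {keep : N → Bool → Prop} {rank : N → ℕ}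
    (hr : ∀ p b q, ch b p = Sum.inr q → rank q < rank p) {p : N} {b : Bool} (h : keep p b) :
    (childGraph ch keep).Adj (Sum.inr p) (ch b p) := by
  rw [childGraph, SimpleGraph.fromRel_adj]
  exact ⟨fun he => lt_irrefl _ (hr p b p he.symm), Or.inl ⟨p, b, rfl, rfl, h⟩⟩

/-- Contracting every inner node to a leaf that represents it, connectedness in the graph becomes
connectedness with respect to the remaining edges between leaves. -/
theorem childGraph_reachable_iff {ch : Bool → N → X ⊕ N} {keep : N → Bool → Prop} {rank : N → ℕ}
    (hr : ∀ p b q, ch b p = Sum.inr q → rank q < rank p) {nr : N → X} {E : List (X × X)}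
    (h1 : ∀ p, ∃ b, keep p b ∧ Sum.elim id nr (ch b p) = nr p)
    (h2 : ∀ p b, keep p b → Conn E (nr p) (Sum.elim id nr (ch b p)))
    (h3 : ∀ a b, (a, b) ∈ E → ∃ p c, keep p c ∧ a = nr p ∧ b = Sum.elim id nr (ch c p))
    (m n : X ⊕ N) :
    (childGraph ch keep).Reachable m n ↔ Conn E (Sum.elim id nr m) (Sum.elim id nr n) := by
  have hnr : ∀ k p, rank p = k → (childGraph ch keep).Reachable (Sum.inr p) (Sum.inl (nr p)) := by
    intro k
    induction k using Nat.strong_induction_on with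
    | _ k ih =>
      intro p hp
      obtain ⟨b, hb, hv⟩ := h1 p
      have ha := (childGraph_adj hr hb).reachable
      rcases hc : ch b p with x | q
      · rw [hc] at hv ha
        simp only [Sum.elim_inl, id] at hv
        rwa [hv] at ha
      · rw [hc] at hv ha
        simp only [Sum.elim_inr] at hv
        rw [← hv]
        exact ha.trans (ih (rank q) (hp ▸ hr p b q hc) q rfl)
  have hm : ∀ m, (childGraph ch keep).Reachable m (Sum.inl (Sum.elim id nr m)) := by
    rintro (x | p)
    · exact SimpleGraph.Reachable.refl _
    · exact hnr _ p rfl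
  constructor
  · intro h
    rw [SimpleGraph.reachable_iff_reflTransGen] at h
    induction h with
    | refl => exact Conn.refl _ _
    | tail _ hab ih =>
      refine ih.trans ?_
      rw [childGraph, SimpleGraph.fromRel_adj] at hab
      rcases hab.2 with ⟨p, b, rfl, rfl, hk⟩ | ⟨p, b, rfl, rfl, hk⟩
      · exact h2 p b hk
      · exact (h2 p b hk).symm
  · intro h
    have : ∀ x y, Conn E x y → (childGraph ch keep).Reachable (Sum.inl x) (Sum.inl y) := by
      intro x y hxy
      induction hxy with
      | rel a b hab =>
        obtain ⟨p, c, hk, rfl, rfl⟩ := h3 a b hab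
        exact (hnr _ p rfl).symm.trans ((childGraph_adj hr hk).reachable.trans (hm _))
      | refl a => exact SimpleGraph.Reachable.refl _
      | symm a b _ ih => exact ih.symm
      | trans a b c _ _ ih ih' => exact ih.trans ih'
    exact (hm m).trans ((this _ _ h).trans (hm n).symm)

end ChildGraphs

namespace OTree

variable {𝒜 : Type u} {X : Type v}

/-- The leaf to which the root of a tree is contracted in the switching `σ`. -/
def rep : (t : OTree 𝒜 X) → (t.Inner → Bool) → X
  | leaf _ x, _ => x
  | tens s _, σ => rep s fun p => σ (some (Sum.inl p))
  | par s t, σ =>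
      if σ none then rep t fun p => σ (some (Sum.inr p)) else rep s fun p => σ (some (Sum.inl p))

/-- The leaf to which an inner node is contracted in the switching `σ`. -/
def nodeRep : (t : OTree 𝒜 X) → (t.Inner → Bool) → t.Inner → X
  | leaf _ _, _, n => nomatch n
  | tens s t, σ, none => rep (tens s t) σ
  | tens s _, σ, some (Sum.inl p) => nodeRep s (fun p => σ (some (Sum.inl p))) p
  | tens _ t, σ, some (Sum.inr p) => nodeRep t (fun p => σ (some (Sum.inr p))) p
  | par s t, σ, none => rep (par s t) σ
  | par s _, σ, some (Sum.inl p) => nodeRep s (fun p => σ (some (Sum.inl p))) p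
  | par _ t, σ, some (Sum.inr p) => nodeRep t (fun p => σ (some (Sum.inr p))) p

/-- The edges between leaves that remain from the switching `σ` of a tree after contraction;
only the nodes in `δ` contribute. -/
noncomputable def edges : (t : OTree 𝒜 X) → (t.Inner → Bool) → (t.Inner → Prop) → List (X × X)
  | leaf _ _, _, _ => []
  | tens s t, σ, δ =>
      (if δ none then
        [(rep s fun p => σ (some (Sum.inl p)), rep t fun p => σ (some (Sum.inr p)))] else []) ++
      (edges s (fun p => σ (some (Sum.inl p))) (fun p => δ (some (Sum.inl p))) ++
        edges t (fun p => σ (some (Sum.inr p))) (fun p => δ (some (Sum.inr p))))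
  | par s t, σ, δ =>
      edges s (fun p => σ (some (Sum.inl p))) (fun p => δ (some (Sum.inl p))) ++
        edges t (fun p => σ (some (Sum.inr p))) (fun p => δ (some (Sum.inr p)))

/-- The number of inner nodes below a node. -/
def rank : (t : OTree 𝒜 X) → t.Inner → ℕ
  | leaf _ _, n => nomatch n
  | tens s t, none => s.leaves.length + t.leaves.length
  | tens s _, some (Sum.inl p) => rank s p
  | tens _ t, some (Sum.inr p) => rank t p
  | par s t, none => s.leaves.length + t.leaves.length
  | par s _, some (Sum.inl p) => rank s p
  | par _ t, some (Sum.inr p) => rank t p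

theorem elim_sumMap {N M : Type*} (g : N → M) (f : M → X) (x : X ⊕ N) :
    Sum.elim id f (Sum.map id g x) = Sum.elim id (fun n => f (g n)) x := by
  cases x <;> rfl

theorem sumMap_eq_inr {N M : Type*} {g : N → M} {x : X ⊕ N} {q : M}
    (h : Sum.map id g x = Sum.inr q) : ∃ q', x = Sum.inr q' ∧ g q' = q := by
  cases x with
  | inl x => simp at h
  | inr q' => exact ⟨q', rfl, by simpa using h⟩

theorem sumMap_eq_inl {N M : Type*} {g : N → M} {x : X ⊕ N} {y : X}
    (h : Sum.map id g x = Sum.inl y) : x = Sum.inl y := by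
  cases x with
  | inl x => simpa using h
  | inr q' => simp at h

theorem leaves_length_pos (t : OTree 𝒜 X) : 0 < t.leaves.length := by
  induction t with
  | leaf => simp [leaves]
  | tens s t ih _ => simp only [leaves, List.length_append]; omega
  | par s t ih _ => simp only [leaves, List.length_append]; omega

theorem rank_le (t : OTree 𝒜 X) (p : t.Inner) : rank t p ≤ t.leaves.length := by
  induction t with
  | leaf => exact nomatch p
  | tens s t ih ih' =>
    match p with
    | none => simp [rank, leaves]
    | some (Sum.inl p) =>
      have := ih p
      simp only [rank, leaves, List.length_append]; omega
    | some (Sum.inr p) =>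
      have := ih' p
      simp only [rank, leaves, List.length_append]; omega
  | par s t ih ih' =>
    match p with
    | none => simp [rank, leaves]
    | some (Sum.inl p) =>
      have := ih p
      simp only [rank, leaves, List.length_append]; omega
    | some (Sum.inr p) =>
      have := ih' p
      simp only [rank, leaves, List.length_append]; omega

theorem rank_child (t : OTree 𝒜 X) (p : t.Inner) (b : Bool) (q : t.Inner)
    (h : child b t p = Sum.inr q) : rank t q < rank t p := by
  have key : ∀ (s : OTree 𝒜 X) (q : s.Inner), ∀ n > 0, rank s q < s.leaves.length + n :=
    fun s q n hn => lt_of_le_of_lt (rank_le s q) (by omega)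
  induction t with
  | leaf => exact nomatch p
  | tens s t ih ih' =>
    have hs := leaves_length_pos s
    have ht := leaves_length_pos t
    match p with
    | none =>
      cases b
      · obtain ⟨q', hc, rfl⟩ := sumMap_eq_inr h
        exact key s q' _ ht
      · obtain ⟨q', hc, rfl⟩ := sumMap_eq_inr h
        have := key t q' _ hs
        simp only [rank]; omega
    | some (Sum.inl p) =>
      obtain ⟨q', hc, rfl⟩ := sumMap_eq_inr h
      exact ih p q' hc
    | some (Sum.inr p) =>
      obtain ⟨q', hc, rfl⟩ := sumMap_eq_inr h
      exact ih' p q' hc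
  | par s t ih ih' =>
    have hs := leaves_length_pos s
    have ht := leaves_length_pos t
    match p with
    | none =>
      cases b
      · obtain ⟨q', hc, rfl⟩ := sumMap_eq_inr h
        exact key s q' _ ht
      · obtain ⟨q', hc, rfl⟩ := sumMap_eq_inr h
        have := key t q' _ hs
        simp only [rank]; omega
    | some (Sum.inl p) =>
      obtain ⟨q', hc, rfl⟩ := sumMap_eq_inr h
      exact ih p q' hc
    | some (Sum.inr p) =>
      obtain ⟨q', hc, rfl⟩ := sumMap_eq_inr h
      exact ih' p q' hc

theorem elim_root (t : OTree 𝒜 X) (σ : t.Inner → Bool) :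
    Sum.elim id (nodeRep t σ) (root t) = rep t σ := by
  cases t <;> rfl

theorem elim_child_of_not_isPar (t : OTree 𝒜 X) (σ : t.Inner → Bool) (p : t.Inner)
    (hp : ¬ IsPar t p) : Sum.elim id (nodeRep t σ) (child false t p) = nodeRep t σ p := by
  induction t with
  | leaf => exact nomatch p
  | tens s t ih ih' =>
    match p with
    | none =>
      exact (elim_sumMap _ _ _).trans (elim_root s fun p => σ (some (Sum.inl p)))
    | some (Sum.inl p) => exact (elim_sumMap _ _ _).trans (ih _ p hp)
    | some (Sum.inr p) => exact (elim_sumMap _ _ _).trans (ih' _ p hp)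
  | par s t ih ih' =>
    match p with
    | none => exact absurd trivial hp
    | some (Sum.inl p) => exact (elim_sumMap _ _ _).trans (ih _ p hp)
    | some (Sum.inr p) => exact (elim_sumMap _ _ _).trans (ih' _ p hp)

theorem elim_child_of_isPar (t : OTree 𝒜 X) (σ : t.Inner → Bool) (p : t.Inner)
    (hp : IsPar t p) : Sum.elim id (nodeRep t σ) (child (σ p) t p) = nodeRep t σ p := by
  induction t with
  | leaf => exact nomatch p
  | tens s t ih ih' =>
    match p with
    | none => exact absurd hp id
    | some (Sum.inl p) => exact (elim_sumMap _ _ _).trans (ih _ p hp)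
    | some (Sum.inr p) => exact (elim_sumMap _ _ _).trans (ih' _ p hp)
  | par s t ih ih' =>
    match p with
    | none =>
      cases h : σ none
      · simp only [nodeRep, rep, h]
        exact (elim_sumMap _ _ _).trans (elim_root s fun p => σ (some (Sum.inl p)))
      · simp only [nodeRep, rep, h]
        exact (elim_sumMap _ _ _).trans (elim_root t fun p => σ (some (Sum.inr p)))
    | some (Sum.inl p) => exact (elim_sumMap _ _ _).trans (ih _ p hp)
    | some (Sum.inr p) => exact (elim_sumMap _ _ _).trans (ih' _ p hp)

theorem exists_option_sum {α β : Type} {P : Option (α ⊕ β) → Prop} :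
    (∃ p, P p) ↔ P none ∨ (∃ p, P (some (Sum.inl p))) ∨ ∃ p, P (some (Sum.inr p)) := by
  constructor
  · rintro ⟨_ | p | p, h⟩
    · exact Or.inl h
    · exact Or.inr (Or.inl ⟨p, h⟩)
    · exact Or.inr (Or.inr ⟨p, h⟩)
  · rintro (h | ⟨p, h⟩ | ⟨p, h⟩) <;> exact ⟨_, h⟩

theorem mem_edges (t : OTree 𝒜 X) (σ : t.Inner → Bool) (δ : t.Inner → Prop) (a b : X) :
    (a, b) ∈ edges t σ δ ↔ ∃ p, ¬ IsPar t p ∧ δ p ∧ a = nodeRep t σ p ∧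
      b = Sum.elim id (nodeRep t σ) (child true t p) := by
  induction t with
  | leaf =>
    simp only [edges, List.not_mem_nil, false_iff]
    exact fun ⟨p, _⟩ => nomatch p
  | tens s t ih ih' =>
    have hr : Sum.elim id (nodeRep (tens s t) σ) (child true (tens s t) none) = _ :=
      (elim_sumMap _ _ _).trans (elim_root t fun p => σ (some (Sum.inr p)))
    refine Iff.trans ?_ exists_option_sum.symm
    simp only [edges, List.mem_append, ih, ih']
    refine or_congr ?_ (or_congr (exists_congr fun p => ?_) (exists_congr fun p => ?_))
    · rw [hr]
      by_cases h : δ none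
      · simp [h, nodeRep, rep, IsPar]
      · simp [h]
    · have : Sum.elim id (nodeRep (tens s t) σ) (child true (tens s t) (some (Sum.inl p))) = _ :=
        elim_sumMap _ _ _
      rw [this]; rfl
    · have : Sum.elim id (nodeRep (tens s t) σ) (child true (tens s t) (some (Sum.inr p))) = _ :=
        elim_sumMap _ _ _
      rw [this]; rfl
  | par s t ih ih' =>
    refine Iff.trans ?_ exists_option_sum.symm
    simp only [edges, List.mem_append, ih, ih']
    refine Iff.trans ?_ (or_iff_right (fun h => h.1 trivial)).symm
    refine or_congr (exists_congr fun p => ?_) (exists_congr fun p => ?_)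
    · have : Sum.elim id (nodeRep (par s t) σ) (child true (par s t) (some (Sum.inl p))) = _ :=
        elim_sumMap _ _ _
      rw [this]; rfl
    · have : Sum.elim id (nodeRep (par s t) σ) (child true (par s t) (some (Sum.inr p))) = _ :=
        elim_sumMap _ _ _
      rw [this]; rfl

theorem root_mem_leaves (t : OTree 𝒜 X) (x : X) (h : root t = Sum.inl x) :
    x ∈ t.leaves.map Prod.snd := by
  cases t <;> simp [root] at h
  subst h; simp [leaves]

theorem child_mem_leaves (t : OTree 𝒜 X) (p : t.Inner) (b : Bool) (x : X)
    (h : child b t p = Sum.inl x) : x ∈ t.leaves.map Prod.snd := by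
  induction t with
  | leaf => exact nomatch p
  | tens s t ih ih' =>
    simp only [leaves, List.map_append, List.mem_append]
    match p with
    | none =>
      cases b
      · exact Or.inl (root_mem_leaves _ _ (sumMap_eq_inl h))
      · exact Or.inr (root_mem_leaves _ _ (sumMap_eq_inl h))
    | some (Sum.inl p) =>
      exact Or.inl (ih p (sumMap_eq_inl h))
    | some (Sum.inr p) =>
      exact Or.inr (ih' p (sumMap_eq_inl h))
  | par s t ih ih' =>
    simp only [leaves, List.map_append, List.mem_append]
    match p with
    | none =>
      cases b
      · exact Or.inl (root_mem_leaves _ _ (sumMap_eq_inl h))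
      · exact Or.inr (root_mem_leaves _ _ (sumMap_eq_inl h))
    | some (Sum.inl p) =>
      exact Or.inl (ih p (sumMap_eq_inl h))
    | some (Sum.inr p) =>
      exact Or.inr (ih' p (sumMap_eq_inl h))

theorem child_false_ne_child_true (t : OTree 𝒜 X) (hn : (t.leaves.map Prod.snd).Nodup)
    (p : t.Inner) : child false t p ≠ child true t p := by
  have hmap : ∀ {M M' : Type} {f : M → M'}, Function.Injective f →
      Function.Injective (Sum.map (id : X → X) f) := fun hf =>
    Function.Injective.sumMap Function.injective_id hf
  have hroot : ∀ s t : OTree 𝒜 X, (s.leaves.map Prod.snd).Disjoint (t.leaves.map Prod.snd) →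
      Sum.map id (fun p => some (Sum.inl p)) (root s) ≠
        Sum.map id (fun p => some (Sum.inr p)) (root t) := by
    intro s t hd h
    rcases hs : root s with x | q
    · rw [hs] at h
      exact hd (root_mem_leaves _ _ hs) (root_mem_leaves _ _ (sumMap_eq_inl h.symm))
    · rw [hs] at h
      obtain ⟨q', -, hq⟩ := sumMap_eq_inr h.symm
      simp at hq
  induction t with
  | leaf => exact nomatch p
  | tens s t ih ih' =>
    simp only [leaves, List.map_append] at hn
    match p with
    | none => exact hroot s t (List.disjoint_of_nodup_append hn)
    | some (Sum.inl p) =>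
      intro h
      exact ih hn.of_append_left p (hmap (fun a b h => Sum.inl.inj (Option.some.inj h)) h)
    | some (Sum.inr p) =>
      intro h
      exact ih' hn.of_append_right p (hmap (fun a b h => Sum.inr.inj (Option.some.inj h)) h)
  | par s t ih ih' =>
    simp only [leaves, List.map_append] at hn
    match p with
    | none => exact hroot s t (List.disjoint_of_nodup_append hn)
    | some (Sum.inl p) =>
      intro h
      exact ih hn.of_append_left p (hmap (fun a b h => Sum.inl.inj (Option.some.inj h)) h)
    | some (Sum.inr p) =>
      intro h
      exact ih' hn.of_append_right p (hmap (fun a b h => Sum.inr.inj (Option.some.inj h)) h)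

noncomputable instance instFintypeInner : (t : OTree 𝒜 X) → Fintype t.Inner
  | leaf _ _ => inferInstanceAs (Fintype Empty)
  | tens s t =>
      letI := instFintypeInner s
      letI := instFintypeInner t
      inferInstanceAs (Fintype (Option (s.Inner ⊕ t.Inner)))
  | par s t =>
      letI := instFintypeInner s
      letI := instFintypeInner t
      inferInstanceAs (Fintype (Option (s.Inner ⊕ t.Inner)))

theorem sum_inner_tens (s t : OTree 𝒜 X) (f : (tens s t).Inner → ℕ) :
    ∑ p, f p = f none + (∑ p, f (some (Sum.inl p)) + ∑ p, f (some (Sum.inr p))) := by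
  refine (Fintype.sum_option (α := s.Inner ⊕ t.Inner) f).trans ?_
  rw [Fintype.sum_sum_type]

theorem sum_inner_par (s t : OTree 𝒜 X) (f : (par s t).Inner → ℕ) :
    ∑ p, f p = f none + (∑ p, f (some (Sum.inl p)) + ∑ p, f (some (Sum.inr p))) := by
  refine (Fintype.sum_option (α := s.Inner ⊕ t.Inner) f).trans ?_
  rw [Fintype.sum_sum_type]

theorem sum_not_isPar (t : OTree 𝒜 X) (σ : t.Inner → Bool) :
    ∑ p, (if IsPar t p then 0 else 1) = (edges t σ fun _ => True).length := by
  induction t with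
  | leaf => rfl
  | tens s t ih ih' =>
    rw [sum_inner_tens]
    simp only [edges, if_true, List.length_append, List.length_singleton]
    rw [← ih, ← ih']
    rw [if_neg (show ¬ IsPar (tens s t) none from id)]
    rfl
  | par s t ih ih' =>
    rw [sum_inner_par]
    simp only [edges, List.length_append]
    rw [← ih, ← ih']
    rw [if_pos (show IsPar (par s t) none from trivial), zero_add]
    rfl

end OTree


section ChildGraphTrees

variable {X : Type v} {N : Type w}

theorem reachable_induce_of_closed {W : Type w} (G : SimpleGraph W) (s : Set W)
    (hs : ∀ a b, a ∈ s → G.Adj a b → b ∈ s) {a b : W} (ha : a ∈ s) (hb : b ∈ s)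
    (h : G.Reachable a b) : (G.induce s).Reachable ⟨a, ha⟩ ⟨b, hb⟩ := by
  rw [SimpleGraph.reachable_iff_reflTransGen] at h
  suffices ∃ hb : b ∈ s, (G.induce s).Reachable ⟨a, ha⟩ ⟨b, hb⟩ from this.2
  clear hb
  induction h with
  | refl => exact ⟨ha, SimpleGraph.Reachable.refl _⟩
  | @tail b c _ hbc ih =>
    obtain ⟨hb, ih⟩ := ih
    have hc := hs _ _ hb hbc
    have hbc' : (G.induce s).Adj ⟨b, hb⟩ ⟨c, hc⟩ := hbc
    exact ⟨hc, ih.trans hbc'.reachable⟩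

theorem card_switching [Fintype N] (par : N → Prop) (σ : N → Bool) :
    Nat.card {q : N × Bool // par q.1 → σ q.1 = q.2} =
      Fintype.card N + ∑ p, (if par p then 0 else 1) := by
  rw [Nat.card_eq_fintype_card, Fintype.card_subtype, Finset.card_filter,
    Fintype.sum_prod_type, Fintype.card_eq_sum_ones, ← Finset.sum_add_distrib]
  refine Finset.sum_congr rfl fun p _ => ?_
  rw [Fintype.sum_bool]
  by_cases hp : par p <;> rcases Bool.eq_false_or_eq_true (σ p) with h | h <;> simp [hp, h]

theorem childGraph_isTree_iff [Fintype N] {ch : Bool → N → X ⊕ N} {par : N → Prop} {σ : N → Bool}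
    {rank : N → ℕ} (L : List X) (hr : ∀ p b q, ch b p = Sum.inr q → rank q < rank p)
    (hL : ∀ p b x, ch b p = Sum.inl x → x ∈ L) (hne : ∀ p, ch false p ≠ ch true p)
    {nr : N → X} {E : List (X × X)} (hnr : ∀ p, nr p ∈ L)
    (h1 : ∀ p, ∃ b, (par p → σ p = b) ∧ Sum.elim id nr (ch b p) = nr p)
    (h2 : ∀ p b, (par p → σ p = b) → Conn E (nr p) (Sum.elim id nr (ch b p)))
    (h3 : ∀ a b, (a, b) ∈ E → ∃ p c, (par p → σ p = c) ∧ a = nr p ∧ b = Sum.elim id nr (ch c p))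
    (hlen : ∑ p, (if par p then 0 else 1) = E.length) :
    (((childGraph ch fun p b => par p → σ p = b).induce
        {n | ∀ x, n = Sum.inl x → x ∈ L}).Connected ∧
      ((childGraph ch fun p b => par p → σ p = b).induce
        {n | ∀ x, n = Sum.inl x → x ∈ L}).IsAcyclic) ↔ TreeOn L.toFinset E := by
  set keep : N → Bool → Prop := fun p b => par p → σ p = b
  set s : Set (X ⊕ N) := {n | ∀ x, n = Sum.inl x → x ∈ L}
  have hch : ∀ p b, ch b p ∈ s := fun p b x hx => hL p b x hx
  have hin : ∀ p, (Sum.inr p : X ⊕ N) ∈ s := fun p x hx => by simp at hx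
  have hreach := childGraph_reachable_iff hr (keep := keep) h1 h2 h3
  have hclosed : ∀ a b, a ∈ s → (childGraph ch keep).Adj a b → b ∈ s := by
    intro a b _ hab
    rw [childGraph, SimpleGraph.fromRel_adj] at hab
    rcases hab.2 with ⟨p, c, rfl, rfl, -⟩ | ⟨p, c, rfl, rfl, -⟩
    · exact hch p c
    · exact hin p
  let e : s ≃ L.toFinset ⊕ N :=
    { toFun := fun n => match n with
        | ⟨Sum.inl x, h⟩ => Sum.inl ⟨x, List.mem_toFinset.2 (h x rfl)⟩
        | ⟨Sum.inr p, _⟩ => Sum.inr p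
      invFun := fun n => match n with
        | Sum.inl x => ⟨Sum.inl x.1, fun y hy => by
            rw [← Sum.inl.inj hy]; exact List.mem_toFinset.1 x.2⟩
        | Sum.inr p => ⟨Sum.inr p, hin p⟩
      left_inv := by rintro ⟨x | p, h⟩ <;> rfl
      right_inv := by rintro (x | p) <;> rfl }
  have : Finite s := Finite.of_equiv _ e.symm
  have hcard : Nat.card s = L.toFinset.card + Fintype.card N := by
    rw [Nat.card_congr e, Nat.card_sum, Nat.card_eq_fintype_card, Nat.card_eq_fintype_card,
      Fintype.card_coe]
  have hedge : Nat.card ((childGraph ch keep).induce s).edgeSet = Fintype.card N + E.length := by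
    rw [← hlen, ← card_switching par σ]
    symm
    let g : {q : N × Bool // par q.1 → σ q.1 = q.2} → ((childGraph ch keep).induce s).edgeSet :=
      fun q => ⟨s(⟨Sum.inr q.1.1, hin _⟩, ⟨ch q.1.2 q.1.1, hch _ _⟩), childGraph_adj hr q.2⟩
    refine Nat.card_congr (Equiv.ofBijective g ⟨?_, ?_⟩)
    · rintro ⟨⟨p, b⟩, hp⟩ ⟨⟨q, c⟩, hq⟩ h
      have h' : (s((Sum.inr p : X ⊕ N), ch b p)) = s(Sum.inr q, ch c q) := by
        have := congrArg (Sym2.map Subtype.val) (congrArg Subtype.val h)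
        simpa [g] using this
      rcases Sym2.eq_iff.1 h' with ⟨h1, h2⟩ | ⟨h1, h2⟩
      · obtain rfl := Sum.inr.inj h1
        have : b = c := by
          cases b <;> cases c
          · rfl
          · exact absurd h2 (hne p)
          · exact absurd h2.symm (hne p)
          · rfl
        subst this
        rfl
      · exact absurd ((hr _ _ _ h1.symm).trans (hr _ _ _ h2)) (lt_irrefl _)
    · rintro ⟨d, hd⟩
      induction d using Sym2.ind with
      | _ m n =>
        obtain ⟨m, hm⟩ := m
        obtain ⟨n, hn⟩ := n
        have hd' : (childGraph ch keep).Adj m n := hd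
        rw [childGraph, SimpleGraph.fromRel_adj] at hd'
        rcases hd'.2 with ⟨p, b, rfl, rfl, hk⟩ | ⟨p, b, rfl, rfl, hk⟩
        · exact ⟨⟨(p, b), hk⟩, rfl⟩
        · exact ⟨⟨(p, b), hk⟩, Subtype.ext Sym2.eq_swap⟩
  have hconn : ((childGraph ch keep).induce s).Connected ↔
      (∀ x ∈ L.toFinset, ∀ y ∈ L.toFinset, Conn E x y) ∧ L.toFinset.Nonempty := by
    rw [SimpleGraph.connected_iff]
    refine and_congr ⟨fun h x hx y hy => ?_, fun h => ?_⟩ ?_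
    · have hx' : (Sum.inl x : X ⊕ N) ∈ s := fun z hz => by
        rw [← Sum.inl.inj hz]; exact List.mem_toFinset.1 hx
      have hy' : (Sum.inl y : X ⊕ N) ∈ s := fun z hz => by
        rw [← Sum.inl.inj hz]; exact List.mem_toFinset.1 hy
      have := (h ⟨_, hx'⟩ ⟨_, hy'⟩).map (SimpleGraph.Embedding.induce s).toHom
      exact (hreach _ _).1 this
    · rintro ⟨a, ha⟩ ⟨b, hb⟩
      refine reachable_induce_of_closed _ _ hclosed ha hb ((hreach _ _).2 (h _ ?_ _ ?_))
      · rcases a with x | p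
        · exact List.mem_toFinset.2 (ha x rfl)
        · exact List.mem_toFinset.2 (hnr p)
      · rcases b with x | p
        · exact List.mem_toFinset.2 (hb x rfl)
        · exact List.mem_toFinset.2 (hnr p)
    · constructor
      · rintro ⟨⟨x | p, h⟩⟩
        · exact ⟨x, List.mem_toFinset.2 (h x rfl)⟩
        · exact ⟨_, List.mem_toFinset.2 (hnr p)⟩
      · rintro ⟨x, hx⟩
        exact ⟨⟨Sum.inl x, fun y hy => by
          rw [← Sum.inl.inj hy]; exact List.mem_toFinset.1 hx⟩⟩
  rw [← SimpleGraph.isTree_iff, SimpleGraph.isTree_iff_connected_and_card, hcard, hedge, hconn]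
  constructor
  · rintro ⟨⟨h, -⟩, h'⟩
    exact ⟨h, by omega⟩
  · rintro ⟨h, h'⟩
    exact ⟨⟨h, Finset.card_pos.1 (by omega)⟩, by omega⟩

end ChildGraphTrees

namespace OTree

variable {𝒜 : Type u} {X : Type v}

theorem rep_mem_leaves (t : OTree 𝒜 X) (σ : t.Inner → Bool) :
    rep t σ ∈ t.leaves.map Prod.snd := by
  induction t with
  | leaf => simp [rep, leaves]
  | tens s t ih ih' =>
    simp only [leaves, List.map_append, List.mem_append]
    exact Or.inl (ih _)
  | par s t ih ih' =>
    simp only [leaves, List.map_append, List.mem_append, rep]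
    split_ifs
    · exact Or.inr (ih' _)
    · exact Or.inl (ih _)

theorem nodeRep_mem_leaves (t : OTree 𝒜 X) (σ : t.Inner → Bool) (p : t.Inner) :
    nodeRep t σ p ∈ t.leaves.map Prod.snd := by
  induction t with
  | leaf => exact nomatch p
  | tens s t ih ih' =>
    match p with
    | none => exact rep_mem_leaves (tens s t) σ
    | some (Sum.inl p) =>
      simp only [leaves, List.map_append, List.mem_append]
      exact Or.inl (ih _ p)
    | some (Sum.inr p) =>
      simp only [leaves, List.map_append, List.mem_append]
      exact Or.inr (ih' _ p)
  | par s t ih ih' =>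
    match p with
    | none => exact rep_mem_leaves (par s t) σ
    | some (Sum.inl p) =>
      simp only [leaves, List.map_append, List.mem_append]
      exact Or.inl (ih _ p)
    | some (Sum.inr p) =>
      simp only [leaves, List.map_append, List.mem_append]
      exact Or.inr (ih' _ p)

end OTree

namespace Forest

variable {𝒜 : Type u} {X : Type v}

/-- The leaf to which an inner node is contracted in the switching `σ`. -/
def nodeRep : (F : List (OTree 𝒜 X)) → (Inner F → Bool) → Inner F → X
  | [], _, n => nomatch n
  | t :: _, σ, Sum.inl p => t.nodeRep (fun p => σ (Sum.inl p)) p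
  | _ :: F, σ, Sum.inr p => nodeRep F (fun p => σ (Sum.inr p)) p

/-- The edges between leaves that remain after contraction. -/
noncomputable def edges :
    (F : List (OTree 𝒜 X)) → (Inner F → Bool) → (Inner F → Prop) → List (X × X)
  | [], _, _ => []
  | t :: F, σ, δ => t.edges (fun p => σ (Sum.inl p)) (fun p => δ (Sum.inl p)) ++
      edges F (fun p => σ (Sum.inr p)) (fun p => δ (Sum.inr p))

def rank : (F : List (OTree 𝒜 X)) → Inner F → ℕ
  | [], n => nomatch n
  | t :: _, Sum.inl p => t.rank p
  | _ :: F, Sum.inr p => rank F p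

theorem rank_child (F : List (OTree 𝒜 X)) (p : Inner F) (b : Bool) (q : Inner F)
    (h : child b F p = Sum.inr q) : rank F q < rank F p := by
  induction F with
  | nil => exact nomatch p
  | cons t F ih =>
    match p with
    | Sum.inl p =>
      obtain ⟨q', hc, rfl⟩ := OTree.sumMap_eq_inr h
      exact OTree.rank_child t p b q' hc
    | Sum.inr p =>
      obtain ⟨q', hc, rfl⟩ := OTree.sumMap_eq_inr h
      exact ih p q' hc

theorem elim_child_of_not_isPar (F : List (OTree 𝒜 X)) (σ : Inner F → Bool) (p : Inner F)
    (hp : ¬ IsPar F p) : Sum.elim id (nodeRep F σ) (child false F p) = nodeRep F σ p := by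
  induction F with
  | nil => exact nomatch p
  | cons t F ih =>
    match p with
    | Sum.inl p =>
      exact (OTree.elim_sumMap _ _ _).trans (OTree.elim_child_of_not_isPar t _ p hp)
    | Sum.inr p => exact (OTree.elim_sumMap _ _ _).trans (ih _ p hp)

theorem elim_child_of_isPar (F : List (OTree 𝒜 X)) (σ : Inner F → Bool) (p : Inner F)
    (hp : IsPar F p) : Sum.elim id (nodeRep F σ) (child (σ p) F p) = nodeRep F σ p := by
  induction F with
  | nil => exact nomatch p
  | cons t F ih =>
    match p with
    | Sum.inl p =>
      exact (OTree.elim_sumMap _ _ _).trans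
        (OTree.elim_child_of_isPar t (fun p => σ (Sum.inl p)) p hp)
    | Sum.inr p => exact (OTree.elim_sumMap _ _ _).trans (ih (fun p => σ (Sum.inr p)) p hp)

theorem exists_inner_cons {t : OTree 𝒜 X} {F : List (OTree 𝒜 X)} {P : Inner (t :: F) → Prop} :
    (∃ p, P p) ↔ (∃ p, P (Sum.inl p)) ∨ ∃ p, P (Sum.inr p) :=
  Sum.exists

theorem mem_edges (F : List (OTree 𝒜 X)) (σ : Inner F → Bool) (δ : Inner F → Prop) (a b : X) :
    (a, b) ∈ edges F σ δ ↔ ∃ p, ¬ IsPar F p ∧ δ p ∧ a = nodeRep F σ p ∧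
      b = Sum.elim id (nodeRep F σ) (child true F p) := by
  induction F with
  | nil =>
    simp only [edges, List.not_mem_nil, false_iff]
    exact fun ⟨p, _⟩ => nomatch p
  | cons t F ih =>
    refine Iff.trans ?_ exists_inner_cons.symm
    simp only [edges, List.mem_append, ih, OTree.mem_edges]
    refine or_congr (exists_congr fun p => ?_) (exists_congr fun p => ?_)
    · have : Sum.elim id (nodeRep (t :: F) σ) (child true (t :: F) (Sum.inl p)) = _ :=
        OTree.elim_sumMap _ _ _
      rw [this]; rfl
    · have : Sum.elim id (nodeRep (t :: F) σ) (child true (t :: F) (Sum.inr p)) = _ :=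
        OTree.elim_sumMap _ _ _
      rw [this]; rfl

theorem child_mem_leaves (F : List (OTree 𝒜 X)) (p : Inner F) (b : Bool) (x : X)
    (h : child b F p = Sum.inl x) : x ∈ (leaves F).map Prod.snd := by
  induction F with
  | nil => exact nomatch p
  | cons t F ih =>
    simp only [leaves, List.flatMap_cons, List.map_append, List.mem_append]
    match p with
    | Sum.inl p => exact Or.inl (OTree.child_mem_leaves t p b x (OTree.sumMap_eq_inl h))
    | Sum.inr p => exact Or.inr (ih p (OTree.sumMap_eq_inl h))

theorem nodeRep_mem_leaves (F : List (OTree 𝒜 X)) (σ : Inner F → Bool) (p : Inner F) :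
    nodeRep F σ p ∈ (leaves F).map Prod.snd := by
  induction F with
  | nil => exact nomatch p
  | cons t F ih =>
    simp only [leaves, List.flatMap_cons, List.map_append, List.mem_append]
    match p with
    | Sum.inl p => exact Or.inl (OTree.nodeRep_mem_leaves t _ p)
    | Sum.inr p => exact Or.inr (ih _ p)

theorem child_false_ne_child_true (F : List (OTree 𝒜 X))
    (hn : ∀ t ∈ F, (t.leaves.map Prod.snd).Nodup) (p : Inner F) :
    child false F p ≠ child true F p := by
  induction F with
  | nil => exact nomatch p
  | cons t F ih =>
    match p with
    | Sum.inl p =>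
      intro h
      exact OTree.child_false_ne_child_true t (hn t (by simp)) p
        (Function.Injective.sumMap Function.injective_id Sum.inl_injective h)
    | Sum.inr p =>
      intro h
      exact ih (fun t ht => hn t (by simp [ht])) p
        (Function.Injective.sumMap Function.injective_id Sum.inr_injective h)

noncomputable instance instFintypeInner : (F : List (OTree 𝒜 X)) → Fintype (Inner F)
  | [] => inferInstanceAs (Fintype Empty)
  | t :: F =>
      letI := instFintypeInner F
      inferInstanceAs (Fintype (t.Inner ⊕ Inner F))

theorem sum_not_isPar (F : List (OTree 𝒜 X)) (σ : Inner F → Bool) :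
    ∑ p, (if IsPar F p then 0 else 1) = (edges F σ fun _ => True).length := by
  induction F with
  | nil => rfl
  | cons t F ih =>
    refine (Fintype.sum_sum_type (α₁ := t.Inner) (α₂ := Inner F) _).trans ?_
    simp only [edges, List.length_append]
    rw [← ih, ← OTree.sum_not_isPar]
    rfl

/-- The choice of a child that is kept by the switching `σ` and by `δ`. -/
def Keep (F : List (OTree 𝒜 X)) (σ : Inner F → Bool) (δ : Inner F → Prop) (p : Inner F)
    (b : Bool) : Prop :=
  (IsPar F p → σ p = b) ∧ (¬ IsPar F p → b = true → δ p)

theorem exists_keep (F : List (OTree 𝒜 X)) (σ : Inner F → Bool) (δ : Inner F → Prop)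
    (p : Inner F) : ∃ b, Keep F σ δ p b ∧
      Sum.elim id (nodeRep F σ) (child b F p) = nodeRep F σ p := by
  by_cases hp : IsPar F p
  · exact ⟨σ p, ⟨fun _ => rfl, fun h => absurd hp h⟩, elim_child_of_isPar F σ p hp⟩
  · exact ⟨false, ⟨fun h => absurd h hp, fun _ h => by simp at h⟩,
      elim_child_of_not_isPar F σ p hp⟩

theorem conn_of_keep (F : List (OTree 𝒜 X)) (σ : Inner F → Bool) (δ : Inner F → Prop)
    (p : Inner F) (b : Bool) (h : Keep F σ δ p b) :
    Conn (edges F σ δ) (nodeRep F σ p) (Sum.elim id (nodeRep F σ) (child b F p)) := by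
  by_cases hp : IsPar F p
  · rw [← h.1 hp, elim_child_of_isPar F σ p hp]; exact Conn.refl _ _
  · cases b
    · rw [elim_child_of_not_isPar F σ p hp]; exact Conn.refl _ _
    · exact Conn.of_mem ((mem_edges F σ δ _ _).2 ⟨p, hp, h.2 hp rfl, rfl, rfl⟩)

theorem exists_keep_of_mem_edges (F : List (OTree 𝒜 X)) (σ : Inner F → Bool)
    (δ : Inner F → Prop) (a b : X) (h : (a, b) ∈ edges F σ δ) :
    ∃ p c, Keep F σ δ p c ∧ a = nodeRep F σ p ∧
      b = Sum.elim id (nodeRep F σ) (child c F p) := by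
  obtain ⟨p, hp, hδ, ha, hb⟩ := (mem_edges F σ δ a b).1 h
  exact ⟨p, true, ⟨fun h => absurd h hp, fun _ _ => hδ⟩, ha, hb⟩

theorem reachable_keep_iff (F : List (OTree 𝒜 X)) (σ : Inner F → Bool) (δ : Inner F → Prop)
    (m n : X ⊕ Inner F) :
    (childGraph (fun b p => child b F p) (Keep F σ δ)).Reachable m n ↔
      Conn (edges F σ δ) (Sum.elim id (nodeRep F σ) m) (Sum.elim id (nodeRep F σ) n) :=
  childGraph_reachable_iff (rank_child F) (exists_keep F σ δ) (conn_of_keep F σ δ)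
    (exists_keep_of_mem_edges F σ δ) m n

theorem switching_isTree_iff (F : List (OTree 𝒜 X))
    (hn : ∀ t ∈ F, (t.leaves.map Prod.snd).Nodup) (σ : Inner F → Bool) :
    (((switching F σ).induce (nodes F)).Connected ∧ ((switching F σ).induce (nodes F)).IsAcyclic) ↔
      TreeOn ((leaves F).map Prod.snd).toFinset (edges F σ fun _ => True) := by
  have hk : ∀ p b, Keep F σ (fun _ => True) p b ↔ (IsPar F p → σ p = b) := fun p b => by
    simp [Keep]
  refine childGraph_isTree_iff (ch := fun b p => child b F p) _ (rank_child F) (child_mem_leaves F)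
    (child_false_ne_child_true F hn) (nodeRep_mem_leaves F σ) ?_ ?_ ?_ (sum_not_isPar F σ)
  · intro p
    obtain ⟨b, hb, h⟩ := exists_keep F σ (fun _ => True) p
    exact ⟨b, hb.1, h⟩
  · intro p b h
    exact conn_of_keep F σ _ p b ((hk p b).2 h)
  · intro a b h
    obtain ⟨p, c, hc, h⟩ := exists_keep_of_mem_edges F σ _ a b h
    exact ⟨p, c, hc.1, h⟩

end Forest


section Switchings

variable {𝒜 : Type u} {X : Type v}

/-- The contracted switchings of a tree: a leaf `r` representing the root, and a list of edges
between leaves. -/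
def OTree.Sw : OTree 𝒜 X → X → List (X × X) → Prop
  | .leaf _ x, r, E => r = x ∧ E = []
  | .tens s t, r, E => ∃ E₁ r₂ E₂, Sw s r E₁ ∧ Sw t r₂ E₂ ∧ E = (r, r₂) :: (E₁ ++ E₂)
  | .par s t, r, E => ∃ r₁ E₁ r₂ E₂, Sw s r₁ E₁ ∧ Sw t r₂ E₂ ∧ (r = r₁ ∨ r = r₂) ∧ E = E₁ ++ E₂

/-- The contracted switchings of a forest. -/
def Forest.Sw : List (OTree 𝒜 X) → List (X × X) → Prop
  | [], E => E = []
  | t :: F, E => ∃ r E₁ E₂, t.Sw r E₁ ∧ Forest.Sw F E₂ ∧ E = E₁ ++ E₂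

/-- The contracted switchings of a linking; the root is represented by a positive leaf. -/
def Linking.Sw : Linking 𝒜 X → X → List (X × X) → Prop
  | .one x, r, E => r = x ∧ E = []
  | .ax _ x y, r, E => r = x ∧ E = [(y, x)]
  | .xa _ x y, r, E => r = y ∧ E = [(x, y)]
  | .botTens x Q, r, E => ∃ E', Sw Q r E' ∧ E = (x, r) :: E'
  | .tensBot Q x, r, E => ∃ E', Sw Q r E' ∧ E = (x, r) :: E'
  | .par Q R, r, E => ∃ r₁ E₁ r₂ E₂, Sw Q r₁ E₁ ∧ Sw R r₂ E₂ ∧ (r = r₁ ∨ r = r₂) ∧ E = E₁ ++ E₂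

theorem OTree.sw_iff (t : OTree 𝒜 X) (r : X) (E : List (X × X)) :
    t.Sw r E ↔ ∃ σ, t.rep σ = r ∧ t.edges σ (fun _ => True) = E := by
  induction t generalizing r E with
  | leaf l x =>
    constructor
    · rintro ⟨rfl, rfl⟩; exact ⟨(fun n => nomatch n), rfl, rfl⟩
    · rintro ⟨σ, rfl, rfl⟩; exact ⟨rfl, rfl⟩
  | tens s t ih ih' =>
    constructor
    · rintro ⟨E₁, r₂, E₂, hs, ht, rfl⟩
      obtain ⟨σ, rfl, rfl⟩ := (ih _ _).1 hs
      obtain ⟨τ, rfl, rfl⟩ := (ih' _ _).1 ht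
      exact ⟨fun n => match n with
        | none => false
        | some (Sum.inl p) => σ p
        | some (Sum.inr p) => τ p, rfl, by simp [OTree.edges]⟩
    · rintro ⟨σ, rfl, rfl⟩
      exact ⟨_, _, _, (ih _ _).2 ⟨_, rfl, rfl⟩, (ih' _ _).2 ⟨fun p => σ (some (Sum.inr p)), rfl, rfl⟩, by
        simp [OTree.edges, OTree.rep]⟩
  | par s t ih ih' =>
    constructor
    · rintro ⟨r₁, E₁, r₂, E₂, hs, ht, hr, rfl⟩
      obtain ⟨σ, rfl, rfl⟩ := (ih _ _).1 hs
      obtain ⟨τ, rfl, rfl⟩ := (ih' _ _).1 ht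
      rcases hr with rfl | rfl
      · exact ⟨fun n => match n with
          | none => false
          | some (Sum.inl p) => σ p
          | some (Sum.inr p) => τ p, by simp [OTree.rep], by simp [OTree.edges]⟩
      · exact ⟨fun n => match n with
          | none => true
          | some (Sum.inl p) => σ p
          | some (Sum.inr p) => τ p, by simp [OTree.rep], by simp [OTree.edges]⟩
    · rintro ⟨σ, rfl, rfl⟩
      refine ⟨_, _, _, _, (ih _ _).2 ⟨_, rfl, rfl⟩, (ih' _ _).2 ⟨_, rfl, rfl⟩, ?_, rfl⟩
      simp only [OTree.rep]
      split_ifs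
      · exact Or.inr rfl
      · exact Or.inl rfl

theorem Forest.sw_iff (F : List (OTree 𝒜 X)) (E : List (X × X)) :
    Forest.Sw F E ↔ ∃ σ, Forest.edges F σ (fun _ => True) = E := by
  induction F generalizing E with
  | nil =>
    constructor
    · rintro rfl; exact ⟨(fun n => nomatch n), rfl⟩
    · rintro ⟨σ, rfl⟩; rfl
  | cons t F ih =>
    constructor
    · rintro ⟨r, E₁, E₂, ht, hF, rfl⟩
      obtain ⟨σ, -, rfl⟩ := (OTree.sw_iff _ _ _).1 ht
      obtain ⟨τ, rfl⟩ := (ih _).1 hF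
      exact ⟨Sum.elim σ τ, rfl⟩
    · rintro ⟨σ, rfl⟩
      exact ⟨_, _, _, (OTree.sw_iff _ _ _).2 ⟨_, rfl, rfl⟩, (ih _).2 ⟨_, rfl⟩, rfl⟩

/-- Two pointed lists of edges give the same connectedness and have the same length. -/
structure SwEquiv (r : X) (E : List (X × X)) (r' : X) (E' : List (X × X)) : Prop where
  length : E.length = E'.length
  le : ∀ a b, (a, b) ∈ E → Conn E' a b
  ge : ∀ a b, (a, b) ∈ E' → Conn E a b
  root : Conn E r r'

theorem SwEquiv.rfl {r : X} {E : List (X × X)} : SwEquiv r E r E :=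
  ⟨_root_.rfl, fun _ _ => Conn.of_mem, fun _ _ => Conn.of_mem, Conn.refl _ _⟩

theorem SwEquiv.root' {r r' : X} {E E' : List (X × X)} (h : SwEquiv r E r' E') : Conn E' r r' :=
  h.root.of_le h.le

theorem SwEquiv.symm {r r' : X} {E E' : List (X × X)} (h : SwEquiv r E r' E') :
    SwEquiv r' E' r E :=
  ⟨h.length.symm, h.ge, h.le, h.root'.symm⟩

theorem SwEquiv.append_le {r r' : X} {E E' : List (X × X)} (h : SwEquiv r E r' E')
    (F : List (X × X)) (a b : X) (hab : (a, b) ∈ E ++ F) : Conn (E' ++ F) a b := by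
  rcases List.mem_append.1 hab with hab | hab
  · exact (h.le a b hab).mono (List.subset_append_left _ _)
  · exact Conn.of_mem (List.mem_append_right _ hab)

theorem SwEquiv.append {r r' s s' : X} {E E' F F' : List (X × X)} (h : SwEquiv r E r' E')
    (h' : SwEquiv s F s' F') : SwEquiv r (E ++ F) r' (E' ++ F') := by
  have key : ∀ {E E' F F' : List (X × X)}, (∀ a b, (a, b) ∈ E → Conn E' a b) →
      (∀ a b, (a, b) ∈ F → Conn F' a b) → ∀ a b, (a, b) ∈ E ++ F → Conn (E' ++ F') a b := by
    intro E E' F F' h h' a b hab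
    rcases List.mem_append.1 hab with hab | hab
    · exact (h a b hab).mono (List.subset_append_left _ _)
    · exact (h' a b hab).mono (List.subset_append_right _ _)
  exact ⟨by simp [h.length, h'.length], key h.le h'.le, key h.ge h'.ge,
    h.root.mono (List.subset_append_left _ _)⟩

theorem SwEquiv.append_right {r r' s s' : X} {E E' F F' : List (X × X)} (h : SwEquiv r E r' E')
    (h' : SwEquiv s F s' F') : SwEquiv s (E ++ F) s' (E' ++ F') :=
  let k := h.append h'
  ⟨k.length, k.le, k.ge, h'.root.mono (List.subset_append_right _ _)⟩

/-- Adding an edge from a vertex to the root. -/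
theorem SwEquiv.cons {r r' : X} {E E' : List (X × X)} (h : SwEquiv r E r' E') (x : X) :
    SwEquiv r ((x, r) :: E) r' ((x, r') :: E') := by
  have key : ∀ {r r' : X} {E E' : List (X × X)}, SwEquiv r E r' E' →
      ∀ a b, (a, b) ∈ (x, r) :: E → Conn ((x, r') :: E') a b := by
    intro r r' E E' h a b hab
    rcases List.mem_cons.1 hab with hab | hab
    · obtain ⟨rfl, rfl⟩ := Prod.mk.inj hab
      exact (Conn.of_mem List.mem_cons_self).trans
        (h.root'.symm.mono (List.subset_cons_self _ _))
    · exact (h.le a b hab).mono (List.subset_cons_self _ _)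
  exact ⟨by simp [h.length], key h, key h.symm, h.root.mono (List.subset_cons_self _ _)⟩

/-- Moving the root along an edge, and turning that edge. -/
theorem SwEquiv.turn {r r' : X} {E E' : List (X × X)} {x : X}
    (h : SwEquiv r ((x, r) :: E) r' E') : SwEquiv x ((x, r) :: E) r' E' :=
  ⟨h.length, h.le, h.ge, (Conn.of_mem List.mem_cons_self).trans h.root⟩

theorem SwEquiv.flip {r r' s x y : X} {E E' : List (X × X)}
    (h : SwEquiv s ((x, r) :: E) r' E') (hy : y = s) : SwEquiv y ((r, x) :: E) r' E' := by
  subst hy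
  have h1 : ∀ a b, (a, b) ∈ (x, r) :: E → Conn ((r, x) :: E) a b := by
    intro a b hab
    rcases List.mem_cons.1 hab with hab | hab
    · obtain ⟨rfl, rfl⟩ := Prod.mk.inj hab
      exact (Conn.of_mem List.mem_cons_self).symm
    · exact Conn.of_mem (List.mem_cons_of_mem _ hab)
  refine ⟨h.length, fun a b hab => ?_, fun a b hab => (h.ge a b hab).of_le h1, h.root.of_le h1⟩
  rcases List.mem_cons.1 hab with hab | hab
  · obtain ⟨rfl, rfl⟩ := Prod.mk.inj hab
    exact (h.le _ _ List.mem_cons_self).symm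
  · exact h.le a b (List.mem_cons_of_mem _ hab)

theorem Linking.sw_of_sw_toTree (P : Linking 𝒜 X) (r : X) (E : List (X × X))
    (h : P.toTree.Sw r E) : ∃ r' E', P.Sw r' E' ∧ SwEquiv r E r' E' := by
  induction P generalizing r E with
  | one x => exact ⟨r, E, h, SwEquiv.rfl⟩
  | ax a x y =>
    obtain ⟨_, _, _, ⟨rfl, rfl⟩, ⟨rfl, rfl⟩, rfl⟩ := h
    exact ⟨_, _, ⟨rfl, rfl⟩, (SwEquiv.rfl (r := r)).flip rfl⟩
  | xa a x y =>
    obtain ⟨_, _, _, ⟨rfl, rfl⟩, ⟨rfl, rfl⟩, rfl⟩ := h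
    exact ⟨_, _, ⟨rfl, rfl⟩, SwEquiv.rfl.turn⟩
  | botTens x Q ih =>
    obtain ⟨_, r₂, E₂, ⟨rfl, rfl⟩, h, rfl⟩ := h
    obtain ⟨r', E', h', he⟩ := ih _ _ h
    exact ⟨r', _, ⟨E', h', rfl⟩, (he.cons r).turn⟩
  | tensBot Q x ih =>
    obtain ⟨E₁, _, _, h, ⟨rfl, rfl⟩, rfl⟩ := h
    obtain ⟨r', E', h', he⟩ := ih _ _ h
    refine ⟨r', _, ⟨E', h', rfl⟩, ?_⟩
    rw [List.append_nil]
    exact (he.cons _).flip rfl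
  | par Q R ih ih' =>
    obtain ⟨r₁, E₁, r₂, E₂, h₁, h₂, hr, rfl⟩ := h
    obtain ⟨r₁', E₁', h₁', he₁⟩ := ih _ _ h₁
    obtain ⟨r₂', E₂', h₂', he₂⟩ := ih' _ _ h₂
    rcases hr with rfl | rfl
    · exact ⟨r₁', _, ⟨_, _, _, _, h₁', h₂', Or.inl rfl, rfl⟩, he₁.append he₂⟩
    · exact ⟨r₂', _, ⟨_, _, _, _, h₁', h₂', Or.inr rfl, rfl⟩, he₁.append_right he₂⟩

theorem Linking.sw_toTree_of_sw (P : Linking 𝒜 X) (r : X) (E : List (X × X))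
    (h : P.Sw r E) : ∃ r' E', P.toTree.Sw r' E' ∧ SwEquiv r' E' r E := by
  induction P generalizing r E with
  | one x => exact ⟨r, E, h, SwEquiv.rfl⟩
  | ax a x y =>
    obtain ⟨rfl, rfl⟩ := h
    exact ⟨_, _, ⟨_, _, _, ⟨rfl, rfl⟩, ⟨rfl, rfl⟩, rfl⟩, (SwEquiv.rfl (r := r)).flip rfl⟩
  | xa a x y =>
    obtain ⟨rfl, rfl⟩ := h
    exact ⟨_, _, ⟨_, _, _, ⟨rfl, rfl⟩, ⟨rfl, rfl⟩, rfl⟩, SwEquiv.rfl.turn⟩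
  | botTens x Q ih =>
    obtain ⟨E', h, rfl⟩ := h
    obtain ⟨r', E'', h', he⟩ := ih _ _ h
    exact ⟨x, _, ⟨_, _, _, ⟨rfl, rfl⟩, h', rfl⟩, (he.cons x).turn⟩
  | tensBot Q x ih =>
    obtain ⟨E', h, rfl⟩ := h
    obtain ⟨r', E'', h', he⟩ := ih _ _ h
    refine ⟨r', _, ⟨_, _, _, h', ⟨rfl, rfl⟩, rfl⟩, ?_⟩
    rw [List.append_nil]
    exact (he.cons _).flip rfl
  | par Q R ih ih' =>
    obtain ⟨r₁, E₁, r₂, E₂, h₁, h₂, hr, rfl⟩ := h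
    obtain ⟨r₁', E₁', h₁', he₁⟩ := ih _ _ h₁
    obtain ⟨r₂', E₂', h₂', he₂⟩ := ih' _ _ h₂
    rcases hr with rfl | rfl
    · exact ⟨r₁', _, ⟨_, _, _, _, h₁', h₂', Or.inl rfl, rfl⟩, he₁.append he₂⟩
    · exact ⟨r₂', _, ⟨_, _, _, _, h₁', h₂', Or.inr rfl, rfl⟩, he₁.append_right he₂⟩

/-- The names of the leaves of a linking. -/
def Linking.names (P : Linking 𝒜 X) : List X :=
  P.toTree.leaves.map Prod.snd

theorem Linking.Sw.root_mem {P : Linking 𝒜 X} {r : X} {E : List (X × X)} (h : P.Sw r E) :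
    r ∈ P.names := by
  induction P generalizing r E with
  | one x => simp [Linking.names, Linking.toTree, OTree.leaves, h.1]
  | ax a x y => simp [Linking.names, Linking.toTree, OTree.leaves, h.1]
  | xa a x y => simp [Linking.names, Linking.toTree, OTree.leaves, h.1]
  | botTens x Q ih =>
    obtain ⟨E', h, -⟩ := h
    simp only [Linking.names, Linking.toTree, OTree.leaves, List.map_append, List.mem_append]
    exact Or.inr (ih h)
  | tensBot Q x ih =>
    obtain ⟨E', h, -⟩ := h
    simp only [Linking.names, Linking.toTree, OTree.leaves, List.map_append, List.mem_append]
    exact Or.inl (ih h)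
  | par Q R ih ih' =>
    obtain ⟨r₁, E₁, r₂, E₂, h₁, h₂, hr, -⟩ := h
    simp only [Linking.names, Linking.toTree, OTree.leaves, List.map_append, List.mem_append]
    rcases hr with rfl | rfl
    · exact Or.inl (ih h₁)
    · exact Or.inr (ih' h₂)

/-- Correctness in terms of contracted switchings. -/
def SwCorrect (P : Linking 𝒜 X) (Γ : List (Item 𝒜 X)) : Prop :=
  ∀ r E F, P.Sw r E → Forest.Sw (Γ.map Item.toTree) F → TreeOn P.names.toFinset (E ++ F)

theorem PreGraph.correct_iff (G : PreGraph 𝒜 X) : G.Correct ↔ SwCorrect G.link G.seq := by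
  have hn : ∀ t ∈ forest G.link G.seq, (t.leaves.map Prod.snd).Nodup := by
    intro t ht
    rcases List.mem_cons.1 ht with rfl | ht
    · exact G.nodup
    · refine List.Nodup.sublist ?_ ((G.leaves_perm.map Prod.snd).nodup_iff.1 G.nodup)
      rw [Forest.leaves, List.flatMap_def]
      exact (List.sublist_flatten_of_mem (List.mem_map_of_mem ht)).map _
  have hV : ((Forest.leaves (forest G.link G.seq)).map Prod.snd).toFinset =
      G.link.names.toFinset := by
    ext x
    have := (G.leaves_perm.map Prod.snd).mem_iff (a := x)
    simp only [forest, Forest.leaves, List.flatMap_cons, List.map_append, List.mem_toFinset,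
      List.mem_append, Linking.names] at this ⊢
    rw [← this, or_self]
  have h1 : G.Correct ↔ ∀ E, Forest.Sw (forest G.link G.seq) E →
      TreeOn G.link.names.toFinset E := by
    rw [← hV]
    refine ⟨fun h E hE => ?_, fun h σ => ?_⟩
    · obtain ⟨σ, rfl⟩ := (Forest.sw_iff _ _).1 hE
      exact (Forest.switching_isTree_iff _ hn σ).1 (h σ)
    · exact (Forest.switching_isTree_iff _ hn σ).2 (h _ ((Forest.sw_iff _ _).2 ⟨σ, rfl⟩))
  rw [h1]
  constructor
  · intro h r E F hE hF
    obtain ⟨r', E', hE', he⟩ := Linking.sw_toTree_of_sw _ _ _ hE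
    exact (h _ ⟨r', E', F, hE', hF, rfl⟩).of_le (he.append_le F) (by simp [he.length])
  · rintro h _ ⟨r, E, F, hE, hF, rfl⟩
    obtain ⟨r', E', hE', he⟩ := Linking.sw_of_sw_toTree _ _ _ hE
    exact (h r' E' F hE' hF).of_le (he.symm.append_le F) (by simp [he.length])

end Switchings


section Contexts

variable {𝒜 : Type u} {X : Type v}

/-- The contracted switchings of a context: `none` as the root means the root of the hole, `S` are
the leaves that are joined to the root of the hole, `A` the remaining edges. -/
def Ctx.Sw : Ctx 𝒜 X → Option X → List X → List (X × X) → Prop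
  | .hole, o, S, A => o = none ∧ S = [] ∧ A = []
  | .botTens x C, o, S, A => ∃ S' A', Sw C o S' A' ∧
      ((o = none ∧ S = x :: S' ∧ A = A') ∨ ∃ r, o = some r ∧ S = S' ∧ A = (x, r) :: A')
  | .tensBot C x, o, S, A => ∃ S' A', Sw C o S' A' ∧
      ((o = none ∧ S = x :: S' ∧ A = A') ∨ ∃ r, o = some r ∧ S = S' ∧ A = (x, r) :: A')
  | .parL C R, o, S, A => ∃ o' A' r E, Sw C o' S A' ∧ R.Sw r E ∧ (o = o' ∨ o = some r) ∧ A = A' ++ E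
  | .parR R C, o, S, A => ∃ o' A' r E, Sw C o' S A' ∧ R.Sw r E ∧ (o = o' ∨ o = some r) ∧ A = E ++ A'

theorem perm_iff_coe_eq {α : Type*} {l l' : List α} :
    l.Perm l' ↔ (l : Multiset α) = (l' : Multiset α) :=
  Multiset.coe_eq_coe.symm

theorem SwEquiv.perm {r r' : X} {E E' E'' : List (X × X)} (h : SwEquiv r E r' E')
    (hp : E'.Perm E'') : SwEquiv r E r' E'' :=
  ⟨h.length.trans hp.length_eq,
    fun a b hab => (h.le a b hab).mono hp.subset, fun a b hab => h.ge a b (hp.symm.subset hab),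
    h.root⟩

theorem perm_cons_star (x r : X) (E : List (X × X)) (S : List X) (A : List (X × X)) :
    ((x, r) :: (E ++ (star S r ++ A))).Perm (E ++ (star (x :: S) r ++ A)) := by
  simp only [star_cons, perm_iff_coe_eq, ← Multiset.coe_add, ← Multiset.cons_coe,
    ← Multiset.singleton_add]
  abel

theorem perm_cons_middle (x r s : X) (E : List (X × X)) (S : List X) (A : List (X × X)) :
    ((x, s) :: (E ++ (star S r ++ A))).Perm (E ++ (star S r ++ (x, s) :: A)) := by
  simp only [perm_iff_coe_eq, ← Multiset.coe_add, ← Multiset.cons_coe, ← Multiset.singleton_add]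
  abel

theorem Ctx.sw_of_sw_fill (C : Ctx 𝒜 X) (Q : Linking 𝒜 X) (r : X) (E : List (X × X))
    (h : (C.fill Q).Sw r E) : ∃ r₀ E₀ o S A, Q.Sw r₀ E₀ ∧ C.Sw o S A ∧ r = o.getD r₀ ∧
      E.Perm (E₀ ++ (star S r₀ ++ A)) := by
  have bot : ∀ (x : X) (C : Ctx 𝒜 X) (r : X) (E : List (X × X)), (∃ r₀ E₀ o S A, Q.Sw r₀ E₀ ∧
      C.Sw o S A ∧ r = o.getD r₀ ∧ E.Perm (E₀ ++ (star S r₀ ++ A))) → ∃ r₀ E₀ o S A, Q.Sw r₀ E₀ ∧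
      (Ctx.botTens x C).Sw o S A ∧ r = o.getD r₀ ∧
      ((x, r) :: E).Perm (E₀ ++ (star S r₀ ++ A)) := by
    rintro x C r E ⟨r₀, E₀, o, S, A, hQ, hC, rfl, hp⟩
    cases o with
    | none => exact ⟨r₀, E₀, none, x :: S, A, hQ, ⟨S, A, hC, Or.inl ⟨rfl, rfl, rfl⟩⟩, rfl,
        (hp.cons _).trans (perm_cons_star _ _ _ _ _)⟩
    | some s => exact ⟨r₀, E₀, some s, S, (x, s) :: A, hQ, ⟨S, A, hC, Or.inr ⟨s, rfl, rfl, rfl⟩⟩,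
        rfl, (hp.cons _).trans (perm_cons_middle _ _ _ _ _ _)⟩
  induction C generalizing r E with
  | hole => exact ⟨r, E, none, [], [], h, ⟨rfl, rfl, rfl⟩, rfl, by simp⟩
  | botTens x C ih =>
    obtain ⟨E', h, rfl⟩ := h
    exact bot x C _ _ (ih _ _ h)
  | tensBot C x ih =>
    obtain ⟨E', h, rfl⟩ := h
    exact bot x C _ _ (ih _ _ h)
  | parL C R ih =>
    obtain ⟨r₁, E₁, r₂, E₂, h₁, h₂, hr, rfl⟩ := h
    obtain ⟨r₀, E₀, o, S, A, hQ, hC, rfl, hp⟩ := ih _ _ h₁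
    have hp' : (E₁ ++ E₂).Perm (E₀ ++ (star S r₀ ++ (A ++ E₂))) := by
      simpa only [List.append_assoc] using hp.append_right E₂
    rcases hr with rfl | rfl
    · exact ⟨r₀, E₀, o, S, _, hQ, ⟨o, A, r₂, E₂, hC, h₂, Or.inl rfl, rfl⟩, rfl, hp'⟩
    · exact ⟨r₀, E₀, some r, S, _, hQ, ⟨o, A, r, E₂, hC, h₂, Or.inr rfl, rfl⟩, rfl, hp'⟩
  | parR R C ih =>
    obtain ⟨r₁, E₁, r₂, E₂, h₁, h₂, hr, rfl⟩ := h
    obtain ⟨r₀, E₀, o, S, A, hQ, hC, rfl, hp⟩ := ih _ _ h₂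
    have hp' : (E₁ ++ E₂).Perm (E₀ ++ (star S r₀ ++ (E₁ ++ A))) := by
      refine (hp.append_left E₁).trans ?_
      simp only [perm_iff_coe_eq, ← Multiset.coe_add]
      abel
    rcases hr with rfl | rfl
    · exact ⟨r₀, E₀, some r, S, _, hQ, ⟨o, A, r, E₁, hC, h₁, Or.inr rfl, rfl⟩, rfl, hp'⟩
    · exact ⟨r₀, E₀, o, S, _, hQ, ⟨o, A, r₁, E₁, hC, h₁, Or.inl rfl, rfl⟩, rfl, hp'⟩

theorem Ctx.sw_fill (C : Ctx 𝒜 X) (Q : Linking 𝒜 X) {r₀ : X} {E₀ : List (X × X)} {o : Option X}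
    {S : List X} {A : List (X × X)} (hQ : Q.Sw r₀ E₀) (hC : C.Sw o S A) :
    ∃ E, (C.fill Q).Sw (o.getD r₀) E ∧ E.Perm (E₀ ++ (star S r₀ ++ A)) := by
  induction C generalizing o S A with
  | hole =>
    obtain ⟨rfl, rfl, rfl⟩ := hC
    exact ⟨E₀, hQ, by simp⟩
  | botTens x C ih =>
    obtain ⟨S', A', hC, ⟨rfl, rfl, rfl⟩ | ⟨r, rfl, rfl, rfl⟩⟩ := hC <;>
      obtain ⟨E, h, hp⟩ := ih hC
    · exact ⟨_, ⟨E, h, rfl⟩, (hp.cons _).trans (perm_cons_star _ _ _ _ _)⟩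
    · exact ⟨_, ⟨E, h, rfl⟩, (hp.cons _).trans (perm_cons_middle _ _ _ _ _ _)⟩
  | tensBot C x ih =>
    obtain ⟨S', A', hC, ⟨rfl, rfl, rfl⟩ | ⟨r, rfl, rfl, rfl⟩⟩ := hC <;>
      obtain ⟨E, h, hp⟩ := ih hC
    · exact ⟨_, ⟨E, h, rfl⟩, (hp.cons _).trans (perm_cons_star _ _ _ _ _)⟩
    · exact ⟨_, ⟨E, h, rfl⟩, (hp.cons _).trans (perm_cons_middle _ _ _ _ _ _)⟩
  | parL C R ih =>
    obtain ⟨o', A', r, E, hC, hR, ho, rfl⟩ := hC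
    obtain ⟨E', h, hp⟩ := ih hC
    refine ⟨E' ++ E, ⟨_, _, _, _, h, hR, ?_, rfl⟩, ?_⟩
    · rcases ho with rfl | rfl
      · exact Or.inl rfl
      · exact Or.inr rfl
    · simpa only [List.append_assoc] using hp.append_right E
  | parR R C ih =>
    obtain ⟨o', A', r, E, hC, hR, ho, rfl⟩ := hC
    obtain ⟨E', h, hp⟩ := ih hC
    refine ⟨E ++ E', ⟨_, _, _, _, hR, h, ?_, rfl⟩, ?_⟩
    · rcases ho with rfl | rfl
      · exact Or.inr rfl
      · exact Or.inl rfl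
    · refine (hp.append_left E).trans ?_
      simp only [perm_iff_coe_eq, ← Multiset.coe_add]
      abel

/-- The switchings of the surroundings of a hole: the leaves joined to the root of the hole, and
the edges of the context and of the sequent. -/
def Env (C : Ctx 𝒜 X) (Γ : List (Item 𝒜 X)) (S : List X) (B : List (X × X)) : Prop :=
  ∃ o A F, C.Sw o S A ∧ Forest.Sw (Γ.map Item.toTree) F ∧ B = A ++ F

theorem swCorrect_fill_iff (C : Ctx 𝒜 X) (Q : Linking 𝒜 X) (Γ : List (Item 𝒜 X)) :
    SwCorrect (C.fill Q) Γ ↔ ∀ r E S B, Q.Sw r E → Env C Γ S B →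
      TreeOn (C.fill Q).names.toFinset (E ++ (star S r ++ B)) := by
  constructor
  · rintro h r E S _ hQ ⟨o, A, F, hC, hF, rfl⟩
    obtain ⟨E', h', hp⟩ := C.sw_fill Q hQ hC
    refine (h _ _ F h' hF).perm ?_
    simpa only [List.append_assoc] using hp.append_right F
  · intro h r E F hE hF
    obtain ⟨r₀, E₀, o, S, A, hQ, hC, rfl, hp⟩ := C.sw_of_sw_fill Q _ _ hE
    refine (h r₀ E₀ S (A ++ F) hQ ⟨o, A, F, hC, hF, rfl⟩).perm ?_
    simpa only [List.append_assoc] using (hp.append_right F).symm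

theorem Ctx.perm_leaves_fill (C : Ctx 𝒜 X) {Q R : Linking 𝒜 X}
    (h : Q.toTree.leaves.Perm R.toTree.leaves) :
    (C.fill Q).toTree.leaves.Perm (C.fill R).toTree.leaves := by
  induction C with
  | hole => exact h
  | botTens x C ih => exact ih.append_left _
  | tensBot C x ih => exact ih.append_right _
  | parL C R ih => exact ih.append_right _
  | parR R C ih => exact ih.append_left _

theorem SwCorrect.mono_fill {C : Ctx 𝒜 X} {Q R : Linking 𝒜 X} {Γ : List (Item 𝒜 X)}
    (h : SwCorrect (C.fill Q) Γ) (hp : Q.toTree.leaves.Perm R.toTree.leaves)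
    (hsw : ∀ r E, R.Sw r E → ∃ E', Q.Sw r E' ∧ E'.Perm E) : SwCorrect (C.fill R) Γ := by
  rw [swCorrect_fill_iff] at h ⊢
  intro r E S B hR hB
  obtain ⟨E', hQ, hp'⟩ := hsw r E hR
  have hV : (C.fill R).names.toFinset = (C.fill Q).names.toFinset :=
    List.toFinset_eq_of_perm _ _ ((C.perm_leaves_fill hp).symm.map _)
  rw [hV]
  exact (h r E' S B hQ hB).perm (hp'.append_right _)

/-- The basic connectedness fact on a wide scope `(Q ⅋ R) ⊗ ⊥_i`. -/
theorem conn_of_swCorrect_wide {C : Ctx 𝒜 X} {Q R : Linking 𝒜 X} {i : X} {Γ : List (Item 𝒜 X)}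
    (h : SwCorrect (C.fill (.tensBot (.par Q R) i)) Γ) {q r : X} {E F B : List (X × X)} {S : List X}
    (hQ : Q.Sw q E) (hR : R.Sw r F) (hB : Env C Γ S B) (hq : q ∈ (C.fill
      (.tensBot (.par Q R) i)).names) (hr : r ∈ (C.fill (.tensBot (.par Q R) i)).names) :
    Conn (E ++ (F ++ B)) q r := by
  rw [swCorrect_fill_iff] at h
  have key : ∀ s, ((i, s) :: (E ++ F) ++ (star S s ++ B)).Perm (star (i :: S) s ++ (E ++ (F ++ B))) := by
    intro s
    simp only [star_cons, perm_iff_coe_eq, ← Multiset.coe_add, ← Multiset.cons_coe,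
      ← Multiset.singleton_add]
    abel
  have h1 := (h q _ S B ⟨_, ⟨q, E, r, F, hQ, hR, Or.inl rfl, rfl⟩, rfl⟩ hB).perm (key q)
  have h2 := (h r _ S B ⟨_, ⟨q, E, r, F, hQ, hR, Or.inr rfl, rfl⟩, rfl⟩ hB).perm (key r)
  exact conn_of_treeOn_star h1 h2 (List.mem_toFinset.2 hq) (List.mem_toFinset.2 hr)

theorem Ctx.mem_names_fill (C : Ctx 𝒜 X) {Q : Linking 𝒜 X} {x : X} (h : x ∈ Q.names) :
    x ∈ (C.fill Q).names := by
  induction C with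
  | hole => exact h
  | botTens y C ih =>
    simp only [Linking.names, Ctx.fill, Linking.toTree, OTree.leaves, List.map_append,
      List.mem_append]
    exact Or.inr ih
  | tensBot C y ih =>
    simp only [Linking.names, Ctx.fill, Linking.toTree, OTree.leaves, List.map_append,
      List.mem_append]
    exact Or.inl ih
  | parL C R ih =>
    simp only [Linking.names, Ctx.fill, Linking.toTree, OTree.leaves, List.map_append,
      List.mem_append]
    exact Or.inl ih
  | parR R C ih =>
    simp only [Linking.names, Ctx.fill, Linking.toTree, OTree.leaves, List.map_append,
      List.mem_append]
    exact Or.inr ih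

theorem perm_leaves_parTens (Q R : Linking 𝒜 X) (i : X) :
    (Linking.par Q (.tensBot R i)).toTree.leaves.Perm
      (Linking.tensBot (.par Q R) i).toTree.leaves := by
  simp [Linking.toTree, OTree.leaves]

/-- Narrowing the scope of a `⊥` preserves correctness. -/
theorem SwCorrect.narrow {C : Ctx 𝒜 X} {Q R : Linking 𝒜 X} {i : X} {Γ : List (Item 𝒜 X)}
    (h : SwCorrect (C.fill (.tensBot (.par Q R) i)) Γ) :
    SwCorrect (C.fill (.par Q (.tensBot R i))) Γ := by
  have hcon := fun q r E F B S => conn_of_swCorrect_wide (q := q) (r := r) (E := E) (F := F)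
    (B := B) (S := S) h
  have hV : (C.fill (.par Q (.tensBot R i))).names.toFinset =
      (C.fill (.tensBot (.par Q R) i)).names.toFinset :=
    List.toFinset_eq_of_perm _ _ ((C.perm_leaves_fill (perm_leaves_parTens Q R i)).map _)
  rw [swCorrect_fill_iff] at h ⊢
  rw [hV]
  rintro s _ S B ⟨q, E, r, _, hQ, ⟨F, hR, rfl⟩, hs, rfl⟩ hB
  have hqm : q ∈ (C.fill (.tensBot (.par Q R) i)).names := C.mem_names_fill (by
    have := hQ.root_mem
    simp only [Linking.names, Linking.toTree, OTree.leaves, List.map_append, List.mem_append] at *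
    exact Or.inl (Or.inl this))
  have hrm : r ∈ (C.fill (.tensBot (.par Q R) i)).names := C.mem_names_fill (by
    have := hR.root_mem
    simp only [Linking.names, Linking.toTree, OTree.leaves, List.map_append, List.mem_append] at *
    exact Or.inl (Or.inr this))
  rcases hs with rfl | rfl
  · have hc := hcon s r E F B S hQ hR hB hqm hrm
    have h1 := h s _ S B ⟨_, ⟨s, E, r, F, hQ, hR, Or.inl rfl, rfl⟩, rfl⟩ hB
    have h2 : TreeOn (C.fill (.tensBot (.par Q R) i)).names.toFinset
        ((i, s) :: (E ++ (F ++ (star S s ++ B)))) := by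
      simpa only [List.append_assoc, List.cons_append] using h1
    refine (h2.exchange (hc.mono ?_)).perm ?_
    · intro e he
      simp only [List.mem_append] at he ⊢
      tauto
    · simp only [perm_iff_coe_eq, ← Multiset.coe_add, ← Multiset.cons_coe,
        ← Multiset.singleton_add]
      abel
  · refine (h s _ S B ⟨_, ⟨q, E, s, F, hQ, hR, Or.inr rfl, rfl⟩, rfl⟩ hB).perm ?_
    simp only [perm_iff_coe_eq, ← Multiset.coe_add, ← Multiset.cons_coe, ← Multiset.singleton_add]
    abel

/-- Widening the scope of a `⊥` preserves correctness if the side condition holds. -/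
theorem SwCorrect.widen {C : Ctx 𝒜 X} {Q R : Linking 𝒜 X} {i : X} {Γ : List (Item 𝒜 X)}
    (h : SwCorrect (C.fill (.par Q (.tensBot R i))) Γ)
    (side : ∀ q E r F S B, Q.Sw q E → R.Sw r F → Env C Γ S B →
      ¬ Conn (E ++ (F ++ (star S q ++ B))) i q) :
    SwCorrect (C.fill (.tensBot (.par Q R) i)) Γ := by
  have hV : (C.fill (.par Q (.tensBot R i))).names.toFinset =
      (C.fill (.tensBot (.par Q R) i)).names.toFinset :=
    List.toFinset_eq_of_perm _ _ ((C.perm_leaves_fill (perm_leaves_parTens Q R i)).map _)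
  rw [swCorrect_fill_iff] at h ⊢
  rw [← hV]
  rintro s _ S B ⟨_, ⟨q, E, r, F, hQ, hR, hs, rfl⟩, rfl⟩ hB
  have hq : q ∈ (C.fill (.par Q (.tensBot R i))).names := C.mem_names_fill (by
    have := hQ.root_mem
    simp only [Linking.names, Linking.toTree, OTree.leaves, List.map_append, List.mem_append] at *
    exact Or.inl this)
  have hr : r ∈ (C.fill (.par Q (.tensBot R i))).names := C.mem_names_fill (by
    have := hR.root_mem
    simp only [Linking.names, Linking.toTree, OTree.leaves, List.map_append, List.mem_append] at *
    exact Or.inr (Or.inl this))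
  rcases hs with rfl | rfl
  · have h1 := (h s _ S B ⟨s, E, r, _, hQ, ⟨F, hR, rfl⟩, Or.inl rfl, rfl⟩ hB).perm
      (F := star [i] r ++ (E ++ (F ++ (star S s ++ B)))) (by
        simp only [star_cons, star_nil, perm_iff_coe_eq, ← Multiset.coe_add, ← Multiset.cons_coe,
          ← Multiset.singleton_add, Multiset.coe_nil]
        abel)
    have hc : Conn (E ++ (F ++ (star S s ++ B))) r s := by
      have hsr := conn_star_append (h1.1 s (List.mem_toFinset.2 hq) r (List.mem_toFinset.2 hr))
      rcases hsr with hsr | ⟨hsr | ⟨j, hj, hsr⟩, -⟩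
      · exact hsr.symm
      · exact hsr.symm
      · obtain rfl := List.mem_singleton.1 hj
        exact absurd hsr.symm (side s E r F S B hQ hR hB)
    have h2 : TreeOn _ ((i, r) :: (E ++ (F ++ (star S s ++ B)))) := h1
    simpa only [List.append_assoc, List.cons_append] using h2.exchange hc
  · refine (h s _ S B ⟨q, E, s, _, hQ, ⟨F, hR, rfl⟩, Or.inr rfl, rfl⟩ hB).perm ?_
    simp only [perm_iff_coe_eq, ← Multiset.coe_add, ← Multiset.cons_coe, ← Multiset.singleton_add]
    abel

end Contexts


section SideConditions

variable {𝒜 : Type u} {X : Type v}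

theorem Ctx.child_emb (C : Ctx 𝒜 X) (H : Linking 𝒜 X) (b : Bool) (q : H.toTree.Inner) :
    OTree.child b (C.fill H).toTree (C.emb H q) = Sum.map id (C.emb H) (OTree.child b H.toTree q) := by
  have key : ∀ {N M K : Type} (f : M → K) (g : N → M) (x : X ⊕ N),
      Sum.map id f (Sum.map id g x) = Sum.map id (fun n => f (g n)) x := by
    intro N M K f g x; cases x <;> rfl
  induction C with
  | hole => cases h : OTree.child b H.toTree q <;> exact h
  | botTens x C ih => exact (congrArg _ ih).trans (key _ _ _)
  | tensBot C x ih => exact (congrArg _ ih).trans (key _ _ _)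
  | parL C R ih => exact (congrArg _ ih).trans (key _ _ _)
  | parR R C ih => exact (congrArg _ ih).trans (key _ _ _)

theorem Ctx.isPar_emb (C : Ctx 𝒜 X) (H : Linking 𝒜 X) (q : H.toTree.Inner) :
    OTree.IsPar (C.fill H).toTree (C.emb H q) ↔ OTree.IsPar H.toTree q := by
  induction C with
  | hole => exact Iff.rfl
  | botTens x C ih => exact ih
  | tensBot C x ih => exact ih
  | parL C R ih => exact ih
  | parR R C ih => exact ih

theorem Ctx.nodeRep_emb (C : Ctx 𝒜 X) (H : Linking 𝒜 X) (σ : (C.fill H).toTree.Inner → Bool)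
    (q : H.toTree.Inner) :
    OTree.nodeRep (C.fill H).toTree σ (C.emb H q) =
      OTree.nodeRep H.toTree (fun q => σ (C.emb H q)) q := by
  induction C with
  | hole => rfl
  | botTens x C ih => exact ih _
  | tensBot C x ih => exact ih _
  | parL C R ih => exact ih _
  | parR R C ih => exact ih _

theorem Ctx.emb_injective (C : Ctx 𝒜 X) (H : Linking 𝒜 X) : Function.Injective (C.emb H) := by
  induction C with
  | hole => exact fun _ _ h => h
  | botTens x C ih => exact fun _ _ h => ih (Sum.inr.inj (Option.some.inj h))
  | tensBot C x ih => exact fun _ _ h => ih (Sum.inl.inj (Option.some.inj h))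
  | parL C R ih => exact fun _ _ h => ih (Sum.inl.inj (Option.some.inj h))
  | parR R C ih => exact fun _ _ h => ih (Sum.inr.inj (Option.some.inj h))

theorem Ctx.root_fill_ne (C : Ctx 𝒜 X) {H : Linking 𝒜 X} {x : X} (h : H.toTree.root ≠ Sum.inl x) :
    (C.fill H).toTree.root ≠ Sum.inl x := by
  cases C
  · exact h
  all_goals exact fun h => by cases h

/-- A leaf in the hole of a context has its parent in the hole. -/
theorem Ctx.parent_mem_hole (C : Ctx 𝒜 X) {H : Linking 𝒜 X} {x : X} (hx : x ∈ H.names)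
    (hroot : H.toTree.root ≠ Sum.inl x) (hn : (C.fill H).names.Nodup) (b : Bool)
    (p : (C.fill H).toTree.Inner) (h : OTree.child b (C.fill H).toTree p = Sum.inl x) :
    ∃ q, p = C.emb H q ∧ OTree.child b H.toTree q = Sum.inl x := by
  induction C with
  | hole => exact ⟨p, rfl, h⟩
  | botTens y C ih =>
    have hn' : ([y] ++ (C.fill H).names).Nodup := by
      simpa [Linking.names, Ctx.fill, Linking.toTree, OTree.leaves] using hn
    have hd := List.disjoint_of_nodup_append hn'
    match p with
    | none =>
      cases b
      · have h' : (Sum.inl y : X ⊕ ((Ctx.botTens y C).fill H).toTree.Inner) = Sum.inl x := h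
        exact absurd (C.mem_names_fill hx) (hd (by simp [Sum.inl.inj h']))
      · exact absurd (OTree.sumMap_eq_inl h) (C.root_fill_ne hroot)
    | some (Sum.inl p) => exact nomatch p
    | some (Sum.inr p) =>
      obtain ⟨q, rfl, hq⟩ := ih hn'.of_append_right p (OTree.sumMap_eq_inl h)
      exact ⟨q, rfl, hq⟩
  | tensBot C y ih =>
    have hn' : ((C.fill H).names ++ [y]).Nodup := by
      simpa [Linking.names, Ctx.fill, Linking.toTree, OTree.leaves] using hn
    have hd := List.disjoint_of_nodup_append hn'
    match p with
    | none =>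
      cases b
      · exact absurd (OTree.sumMap_eq_inl h) (C.root_fill_ne hroot)
      · have h' : (Sum.inl y : X ⊕ ((Ctx.tensBot C y).fill H).toTree.Inner) = Sum.inl x := h
        exact absurd (by simp [Sum.inl.inj h']) (hd (C.mem_names_fill hx))
    | some (Sum.inr p) => exact nomatch p
    | some (Sum.inl p) =>
      obtain ⟨q, rfl, hq⟩ := ih hn'.of_append_left p (OTree.sumMap_eq_inl h)
      exact ⟨q, rfl, hq⟩
  | parL C R ih =>
    have hn' : ((C.fill H).names ++ R.names).Nodup := by
      simpa [Linking.names, Ctx.fill, Linking.toTree, OTree.leaves] using hn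
    have hd := List.disjoint_of_nodup_append hn'
    match p with
    | none =>
      cases b
      · exact absurd (OTree.sumMap_eq_inl h) (C.root_fill_ne hroot)
      · exact absurd (OTree.root_mem_leaves _ _ (OTree.sumMap_eq_inl h)) (hd (C.mem_names_fill hx))
    | some (Sum.inr p) =>
      exact absurd (OTree.child_mem_leaves _ _ _ _ (OTree.sumMap_eq_inl h))
        (hd (C.mem_names_fill hx))
    | some (Sum.inl p) =>
      obtain ⟨q, rfl, hq⟩ := ih hn'.of_append_left p (OTree.sumMap_eq_inl h)
      exact ⟨q, rfl, hq⟩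
  | parR R C ih =>
    have hn' : (R.names ++ (C.fill H).names).Nodup := by
      simpa [Linking.names, Ctx.fill, Linking.toTree, OTree.leaves] using hn
    have hd := List.disjoint_of_nodup_append hn'
    match p with
    | none =>
      cases b
      · exact absurd (C.mem_names_fill hx)
          (hd (OTree.root_mem_leaves _ _ (OTree.sumMap_eq_inl h)))
      · exact absurd (OTree.sumMap_eq_inl h) (C.root_fill_ne hroot)
    | some (Sum.inl p) =>
      exact absurd (C.mem_names_fill hx)
        (hd (OTree.child_mem_leaves _ _ _ _ (OTree.sumMap_eq_inl h)))
    | some (Sum.inr p) =>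
      obtain ⟨q, rfl, hq⟩ := ih hn'.of_append_right p (OTree.sumMap_eq_inl h)
      exact ⟨q, rfl, hq⟩

/-- The linking `Q ⅋ (R ⊗ ⊥_i)`. -/
abbrev narrowLink (Q R : Linking 𝒜 X) (i : X) : Linking 𝒜 X := .par Q (.tensBot R i)

/-- The parent of `⊥_i` in `Q ⅋ (R ⊗ ⊥_i)`. -/
def botParent (Q R : Linking 𝒜 X) (i : X) : (narrowLink Q R i).toTree.Inner :=
  some (Sum.inr none)

theorem parent_eq_botParent (Q R : Linking 𝒜 X) (i : X) (hn : (narrowLink Q R i).names.Nodup)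
    (b : Bool) (q : (narrowLink Q R i).toTree.Inner)
    (h : OTree.child b (narrowLink Q R i).toTree q = Sum.inl i) :
    q = botParent Q R i ∧ b = true := by
  have hn' : (Q.names ++ (R.names ++ [i])).Nodup := by
    simpa [Linking.names, Ctx.fill, Linking.toTree, OTree.leaves] using hn
  have hQ : i ∉ Q.names := fun hi => List.disjoint_of_nodup_append hn' hi (by simp)
  have hR : i ∉ R.names := fun hi =>
    List.disjoint_of_nodup_append hn'.of_append_right hi (by simp)
  match q with
  | none =>
    cases b
    · exact absurd (OTree.root_mem_leaves _ _ (OTree.sumMap_eq_inl h)) hQ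
    · have h' : (Sum.inr (some (Sum.inr none)) : X ⊕ (narrowLink Q R i).toTree.Inner) =
        Sum.inl i := h
      cases h'
  | some (Sum.inl q) => exact absurd (OTree.child_mem_leaves _ _ _ _ (OTree.sumMap_eq_inl h)) hQ
  | some (Sum.inr none) =>
    cases b
    · exact absurd (OTree.root_mem_leaves _ _ (OTree.sumMap_eq_inl (OTree.sumMap_eq_inl h))) hR
    · exact ⟨rfl, rfl⟩
  | some (Sum.inr (some (Sum.inl q))) =>
    exact absurd (OTree.child_mem_leaves _ _ _ _ (OTree.sumMap_eq_inl (OTree.sumMap_eq_inl h))) hR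
  | some (Sum.inr (some (Sum.inr q))) => exact nomatch q

/-- The forest of `C{Q ⅋ (R ⊗ ⊥_i)} ▷ Γ`. -/
abbrev wholeForest (C : Ctx 𝒜 X) (Q R : Linking 𝒜 X) (i : X) (Γ : List (Item 𝒜 X)) :
    List (OTree 𝒜 X) :=
  forest (C.fill (narrowLink Q R i)) Γ

/-- The nodes of `C{Q ⅋ (R ⊗ ⊥_i)} ▷ Γ` other than the parent of `⊥_i`. -/
def offBot (C : Ctx 𝒜 X) (Q R : Linking 𝒜 X) (i : X) (Γ : List (Item 𝒜 X))
    (p : Forest.Inner (wholeForest C Q R i Γ)) : Prop :=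
  p ≠ Sum.inl (C.emb (narrowLink Q R i) (botParent Q R i))

theorem extSwitching_eq (C : Ctx 𝒜 X) (Q R : Linking 𝒜 X) (i : X) (Γ : List (Item 𝒜 X))
    (hn : (C.fill (narrowLink Q R i)).names.Nodup) (hn' : (narrowLink Q R i).names.Nodup)
    (σ : Forest.Inner (wholeForest C Q R i Γ) → Bool) :
    extSwitching (C.fill (narrowLink Q R i)) Γ σ i =
      childGraph (fun b p => Forest.child b _ p)
        (Forest.Keep (wholeForest C Q R i Γ) σ (offBot C Q R i Γ)) := by
  have hi : i ∈ (narrowLink Q R i).names := by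
    simp [Linking.names, Linking.toTree, OTree.leaves]
  have key : ∀ (p : Forest.Inner (wholeForest C Q R i Γ)) (b : Bool),
      (s((Sum.inr p : X ⊕ Forest.Inner (wholeForest C Q R i Γ)), Forest.child b (wholeForest C Q R i Γ) p) ∈
        {d | ∃ p : (C.fill (narrowLink Q R i)).toTree.Inner,
          d = s(Sum.inl i, (Sum.inr (Sum.inl p) : X ⊕ Forest.Inner (wholeForest C Q R i Γ)))}) ↔
      ¬ offBot C Q R i Γ p ∧ b = true := by
    intro p b
    constructor
    · rintro ⟨q, hq⟩
      rcases Sym2.eq_iff.1 hq with ⟨h, -⟩ | ⟨h, h'⟩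
      · cases h
      · obtain rfl := Sum.inr.inj h
        obtain ⟨q', rfl, hq'⟩ := C.parent_mem_hole hi (fun h => by cases h) hn b q
          (OTree.sumMap_eq_inl h')
        obtain ⟨rfl, hb⟩ := parent_eq_botParent Q R i hn' b q' hq'
        exact ⟨fun h => h rfl, hb⟩
    · rintro ⟨hp, rfl⟩
      obtain rfl := not_not.1 hp
      refine ⟨C.emb (narrowLink Q R i) (botParent Q R i), ?_⟩
      have : Forest.child true (wholeForest C Q R i Γ) (Sum.inl (C.emb (narrowLink Q R i) (botParent Q R i))) =
          Sum.inl i := by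
        have := C.child_emb (narrowLink Q R i) true (botParent Q R i)
        exact congrArg (Sum.map id Sum.inl) this
      rw [this]
      exact Sym2.eq_swap
  have hpar : ∀ p, ¬ offBot C Q R i Γ p → ¬ Forest.IsPar (wholeForest C Q R i Γ) p := by
    intro p hp
    obtain rfl := not_not.1 hp
    exact fun h => (C.isPar_emb (narrowLink Q R i) (botParent Q R i)).1 h
  ext m n
  rw [extSwitching, SimpleGraph.deleteEdges_adj, Forest.switching, childGraph,
    SimpleGraph.fromRel_adj, SimpleGraph.fromRel_adj, and_assoc]
  refine and_congr_right fun _ => ?_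
  have hone : ∀ p b, ((Forest.IsPar (wholeForest C Q R i Γ) p → σ p = b) ∧ ¬ (¬ offBot C Q R i Γ p ∧ b = true)) ↔
      Forest.Keep (wholeForest C Q R i Γ) σ (offBot C Q R i Γ) p b := by
    intro p b
    have := hpar p
    unfold Forest.Keep
    tauto
  constructor
  · rintro ⟨⟨p, b, rfl, rfl, h⟩ | ⟨p, b, rfl, rfl, h⟩, h'⟩
    · exact Or.inl ⟨p, b, rfl, rfl, (hone p b).1 ⟨h, fun h'' => h' ((key p b).2 h'')⟩⟩
    · exact Or.inr ⟨p, b, rfl, rfl, (hone p b).1 ⟨h, fun h'' => h' (by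
        rw [Sym2.eq_swap]; exact (key p b).2 h'')⟩⟩
  · rintro (⟨p, b, rfl, rfl, h⟩ | ⟨p, b, rfl, rfl, h⟩)
    · have := (hone p b).2 h
      exact ⟨Or.inl ⟨p, b, rfl, rfl, this.1⟩, fun h'' => this.2 ((key p b).1 h'')⟩
    · have := (hone p b).2 h
      exact ⟨Or.inr ⟨p, b, rfl, rfl, this.1⟩, fun h'' => this.2 ((key p b).1 (by
        rw [Sym2.eq_swap]; exact h''))⟩

theorem Ctx.Sw.exists_cons {C : Ctx 𝒜 X} {o : Option X} {S : List X} {A : List (X × X)}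
    (hC : C.Sw o S A) (x : X) : ∃ S' A', (Ctx.botTens x C).Sw o S' A' ∧
      (∀ r₀ E₀, ((x, o.getD r₀) :: (E₀ ++ (star S r₀ ++ A))).Perm (E₀ ++ (star S' r₀ ++ A'))) ∧
        ∀ s ∈ S', s = x ∨ s ∈ S := by
  cases o with
  | none => exact ⟨x :: S, A, ⟨S, A, hC, Or.inl ⟨rfl, rfl, rfl⟩⟩,
      fun _ _ => perm_cons_star _ _ _ _ _, fun _ => List.mem_cons.1⟩
  | some s => exact ⟨S, (x, s) :: A, ⟨S, A, hC, Or.inr ⟨s, rfl, rfl, rfl⟩⟩,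
      fun _ _ => perm_cons_middle _ _ _ _ _ _, fun _ => Or.inr⟩

/-- Every switching of a filled context comes from switchings of the context and of the hole. -/
theorem Ctx.exists_sw_of_switching (C : Ctx 𝒜 X) (H : Linking 𝒜 X)
    (σ : (C.fill H).toTree.Inner → Bool) (δ : (C.fill H).toTree.Inner → Prop)
    (hδ : ∀ p, (∀ q, p ≠ C.emb H q) → δ p) :
    ∃ o S A, C.Sw o S A ∧ ∀ r₀ E₀,
      SwEquiv (H.toTree.rep fun q => σ (C.emb H q))
        (H.toTree.edges (fun q => σ (C.emb H q)) fun q => δ (C.emb H q)) r₀ E₀ →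
      SwEquiv ((C.fill H).toTree.rep σ) ((C.fill H).toTree.edges σ δ) (o.getD r₀)
        (E₀ ++ (star S r₀ ++ A)) := by
  induction C with
  | hole => exact ⟨none, [], [], ⟨rfl, rfl, rfl⟩, fun r₀ E₀ h => by
      rw [star_nil, List.append_nil, List.append_nil]; exact h⟩
  | botTens x C ih =>
    have hnone : δ none := hδ none fun q h => by cases h
    obtain ⟨o, S, A, hC, h⟩ := ih (fun p => σ (some (Sum.inr p))) (fun p => δ (some (Sum.inr p)))
      fun p hp => hδ _ fun q hq => hp q (Sum.inr.inj (Option.some.inj hq))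
    obtain ⟨S', A', hC', hp, -⟩ := hC.exists_cons x
    refine ⟨o, S', A', hC', fun r₀ E₀ h₀ => ?_⟩
    have := (((h r₀ E₀ h₀).cons x).turn).perm (hp r₀ E₀)
    simpa [Ctx.fill, Linking.toTree, OTree.edges, OTree.rep, hnone] using this
  | tensBot C x ih =>
    have hnone : δ none := hδ none fun q h => by cases h
    obtain ⟨o, S, A, hC, h⟩ := ih (fun p => σ (some (Sum.inl p))) (fun p => δ (some (Sum.inl p)))
      fun p hp => hδ _ fun q hq => hp q (Sum.inl.inj (Option.some.inj hq))
    obtain ⟨S', A', hC', hp, -⟩ := hC.exists_cons x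
    refine ⟨o, S', A', hC', fun r₀ E₀ h₀ => ?_⟩
    have := (((h r₀ E₀ h₀).cons x).flip rfl).perm (hp r₀ E₀)
    simpa [Ctx.fill, Linking.toTree, OTree.edges, OTree.rep, hnone] using this
  | parL C R ih =>
    have hR : (fun p => δ (some (Sum.inr p))) = fun _ : R.toTree.Inner => True :=
      funext fun p => eq_true (hδ _ fun q hq => by cases Option.some.inj hq)
    obtain ⟨o, S, A, hC, h⟩ := ih (fun p => σ (some (Sum.inl p))) (fun p => δ (some (Sum.inl p)))
      fun p hp => hδ _ fun q hq => hp q (Sum.inl.inj (Option.some.inj hq))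
    obtain ⟨r, E, hRE, hE⟩ := R.sw_of_sw_toTree _ _
      ((OTree.sw_iff _ _ _).2 ⟨fun p => σ (some (Sum.inr p)), rfl, rfl⟩)
    by_cases hs : σ none = true
    · refine ⟨some r, S, A ++ E, ⟨o, A, r, E, hC, hRE, Or.inr rfl, rfl⟩, fun r₀ E₀ h₀ => ?_⟩
      have := (h r₀ E₀ h₀).append_right hE
      simp only [List.append_assoc] at this
      simpa [Ctx.fill, Linking.toTree, OTree.edges, OTree.rep, hR, hs] using this
    · refine ⟨o, S, A ++ E, ⟨o, A, r, E, hC, hRE, Or.inl rfl, rfl⟩, fun r₀ E₀ h₀ => ?_⟩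
      have := (h r₀ E₀ h₀).append hE
      simp only [List.append_assoc] at this
      simpa [Ctx.fill, Linking.toTree, OTree.edges, OTree.rep, hR, hs] using this
  | parR R C ih =>
    have hR : (fun p => δ (some (Sum.inl p))) = fun _ : R.toTree.Inner => True :=
      funext fun p => eq_true (hδ _ fun q hq => by cases Option.some.inj hq)
    obtain ⟨o, S, A, hC, h⟩ := ih (fun p => σ (some (Sum.inr p))) (fun p => δ (some (Sum.inr p)))
      fun p hp => hδ _ fun q hq => hp q (Sum.inr.inj (Option.some.inj hq))
    obtain ⟨r, E, hRE, hE⟩ := R.sw_of_sw_toTree _ _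
      ((OTree.sw_iff _ _ _).2 ⟨fun p => σ (some (Sum.inl p)), rfl, rfl⟩)
    have hp : ∀ r₀ (E₀ : List (X × X)), (E ++ (E₀ ++ (star S r₀ ++ A))).Perm
        (E₀ ++ (star S r₀ ++ (E ++ A))) := by
      intro r₀ E₀
      simp only [perm_iff_coe_eq, ← Multiset.coe_add]
      abel
    by_cases hs : σ none = true
    · refine ⟨o, S, E ++ A, ⟨o, A, r, E, hC, hRE, Or.inl rfl, rfl⟩, fun r₀ E₀ h₀ => ?_⟩
      have := (hE.append_right (h r₀ E₀ h₀)).perm (hp r₀ E₀)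
      simpa [Ctx.fill, Linking.toTree, OTree.edges, OTree.rep, hR, hs] using this
    · refine ⟨some r, S, E ++ A, ⟨o, A, r, E, hC, hRE, Or.inr rfl, rfl⟩, fun r₀ E₀ h₀ => ?_⟩
      have := (hE.append (h r₀ E₀ h₀)).perm (hp r₀ E₀)
      simpa [Ctx.fill, Linking.toTree, OTree.edges, OTree.rep, hR, hs] using this

/-- Every switching of a context is realized. -/
theorem Ctx.exists_switching_of_sw (C : Ctx 𝒜 X) (H : Linking 𝒜 X) {o : Option X} {S : List X}
    {A : List (X × X)} (hC : C.Sw o S A) (τ : H.toTree.Inner → Bool) :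
    ∃ σ : (C.fill H).toTree.Inner → Bool, (∀ q, σ (C.emb H q) = τ q) ∧
      ∀ δ : (C.fill H).toTree.Inner → Prop, (∀ p, (∀ q, p ≠ C.emb H q) → δ p) → ∀ r₀ E₀,
      SwEquiv (H.toTree.rep τ) (H.toTree.edges τ fun q => δ (C.emb H q)) r₀ E₀ →
      SwEquiv ((C.fill H).toTree.rep σ) ((C.fill H).toTree.edges σ δ) (o.getD r₀)
        (E₀ ++ (star S r₀ ++ A)) := by
  induction C generalizing o S A with
  | hole =>
    obtain ⟨rfl, rfl, rfl⟩ := hC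
    exact ⟨τ, fun _ => rfl, fun δ _ r₀ E₀ h => by
      rw [star_nil, List.append_nil, List.append_nil]; exact h⟩
  | botTens x C ih =>
    obtain ⟨S', A', hC, ho⟩ := hC
    obtain ⟨σ, hσ, h⟩ := ih hC
    refine ⟨fun n => match n with
      | none => false
      | some (Sum.inl p) => nomatch p
      | some (Sum.inr p) => σ p, hσ, fun δ hδ r₀ E₀ h₀ => ?_⟩
    have hnone : δ none := hδ none fun q h => by cases h
    have h1 := ((h (fun p => δ (some (Sum.inr p))) (fun p hp => hδ _ fun q hq =>
      hp q (Sum.inr.inj (Option.some.inj hq))) r₀ E₀ h₀).cons x).turn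
    have h2 : ((x, o.getD r₀) :: (E₀ ++ (star S' r₀ ++ A'))).Perm (E₀ ++ (star S r₀ ++ A)) := by
      rcases ho with ⟨rfl, rfl, rfl⟩ | ⟨r, rfl, rfl, rfl⟩
      · exact perm_cons_star _ _ _ _ _
      · exact perm_cons_middle _ _ _ _ _ _
    simpa [Ctx.fill, Linking.toTree, OTree.edges, OTree.rep, hnone] using h1.perm h2
  | tensBot C x ih =>
    obtain ⟨S', A', hC, ho⟩ := hC
    obtain ⟨σ, hσ, h⟩ := ih hC
    refine ⟨fun n => match n with
      | none => false
      | some (Sum.inr p) => nomatch p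
      | some (Sum.inl p) => σ p, hσ, fun δ hδ r₀ E₀ h₀ => ?_⟩
    have hnone : δ none := hδ none fun q h => by cases h
    have h1 := ((h (fun p => δ (some (Sum.inl p))) (fun p hp => hδ _ fun q hq =>
      hp q (Sum.inl.inj (Option.some.inj hq))) r₀ E₀ h₀).cons x).flip rfl
    have h2 : ((x, o.getD r₀) :: (E₀ ++ (star S' r₀ ++ A'))).Perm (E₀ ++ (star S r₀ ++ A)) := by
      rcases ho with ⟨rfl, rfl, rfl⟩ | ⟨r, rfl, rfl, rfl⟩
      · exact perm_cons_star _ _ _ _ _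
      · exact perm_cons_middle _ _ _ _ _ _
    simpa [Ctx.fill, Linking.toTree, OTree.edges, OTree.rep, hnone] using h1.perm h2
  | parL C R ih =>
    obtain ⟨o', A', r, E, hC, hR, ho, rfl⟩ := hC
    obtain ⟨σ, hσ, h⟩ := ih hC
    obtain ⟨r', E', hR', hE⟩ := R.sw_toTree_of_sw _ _ hR
    obtain ⟨ρ, rfl, rfl⟩ := (OTree.sw_iff _ _ _).1 hR'
    refine ⟨fun n => match n with
      | none => decide (o ≠ o')
      | some (Sum.inl p) => σ p
      | some (Sum.inr p) => ρ p, hσ, fun δ hδ r₀ E₀ h₀ => ?_⟩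
    have hδR : (fun p => δ (some (Sum.inr p))) = fun _ : R.toTree.Inner => True :=
      funext fun p => eq_true (hδ _ fun q hq => by cases Option.some.inj hq)
    have h1 := h (fun p => δ (some (Sum.inl p))) (fun p hp => hδ _ fun q hq =>
      hp q (Sum.inl.inj (Option.some.inj hq))) r₀ E₀ h₀
    by_cases hs : o = o'
    · subst hs
      have := h1.append hE
      simp only [List.append_assoc] at this
      simpa [Ctx.fill, Linking.toTree, OTree.edges, OTree.rep, hδR] using this
    · obtain rfl := ho.resolve_left hs
      have := h1.append_right hE
      simp only [List.append_assoc] at this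
      simpa [Ctx.fill, Linking.toTree, OTree.edges, OTree.rep, hδR, hs] using this
  | parR R C ih =>
    obtain ⟨o', A', r, E, hC, hR, ho, rfl⟩ := hC
    obtain ⟨σ, hσ, h⟩ := ih hC
    obtain ⟨r', E', hR', hE⟩ := R.sw_toTree_of_sw _ _ hR
    obtain ⟨ρ, rfl, rfl⟩ := (OTree.sw_iff _ _ _).1 hR'
    refine ⟨fun n => match n with
      | none => decide (o = o')
      | some (Sum.inl p) => ρ p
      | some (Sum.inr p) => σ p, hσ, fun δ hδ r₀ E₀ h₀ => ?_⟩
    have hδR : (fun p => δ (some (Sum.inl p))) = fun _ : R.toTree.Inner => True :=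
      funext fun p => eq_true (hδ _ fun q hq => by cases Option.some.inj hq)
    have h1 := h (fun p => δ (some (Sum.inr p))) (fun p hp => hδ _ fun q hq =>
      hp q (Sum.inr.inj (Option.some.inj hq))) r₀ E₀ h₀
    have hp : (E ++ (E₀ ++ (star S r₀ ++ A'))).Perm (E₀ ++ (star S r₀ ++ (E ++ A'))) := by
      simp only [perm_iff_coe_eq, ← Multiset.coe_add]
      abel
    by_cases hs : o = o'
    · subst hs
      have := (hE.append_right h1).perm hp
      simpa [Ctx.fill, Linking.toTree, OTree.edges, OTree.rep, hδR] using this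
    · obtain rfl := ho.resolve_left hs
      have := (hE.append h1).perm hp
      simpa [Ctx.fill, Linking.toTree, OTree.edges, OTree.rep, hδR, hs] using this

theorem SwEquiv.of_conn_append {r r' : X} {E E' : List (X × X)} (h : SwEquiv r E r' E')
    (F : List (X × X)) {x y : X} (hxy : Conn (E ++ F) x y) : Conn (E' ++ F) x y :=
  hxy.of_le (h.append_le F)

theorem offBot_emb_iff (C : Ctx 𝒜 X) (Q R : Linking 𝒜 X) (i : X) (Γ : List (Item 𝒜 X))
    (q : (narrowLink Q R i).toTree.Inner) :
    offBot C Q R i Γ (Sum.inl (C.emb _ q)) ↔ q ≠ botParent Q R i :=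
  not_congr ⟨fun h => C.emb_injective _ (Sum.inl.inj h), fun h => by rw [h]⟩

theorem edges_narrowLink (C : Ctx 𝒜 X) (Q R : Linking 𝒜 X) (i : X) (Γ : List (Item 𝒜 X))
    (τ : (narrowLink Q R i).toTree.Inner → Bool) :
    (narrowLink Q R i).toTree.edges τ (fun q => offBot C Q R i Γ (Sum.inl (C.emb _ q))) =
      Q.toTree.edges (fun p => τ (some (Sum.inl p))) (fun _ => True) ++
        R.toTree.edges (fun p => τ (some (Sum.inr (some (Sum.inl p))))) (fun _ => True) := by
  have h0 : (fun q => offBot C Q R i Γ (Sum.inl (C.emb _ q))) = fun q => q ≠ botParent Q R i :=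
    funext fun q => propext (offBot_emb_iff C Q R i Γ q)
  have h1 : (fun p : Q.toTree.Inner => (some (Sum.inl p) : (narrowLink Q R i).toTree.Inner) ≠
      botParent Q R i) = fun _ => True :=
    funext fun p => eq_true fun h => by cases Option.some.inj h
  have h2 : (fun p : R.toTree.Inner => (some (Sum.inr (some (Sum.inl p))) :
      (narrowLink Q R i).toTree.Inner) ≠ botParent Q R i) = fun _ => True :=
    funext fun p => eq_true fun h => by cases Sum.inr.inj (Option.some.inj h)
  have h3 : ¬ ((some (Sum.inr none) : (narrowLink Q R i).toTree.Inner) ≠ botParent Q R i) :=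
    fun h => h rfl
  rw [h0]
  simp only [narrowLink, Linking.toTree, OTree.edges]
  erw [h1, h2, if_neg h3]
  simp

/-- The side condition, for the root of `Q`, in terms of contracted switchings. -/
theorem SideCondition.not_conn {C : Ctx 𝒜 X} {Q R : Linking 𝒜 X} {i : X} {Γ : List (Item 𝒜 X)}
    (side : SideCondition C Q R i Γ) (hn : (C.fill (narrowLink Q R i)).names.Nodup)
    (hn' : (narrowLink Q R i).names.Nodup) {q r : X} {E F B : List (X × X)} {S : List X}
    (hQ : Q.Sw q E) (hR : R.Sw r F) (hB : Env C Γ S B) :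
    ¬ Conn (E ++ (F ++ (star S q ++ B))) i q := by
  obtain ⟨o, A, L, hC, hL, rfl⟩ := hB
  obtain ⟨q', E', hQ', hE⟩ := Q.sw_toTree_of_sw _ _ hQ
  obtain ⟨σQ, rfl, rfl⟩ := (OTree.sw_iff _ _ _).1 hQ'
  obtain ⟨r', F', hR', hF⟩ := R.sw_toTree_of_sw _ _ hR
  obtain ⟨σR, rfl, rfl⟩ := (OTree.sw_iff _ _ _).1 hR'
  obtain ⟨σΓ, rfl⟩ := (Forest.sw_iff _ _).1 hL
  let τ : (narrowLink Q R i).toTree.Inner → Bool := fun n => match n with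
    | none => false
    | some (Sum.inl p) => σQ p
    | some (Sum.inr none) => false
    | some (Sum.inr (some (Sum.inl p))) => σR p
    | some (Sum.inr (some (Sum.inr p))) => nomatch p
  obtain ⟨σP, hσP, hP⟩ := C.exists_switching_of_sw (narrowLink Q R i) hC τ
  have hτ := edges_narrowLink C Q R i Γ τ
  have hH : SwEquiv ((narrowLink Q R i).toTree.rep τ) ((narrowLink Q R i).toTree.edges τ
      (fun q => offBot C Q R i Γ (Sum.inl (C.emb _ q)))) q (E ++ F) := by
    rw [hτ]
    have : (narrowLink Q R i).toTree.rep τ = Q.toTree.rep σQ := by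
      simp [narrowLink, Linking.toTree, OTree.rep, τ]
    rw [this]
    exact hE.append hF
  have hP' := hP (fun p => offBot C Q R i Γ (Sum.inl p))
    (fun p hp => fun h => hp _ (Sum.inl.inj h)) _ _ hH
  let σ : Forest.Inner (wholeForest C Q R i Γ) → Bool := Sum.elim σP σΓ
  have hδΓ : (fun p => offBot C Q R i Γ (Sum.inr p)) = fun _ => True :=
    funext fun p => eq_true fun h => by cases h
  have hedges : Forest.edges (wholeForest C Q R i Γ) σ (offBot C Q R i Γ) =
      (C.fill (narrowLink Q R i)).toTree.edges σP (fun p => offBot C Q R i Γ (Sum.inl p)) ++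
        Forest.edges (Γ.map Item.toTree) σΓ fun _ => True := by
    rw [← hδΓ]; rfl
  have hreach := Forest.reachable_keep_iff (wholeForest C Q R i Γ) σ
    (offBot C Q R i Γ)
  rw [← extSwitching_eq C Q R i Γ hn hn' σ, hedges] at hreach
  have hroot : ¬ Conn ((C.fill (narrowLink Q R i)).toTree.edges σP
      (fun p => offBot C Q R i Γ (Sum.inl p)) ++ Forest.edges (Γ.map Item.toTree) σΓ fun _ => True)
      i (Q.toTree.rep σQ) := by
    have h := side σ
    have he := OTree.elim_root Q.toTree σQ
    rcases hr : Q.toTree.root with x | n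
    · rw [hr] at he
      rw [← he]
      have := h.1 x (OTree.root_mem_leaves _ _ hr)
      rwa [hreach] at this
    · rw [hr] at he
      rw [← he]
      have := h.2 n
      rw [hreach] at this
      intro hc
      apply this
      have h1 := C.nodeRep_emb (narrowLink Q R i) σP (some (Sum.inl n))
      have h2 : (fun q => σP (C.emb (narrowLink Q R i) q)) = τ := funext hσP
      rw [h2] at h1
      have h3 : Sum.elim id (Forest.nodeRep (wholeForest C Q R i Γ) σ)
          (Sum.inr (Sum.inl (C.emb (narrowLink Q R i) (some (Sum.inl n))))) =
          Q.toTree.nodeRep σQ n := h1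
      rw [h3]
      exact hc
  intro hc
  refine hroot (Conn.of_le ?_ (hc.trans ?_))
  · intro a b hab
    refine hP'.symm.append_le _ a b ?_
    simpa only [List.append_assoc] using hab
  · exact hE.root'.symm.mono (List.subset_append_left _ _)

/-- Linkings without `⅋`. -/
def Linking.ParFree : Linking 𝒜 X → Prop
  | .one _ => True
  | .ax _ _ _ => True
  | .xa _ _ _ => True
  | .botTens _ Q => ParFree Q
  | .tensBot Q _ => ParFree Q
  | .par _ _ => False

theorem Linking.ParFree.conn {Q : Linking 𝒜 X} (h : Q.ParFree) {q : X} {E : List (X × X)}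
    (hQ : Q.Sw q E) {x : X} (hx : x ∈ Q.names) : Conn E x q := by
  induction Q generalizing q E with
  | one y =>
    obtain ⟨rfl, rfl⟩ := hQ
    have : x = q := by simpa [Linking.names, Linking.toTree, OTree.leaves] using hx
    rw [this]; exact Conn.refl _ _
  | ax a y z =>
    obtain ⟨rfl, rfl⟩ := hQ
    have : x = q ∨ x = z := by simpa [Linking.names, Linking.toTree, OTree.leaves] using hx
    rcases this with rfl | rfl
    · exact Conn.refl _ _
    · exact Conn.of_mem (by simp)
  | xa a y z =>
    obtain ⟨rfl, rfl⟩ := hQ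
    have : x = y ∨ x = q := by simpa [Linking.names, Linking.toTree, OTree.leaves] using hx
    rcases this with rfl | rfl
    · exact Conn.of_mem (by simp)
    · exact Conn.refl _ _
  | botTens y Q ih =>
    obtain ⟨E', hQ, rfl⟩ := hQ
    have : x = y ∨ x ∈ Q.names := by
      simpa [Linking.names, Linking.toTree, OTree.leaves] using hx
    rcases this with rfl | hx
    · exact Conn.of_mem (by simp)
    · exact (ih h hQ hx).mono (List.subset_cons_self _ _)
  | tensBot Q y ih =>
    obtain ⟨E', hQ, rfl⟩ := hQ
    have : x ∈ Q.names ∨ x = y := by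
      simpa [Linking.names, Linking.toTree, OTree.leaves, or_comm] using hx
    rcases this with hx | rfl
    · exact (ih h hQ hx).mono (List.subset_cons_self _ _)
    · exact Conn.of_mem (by simp)
  | par Q R => exact absurd h id

/-- The side condition holds for a `⅋`-free `Q` if the target of the step is correct. -/
theorem SwCorrect.sideCondition {C : Ctx 𝒜 X} {Q R : Linking 𝒜 X} {i : X} {Γ : List (Item 𝒜 X)}
    (h : SwCorrect (C.fill (.tensBot (.par Q R) i)) Γ) (hpf : Q.ParFree)
    (hn : (C.fill (narrowLink Q R i)).names.Nodup) (hn' : (narrowLink Q R i).names.Nodup) :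
    SideCondition C Q R i Γ := by
  intro σ
  have hreach := Forest.reachable_keep_iff (wholeForest C Q R i Γ) σ
    (offBot C Q R i Γ)
  rw [← extSwitching_eq C Q R i Γ hn hn' σ] at hreach
  have hδΓ : (fun p => offBot C Q R i Γ (Sum.inr p)) = fun _ => True :=
    funext fun p => eq_true fun h => by cases h
  let σP : (C.fill (narrowLink Q R i)).toTree.Inner → Bool := fun p => σ (Sum.inl p)
  let σΓ : Forest.Inner (Γ.map Item.toTree) → Bool := fun p => σ (Sum.inr p)
  have hedges : Forest.edges (wholeForest C Q R i Γ) σ (offBot C Q R i Γ) =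
      (C.fill (narrowLink Q R i)).toTree.edges σP (fun p => offBot C Q R i Γ (Sum.inl p)) ++
        Forest.edges (Γ.map Item.toTree) σΓ fun _ => True := by
    rw [← hδΓ]; rfl
  rw [hedges] at hreach
  obtain ⟨o, S, A, hC, hP⟩ := C.exists_sw_of_switching (narrowLink Q R i) σP
    (fun p => offBot C Q R i Γ (Sum.inl p)) (fun p hp => fun h => hp _ (Sum.inl.inj h))
  let τ : (narrowLink Q R i).toTree.Inner → Bool := fun q => σP (C.emb (narrowLink Q R i) q)
  obtain ⟨q, E, hQ, hE⟩ := Q.sw_of_sw_toTree _ _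
    ((OTree.sw_iff _ _ _).2 ⟨fun p => τ (some (Sum.inl p)), rfl, rfl⟩)
  obtain ⟨r, F, hR, hF⟩ := R.sw_of_sw_toTree _ _
    ((OTree.sw_iff _ _ _).2 ⟨fun p => τ (some (Sum.inr (some (Sum.inl p)))), rfl, rfl⟩)
  have hτ := edges_narrowLink C Q R i Γ τ
  have hB : Env C Γ S (A ++ Forest.edges (Γ.map Item.toTree) σΓ fun _ => True) :=
    ⟨o, A, _, hC, (Forest.sw_iff _ _).2 ⟨σΓ, rfl⟩, rfl⟩
  set B := A ++ Forest.edges (Γ.map Item.toTree) σΓ fun _ => True with hBdef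
  have hwide := fun hq hr => conn_of_swCorrect_wide h hQ hR hB hq hr
  rw [swCorrect_fill_iff] at h
  have hmem : ∀ x, x ∈ Q.names ∨ x ∈ R.names →
      x ∈ (C.fill (.tensBot (.par Q R) i)).names := by
    intro x hx
    apply C.mem_names_fill
    simp only [Linking.names, Linking.toTree, OTree.leaves, List.map_append, List.mem_append] at *
    exact Or.inl hx
  have hqr := hwide (hmem q (Or.inl hQ.root_mem)) (hmem r (Or.inr hR.root_mem))
  have key : ∀ x ∈ Q.names, ¬ Conn ((C.fill (narrowLink Q R i)).toTree.edges σP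
      (fun p => offBot C Q R i Γ (Sum.inl p)) ++ Forest.edges (Γ.map Item.toTree) σΓ fun _ => True)
      i x := by
    intro x hx hix
    obtain ⟨s, hs, hH⟩ : ∃ s, (s = q ∨ s = r) ∧ SwEquiv ((narrowLink Q R i).toTree.rep τ)
        ((narrowLink Q R i).toTree.edges τ
          (fun q => offBot C Q R i Γ (Sum.inl (C.emb _ q)))) s (E ++ F) := by
      rw [hτ]
      by_cases h0 : τ none = true
      · refine ⟨r, Or.inr rfl, ?_⟩
        have : (narrowLink Q R i).toTree.rep τ =
            R.toTree.rep fun p => τ (some (Sum.inr (some (Sum.inl p)))) := if_pos h0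
        rw [this]
        exact hE.append_right hF
      · refine ⟨q, Or.inl rfl, ?_⟩
        have : (narrowLink Q R i).toTree.rep τ = Q.toTree.rep fun p => τ (some (Sum.inl p)) :=
          if_neg h0
        rw [this]
        exact hE.append hF
    have h1 := (hP s _ hH).of_conn_append _ hix
    have h2 : Conn (E ++ F ++ (star S s ++ B)) i x := by
      simpa only [List.append_assoc, hBdef] using h1
    have h3 : Conn (E ++ F ++ (star S s ++ B)) x s := by
      have hxq : Conn (E ++ F ++ (star S s ++ B)) x q :=
        (hpf.conn hQ hx).mono (by intro e he; simp [he])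
      rcases hs with rfl | rfl
      · exact hxq
      · refine hxq.trans (hqr.mono ?_)
        intro e he
        simp only [List.mem_append] at he ⊢
        tauto
    have h4 := h s _ S B ⟨E ++ F, ⟨q, E, r, F, hQ, hR, hs, rfl⟩, rfl⟩ hB
    exact TreeOn.not_conn (by simpa only [List.cons_append] using h4) (h2.trans h3)
  refine ⟨fun x hx hc => key x hx ((hreach _ _).1 hc), fun n hc => ?_⟩
  have h1 := C.nodeRep_emb (narrowLink Q R i) σP (some (Sum.inl n))
  refine key _ (OTree.nodeRep_mem_leaves Q.toTree (fun p => τ (some (Sum.inl p))) n) ?_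
  have h2 := (hreach _ _).1 hc
  have h3 : Sum.elim id (Forest.nodeRep (wholeForest C Q R i Γ) σ)
      (Sum.inr (Sum.inl (C.emb (narrowLink Q R i) (some (Sum.inl n))))) =
      Q.toTree.nodeRep (fun p => τ (some (Sum.inl p))) n := h1
  rw [h3] at h2
  exact h2

end SideConditions


section Wires

variable {𝒜 : Type u} {X : Type v}

/-- A distinguished positive leaf of a linking. -/
def Linking.lead : Linking 𝒜 X → X
  | .one x => x
  | .ax _ x _ => x
  | .xa _ _ y => y
  | .botTens _ Q => lead Q
  | .tensBot Q _ => lead Q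
  | .par _ R => lead R

/-- The wires of a linking join each negative leaf to a positive one: a negated atom to its
partner, a `⊥` to the distinguished leaf of its scope. -/
def Linking.wires : Linking 𝒜 X → List (X × X)
  | .one _ => []
  | .ax _ x y => [(y, x)]
  | .xa _ x y => [(x, y)]
  | .botTens x Q => (x, Q.lead) :: wires Q
  | .tensBot Q x => (x, Q.lead) :: wires Q
  | .par Q R => wires Q ++ wires R

theorem Linking.sw_wires (P : Linking 𝒜 X) : P.Sw P.lead P.wires := by
  induction P with
  | one x => exact ⟨rfl, rfl⟩
  | ax a x y => exact ⟨rfl, rfl⟩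
  | xa a x y => exact ⟨rfl, rfl⟩
  | botTens x Q ih => exact ⟨_, ih, rfl⟩
  | tensBot Q x ih => exact ⟨_, ih, rfl⟩
  | par Q R ih ih' => exact ⟨_, _, _, _, ih, ih', Or.inr rfl, rfl⟩

/-- Is the decoration negative, i.e. `a^⊥` or `⊥`? -/
def Lit.IsNeg : Lit 𝒜 → Prop
  | .pos _ => False
  | .neg _ => True
  | .one => False
  | .bot => True

@[simp] theorem Lit.isNeg_pos (a : 𝒜) : ¬ (Lit.pos a).IsNeg := id
@[simp] theorem Lit.isNeg_neg (a : 𝒜) : (Lit.neg a).IsNeg := trivial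
@[simp] theorem Lit.isNeg_one : ¬ (Lit.one : Lit 𝒜).IsNeg := id
@[simp] theorem Lit.isNeg_bot : (Lit.bot : Lit 𝒜).IsNeg := trivial

/-- The leaves of a linking. -/
abbrev Linking.leaves (P : Linking 𝒜 X) : List (Lit 𝒜 × X) := P.toTree.leaves

theorem Linking.lead_mem (P : Linking 𝒜 X) : ∃ l, ¬ l.IsNeg ∧ (l, P.lead) ∈ P.leaves := by
  induction P with
  | one x => exact ⟨.one, by simp, by simp [leaves, toTree, OTree.leaves, lead]⟩
  | ax a x y => exact ⟨.pos a, by simp, by simp [leaves, toTree, OTree.leaves, lead]⟩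
  | xa a x y => exact ⟨.pos a, by simp, by simp [leaves, toTree, OTree.leaves, lead]⟩
  | botTens x Q ih =>
    obtain ⟨l, hl, h⟩ := ih
    exact ⟨l, hl, List.mem_append_right _ h⟩
  | tensBot Q x ih =>
    obtain ⟨l, hl, h⟩ := ih
    exact ⟨l, hl, List.mem_append_left _ h⟩
  | par Q R _ ih =>
    obtain ⟨l, hl, h⟩ := ih
    exact ⟨l, hl, List.mem_append_right _ h⟩

/-- The sources of the wires are exactly the negative leaves. -/
theorem Linking.perm_wires_fst (P : Linking 𝒜 X) :
    (P.wires.map Prod.fst).Perm ((P.leaves.filter fun l => decide l.1.IsNeg).map Prod.snd) := by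
  induction P with
  | one x => simp [wires, leaves, toTree, OTree.leaves]
  | ax a x y => simp [wires, leaves, toTree, OTree.leaves]
  | xa a x y => simp [wires, leaves, toTree, OTree.leaves]
  | botTens x Q ih => simpa [wires, leaves, toTree, OTree.leaves] using ih
  | tensBot Q x ih =>
    have := ih.cons x
    simp only [wires, leaves, toTree, OTree.leaves, List.map_cons, List.filter_append,
      List.map_append] at this ⊢
    refine this.trans ?_
    simpa using (List.perm_append_singleton x _).symm
  | par Q R ih ih' =>
    simp only [wires, leaves, toTree, OTree.leaves, List.map_append, List.filter_append]
    exact ih.append ih'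

/-- The types of wires: a negated atom is wired to a positive atom, a `⊥` to any positive leaf. -/
theorem Linking.wires_types (P : Linking 𝒜 X) {n p : X} (h : (n, p) ∈ P.wires) :
    ∃ l m, (l, n) ∈ P.leaves ∧ (m, p) ∈ P.leaves ∧ l.IsNeg ∧ ¬ m.IsNeg ∧
      (l = Lit.bot ∨ ∃ a, l = Lit.neg a ∧ m = Lit.pos a) := by
  induction P with
  | one x => simp [wires] at h
  | ax a x y =>
    simp only [wires, List.mem_singleton, Prod.mk.injEq] at h
    obtain ⟨rfl, rfl⟩ := h
    exact ⟨.neg a, .pos a, by simp [leaves, toTree, OTree.leaves],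
      by simp [leaves, toTree, OTree.leaves], by simp, by simp, Or.inr ⟨a, rfl, rfl⟩⟩
  | xa a x y =>
    simp only [wires, List.mem_singleton, Prod.mk.injEq] at h
    obtain ⟨rfl, rfl⟩ := h
    exact ⟨.neg a, .pos a, by simp [leaves, toTree, OTree.leaves],
      by simp [leaves, toTree, OTree.leaves], by simp, by simp, Or.inr ⟨a, rfl, rfl⟩⟩
  | botTens x Q ih =>
    rcases List.mem_cons.1 h with h | h
    · obtain ⟨rfl, rfl⟩ := Prod.mk.inj h
      obtain ⟨m, hm, hp⟩ := Q.lead_mem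
      exact ⟨.bot, m, by simp [leaves, toTree, OTree.leaves],
        by simp [leaves, toTree, OTree.leaves, hp], by simp, hm, Or.inl rfl⟩
    · obtain ⟨l, m, h1, h2, h3⟩ := ih h
      exact ⟨l, m, List.mem_append_right _ h1, List.mem_append_right _ h2, h3⟩
  | tensBot Q x ih =>
    rcases List.mem_cons.1 h with h | h
    · obtain ⟨rfl, rfl⟩ := Prod.mk.inj h
      obtain ⟨m, hm, hp⟩ := Q.lead_mem
      exact ⟨.bot, m, by simp [leaves, toTree, OTree.leaves],
        by simp [leaves, toTree, OTree.leaves, hp], by simp, hm, Or.inl rfl⟩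
    · obtain ⟨l, m, h1, h2, h3⟩ := ih h
      exact ⟨l, m, List.mem_append_left _ h1, List.mem_append_left _ h2, h3⟩
  | par Q R ih ih' =>
    rcases List.mem_append.1 h with h | h
    · obtain ⟨l, m, h1, h2, h3⟩ := ih h
      exact ⟨l, m, List.mem_append_left _ h1, List.mem_append_left _ h2, h3⟩
    · obtain ⟨l, m, h1, h2, h3⟩ := ih' h
      exact ⟨l, m, List.mem_append_right _ h1, List.mem_append_right _ h2, h3⟩

theorem label_unique {L : List (Lit 𝒜 × X)} (hn : (L.map Prod.snd).Nodup) {l m : Lit 𝒜} {x : X}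
    (hl : (l, x) ∈ L) (hm : (m, x) ∈ L) : l = m :=
  congrArg Prod.fst (List.inj_on_of_nodup_map hn hl hm rfl)

theorem Linking.wires_fst_nodup {P : Linking 𝒜 X} (hn : P.names.Nodup) :
    (P.wires.map Prod.fst).Nodup :=
  P.perm_wires_fst.nodup_iff.2 (hn.sublist (List.filter_sublist.map _))

theorem Linking.wires_unique {P : Linking 𝒜 X} (hn : P.names.Nodup) {n p q : X}
    (hp : (n, p) ∈ P.wires) (hq : (n, q) ∈ P.wires) : p = q :=
  congrArg Prod.snd (List.inj_on_of_nodup_map (wires_fst_nodup hn) hp hq rfl)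

theorem Linking.exists_wire {P : Linking 𝒜 X} {l : Lit 𝒜} {n : X} (hl : l.IsNeg)
    (h : (l, n) ∈ P.leaves) : ∃ p, (n, p) ∈ P.wires := by
  have : n ∈ P.wires.map Prod.fst := P.perm_wires_fst.mem_iff.2
    (List.mem_map.2 ⟨(l, n), List.mem_filter.2 ⟨h, by simpa using hl⟩, rfl⟩)
  obtain ⟨⟨n, p⟩, hp, rfl⟩ := List.mem_map.1 this
  exact ⟨p, hp⟩

/-- If two linkings have the same leaves and the wires of one are among those of the other, then
they have the same wires. -/
theorem Linking.wires_iff_of_subset {P Q : Linking 𝒜 X} (hn : Q.names.Nodup)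
    (hp : P.leaves.Perm Q.leaves) (h : ∀ n p, (n, p) ∈ P.wires → (n, p) ∈ Q.wires) (n p : X) :
    (n, p) ∈ P.wires ↔ (n, p) ∈ Q.wires := by
  refine ⟨h n p, fun hq => ?_⟩
  obtain ⟨l, m, hl, -, hneg, -⟩ := Q.wires_types hq
  obtain ⟨p', hp'⟩ := exists_wire hneg (hp.mem_iff.2 hl)
  rwa [Linking.wires_unique hn hq (h _ _ hp')]

/-- `P ▷ Γ` is a pre-proof graph. -/
structure Valid (P : Linking 𝒜 X) (Γ : List (Item 𝒜 X)) : Prop where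
  wellFormed : ∀ i ∈ Γ, i.WellFormed
  nodup : P.names.Nodup
  perm : P.leaves.Perm (Forest.leaves (Γ.map Item.toTree))

/-- The pre-proof graph `P ▷ Γ`. -/
def Valid.graph {P : Linking 𝒜 X} {Γ : List (Item 𝒜 X)} (h : Valid P Γ) : PreGraph 𝒜 X :=
  ⟨P, Γ, h.wellFormed, h.nodup, h.perm⟩

theorem PreGraph.valid (G : PreGraph 𝒜 X) : Valid G.link G.seq :=
  ⟨G.wellFormed, G.nodup, G.leaves_perm⟩

theorem Valid.perm_leaves {P Q : Linking 𝒜 X} {Γ : List (Item 𝒜 X)} (h : Valid P Γ)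
    (h' : Valid Q Γ) : P.leaves.Perm Q.leaves :=
  h.perm.trans h'.perm.symm

theorem Valid.of_perm {P Q : Linking 𝒜 X} {Γ : List (Item 𝒜 X)} (h : Valid P Γ)
    (hp : P.leaves.Perm Q.leaves) : Valid Q Γ :=
  ⟨h.wellFormed, (hp.map Prod.snd).nodup_iff.1 h.nodup, hp.symm.trans h.perm⟩

/-- The equations between linkings, the sequent being fixed. -/
inductive LinkStep (Γ : List (Item 𝒜 X)) : Linking 𝒜 X → Linking 𝒜 X → Prop
  | parComm (C : Ctx 𝒜 X) (Q R : Linking 𝒜 X) :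
      LinkStep Γ (C.fill (.par Q R)) (C.fill (.par R Q))
  | parAssoc (C : Ctx 𝒜 X) (Q R S : Linking 𝒜 X) :
      LinkStep Γ (C.fill (.par (.par Q R) S)) (C.fill (.par Q (.par R S)))
  | axComm (C : Ctx 𝒜 X) (a : 𝒜) (x y : X) : LinkStep Γ (C.fill (.ax a x y)) (C.fill (.xa a y x))
  | botComm (C : Ctx 𝒜 X) (Q : Linking 𝒜 X) (x : X) :
      LinkStep Γ (C.fill (.botTens x Q)) (C.fill (.tensBot Q x))
  | tensAssoc (C : Ctx 𝒜 X) (Q : Linking 𝒜 X) (i j : X) :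
      LinkStep Γ (C.fill (.botTens i (.tensBot Q j))) (C.fill (.tensBot (.botTens i Q) j))
  | parTens (C : Ctx 𝒜 X) (Q R : Linking 𝒜 X) (i : X) (side : SideCondition C Q R i Γ) :
      LinkStep Γ (C.fill (.par Q (.tensBot R i))) (C.fill (.tensBot (.par Q R) i))

theorem SimStep.seq_eq {G H : PreGraph 𝒜 X} (h : SimStep G H) : G.seq = H.seq := by
  cases h <;> assumption

theorem SimStep.linkStep {G H : PreGraph 𝒜 X} (h : SimStep G H) :
    LinkStep G.seq G.link H.link := by
  cases h with
  | parComm C Q R hs hG hH => rw [hG, hH]; exact .parComm C Q R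
  | parAssoc C Q R S hs hG hH => rw [hG, hH]; exact .parAssoc C Q R S
  | axComm C a x y hs hG hH => rw [hG, hH]; exact .axComm C a x y
  | botComm C Q x hs hG hH => rw [hG, hH]; exact .botComm C Q x
  | tensAssoc C Q i j hs hG hH => rw [hG, hH]; exact .tensAssoc C Q i j
  | parTens C Q R i hs hG hH side => rw [hG, hH]; exact .parTens C Q R i side

theorem LinkStep.simStep {P Q : Linking 𝒜 X} {Γ : List (Item 𝒜 X)} (h : LinkStep Γ P Q)
    (hP : Valid P Γ) (hQ : Valid Q Γ) : SimStep hP.graph hQ.graph := by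
  cases h with
  | parComm C Q R => exact .parComm C Q R rfl rfl rfl
  | parAssoc C Q R S => exact .parAssoc C Q R S rfl rfl rfl
  | axComm C a x y => exact .axComm C a x y rfl rfl rfl
  | botComm C Q x => exact .botComm C Q x rfl rfl rfl
  | tensAssoc C Q i j => exact .tensAssoc C Q i j rfl rfl rfl
  | parTens C Q R i side => exact .parTens C Q R i rfl rfl rfl side

theorem LinkStep.perm {P Q : Linking 𝒜 X} {Γ : List (Item 𝒜 X)} (h : LinkStep Γ P Q) :
    P.leaves.Perm Q.leaves := by
  cases h with
  | parComm C Q R => exact C.perm_leaves_fill List.perm_append_comm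
  | parAssoc C Q R S =>
    exact C.perm_leaves_fill (by simp [Linking.toTree, OTree.leaves])
  | axComm C a x y => exact C.perm_leaves_fill List.perm_append_comm
  | botComm C Q x => exact C.perm_leaves_fill List.perm_append_comm
  | tensAssoc C Q i j => exact C.perm_leaves_fill (by simp [Linking.toTree, OTree.leaves])
  | parTens C Q R i side => exact C.perm_leaves_fill (perm_leaves_parTens Q R i)

theorem Ctx.names_fill_nodup (C : Ctx 𝒜 X) {Q : Linking 𝒜 X} (h : (C.fill Q).names.Nodup) :
    Q.names.Nodup := by
  induction C with
  | hole => exact h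
  | botTens x C ih =>
    simp only [Ctx.fill, Linking.names, Linking.toTree, OTree.leaves, List.map_append] at h
    exact ih h.of_append_right
  | tensBot C x ih =>
    simp only [Ctx.fill, Linking.names, Linking.toTree, OTree.leaves, List.map_append] at h
    exact ih h.of_append_left
  | parL C R ih =>
    simp only [Ctx.fill, Linking.names, Linking.toTree, OTree.leaves, List.map_append] at h
    exact ih h.of_append_left
  | parR R C ih =>
    simp only [Ctx.fill, Linking.names, Linking.toTree, OTree.leaves, List.map_append] at h
    exact ih h.of_append_right

/-- The equations preserve and reflect correctness. -/
theorem LinkStep.swCorrect_iff {P Q : Linking 𝒜 X} {Γ : List (Item 𝒜 X)} (h : LinkStep Γ P Q)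
    (hn : P.names.Nodup) : SwCorrect P Γ ↔ SwCorrect Q Γ := by
  have hperm := h.perm
  cases h with
  | parComm C Q R =>
    have key : ∀ Q R : Linking 𝒜 X, ∀ r E, (Linking.par R Q).Sw r E →
        ∃ E', (Linking.par Q R).Sw r E' ∧ E'.Perm E := by
      rintro Q R r _ ⟨r₁, E₁, r₂, E₂, h₁, h₂, hr, rfl⟩
      exact ⟨_, ⟨r₂, E₂, r₁, E₁, h₂, h₁, hr.symm, rfl⟩, List.perm_append_comm⟩
    exact ⟨fun h => h.mono_fill List.perm_append_comm (key _ _),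
      fun h => h.mono_fill List.perm_append_comm (key _ _)⟩
  | parAssoc C Q R S =>
    have hp : (Linking.par (.par Q R) S).leaves.Perm (Linking.par Q (.par R S)).leaves := by
      simp [Linking.leaves, Linking.toTree, OTree.leaves]
    constructor
    · refine fun h => h.mono_fill hp ?_
      rintro r _ ⟨r₁, E₁, _, _, h₁, ⟨r₂, E₂, r₃, E₃, h₂, h₃, hr', rfl⟩, hr, rfl⟩
      refine ⟨(E₁ ++ E₂) ++ E₃, ?_, by simp⟩
      rcases hr with rfl | rfl
      · exact ⟨r, _, r₃, _, ⟨r, E₁, r₂, E₂, h₁, h₂, Or.inl rfl, rfl⟩, h₃, Or.inl rfl, rfl⟩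
      · rcases hr' with rfl | rfl
        · exact ⟨r, _, r₃, _, ⟨r₁, E₁, r, E₂, h₁, h₂, Or.inr rfl, rfl⟩, h₃, Or.inl rfl, rfl⟩
        · exact ⟨r₁, _, r, _, ⟨r₁, E₁, r₂, E₂, h₁, h₂, Or.inl rfl, rfl⟩, h₃, Or.inr rfl, rfl⟩
    · refine fun h => h.mono_fill hp.symm ?_
      rintro r _ ⟨_, _, r₃, E₃, ⟨r₁, E₁, r₂, E₂, h₁, h₂, hr', rfl⟩, h₃, hr, rfl⟩
      refine ⟨E₁ ++ (E₂ ++ E₃), ?_, by simp⟩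
      rcases hr with rfl | rfl
      · rcases hr' with rfl | rfl
        · exact ⟨r, _, r₃, _, h₁, ⟨r₂, E₂, r₃, E₃, h₂, h₃, Or.inr rfl, rfl⟩, Or.inl rfl, rfl⟩
        · exact ⟨r₁, _, r, _, h₁, ⟨r, E₂, r₃, E₃, h₂, h₃, Or.inl rfl, rfl⟩, Or.inr rfl, rfl⟩
      · exact ⟨r₁, _, r, _, h₁, ⟨r₂, E₂, r, E₃, h₂, h₃, Or.inr rfl, rfl⟩, Or.inr rfl, rfl⟩
  | axComm C a x y =>
    exact ⟨fun h => h.mono_fill List.perm_append_comm fun r E h => ⟨E, h, List.Perm.refl _⟩,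
      fun h => h.mono_fill List.perm_append_comm fun r E h => ⟨E, h, List.Perm.refl _⟩⟩
  | botComm C Q x =>
    exact ⟨fun h => h.mono_fill List.perm_append_comm fun r E h => ⟨E, h, List.Perm.refl _⟩,
      fun h => h.mono_fill List.perm_append_comm fun r E h => ⟨E, h, List.Perm.refl _⟩⟩
  | tensAssoc C Q i j =>
    have hp : (Linking.botTens i (.tensBot Q j)).leaves.Perm
        (Linking.tensBot (.botTens i Q) j).leaves := by
      simp [Linking.leaves, Linking.toTree, OTree.leaves]
    refine ⟨fun h => h.mono_fill hp ?_, fun h => h.mono_fill hp.symm ?_⟩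
    · rintro r _ ⟨_, ⟨E, h, rfl⟩, rfl⟩
      exact ⟨_, ⟨_, ⟨E, h, rfl⟩, rfl⟩, List.Perm.swap _ _ _⟩
    · rintro r _ ⟨_, ⟨E, h, rfl⟩, rfl⟩
      exact ⟨_, ⟨_, ⟨E, h, rfl⟩, rfl⟩, List.Perm.swap _ _ _⟩
  | parTens C Q R i side =>
    exact ⟨fun h => h.widen fun q E r F S B hQ hR hB =>
      side.not_conn hn (C.names_fill_nodup hn) hQ hR hB, fun h => h.narrow⟩

/-- The equivalence of linkings for a fixed sequent. -/
def Sim (Γ : List (Item 𝒜 X)) : Linking 𝒜 X → Linking 𝒜 X → Prop :=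
  EqvGen (LinkStep Γ)

theorem Sim.perm {Γ : List (Item 𝒜 X)} {P Q : Linking 𝒜 X} (h : Sim Γ P Q) :
    P.leaves.Perm Q.leaves := by
  induction h with
  | rel _ _ h => exact h.perm
  | refl _ => exact List.Perm.refl _
  | symm _ _ _ ih => exact ih.symm
  | trans _ _ _ _ _ ih ih' => exact ih.trans ih'

theorem Sim.refl (Γ : List (Item 𝒜 X)) (P : Linking 𝒜 X) : Sim Γ P P := EqvGen.refl _

theorem Sim.symm {Γ : List (Item 𝒜 X)} {P Q : Linking 𝒜 X} (h : Sim Γ P Q) : Sim Γ Q P :=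
  EqvGen.symm _ _ h

theorem Sim.trans {Γ : List (Item 𝒜 X)} {P Q R : Linking 𝒜 X} (h : Sim Γ P Q)
    (h' : Sim Γ Q R) : Sim Γ P R :=
  EqvGen.trans _ _ _ h h'

theorem LinkStep.sim {Γ : List (Item 𝒜 X)} {P Q : Linking 𝒜 X} (h : LinkStep Γ P Q) : Sim Γ P Q :=
  EqvGen.rel _ _ h

theorem Sim.swCorrect_iff {Γ : List (Item 𝒜 X)} {P Q : Linking 𝒜 X} (h : Sim Γ P Q)
    (hn : P.names.Nodup) : SwCorrect P Γ ↔ SwCorrect Q Γ := by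
  induction h with
  | rel _ _ h => exact h.swCorrect_iff hn
  | refl _ => exact Iff.rfl
  | symm _ _ h ih => exact (ih ((Sim.perm h).map Prod.snd |>.nodup_iff.2 hn)).symm
  | trans _ _ _ h _ ih ih' =>
    exact (ih hn).trans (ih' ((Sim.perm h).map Prod.snd |>.nodup_iff.1 hn))

theorem Sim.toNet_eq {Γ : List (Item 𝒜 X)} {P Q : Linking 𝒜 X} (h : Sim Γ P Q)
    (hP : Valid P Γ) (hQ : Valid Q Γ) : hP.graph.toNet = hQ.graph.toNet := by
  induction h with
  | rel _ _ h => exact Quotient.sound (EqvGen.rel _ _ (h.simStep hP hQ))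
  | refl _ => rfl
  | symm _ _ _ ih => exact (ih hQ hP).symm
  | trans P R Q h _ ih ih' =>
    have hR : Valid R Γ := hP.of_perm (Sim.perm h)
    exact (ih hP hR).trans (ih' hR hQ)

theorem sim_of_toNet_eq {G H : PreGraph 𝒜 X} (h : G.toNet = H.toNet) :
    G.seq = H.seq ∧ Sim G.seq G.link H.link := by
  have h' : EqvGen SimStep G H := Quotient.exact h
  clear h
  induction h' with
  | rel _ _ h => exact ⟨h.seq_eq, h.linkStep.sim⟩
  | refl _ => exact ⟨rfl, Sim.refl _ _⟩
  | symm _ _ _ ih => exact ⟨ih.1.symm, ih.1 ▸ ih.2.symm⟩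
  | trans _ _ _ _ _ ih ih' => exact ⟨ih.1.trans ih'.1, ih.2.trans (ih.1 ▸ ih'.2)⟩

/-- The wires of a filled context. -/
theorem Ctx.exists_wires_fill (C : Ctx 𝒜 X) : ∃ (o : Option X) (S : List X) (A : List (X × X)),
    C.Sw o S A ∧ ∀ Q : Linking 𝒜 X, (C.fill Q).lead = o.getD Q.lead ∧
      (C.fill Q).wires.Perm (Q.wires ++ (star S Q.lead ++ A)) ∧
      ∀ s ∈ S, (Lit.bot, s) ∈ (C.fill Q).leaves := by
  induction C with
  | hole => exact ⟨none, [], [], ⟨rfl, rfl, rfl⟩, fun Q => ⟨rfl, by simp [Ctx.fill], by simp⟩⟩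
  | botTens x C ih =>
    obtain ⟨o, S, A, hC, h⟩ := ih
    obtain ⟨S', A', hC', hp, hS⟩ := hC.exists_cons x
    refine ⟨o, S', A', hC', fun Q => ⟨(h Q).1, ?_, fun s hs => ?_⟩⟩
    · have := (h Q).2.1.cons (x, (C.fill Q).lead)
      rw [(h Q).1] at this
      simp only [Ctx.fill, Linking.wires, (h Q).1]
      exact this.trans (hp _ _)
    · rcases hS s hs with rfl | hs
      · exact List.mem_append_left _ (by simp [OTree.leaves])
      · exact List.mem_append_right _ ((h Q).2.2 s hs)
  | tensBot C x ih =>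
    obtain ⟨o, S, A, hC, h⟩ := ih
    obtain ⟨S', A', hC', hp, hS⟩ := hC.exists_cons x
    refine ⟨o, S', A', hC', fun Q => ⟨(h Q).1, ?_, fun s hs => ?_⟩⟩
    · have := (h Q).2.1.cons (x, (C.fill Q).lead)
      rw [(h Q).1] at this
      simp only [Ctx.fill, Linking.wires, (h Q).1]
      exact this.trans (hp _ _)
    · rcases hS s hs with rfl | hs
      · exact List.mem_append_right _ (by simp [OTree.leaves])
      · exact List.mem_append_left _ ((h Q).2.2 s hs)
  | parL C R ih =>
    obtain ⟨o, S, A, hC, h⟩ := ih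
    refine ⟨some R.lead, S, A ++ R.wires,
      ⟨o, A, R.lead, R.wires, hC, R.sw_wires, Or.inr rfl, rfl⟩, fun Q => ⟨rfl, ?_, ?_⟩⟩
    · simpa only [Ctx.fill, Linking.wires, List.append_assoc] using
        (h Q).2.1.append_right R.wires
    · exact fun s hs => List.mem_append_left _ ((h Q).2.2 s hs)
  | parR R C ih =>
    obtain ⟨o, S, A, hC, h⟩ := ih
    refine ⟨o, S, R.wires ++ A,
      ⟨o, A, R.lead, R.wires, hC, R.sw_wires, Or.inl rfl, rfl⟩, fun Q => ⟨(h Q).1, ?_, ?_⟩⟩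
    · refine ((h Q).2.1.append_left R.wires).trans ?_
      simp only [perm_iff_coe_eq, ← Multiset.coe_add]
      abel
    · exact fun s hs => List.mem_append_right _ ((h Q).2.2 s hs)

/-- The wires of `Q` arise from those of `P` by moving some `⊥`s from one leaf to another. -/
def Adjacent (P Q : Linking 𝒜 X) : Prop :=
  ∃ q q', ∀ n p, (n, p) ∈ P.wires →
    (n, p) ∈ Q.wires ∨ ((Lit.bot, n) ∈ P.leaves ∧ p = q ∧ (n, q') ∈ Q.wires)

theorem Adjacent.of_subset {P Q : Linking 𝒜 X} (h : ∀ n p, (n, p) ∈ P.wires → (n, p) ∈ Q.wires) :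
    Adjacent P Q :=
  ⟨P.lead, P.lead, fun n p hp => Or.inl (h n p hp)⟩

theorem Adjacent.fill {Q R : Linking 𝒜 X} (h : ∀ n p, (n, p) ∈ Q.wires → (n, p) ∈ R.wires)
    (C : Ctx 𝒜 X) : Adjacent (C.fill Q) (C.fill R) := by
  obtain ⟨o, S, A, -, hC⟩ := C.exists_wires_fill
  refine ⟨Q.lead, R.lead, fun n p hp => ?_⟩
  have hp' := (hC Q).2.1.mem_iff.1 hp
  rcases List.mem_append.1 hp' with h1 | h1
  · exact Or.inl ((hC R).2.1.mem_iff.2 (List.mem_append_left _ (h n p h1)))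
  · rcases List.mem_append.1 h1 with h1 | h1
    · obtain ⟨hn, rfl⟩ := mem_star.1 h1
      exact Or.inr ⟨(hC Q).2.2 n hn, rfl, (hC R).2.1.mem_iff.2 (by simp [hn])⟩
    · exact Or.inl ((hC R).2.1.mem_iff.2 (by simp [h1]))

theorem LinkStep.adjacent {Γ : List (Item 𝒜 X)} {P Q : Linking 𝒜 X} (h : LinkStep Γ P Q) :
    Adjacent P Q := by
  cases h with
  | parComm C Q R => exact Adjacent.fill (by simp [Linking.wires, or_comm]) C
  | parAssoc C Q R S => exact Adjacent.fill (by simp [Linking.wires]) C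
  | axComm C a x y => exact Adjacent.fill (by simp [Linking.wires]) C
  | botComm C Q x => exact Adjacent.fill (by simp [Linking.wires]) C
  | tensAssoc C Q i j =>
    exact Adjacent.fill (by
      intro n p
      simp only [Linking.wires, Linking.lead, List.mem_cons]
      tauto) C
  | parTens C Q R i side =>
    exact Adjacent.fill (by
      intro n p
      simp only [Linking.wires, Linking.lead, List.mem_cons, List.mem_append]
      tauto) C

end Wires


section Flat

variable {𝒜 : Type u} {X : Type v} {Γ : List (Item 𝒜 X)}

/-- Composition of contexts. -/
def Ctx.comp : Ctx 𝒜 X → Ctx 𝒜 X → Ctx 𝒜 X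
  | .hole, D => D
  | .botTens x C, D => .botTens x (comp C D)
  | .tensBot C x, D => .tensBot (comp C D) x
  | .parL C R, D => .parL (comp C D) R
  | .parR R C, D => .parR R (comp C D)

@[simp] theorem Ctx.fill_comp (C D : Ctx 𝒜 X) (Q : Linking 𝒜 X) :
    (C.comp D).fill Q = C.fill (D.fill Q) := by
  induction C with
  | hole => rfl
  | botTens x C ih => simp [comp, fill, ih]
  | tensBot C x ih => simp [comp, fill, ih]
  | parL C R ih => simp [comp, fill, ih]
  | parR R C ih => simp [comp, fill, ih]

/-- Linkings that are equivalent in all contexts. -/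
def FreeSim (Γ : List (Item 𝒜 X)) (P Q : Linking 𝒜 X) : Prop :=
  ∀ C : Ctx 𝒜 X, Sim Γ (C.fill P) (C.fill Q)

namespace FreeSim

theorem refl (P : Linking 𝒜 X) : FreeSim Γ P P := fun _ => Sim.refl _ _

theorem symm {P Q : Linking 𝒜 X} (h : FreeSim Γ P Q) : FreeSim Γ Q P := fun C => (h C).symm

theorem trans {P Q R : Linking 𝒜 X} (h : FreeSim Γ P Q) (h' : FreeSim Γ Q R) : FreeSim Γ P R :=
  fun C => (h C).trans (h' C)

theorem fill {P Q : Linking 𝒜 X} (h : FreeSim Γ P Q) (D : Ctx 𝒜 X) :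
    FreeSim Γ (D.fill P) (D.fill Q) := fun C => by
  simpa using h (C.comp D)

theorem parComm (Q R : Linking 𝒜 X) : FreeSim Γ (.par Q R) (.par R Q) :=
  fun C => (LinkStep.parComm C Q R).sim

theorem parAssoc (Q R S : Linking 𝒜 X) : FreeSim Γ (.par (.par Q R) S) (.par Q (.par R S)) :=
  fun C => (LinkStep.parAssoc C Q R S).sim

theorem axComm (a : 𝒜) (x y : X) : FreeSim Γ (.ax a x y) (.xa a y x) :=
  fun C => (LinkStep.axComm C a x y).sim

theorem botComm (Q : Linking 𝒜 X) (x : X) : FreeSim Γ (.botTens x Q) (.tensBot Q x) :=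
  fun C => (LinkStep.botComm C Q x).sim

theorem tensComm (Q : Linking 𝒜 X) (x y : X) :
    FreeSim Γ (.tensBot (.tensBot Q x) y) (.tensBot (.tensBot Q y) x) :=
  (((botComm Q x).symm.fill (.tensBot .hole y)).trans
    fun C => (LinkStep.tensAssoc C Q x y).sim.symm).trans (botComm _ x)

theorem parLeftComm (Q R S : Linking 𝒜 X) : FreeSim Γ (.par Q (.par R S)) (.par R (.par Q S)) :=
  ((parAssoc Q R S).symm.trans ((parComm Q R).fill (.parL .hole S))).trans (parAssoc R Q S)

end FreeSim

/-- The linking `Q` tensored with some `⊥`s. -/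
def botsOn (B : List X) (Q : Linking 𝒜 X) : Linking 𝒜 X :=
  B.foldr (fun x R => .tensBot R x) Q

theorem FreeSim.botsOn {Q R : Linking 𝒜 X} (h : FreeSim Γ Q R) (B : List X) :
    FreeSim Γ (MLL.botsOn B Q) (MLL.botsOn B R) := by
  induction B with
  | nil => exact h
  | cons x B ih => exact ih.fill (.tensBot .hole x)

theorem FreeSim.botsOn_perm {B B' : List X} (h : B.Perm B') (Q : Linking 𝒜 X) :
    FreeSim Γ (MLL.botsOn B Q) (MLL.botsOn B' Q) := by
  induction h with
  | nil => exact FreeSim.refl _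
  | cons x _ ih => exact ih.fill (.tensBot .hole x)
  | swap x y B => exact FreeSim.tensComm _ _ _
  | trans _ _ ih ih' => exact ih.trans ih'

theorem lead_botsOn (B : List X) (Q : Linking 𝒜 X) : (botsOn B Q).lead = Q.lead := by
  induction B with
  | nil => rfl
  | cons x B ih => exact ih

theorem wires_botsOn (B : List X) (Q : Linking 𝒜 X) :
    (botsOn B Q).wires = star B Q.lead ++ Q.wires := by
  induction B with
  | nil => rfl
  | cons x B ih =>
    show (x, (botsOn B Q).lead) :: (botsOn B Q).wires = _
    rw [ih, lead_botsOn]; rfl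

theorem coe_leaves_botsOn (B : List X) (Q : Linking 𝒜 X) :
    ((botsOn B Q).leaves : Multiset (Lit 𝒜 × X)) =
      (B.map fun x => (Lit.bot, x) : List (Lit 𝒜 × X)) + (Q.leaves : Multiset (Lit 𝒜 × X)) := by
  induction B with
  | nil => simp [botsOn]
  | cons x B ih =>
    show Multiset.ofList ((botsOn B Q).leaves ++ [(Lit.bot, x)]) = _
    simp only [← Multiset.coe_add, ih, List.map_cons, ← Multiset.cons_coe,
      ← Multiset.singleton_add, Multiset.coe_nil]
    abel

theorem sw_botsOn {B : List X} {Q : Linking 𝒜 X} {r : X} {E : List (X × X)}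
    (h : (botsOn B Q).Sw r E) : ∃ E', Q.Sw r E' ∧ E = star B r ++ E' := by
  induction B generalizing E with
  | nil => exact ⟨E, h, rfl⟩
  | cons x B ih =>
    obtain ⟨E', h', rfl⟩ := h
    obtain ⟨E'', h'', rfl⟩ := ih h'
    exact ⟨E'', h'', rfl⟩

/-- The cores of components: `1_x` and `a^⊥_x ⊗ a_y`. -/
inductive Core (𝒜 : Type u) (X : Type v) : Type (max u v)
  | one (x : X)
  | xa (a : 𝒜) (x y : X)

def Core.link : Core 𝒜 X → Linking 𝒜 X
  | .one x => .one x
  | .xa a x y => .xa a x y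

/-- A component of a flat linking: a core tensored with some `⊥`s. -/
structure Comp (𝒜 : Type u) (X : Type v) : Type (max u v) where
  core : Core 𝒜 X
  bots : Multiset X

noncomputable def Comp.link (c : Comp 𝒜 X) : Linking 𝒜 X := botsOn c.bots.toList c.core.link

def Comp.lead (c : Comp 𝒜 X) : X := c.core.link.lead

theorem Comp.lead_link (c : Comp 𝒜 X) : c.link.lead = c.lead := lead_botsOn _ _

theorem Comp.parFree_link (c : Comp 𝒜 X) : c.link.ParFree := by
  have : ∀ B : List X, (botsOn B c.core.link).ParFree := by
    intro B
    induction B with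
    | nil => cases c.core <;> trivial
    | cons x B ih => exact ih
  exact this _

theorem Comp.sw_link {c : Comp 𝒜 X} {r : X} {E : List (X × X)} (h : c.link.Sw r E) :
    r = c.lead ∧ E = c.link.wires := by
  obtain ⟨E', h', rfl⟩ := sw_botsOn h
  rw [Comp.link, wires_botsOn]
  rcases c with ⟨k | ⟨a, x, y⟩, B⟩ <;> obtain ⟨rfl, rfl⟩ := h' <;> exact ⟨rfl, rfl⟩

theorem Comp.freeSim_botsOn (l : List X) (k : Core 𝒜 X) (B : Multiset X) :
    FreeSim Γ (botsOn l (Comp.link ⟨k, B⟩)) (Comp.link ⟨k, l + B⟩) := by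
  have : botsOn l (Comp.link ⟨k, B⟩) = botsOn (l ++ B.toList) k.link := by
    simp [botsOn, Comp.link]
  rw [this]
  refine FreeSim.botsOn_perm ?_ _
  rw [perm_iff_coe_eq, ← Multiset.coe_add]
  simp

theorem Comp.wires_perm (l : List X) (k : Core 𝒜 X) (B : Multiset X) :
    (Comp.link ⟨k, l + B⟩).wires.Perm (star l k.link.lead ++ (Comp.link ⟨k, B⟩).wires) := by
  simp only [Comp.link, wires_botsOn, ← List.append_assoc]
  refine List.Perm.append_right _ ?_
  rw [star, star, star, ← List.map_append]
  refine List.Perm.map _ ?_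
  rw [perm_iff_coe_eq, ← Multiset.coe_add]
  simp

theorem Comp.mem_wires {c : Comp 𝒜 X} {n p : X} : (n, p) ∈ c.link.wires ↔
    (n ∈ c.bots ∧ p = c.lead) ∨ (n, p) ∈ c.core.link.wires := by
  simp [Comp.link, wires_botsOn, Comp.lead]

theorem Comp.coe_leaves (c : Comp 𝒜 X) : (c.link.leaves : Multiset (Lit 𝒜 × X)) =
    c.bots.map (fun x => (Lit.bot, x)) + (c.core.link.leaves : Multiset (Lit 𝒜 × X)) := by
  rw [Comp.link, coe_leaves_botsOn, ← Multiset.map_coe, Multiset.coe_toList]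

theorem Comp.mem_leaves {c : Comp 𝒜 X} {l : Lit 𝒜} {x : X} : (l, x) ∈ c.link.leaves ↔
    (l = .bot ∧ x ∈ c.bots) ∨ (l, x) ∈ c.core.link.leaves := by
  rw [← Multiset.mem_coe, Comp.coe_leaves]
  simp only [Multiset.mem_add, Multiset.mem_map, Prod.mk.injEq, Multiset.mem_coe]
  constructor
  · rintro (⟨y, hy, rfl, rfl⟩ | h)
    · exact Or.inl ⟨rfl, hy⟩
    · exact Or.inr h
  · rintro (⟨rfl, hy⟩ | h)
    · exact Or.inl ⟨x, hy, rfl, rfl⟩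
    · exact Or.inr h

/-- The `⅋` of some components and a linking. -/
noncomputable def parOn (l : List (Comp 𝒜 X)) (Q : Linking 𝒜 X) : Linking 𝒜 X :=
  l.foldr (fun c R => .par c.link R) Q

theorem FreeSim.parOn {Q R : Linking 𝒜 X} (h : FreeSim Γ Q R) (l : List (Comp 𝒜 X)) :
    FreeSim Γ (MLL.parOn l Q) (MLL.parOn l R) := by
  induction l with
  | nil => exact h
  | cons c l ih => exact ih.fill (.parR c.link .hole)

theorem FreeSim.parOn_perm {l l' : List (Comp 𝒜 X)} (h : l.Perm l') (Q : Linking 𝒜 X) :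
    FreeSim Γ (MLL.parOn l Q) (MLL.parOn l' Q) := by
  induction h with
  | nil => exact FreeSim.refl _
  | cons x _ ih => exact ih.fill (.parR x.link .hole)
  | swap x y B => exact FreeSim.parLeftComm _ _ _
  | trans _ _ ih ih' => exact ih.trans ih'

theorem FreeSim.par_parOn (l : List (Comp 𝒜 X)) (Q R : Linking 𝒜 X) :
    FreeSim Γ (.par (MLL.parOn l Q) R) (MLL.parOn l (.par Q R)) := by
  induction l with
  | nil => exact FreeSim.refl _
  | cons c l ih => exact (FreeSim.parAssoc _ _ _).trans (ih.fill (.parR c.link .hole))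

theorem FreeSim.parOn_cons (d : Comp 𝒜 X) (l : List (Comp 𝒜 X)) (Q : Linking 𝒜 X) :
    FreeSim Γ (MLL.parOn (d :: l) Q) (MLL.parOn l (.par d.link Q)) := by
  have := FreeSim.parOn_perm (Γ := Γ) (List.perm_append_singleton d l).symm Q
  simpa [MLL.parOn] using this

theorem FreeSim.of_perm_comps {l l' : List (Comp 𝒜 X)} {c c' : Comp 𝒜 X}
    (h : (c :: l).Perm (c' :: l')) : FreeSim Γ (MLL.parOn l c.link) (MLL.parOn l' c'.link) := by
  by_cases hc : c = c'
  · subst hc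
    exact FreeSim.parOn_perm ((List.perm_cons _).1 h) _
  · have hmem : c ∈ l' := (List.mem_cons.1 (h.mem_iff.1 List.mem_cons_self)).resolve_left hc
    obtain ⟨m, hm⟩ : ∃ m, l'.Perm (c :: m) := ⟨_, List.perm_cons_erase hmem⟩
    have hl : l.Perm (c' :: m) := by
      refine (List.perm_cons c).1 (h.trans ((hm.cons c').trans (List.Perm.swap _ _ _)))
    refine (FreeSim.parOn_perm hl _).trans ((FreeSim.parOn_cons _ _ _).trans ?_)
    refine FreeSim.trans ?_ (FreeSim.parOn_perm hm _).symm
    exact ((FreeSim.parComm _ _).parOn m).trans (FreeSim.parOn_cons _ _ _).symm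

theorem wires_parOn (l : List (Comp 𝒜 X)) (Q : Linking 𝒜 X) :
    (parOn l Q).wires = l.flatMap (fun c => c.link.wires) ++ Q.wires := by
  induction l with
  | nil => rfl
  | cons c l ih =>
    show c.link.wires ++ (parOn l Q).wires = _
    rw [ih, List.flatMap_cons, List.append_assoc]

theorem leaves_parOn (l : List (Comp 𝒜 X)) (Q : Linking 𝒜 X) :
    (parOn l Q).leaves = l.flatMap (fun c => c.link.leaves) ++ Q.leaves := by
  induction l with
  | nil => rfl
  | cons c l ih =>
    show c.link.leaves ++ (parOn l Q).leaves = _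
    rw [ih, List.flatMap_cons, List.append_assoc]

theorem sw_parOn {l : List (Comp 𝒜 X)} {Q : Linking 𝒜 X} {r : X} {E : List (X × X)}
    (h : (parOn l Q).Sw r E) :
    ∃ r' E', Q.Sw r' E' ∧ E = l.flatMap (fun c => c.link.wires) ++ E' := by
  induction l generalizing r E with
  | nil => exact ⟨r, E, h, rfl⟩
  | cons c l ih =>
    obtain ⟨r₁, E₁, r₂, E₂, h₁, h₂, -, rfl⟩ := h
    obtain ⟨r', E', h', rfl⟩ := ih h₂
    obtain ⟨-, rfl⟩ := Comp.sw_link h₁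
    exact ⟨r', E', h', by simp⟩

/-- The scope of a `⊥` can be narrowed in a correct linking. -/
theorem SwCorrect.sim_narrow {l : List (Comp 𝒜 X)} {Q : Linking 𝒜 X} {x : X} {C : Ctx 𝒜 X}
    (h : SwCorrect (C.fill (.tensBot (parOn l Q) x)) Γ)
    (hn : (C.fill (.tensBot (parOn l Q) x)).names.Nodup) :
    Sim Γ (C.fill (.tensBot (parOn l Q) x)) (C.fill (parOn l (.tensBot Q x))) := by
  induction l generalizing C with
  | nil => exact Sim.refl _ _
  | cons c l ih =>
    have hp : (C.fill (narrowLink c.link (parOn l Q) x)).names.Nodup :=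
      ((C.perm_leaves_fill (perm_leaves_parTens c.link (parOn l Q) x)).map Prod.snd).nodup_iff.2 hn
    have hs := h.sideCondition c.parFree_link hp (C.names_fill_nodup hp)
    refine (LinkStep.parTens C c.link (parOn l Q) x hs).sim.symm.trans ?_
    have h' := h.narrow
    have := ih (C := C.comp (.parR c.link .hole)) (by rw [Ctx.fill_comp]; exact h')
      (by rw [Ctx.fill_comp]; exact hp)
    rwa [Ctx.fill_comp, Ctx.fill_comp] at this

/-- The components `c :: l` make up the linking `P`. -/
structure Flat (P : Linking 𝒜 X) (l : List (Comp 𝒜 X)) (c : Comp 𝒜 X) : Prop where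
  lead : P.lead = c.lead
  leaves : P.leaves.Perm (l.flatMap (fun d => d.link.leaves) ++ c.link.leaves)
  wires : P.wires.Perm (l.flatMap (fun d => d.link.wires) ++ c.link.wires)

/-- Every correct linking is equivalent to a flat one. -/
theorem exists_flat (Γ : List (Item 𝒜 X)) (P : Linking 𝒜 X) : ∃ l c, Flat P l c ∧
    ∀ C : Ctx 𝒜 X, SwCorrect (C.fill P) Γ → (C.fill P).names.Nodup →
      Sim Γ (C.fill P) (C.fill (parOn l c.link)) := by
  have htens : ∀ (Q : Linking 𝒜 X) (x : X), (∃ l c, Flat Q l c ∧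
      ∀ C : Ctx 𝒜 X, SwCorrect (C.fill Q) Γ → (C.fill Q).names.Nodup →
        Sim Γ (C.fill Q) (C.fill (parOn l c.link))) →
      ∃ l c, Flat (.tensBot Q x) l c ∧
      ∀ C : Ctx 𝒜 X, SwCorrect (C.fill (.tensBot Q x)) Γ → (C.fill (.tensBot Q x)).names.Nodup →
        Sim Γ (C.fill (.tensBot Q x)) (C.fill (parOn l c.link)) := by
    rintro Q x ⟨l, ⟨k, B⟩, ⟨h₁, h₂, h₃⟩, h⟩
    have hfree := Comp.freeSim_botsOn (Γ := Γ) [x] k B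
    refine ⟨l, ⟨k, [x] + B⟩, ⟨h₁, ?_, ?_⟩, fun C hC hn => ?_⟩
    · have h4 : (Linking.tensBot Q x).leaves.Perm ((l.flatMap fun d => d.link.leaves) ++
          (botsOn [x] (Comp.link ⟨k, B⟩)).leaves) := by
        show (Q.leaves ++ [(Lit.bot, x)]).Perm (_ ++ ((Comp.link ⟨k, B⟩).leaves ++ [(Lit.bot, x)]))
        rw [← List.append_assoc]
        exact h₂.append_right _
      exact h4.trans ((hfree .hole).perm.append_left _)
    · refine List.Perm.trans ?_ ((Comp.wires_perm [x] k B).symm.append_left _)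
      show ((x, Q.lead) :: Q.wires).Perm _
      rw [h₁]
      exact (h₃.cons _).trans (List.perm_middle.symm)
    · have h5 := h (C.comp (.tensBot .hole x)) (by simpa [Ctx.fill] using hC)
        (by simpa [Ctx.fill] using hn)
      simp only [Ctx.fill_comp, Ctx.fill] at h5
      refine h5.trans (Sim.trans ?_ (hfree.parOn l C))
      refine SwCorrect.sim_narrow ((h5.swCorrect_iff hn).1 hC) ?_
      exact (h5.perm.map Prod.snd).nodup_iff.1 hn
  induction P with
  | one x => exact ⟨[], ⟨.one x, 0⟩, ⟨rfl, by simp [Comp.link, botsOn, Core.link],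
      by simp [Comp.link, botsOn, Core.link]⟩, fun C _ _ => by
        simpa [parOn, Comp.link, botsOn, Core.link] using Sim.refl _ _⟩
  | ax a x y =>
    refine ⟨[], ⟨.xa a y x, 0⟩, ⟨rfl, ?_, ?_⟩, fun C _ _ => ?_⟩
    · simp only [Comp.link, botsOn, Core.link, List.flatMap_nil, Multiset.toList_zero,
        List.foldr_nil, List.nil_append]
      exact List.perm_append_comm
    · simp [Comp.link, botsOn, Core.link, Linking.wires]
    · simpa [parOn, Comp.link, botsOn, Core.link] using FreeSim.axComm a x y C
  | xa a x y => exact ⟨[], ⟨.xa a x y, 0⟩, ⟨rfl, by simp [Comp.link, botsOn, Core.link],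
      by simp [Comp.link, botsOn, Core.link]⟩, fun C _ _ => by
        simpa [parOn, Comp.link, botsOn, Core.link] using Sim.refl _ _⟩
  | botTens x Q ih =>
    obtain ⟨l, c, ⟨h₁, h₂, h₃⟩, h⟩ := htens Q x ih
    refine ⟨l, c, ⟨h₁, ((FreeSim.botComm (Γ := Γ) Q x .hole).perm).trans h₂, h₃⟩, fun C hC hn => ?_⟩
    have := FreeSim.botComm (Γ := Γ) Q x C
    exact this.trans (h C ((this.swCorrect_iff hn).1 hC) ((this.perm.map Prod.snd).nodup_iff.1 hn))
  | tensBot Q x ih => exact htens Q x ih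
  | par Q R ih ih' =>
    obtain ⟨l, c, ⟨-, h₂, h₃⟩, h⟩ := ih
    obtain ⟨l', c', ⟨h₁', h₂', h₃'⟩, h'⟩ := ih'
    refine ⟨l ++ c :: l', c', ⟨h₁', ?_, ?_⟩, fun C hC hn => ?_⟩
    · simp only [List.flatMap_append, List.flatMap_cons, List.append_assoc]
      have := h₂.append h₂'
      simp only [List.append_assoc] at this
      exact this
    · simpa [Linking.wires] using h₃.append h₃'
    · have h4 := h (C.comp (.parL .hole R)) (by simpa [Ctx.fill] using hC)
        (by simpa [Ctx.fill] using hn)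
      simp only [Ctx.fill_comp, Ctx.fill] at h4
      have h5 := h' (C.comp (.parR (parOn l c.link) .hole))
        (by simpa [Ctx.fill] using (h4.swCorrect_iff hn).1 hC)
        (by rw [Ctx.fill_comp]; exact (h4.perm.map Prod.snd).nodup_iff.1 hn)
      simp only [Ctx.fill_comp, Ctx.fill] at h5
      refine h4.trans (h5.trans ((FreeSim.par_parOn _ _ _ C).trans ?_))
      have : parOn l (.par c.link (parOn l' c'.link)) = parOn (l ++ c :: l') c'.link := by
        simp [parOn]
      rw [this]
      exact Sim.refl _ _

end Flat


section Adjacency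

variable {𝒜 : Type u} {X : Type v} {Γ : List (Item 𝒜 X)}

theorem Core.pos_iff (k : Core 𝒜 X) {l : Lit 𝒜} {x : X} (h : (l, x) ∈ k.link.leaves) :
    (¬ l.IsNeg → x = k.link.lead) ∧ (l ≠ .bot) ∧ (l.IsNeg → (x, k.link.lead) ∈ k.link.wires) := by
  cases k with
  | one y =>
    obtain ⟨rfl, rfl⟩ : l = .one ∧ x = y := by
      simpa [Core.link, Linking.leaves, Linking.toTree, OTree.leaves] using h
    exact ⟨fun _ => rfl, by simp, by simp⟩
  | xa a y z =>
    have : (l = .neg a ∧ x = y) ∨ (l = .pos a ∧ x = z) := by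
      simpa [Core.link, Linking.leaves, Linking.toTree, OTree.leaves] using h
    rcases this with ⟨rfl, rfl⟩ | ⟨rfl, rfl⟩
    · exact ⟨by simp, by simp, fun _ => by simp [Core.link, Linking.wires, Linking.lead]⟩
    · exact ⟨fun _ => rfl, by simp, by simp⟩

theorem Core.wire_types (k : Core 𝒜 X) {n p : X} (h : (n, p) ∈ k.link.wires) :
    p = k.link.lead ∧ ∃ l, l ≠ .bot ∧ (l, n) ∈ k.link.leaves := by
  cases k with
  | one y => simp [Core.link, Linking.wires] at h
  | xa a y z =>
    obtain ⟨rfl, rfl⟩ : n = y ∧ p = z := by simpa [Core.link, Linking.wires] using h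
    exact ⟨rfl, .neg a, by simp, by simp [Core.link, Linking.leaves, Linking.toTree, OTree.leaves]⟩

theorem Comp.snd_eq_lead {c : Comp 𝒜 X} {n p : X} (h : (n, p) ∈ c.link.wires) : p = c.lead := by
  rcases Comp.mem_wires.1 h with h | h
  · exact h.2
  · exact (c.core.wire_types h).1

namespace Flat

variable {P : Linking 𝒜 X} {l : List (Comp 𝒜 X)} {c : Comp 𝒜 X}

theorem leaves' (h : Flat P l c) : P.leaves.Perm ((c :: l).flatMap fun d => d.link.leaves) := by
  rw [List.flatMap_cons]
  exact h.leaves.trans List.perm_append_comm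

theorem wires' (h : Flat P l c) : P.wires.Perm ((c :: l).flatMap fun d => d.link.wires) := by
  rw [List.flatMap_cons]
  exact h.wires.trans List.perm_append_comm

theorem mem_leaves (h : Flat P l c) {m : Lit 𝒜 × X} :
    m ∈ P.leaves ↔ ∃ d ∈ c :: l, m ∈ d.link.leaves := by
  rw [h.leaves'.mem_iff, List.mem_flatMap]

theorem mem_wires (h : Flat P l c) {m : X × X} :
    m ∈ P.wires ↔ ∃ d ∈ c :: l, m ∈ d.link.wires := by
  rw [h.wires'.mem_iff, List.mem_flatMap]

theorem pairwise (h : Flat P l c) (hn : P.names.Nodup) :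
    (∀ d ∈ c :: l, d.link.names.Nodup) ∧
      (c :: l).Pairwise fun d e => List.Disjoint d.link.names e.link.names := by
  have := (h.leaves'.map Prod.snd).nodup_iff.1 hn
  rw [List.map_flatMap, List.nodup_flatMap] at this
  exact this

theorem lead_mem_names (d : Comp 𝒜 X) : d.lead ∈ d.link.names := by
  obtain ⟨l, -, h⟩ := d.link.lead_mem
  rw [d.lead_link] at h
  exact List.mem_map.2 ⟨_, h, rfl⟩

theorem eq_of_lead (h : Flat P l c) (hn : P.names.Nodup) {d e : Comp 𝒜 X} (hd : d ∈ c :: l)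
    (he : e ∈ c :: l) (hde : d.lead = e.lead) : d = e := by
  by_contra hne
  have : Std.Symm fun d e : Comp 𝒜 X => List.Disjoint d.link.names e.link.names :=
    ⟨fun _ _ h => h.symm⟩
  refine (h.pairwise hn).2.forall hd he hne (lead_mem_names d) ?_
  rw [hde]
  exact lead_mem_names e

theorem nodup (h : Flat P l c) (hn : P.names.Nodup) : (c :: l).Nodup := by
  refine (h.pairwise hn).2.imp fun {d e} hde => ?_
  rintro rfl
  exact hde (lead_mem_names d) (lead_mem_names d)

theorem mem_bots (h : Flat P l c) (hn : P.names.Nodup) {d : Comp 𝒜 X} (hd : d ∈ c :: l) {n : X} :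
    n ∈ d.bots ↔ (n, d.lead) ∈ P.wires ∧ (Lit.bot, n) ∈ P.leaves := by
  constructor
  · intro hb
    exact ⟨h.mem_wires.2 ⟨d, hd, Comp.mem_wires.2 (Or.inl ⟨hb, rfl⟩)⟩,
      h.mem_leaves.2 ⟨d, hd, Comp.mem_leaves.2 (Or.inl ⟨rfl, hb⟩)⟩⟩
  · rintro ⟨hw, hb⟩
    obtain ⟨e, he, hw⟩ := h.mem_wires.1 hw
    obtain rfl := h.eq_of_lead hn hd he (Comp.snd_eq_lead hw)
    rcases Comp.mem_wires.1 hw with hw | hw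
    · exact hw.1
    · obtain ⟨-, m, hm, hm'⟩ := d.core.wire_types hw
      exact absurd (label_unique hn (h.mem_leaves.2 ⟨d, hd, Comp.mem_leaves.2 (Or.inr hm')⟩) hb) hm

theorem mem_core (h : Flat P l c) (hn : P.names.Nodup) {d : Comp 𝒜 X} (hd : d ∈ c :: l) {n : X} :
    (n, d.lead) ∈ d.core.link.wires ↔ (n, d.lead) ∈ P.wires ∧ (Lit.bot, n) ∉ P.leaves := by
  constructor
  · intro hb
    refine ⟨h.mem_wires.2 ⟨d, hd, Comp.mem_wires.2 (Or.inr hb)⟩, fun hbot => ?_⟩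
    obtain ⟨-, m, hm, hm'⟩ := d.core.wire_types hb
    exact hm (label_unique hn (h.mem_leaves.2 ⟨d, hd, Comp.mem_leaves.2 (Or.inr hm')⟩) hbot)
  · rintro ⟨hw, hb⟩
    obtain ⟨e, he, hw⟩ := h.mem_wires.1 hw
    obtain rfl := h.eq_of_lead hn hd he (Comp.snd_eq_lead hw)
    rcases Comp.mem_wires.1 hw with hw | hw
    · exact absurd (h.mem_leaves.2 ⟨d, hd, Comp.mem_leaves.2 (Or.inl ⟨rfl, hw.1⟩)⟩) hb
    · exact hw

theorem bots_nodup (h : Flat P l c) (hn : P.names.Nodup) {d : Comp 𝒜 X} (hd : d ∈ c :: l) :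
    d.bots.Nodup := by
  have h1 := (h.pairwise hn).1 d hd
  have h2 : ((d.link.leaves : Multiset (Lit 𝒜 × X)).map Prod.snd).Nodup := h1
  rw [Comp.coe_leaves, Multiset.map_add, Multiset.map_map] at h2
  simpa using (Multiset.nodup_add.1 h2).1

/-- A positive leaf belongs to the component of which it is the lead. -/
theorem exists_comp (h : Flat P l c) {m : Lit 𝒜} {p : X} (hm : ¬ m.IsNeg)
    (hp : (m, p) ∈ P.leaves) :
    ∃ d ∈ c :: l, d.lead = p ∧ (m, p) ∈ d.core.link.leaves := by
  obtain ⟨d, hd, h'⟩ := h.mem_leaves.1 hp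
  rcases Comp.mem_leaves.1 h' with ⟨rfl, -⟩ | h'
  · exact absurd trivial hm
  · exact ⟨d, hd, ((d.core.pos_iff h').1 hm).symm, h'⟩

theorem subset (h : Flat P l c) (hn : P.names.Nodup) {P' : Linking 𝒜 X} {l' : List (Comp 𝒜 X)}
    {c' : Comp 𝒜 X} (h' : Flat P' l' c') (hp : P.leaves.Perm P'.leaves)
    (hw : ∀ n p, (n, p) ∈ P.wires ↔ (n, p) ∈ P'.wires) {d : Comp 𝒜 X} (hd : d ∈ c :: l) :
    d ∈ c' :: l' := by
  have hn' : P'.names.Nodup := (hp.map Prod.snd).nodup_iff.1 hn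
  obtain ⟨m, hm, hdl⟩ := d.core.link.lead_mem
  obtain ⟨d', hd', hlead, hm'⟩ := h'.exists_comp hm
    (hp.mem_iff.1 (h.mem_leaves.2 ⟨d, hd, Comp.mem_leaves.2 (Or.inr hdl)⟩))
  have hlead : d'.lead = d.lead := hlead
  have hbots : d.bots = d'.bots := by
    rw [Multiset.Nodup.ext (h.bots_nodup hn hd) (h'.bots_nodup hn' hd')]
    intro n
    rw [h.mem_bots hn hd, h'.mem_bots hn' hd', hlead, hw, hp.mem_iff]
  have hcw : ∀ n, (n, d.lead) ∈ d.core.link.wires ↔ (n, d.lead) ∈ d'.core.link.wires := by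
    intro n
    have := h'.mem_core hn' hd' (n := n)
    rw [hlead] at this
    rw [h.mem_core hn hd, this, hw, hp.mem_iff]
  have : d = d' := by
    obtain ⟨k, B⟩ := d
    obtain ⟨k', B'⟩ := d'
    obtain rfl : B = B' := hbots
    clear hd hd'
    cases k with
    | one x =>
      obtain ⟨rfl⟩ : m = .one := by
        simpa [Core.link, Linking.leaves, Linking.toTree, OTree.leaves, Linking.lead] using hdl
      cases k' with
      | one y =>
        obtain rfl : y = x := hlead
        rfl
      | xa a y z => simp [Core.link, Linking.leaves, Linking.toTree, OTree.leaves] at hm'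
    | xa a x y =>
      have hma : (m = .neg a ∧ y = x) ∨ m = .pos a := by
        simpa [Core.link, Linking.leaves, Linking.toTree, OTree.leaves, Linking.lead] using hdl
      have hma : m = .pos a := by
        rcases hma with ⟨rfl, -⟩ | h
        · exact absurd trivial hm
        · exact h
      subst hma
      cases k' with
      | one y => simp [Core.link, Linking.leaves, Linking.toTree, OTree.leaves] at hm'
      | xa a' x' y' =>
        obtain rfl : y' = y := hlead
        have h1 := hcw x
        simp [Core.link, Linking.leaves, Linking.toTree, OTree.leaves, Linking.wires,
          Comp.lead, Linking.lead] at h1 hm'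
        obtain ⟨rfl, -⟩ := hm'
        rw [h1]
  rwa [this]

end Flat

/-- Correct linkings with the same wires are equivalent. -/
theorem sim_of_wires {P P' : Linking 𝒜 X} (hP : Valid P Γ) (hP' : Valid P' Γ)
    (hc : SwCorrect P Γ) (hc' : SwCorrect P' Γ)
    (hw : ∀ n p, (n, p) ∈ P.wires → (n, p) ∈ P'.wires) : Sim Γ P P' := by
  have hperm := hP.perm_leaves hP'
  have hw' := Linking.wires_iff_of_subset hP'.nodup hperm hw
  obtain ⟨l, c, h, hs⟩ := exists_flat Γ P
  obtain ⟨l', c', h', hs'⟩ := exists_flat Γ P'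
  refine (hs .hole hc hP.nodup).trans (Sim.trans ?_ (hs' .hole hc' hP'.nodup).symm)
  refine FreeSim.of_perm_comps (Γ := Γ) ?_ .hole
  rw [List.perm_ext_iff_of_nodup (h.nodup hP.nodup) (h'.nodup hP'.nodup)]
  exact fun d => ⟨fun hd => h.subset hP.nodup h' hperm hw' hd, fun hd => h'.subset hP'.nodup h
    hperm.symm (fun n p => (hw' n p).symm) hd⟩

/-- Correct linkings with adjacent wires are equivalent. -/
theorem Adjacent.sim {P P' : Linking 𝒜 X} (hA : Adjacent P P') (hP : Valid P Γ)
    (hP' : Valid P' Γ) (hc : SwCorrect P Γ) (hc' : SwCorrect P' Γ) : Sim Γ P P' := by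
  obtain ⟨q, q', hA⟩ := hA
  have hperm := hP.perm_leaves hP'
  by_cases hsub : ∀ n p, (n, p) ∈ P.wires → (n, p) ∈ P'.wires
  · exact sim_of_wires hP hP' hc hc' hsub
  push Not at hsub
  obtain ⟨n₀, p₀, hn₀, hn₀'⟩ := hsub
  obtain ⟨hb₀, rfl, hw₀⟩ := (hA _ _ hn₀).resolve_left hn₀'
  obtain ⟨l, c, h, hs⟩ := exists_flat Γ P
  have hqq : p₀ ≠ q' := by rintro rfl; exact hn₀' hw₀
  obtain ⟨-, mq, -, hmq, -, hmq', -⟩ := P.wires_types hn₀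
  obtain ⟨-, mq', -, hmq'', -, hmq''', -⟩ := P'.wires_types hw₀
  obtain ⟨d, hd, rfl, -⟩ := h.exists_comp hmq' hmq
  obtain ⟨e, he, rfl, -⟩ := h.exists_comp hmq''' (hperm.mem_iff.2 hmq'')
  have hde : e ≠ d := by rintro rfl; exact hqq rfl
  obtain ⟨L, hL⟩ : ∃ L, (c :: l).Perm (d :: L) := ⟨_, List.perm_cons_erase hd⟩
  have heL : e ∈ L := (List.mem_cons.1 (hL.mem_iff.1 he)).resolve_left hde
  obtain ⟨m, hm⟩ : ∃ m, L.Perm (e :: m) := ⟨_, List.perm_cons_erase heL⟩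
  have hall : (c :: l).Perm (d :: e :: m) := hL.trans (hm.cons d)
  set S := (d.bots.filter fun n => (n, e.lead) ∈ P'.wires).toList with hS
  set T := d.bots.filter fun n => ¬ (n, e.lead) ∈ P'.wires with hT
  have hST : d.bots = (S : Multiset X) + T := by
    rw [hS, hT, Multiset.coe_toList, Multiset.filter_add_not]
  let t : Comp 𝒜 X := ⟨d.core, T⟩
  have hd_eq : d = ⟨d.core, S + T⟩ := by rw [← hST]
  have hlt : t.lead = d.lead := rfl
  let E : X → List (X × X) := fun r =>
    m.flatMap (fun c => c.link.wires) ++ (star S r ++ (e.link.wires ++ t.link.wires))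
  have hdw : d.link.wires.Perm (star S d.lead ++ t.link.wires) := by
    have := Comp.wires_perm S d.core T
    rwa [← hd_eq] at this
  have hEq : (E d.lead).Perm P.wires := by
    have h1 := h.wires'.trans (hall.flatMap_right _)
    simp only [List.flatMap_cons] at h1
    refine List.Perm.trans ?_ (h1.trans (hdw.append_right _)).symm
    simp only [E, perm_iff_coe_eq, ← Multiset.coe_add]
    abel
  have hE' : ∀ n p, (n, p) ∈ E e.lead → (n, p) ∈ P'.wires := by
    have key : ∀ x : Comp 𝒜 X, x ∈ c :: l → x ≠ d → ∀ n p, (n, p) ∈ x.link.wires →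
        (n, p) ∈ P'.wires := by
      intro x hx hxd n p hnp
      rcases hA n p (h.mem_wires.2 ⟨x, hx, hnp⟩) with h1 | ⟨-, rfl, -⟩
      · exact h1
      · exact absurd (h.eq_of_lead hP.nodup hx hd (Comp.snd_eq_lead hnp).symm) hxd
    have hnd := (hall.nodup_iff).1 (h.nodup hP.nodup)
    intro n p hnp
    simp only [E, List.mem_append, List.mem_flatMap, mem_star] at hnp
    rcases hnp with ⟨x, hx, hnp⟩ | ⟨hn, rfl⟩ | hnp | hnp
    · refine key x (hall.mem_iff.2 (by simp [hx])) ?_ n p hnp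
      rintro rfl
      simp [hx] at hnd
    · rw [hS, Multiset.mem_toList, Multiset.mem_filter] at hn
      exact hn.2
    · exact key e he hde n p hnp
    · have hnp' : (n, p) ∈ d.link.wires := hdw.mem_iff.2 (List.mem_append_right _ hnp)
      rcases hA n p (h.mem_wires.2 ⟨d, hd, hnp'⟩) with h1 | ⟨hb, rfl, h2⟩
      · exact h1
      · rcases Comp.mem_wires.1 hnp with ⟨h3, -⟩ | h3
        · exact absurd h2 (Multiset.mem_filter.1 h3).2
        · exact absurd hb ((h.mem_core hP.nodup hd).1 h3).2
  have hfst : ((E e.lead).map Prod.fst).Perm (P'.wires.map Prod.fst) := by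
    have h1 : (E e.lead).map Prod.fst = (E d.lead).map Prod.fst := by
      simp [E, star, Function.comp_def]
    rw [h1]
    refine (hEq.map _).trans (P.perm_wires_fst.trans (List.Perm.trans ?_ P'.perm_wires_fst.symm))
    exact (hperm.filter _).map _
  have hEq' : (E e.lead).Perm P'.wires := by
    refine (List.subperm_of_subset ?_ fun x hx => hE' x.1 x.2 hx).perm_of_length_le ?_
    · exact List.Nodup.of_map _ (hfst.nodup_iff.2 (Linking.wires_fst_nodup hP'.nodup))
    · simpa using hfst.length_eq.ge
  let W := parOn m (botsOn S (.par e.link t.link))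
  let W' := parOn m (botsOn S (.par t.link e.link))
  have hWW : Sim Γ W W' := ((FreeSim.parComm _ _).botsOn S).parOn m .hole
  have hWl : P.leaves.Perm W.leaves := by
    have h1 := h.leaves'.trans (hall.flatMap_right _)
    refine h1.trans ?_
    have h2 := Comp.coe_leaves d
    rw [hST] at h2
    have h3 := Comp.coe_leaves t
    simp only [List.flatMap_cons, W, perm_iff_coe_eq, leaves_parOn, ← Multiset.coe_add,
      coe_leaves_botsOn]
    have h4 : ((Linking.par e.link t.link).leaves : Multiset (Lit 𝒜 × X)) =
        e.link.leaves + t.link.leaves := rfl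
    rw [h2, h4, h3, Multiset.map_add, Multiset.map_coe]
    abel
  have hWv : Valid W Γ := hP.of_perm hWl
  have hWv' : Valid W' Γ := hWv.of_perm hWW.perm
  have hWw : W.wires = E d.lead := by
    simp only [W, wires_parOn, wires_botsOn, E, Linking.wires]
    rw [← hlt, ← t.lead_link]; rfl
  have hWw' : W'.wires.Perm (E e.lead) := by
    simp only [W', wires_parOn, wires_botsOn, E, Linking.wires, Linking.lead, e.lead_link]
    simp only [perm_iff_coe_eq, ← Multiset.coe_add]
    abel
  have hWc : SwCorrect W Γ := by
    have hV : W.names.toFinset = P.names.toFinset :=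
      List.toFinset_eq_of_perm _ _ (hWl.map _).symm
    have hV' : P'.names.toFinset = P.names.toFinset :=
      List.toFinset_eq_of_perm _ _ (hperm.map _).symm
    intro r E₀ F hE hF
    rw [hV]
    obtain ⟨r', E₁, h1, rfl⟩ := sw_parOn hE
    obtain ⟨E₂, ⟨r₁, E₃, r₂, E₄, h3, h4, hr, rfl⟩, rfl⟩ := sw_botsOn h1
    obtain ⟨rfl, rfl⟩ := Comp.sw_link h3
    obtain ⟨rfl, rfl⟩ := Comp.sw_link h4
    rcases hr with rfl | rfl
    · have := hc' _ _ F P'.sw_wires hF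
      rw [hV'] at this
      exact this.perm (hEq'.symm.append_right F)
    · exact (hc _ _ F P.sw_wires hF).perm (hEq.symm.append_right F)
  have hWc' : SwCorrect W' Γ := (hWW.swCorrect_iff hWv.nodup).1 hWc
  refine (sim_of_wires hP hWv hc hWc fun n p hnp => ?_).trans
    (hWW.trans (sim_of_wires hWv' hP' hWc' hc' fun n p hnp => ?_))
  · rw [hWw]; exact hEq.mem_iff.2 hnp
  · exact hE' n p (hWw'.mem_iff.1 hnp)

end Adjacency


section Cuts

variable {𝒜 : Type u} {X : Type v} {Γ : List (Item 𝒜 X)}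

theorem OTree.Sw.mem {t : OTree 𝒜 X} {r : X} {E : List (X × X)} (h : t.Sw r E) :
    r ∈ t.leaves.map Prod.snd ∧
      ∀ a b, (a, b) ∈ E → a ∈ t.leaves.map Prod.snd ∧ b ∈ t.leaves.map Prod.snd := by
  induction t generalizing r E with
  | leaf l x => obtain ⟨rfl, rfl⟩ := h; simp [OTree.leaves]
  | tens s t ih ih' =>
    obtain ⟨E₁, r₂, E₂, h₁, h₂, rfl⟩ := h
    obtain ⟨h1, h2⟩ := ih h₁
    obtain ⟨h3, h4⟩ := ih' h₂
    simp only [OTree.leaves, List.map_append, List.mem_append, List.mem_cons, Prod.mk.injEq]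
    refine ⟨Or.inl h1, ?_⟩
    rintro a b (⟨rfl, rfl⟩ | hab | hab)
    · exact ⟨Or.inl h1, Or.inr h3⟩
    · exact ⟨Or.inl (h2 _ _ hab).1, Or.inl (h2 _ _ hab).2⟩
    · exact ⟨Or.inr (h4 _ _ hab).1, Or.inr (h4 _ _ hab).2⟩
  | par s t ih ih' =>
    obtain ⟨r₁, E₁, r₂, E₂, h₁, h₂, hr, rfl⟩ := h
    obtain ⟨h1, h2⟩ := ih h₁
    obtain ⟨h3, h4⟩ := ih' h₂
    simp only [OTree.leaves, List.map_append, List.mem_append]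
    refine ⟨?_, ?_⟩
    · rcases hr with rfl | rfl
      · exact Or.inl h1
      · exact Or.inr h3
    · rintro a b (hab | hab)
      · exact ⟨Or.inl (h2 _ _ hab).1, Or.inl (h2 _ _ hab).2⟩
      · exact ⟨Or.inr (h4 _ _ hab).1, Or.inr (h4 _ _ hab).2⟩

theorem Forest.Sw.mem {F : List (OTree 𝒜 X)} {E : List (X × X)} (h : Forest.Sw F E) (a b : X)
    (hab : (a, b) ∈ E) :
    a ∈ (Forest.leaves F).map Prod.snd ∧ b ∈ (Forest.leaves F).map Prod.snd := by
  induction F generalizing E with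
  | nil => rw [show E = [] from h] at hab; simp at hab
  | cons t F ih =>
    obtain ⟨r, E₁, E₂, h₁, h₂, rfl⟩ := h
    simp only [Forest.leaves, List.flatMap_cons, List.map_append, List.mem_append]
    rcases List.mem_append.1 hab with hab | hab
    · exact ⟨Or.inl (h₁.mem.2 _ _ hab).1, Or.inl (h₁.mem.2 _ _ hab).2⟩
    · exact ⟨Or.inr (ih h₂ hab).1, Or.inr (ih h₂ hab).2⟩

theorem Linking.Sw.mem {P : Linking 𝒜 X} {r : X} {E : List (X × X)} (h : P.Sw r E) (a b : X)
    (hab : (a, b) ∈ E) : a ∈ P.names ∧ b ∈ P.names := by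
  induction P generalizing r E with
  | one x => obtain ⟨rfl, rfl⟩ := h; simp at hab
  | ax _ x y =>
    obtain ⟨rfl, rfl⟩ := h
    simp at hab
    simp [Linking.names, Linking.toTree, OTree.leaves, hab]
  | xa _ x y =>
    obtain ⟨rfl, rfl⟩ := h
    simp at hab
    simp [Linking.names, Linking.toTree, OTree.leaves, hab]
  | botTens x Q ih =>
    obtain ⟨E', h', rfl⟩ := h
    simp only [Linking.names, Linking.toTree, OTree.leaves, List.map_append, List.mem_append]
    rcases List.mem_cons.1 hab with hab | hab
    · obtain ⟨rfl, rfl⟩ := Prod.mk.inj hab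
      exact ⟨Or.inl (by simp), Or.inr h'.root_mem⟩
    · exact ⟨Or.inr (ih h' hab).1, Or.inr (ih h' hab).2⟩
  | tensBot Q x ih =>
    obtain ⟨E', h', rfl⟩ := h
    simp only [Linking.names, Linking.toTree, OTree.leaves, List.map_append, List.mem_append]
    rcases List.mem_cons.1 hab with hab | hab
    · obtain ⟨rfl, rfl⟩ := Prod.mk.inj hab
      exact ⟨Or.inr (by simp), Or.inl h'.root_mem⟩
    · exact ⟨Or.inl (ih h' hab).1, Or.inl (ih h' hab).2⟩
  | par Q R ih ih' =>
    obtain ⟨r₁, E₁, r₂, E₂, h₁, h₂, -, rfl⟩ := h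
    simp only [Linking.names, Linking.toTree, OTree.leaves, List.map_append, List.mem_append]
    rcases List.mem_append.1 hab with hab | hab
    · exact ⟨Or.inl (ih h₁ hab).1, Or.inl (ih h₁ hab).2⟩
    · exact ⟨Or.inr (ih' h₂ hab).1, Or.inr (ih' h₂ hab).2⟩

/-- The leaves of a context. -/
def Ctx.leaves : Ctx 𝒜 X → List (Lit 𝒜 × X)
  | .hole => []
  | .botTens x C => (Lit.bot, x) :: leaves C
  | .tensBot C x => (Lit.bot, x) :: leaves C
  | .parL C R => leaves C ++ R.leaves
  | .parR R C => leaves C ++ R.leaves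

theorem Ctx.leaves_fill (C : Ctx 𝒜 X) (Q : Linking 𝒜 X) :
    (C.fill Q).leaves.Perm (Q.leaves ++ C.leaves) := by
  induction C with
  | hole => simp [Ctx.fill, Ctx.leaves]
  | botTens x C ih =>
    show ((Lit.bot, x) :: (C.fill Q).leaves).Perm (Q.leaves ++ (Lit.bot, x) :: C.leaves)
    exact (ih.cons _).trans List.perm_middle.symm
  | tensBot C x ih =>
    show ((C.fill Q).leaves ++ [(Lit.bot, x)]).Perm (Q.leaves ++ (Lit.bot, x) :: C.leaves)
    exact (List.perm_append_singleton _ _).trans ((ih.cons _).trans List.perm_middle.symm)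
  | parL C R ih =>
    show ((C.fill Q).leaves ++ R.leaves).Perm (Q.leaves ++ (C.leaves ++ R.leaves))
    rw [← List.append_assoc]
    exact ih.append_right _
  | parR R C ih =>
    show (R.leaves ++ (C.fill Q).leaves).Perm (Q.leaves ++ (C.leaves ++ R.leaves))
    rw [← List.append_assoc]
    exact List.perm_append_comm.trans (ih.append_right _)

theorem Ctx.Sw.mem {C : Ctx 𝒜 X} {o : Option X} {S : List X} {A : List (X × X)}
    (h : C.Sw o S A) : (∀ r, o = some r → r ∈ C.leaves.map Prod.snd) ∧
      (∀ x ∈ S, x ∈ C.leaves.map Prod.snd) ∧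
      ∀ a b, (a, b) ∈ A → a ∈ C.leaves.map Prod.snd ∧ b ∈ C.leaves.map Prod.snd := by
  have bot : ∀ (x : X) (C : Ctx 𝒜 X) o S A, (∀ o S A, C.Sw o S A →
      (∀ r, o = some r → r ∈ C.leaves.map Prod.snd) ∧ (∀ x ∈ S, x ∈ C.leaves.map Prod.snd) ∧
      ∀ a b, (a, b) ∈ A → a ∈ C.leaves.map Prod.snd ∧ b ∈ C.leaves.map Prod.snd) →
      (Ctx.botTens x C).Sw o S A →
      (∀ r, o = some r → r ∈ (Ctx.botTens x C).leaves.map Prod.snd) ∧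
      (∀ y ∈ S, y ∈ (Ctx.botTens x C).leaves.map Prod.snd) ∧
      ∀ a b, (a, b) ∈ A → a ∈ (Ctx.botTens x C).leaves.map Prod.snd ∧
        b ∈ (Ctx.botTens x C).leaves.map Prod.snd := by
    rintro x C o S A ih ⟨S', A', h, ⟨rfl, rfl, rfl⟩ | ⟨r, rfl, rfl, rfl⟩⟩
    · obtain ⟨h1, h2, h3⟩ := ih _ _ _ h
      simp only [Ctx.leaves, List.map_cons, List.mem_cons]
      refine ⟨fun r hr => Or.inr (h1 r hr), ?_, fun a b hab => ⟨Or.inr (h3 a b hab).1,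
        Or.inr (h3 a b hab).2⟩⟩
      rintro y (rfl | hy)
      · exact Or.inl rfl
      · exact Or.inr (h2 y hy)
    · obtain ⟨h1, h2, h3⟩ := ih _ _ _ h
      simp only [Ctx.leaves, List.map_cons, List.mem_cons]
      refine ⟨fun r hr => Or.inr (h1 r hr), fun y hy => Or.inr (h2 y hy), fun a b hab => ?_⟩
      rcases hab with hab | hab
      · obtain ⟨rfl, rfl⟩ := Prod.mk.inj hab
        exact ⟨Or.inl rfl, Or.inr (h1 _ rfl)⟩
      · exact ⟨Or.inr (h3 a b hab).1, Or.inr (h3 a b hab).2⟩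
  induction C generalizing o S A with
  | hole => obtain ⟨rfl, rfl, rfl⟩ := h; simp
  | botTens x C ih => exact bot x C o S A (fun _ _ _ => ih) h
  | tensBot C x ih => exact bot x C o S A (fun _ _ _ => ih) h
  | parL C R ih =>
    obtain ⟨o', A', r, E, h, hR, ho, rfl⟩ := h
    obtain ⟨h1, h2, h3⟩ := ih h
    simp only [Ctx.leaves, List.map_append, List.mem_append]
    refine ⟨?_, fun y hy => Or.inl (h2 y hy), ?_⟩
    · rintro s rfl
      rcases ho with rfl | ho
      · exact Or.inl (h1 s rfl)
      · cases ho; exact Or.inr hR.root_mem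
    · rintro a b (hab | hab)
      · exact ⟨Or.inl (h3 a b hab).1, Or.inl (h3 a b hab).2⟩
      · exact ⟨Or.inr (hR.mem a b hab).1, Or.inr (hR.mem a b hab).2⟩
  | parR R C ih =>
    obtain ⟨o', A', r, E, h, hR, ho, rfl⟩ := h
    obtain ⟨h1, h2, h3⟩ := ih h
    simp only [Ctx.leaves, List.map_append, List.mem_append]
    refine ⟨?_, fun y hy => Or.inl (h2 y hy), ?_⟩
    · rintro s rfl
      rcases ho with rfl | ho
      · exact Or.inl (h1 s rfl)
      · cases ho; exact Or.inr hR.root_mem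
    · rintro a b (hab | hab)
      · exact ⟨Or.inr (hR.mem a b hab).1, Or.inr (hR.mem a b hab).2⟩
      · exact ⟨Or.inl (h3 a b hab).1, Or.inl (h3 a b hab).2⟩

theorem Forest.sw_of_sw_middle {F G : List (OTree 𝒜 X)} {t : OTree 𝒜 X} {E : List (X × X)}
    (h : Forest.Sw (F ++ t :: G) E) :
    ∃ r E₁ E₂, t.Sw r E₁ ∧ Forest.Sw (F ++ G) E₂ ∧ E.Perm (E₁ ++ E₂) := by
  induction F generalizing E with
  | nil =>
    obtain ⟨r, E₁, E₂, h₁, h₂, rfl⟩ := h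
    exact ⟨r, E₁, E₂, h₁, h₂, List.Perm.refl _⟩
  | cons s F ih =>
    obtain ⟨r, E₁, E₂, h₁, h₂, rfl⟩ := h
    obtain ⟨r', E₃, E₄, h₃, h₄, hp⟩ := ih h₂
    refine ⟨r', E₃, E₁ ++ E₄, h₃, ⟨r, E₁, E₄, h₁, h₄, rfl⟩, (hp.append_left _).trans ?_⟩
    simp only [perm_iff_coe_eq, ← Multiset.coe_add]
    abel

theorem Forest.exists_sw_middle {F G : List (OTree 𝒜 X)} {t : OTree 𝒜 X} {r : X}
    {E₁ E₂ : List (X × X)} (h₁ : t.Sw r E₁) (h₂ : Forest.Sw (F ++ G) E₂) :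
    ∃ E, Forest.Sw (F ++ t :: G) E ∧ E.Perm (E₁ ++ E₂) := by
  induction F generalizing E₂ with
  | nil => exact ⟨_, ⟨r, E₁, E₂, h₁, h₂, rfl⟩, List.Perm.refl _⟩
  | cons s F ih =>
    obtain ⟨r', E₃, E₄, h₃, h₄, rfl⟩ := h₂
    obtain ⟨E, hE, hp⟩ := ih h₄
    refine ⟨_, ⟨r', E₃, E, h₃, hE, rfl⟩, (hp.append_left _).trans ?_⟩
    simp only [perm_iff_coe_eq, ← Multiset.coe_add]
    abel

theorem TreeOn.swap {V : Finset X} {a b : X} {E : List (X × X)} (h : TreeOn V ((a, b) :: E)) :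
    TreeOn V ((b, a) :: E) := by
  refine h.of_le (fun x y hxy => ?_) (by simp)
  rcases List.mem_cons.1 hxy with hxy | hxy
  · obtain ⟨rfl, rfl⟩ := Prod.mk.inj hxy
    exact (Conn.of_mem List.mem_cons_self).symm
  · exact Conn.of_mem (List.mem_cons_of_mem _ hxy)

/-- Correctness of a graph with a distinguished cut. -/
theorem swCorrect_cut_iff {P : Linking 𝒜 X} {Γ Δ : List (Item 𝒜 X)} {c : Item 𝒜 X}
    {s t : OTree 𝒜 X} (hc : c.IsCut s t) : SwCorrect P (Γ ++ c :: Δ) ↔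
      ∀ r E p S q T F, P.Sw r E → s.Sw p S → t.Sw q T →
        Forest.Sw ((Γ ++ Δ).map Item.toTree) F →
        TreeOn P.names.toFinset ((p, q) :: (E ++ (S ++ (T ++ F)))) := by
  have hp1 : ∀ p q : X, ∀ E S T F : List (X × X),
      (E ++ ((p, q) :: (S ++ T) ++ F)).Perm ((p, q) :: (E ++ (S ++ (T ++ F)))) := by
    intro p q E S T F
    simp only [perm_iff_coe_eq, ← Multiset.coe_add, ← Multiset.cons_coe, ← Multiset.singleton_add]
    abel
  have hp2 : ∀ p q : X, ∀ E S T F : List (X × X),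
      (E ++ ((p, q) :: (S ++ T) ++ F)).Perm ((p, q) :: (E ++ (T ++ (S ++ F)))) := by
    intro p q E S T F
    simp only [perm_iff_coe_eq, ← Multiset.coe_add, ← Multiset.cons_coe, ← Multiset.singleton_add]
    abel
  constructor
  · intro h r E p S q T F hP hs ht hF
    rw [List.map_append] at hF
    rcases hc with rfl | rfl
    · obtain ⟨F', hF', hp⟩ := Forest.exists_sw_middle (t := .tens s t)
        ⟨S, q, T, hs, ht, rfl⟩ hF
      refine (h r E F' hP (by simpa [Item.toTree] using hF')).perm ?_
      exact (hp.append_left _).trans (hp1 _ _ _ _ _ _)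
    · obtain ⟨F', hF', hp⟩ := Forest.exists_sw_middle (t := .tens t s)
        ⟨T, p, S, ht, hs, rfl⟩ hF
      refine TreeOn.swap ((h r E F' hP (by simpa [Item.toTree] using hF')).perm ?_)
      exact (hp.append_left _).trans (hp2 _ _ _ _ _ _)
  · intro h r E F' hP hF'
    rw [List.map_append, List.map_cons] at hF'
    obtain ⟨p, S', F, hs, hF, hp⟩ := Forest.sw_of_sw_middle hF'
    rw [← List.map_append] at hF
    rcases hc with rfl | rfl
    · obtain ⟨S, q, T, hs, ht, rfl⟩ := hs
      exact (h r E p S q T F hP hs ht hF).perm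
        ((hp1 _ _ _ _ _ _).symm.trans (hp.append_left E).symm)
    · obtain ⟨T, q, S, ht, hs, rfl⟩ := hs
      exact (h r E q S p T F hP hs ht hF).swap.perm
        ((hp2 _ _ _ _ _ _).symm.trans (hp.append_left E).symm)

/-- Contracting a path `u - v - q` in a tree. -/
theorem TreeOn.splice {V : Finset X} {S : List X} {u v q : X} {B : List (X × X)}
    (h : TreeOn V ((u, v) :: (v, q) :: (star S u ++ B))) (hu : u ∈ V) (hv : v ∈ V) (huv : u ≠ v)
    (hq : q ≠ u ∧ q ≠ v) (hS : ∀ s ∈ S, s ≠ u ∧ s ≠ v)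
    (hB : ∀ a b, (a, b) ∈ B → (a ≠ u ∧ a ≠ v) ∧ (b ≠ u ∧ b ≠ v)) :
    TreeOn ((V.erase u).erase v) (star S q ++ B) := by
  let f : X → X := fun x => if x = u ∨ x = v then q else x
  have hf : ∀ x, x ≠ u ∧ x ≠ v → f x = x := fun x hx => by simp [f, hx.1, hx.2]
  have hfu : f u = q := by simp [f]
  have hfv : f v = q := by simp [f]
  refine ⟨fun x hx y hy => ?_, ?_⟩
  · simp only [Finset.mem_erase] at hx hy
    rw [← hf x ⟨hx.2.1, hx.1⟩, ← hf y ⟨hy.2.1, hy.1⟩]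
    refine Conn.lift f (fun a b hab => ?_) (h.1 x hx.2.2 y hy.2.2)
    simp only [List.mem_cons, List.mem_append, mem_star, Prod.mk.injEq] at hab
    rcases hab with ⟨rfl, rfl⟩ | ⟨rfl, rfl⟩ | ⟨ha, rfl⟩ | hab
    · rw [hfu, hfv]; exact Conn.refl _ _
    · rw [hfv, hf _ hq]; exact Conn.refl _ _
    · rw [hfu, hf _ (hS a ha)]; exact Conn.of_mem (by simp [ha])
    · rw [hf _ (hB a b hab).1, hf _ (hB a b hab).2]
      exact Conn.of_mem (List.mem_append_right _ hab)
  · have h2 := h.2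
    have h3 := Finset.card_erase_of_mem hu
    have h4 := Finset.card_erase_of_mem (Finset.mem_erase.2 ⟨huv.symm, hv⟩)
    simp only [List.length_cons, List.length_append, length_star] at h2 ⊢
    omega

/-- The exchange of edges in the reduction of a compound cut. -/
theorem TreeOn.cut_exchange {V : Finset X} {p q p' q' : X} {B : List (X × X)}
    (h : TreeOn V ((p, q') :: (q', p') :: B)) (h' : TreeOn V ((q, q') :: (q', p') :: B))
    (hp : p ∈ V) (hq : q ∈ V) : TreeOn V ((p, p') :: (q, q') :: B) := by
  have h1 : Conn ((q', p') :: B) p q :=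
    conn_of_treeOn_star (S := [q']) (V := V) (B := (q', p') :: B) h.swap h'.swap hp hq
  have hnot := h.not_conn
  have h2 : Conn B p q := by
    have hmono : ∀ x y, Conn B x y → Conn ((q', p') :: B) x y := fun x y hxy =>
      hxy.mono (List.subset_cons_self _ _)
    rcases conn_star_append (S := [q']) (x := p') (B := B) h1 with h3 | ⟨h3 | ⟨s, hs, h3⟩, -⟩
    · exact h3
    · exact absurd ((hmono _ _ h3).trans (Conn.of_mem List.mem_cons_self).symm) hnot
    · obtain rfl := List.mem_singleton.1 hs
      exact absurd (hmono _ _ h3) hnot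
  have h3 : TreeOn V ((p, p') :: (q', p') :: B) :=
    h.exchange (Conn.of_mem List.mem_cons_self)
  have h4 : TreeOn V ((q', q) :: (p, p') :: B) :=
    (h3.perm (List.Perm.swap _ _ _)).exchange
      ((Conn.of_mem List.mem_cons_self).symm.trans (h2.mono (List.subset_cons_self _ _)))
  exact h4.swap.perm (List.Perm.swap _ _ _)

end Cuts


section CutSteps

variable {𝒜 : Type u} {X : Type v} {Γ : List (Item 𝒜 X)}

@[simp] theorem Lit.dual_dual (l : Lit 𝒜) : l.dual.dual = l := by cases l <;> rfl

@[simp] theorem Formula.neg_neg (A : Formula 𝒜) : A.neg.neg = A := by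
  induction A with
  | lit l => simp [Formula.neg]
  | tens A B ih ih' => simp [Formula.neg, ih, ih']
  | par A B ih ih' => simp [Formula.neg, ih, ih']

theorem Lit.isNeg_dual (l : Lit 𝒜) : l.dual.IsNeg ↔ ¬ l.IsNeg := by
  cases l <;> simp [Lit.dual]

/-- The leaves of a sequent. -/
def seqLeaves (Γ : List (Item 𝒜 X)) : List (Lit 𝒜 × X) :=
  Γ.flatMap fun i => i.toTree.leaves

theorem forest_leaves_map (Γ : List (Item 𝒜 X)) :
    Forest.leaves (Γ.map Item.toTree) = seqLeaves Γ := by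
  rw [Forest.leaves, seqLeaves, List.flatMap_map]

theorem seqLeaves_append (Γ Δ : List (Item 𝒜 X)) :
    seqLeaves (Γ ++ Δ) = seqLeaves Γ ++ seqLeaves Δ :=
  List.flatMap_append

theorem seqLeaves_cons (i : Item 𝒜 X) (Δ : List (Item 𝒜 X)) :
    seqLeaves (i :: Δ) = i.toTree.leaves ++ seqLeaves Δ :=
  List.flatMap_cons

theorem seqLeaves_middle (Γ : List (Item 𝒜 X)) (c : Item 𝒜 X) (Δ : List (Item 𝒜 X)) :
    (seqLeaves (Γ ++ c :: Δ)).Perm (c.toTree.leaves ++ seqLeaves (Γ ++ Δ)) := by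
  simp only [seqLeaves_append, seqLeaves_cons, perm_iff_coe_eq, ← Multiset.coe_add]
  abel

theorem Valid.seq_perm {P : Linking 𝒜 X} (h : Valid P Γ) : P.leaves.Perm (seqLeaves Γ) := by
  rw [← forest_leaves_map]
  exact h.perm

theorem Valid.seq_nodup {P : Linking 𝒜 X} (h : Valid P Γ) :
    ((seqLeaves Γ).map Prod.snd).Nodup :=
  (h.seq_perm.map Prod.snd).nodup_iff.1 h.nodup

theorem Item.IsCut.perm_leaves {c : Item 𝒜 X} {s t : OTree 𝒜 X} (hc : c.IsCut s t) :
    c.toTree.leaves.Perm (s.leaves ++ t.leaves) := by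
  rcases hc with rfl | rfl
  · exact List.Perm.refl _
  · exact List.perm_append_comm

theorem Item.IsCut.wellFormed {c : Item 𝒜 X} {s t : OTree 𝒜 X} (hc : c.IsCut s t)
    (h : c.WellFormed) : t.erase = s.erase.neg := by
  rcases hc with rfl | rfl
  · exact h
  · rw [show s.erase = t.erase.neg from h, Formula.neg_neg]

/-- Removing a cut between two leaves from a pre-proof graph. -/
theorem Valid.remove_cut {P P' : Linking 𝒜 X} {Γ Δ : List (Item 𝒜 X)} {c : Item 𝒜 X}
    {l m : Lit 𝒜} {x y : X} (hv : Valid P (Γ ++ c :: Δ)) (hc : c.IsCut (.leaf l x) (.leaf m y))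
    (hp : P.leaves.Perm ((l, x) :: (m, y) :: P'.leaves)) :
    Valid P' (Γ ++ Δ) ∧ (x ≠ y ∧ (∀ z ∈ P'.names, z ≠ x ∧ z ≠ y)) ∧
      P'.names.toFinset = (P.names.toFinset.erase x).erase y := by
  have hn : (x :: y :: P'.names).Nodup := (hp.map Prod.snd).nodup_iff.1 hv.nodup
  have hn' := List.nodup_cons.1 hn
  have hn'' := List.nodup_cons.1 hn'.2
  have hav : ∀ z ∈ P'.names, z ≠ x ∧ z ≠ y := by
    intro z hz
    constructor
    · rintro rfl; exact hn'.1 (List.mem_cons_of_mem _ hz)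
    · rintro rfl; exact hn''.1 hz
  refine ⟨⟨fun i hi => hv.wellFormed i ?_, hn''.2, ?_⟩, ⟨?_, hav⟩, ?_⟩
  · simp only [List.mem_append, List.mem_cons] at hi ⊢; tauto
  · rw [forest_leaves_map]
    have h1 := hp.symm.trans (hv.seq_perm.trans ((seqLeaves_middle Γ c Δ).trans
      (hc.perm_leaves.append_right _)))
    exact (List.perm_cons _).1 ((List.perm_cons _).1 h1)
  · rintro rfl; exact hn'.1 List.mem_cons_self
  · have h2 : P.names.toFinset = (x :: y :: P'.names).toFinset :=
      List.toFinset_eq_of_perm _ _ (hp.map Prod.snd)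
    rw [h2]
    ext z
    simp only [List.toFinset_cons, Finset.mem_erase, Finset.mem_insert, List.mem_toFinset]
    constructor
    · exact fun hz => ⟨(hav z hz).2, (hav z hz).1, Or.inr (Or.inr hz)⟩
    · tauto

theorem leaves_atom (C : Ctx 𝒜 X) (a : 𝒜) (h i j k : X) :
    (C.fill (.par (.xa a h i) (.xa a j k))).leaves.Perm
      ((Lit.pos a, i) :: (Lit.neg a, j) :: (C.fill (.xa a h k)).leaves) := by
  refine (C.leaves_fill _).trans (List.Perm.trans ?_ (((C.leaves_fill _).symm.cons _).cons _))
  simp only [Linking.leaves, Linking.toTree, OTree.leaves, List.cons_append, List.nil_append,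
    perm_iff_coe_eq, ← Multiset.cons_coe, ← Multiset.singleton_add]
  abel

theorem leaves_unit (C : Ctx 𝒜 X) (Q : Linking 𝒜 X) (i j : X) :
    (C.fill (.par (.tensBot Q i) (.one j))).leaves.Perm
      ((Lit.bot, i) :: (Lit.one, j) :: (C.fill Q).leaves) := by
  refine (C.leaves_fill _).trans (List.Perm.trans ?_ (((C.leaves_fill _).symm.cons _).cons _))
  simp only [Linking.leaves, Linking.toTree, OTree.leaves, List.append_assoc, List.cons_append,
    List.nil_append, perm_iff_coe_eq, ← Multiset.coe_add, ← Multiset.cons_coe,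
    ← Multiset.singleton_add]
  abel

theorem binary_erase {i : Item 𝒜 X} {s t s' t' : OTree 𝒜 X}
    (hi : i.IsCut (.par s t) (.tens t' s')) (hw : i.WellFormed) :
    s'.erase = s.erase.neg ∧ t'.erase = t.erase.neg := by
  have := hi.wellFormed hw
  simp only [OTree.erase, Formula.neg, Formula.tens.injEq] at this
  exact this.symm

theorem CutStep.valid {P P' : Linking 𝒜 X} {Γ Γ' : List (Item 𝒜 X)} (h : CutStep P Γ P' Γ')
    (hv : Valid P Γ) : Valid P' Γ' := by
  cases h with
  | binary _ Γ Δ i s t s' t' hi =>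
    obtain ⟨h1, h2⟩ := binary_erase hi (hv.wellFormed i (by simp))
    refine ⟨fun j hj => ?_, hv.nodup, ?_⟩
    · simp only [List.mem_append, List.mem_cons] at hj
      rcases hj with hj | rfl | rfl | hj
      · exact hv.wellFormed j (by simp [hj])
      · exact h1
      · exact h2
      · exact hv.wellFormed j (by simp [hj])
    · rw [forest_leaves_map]
      refine hv.seq_perm.trans ((seqLeaves_middle Γ i Δ).trans
        ((hi.perm_leaves.append_right _).trans ?_))
      simp only [seqLeaves_append, seqLeaves_cons, Item.toTree, OTree.leaves, perm_iff_coe_eq,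
        ← Multiset.coe_add]
      abel
  | atom C Γ Δ c a h i j k hc => exact (hv.remove_cut hc (leaves_atom C a h i j k)).1
  | unit C Q Γ Δ c i j hc => exact (hv.remove_cut hc (leaves_unit C Q i j)).1

theorem Forest.Sw.mem_seq {F : List (X × X)} (h : Forest.Sw (Γ.map Item.toTree) F) (a b : X)
    (hab : (a, b) ∈ F) :
    a ∈ (seqLeaves Γ).map Prod.snd ∧ b ∈ (seqLeaves Γ).map Prod.snd := by
  rw [← forest_leaves_map]
  exact h.mem a b hab

theorem Valid.mem_names {P : Linking 𝒜 X} (h : Valid P Γ) {x : X} :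
    x ∈ P.names ↔ x ∈ (seqLeaves Γ).map Prod.snd :=
  (h.seq_perm.map Prod.snd).mem_iff

theorem Ctx.mem_names_fill_iff (C : Ctx 𝒜 X) (Q : Linking 𝒜 X) {x : X} :
    x ∈ (C.fill Q).names ↔ x ∈ Q.names ∨ x ∈ C.leaves.map Prod.snd := by
  have := ((C.leaves_fill Q).map Prod.snd).mem_iff (a := x)
  rwa [List.map_append, List.mem_append] at this

theorem CutStep.swCorrect {P P' : Linking 𝒜 X} {Γ Γ' : List (Item 𝒜 X)} (h : CutStep P Γ P' Γ')
    (hv : Valid P Γ) (hP : SwCorrect P Γ) : SwCorrect P' Γ' := by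
  cases h with
  | binary _ Γ Δ i s t s' t' hi =>
    have hmem : ∀ x, x ∈ i.toTree.leaves.map Prod.snd → x ∈ P.names.toFinset := by
      intro x hx
      rw [List.mem_toFinset, hv.mem_names, ((seqLeaves_middle Γ i Δ).map Prod.snd).mem_iff,
        List.map_append, List.mem_append]
      exact Or.inl hx
    have hmem' : ∀ x, x ∈ s.leaves.map Prod.snd ∨ x ∈ t.leaves.map Prod.snd →
        x ∈ P.names.toFinset := by
      intro x hx
      refine hmem x ((hi.perm_leaves.map Prod.snd).mem_iff.2 ?_)
      simp only [OTree.leaves, List.map_append, List.mem_append]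
      exact Or.inl hx
    rw [swCorrect_cut_iff hi] at hP
    rw [swCorrect_cut_iff (Or.inl rfl)]
    intro r E p S p' S' F₀ hE hs hs' hF₀
    rw [List.map_append, List.map_cons] at hF₀
    obtain ⟨q, T₀, F, ⟨T, q', T', ht, ht', rfl⟩, hF, hp⟩ := Forest.sw_of_sw_middle hF₀
    rw [← List.map_append] at hF
    have key : ∀ z, z = p ∨ z = q → TreeOn P.names.toFinset
        ((z, q') :: (q', p') :: (E ++ (S ++ (T ++ (S' ++ (T' ++ F)))))) := by
      intro z hz
      refine (hP r E z (S ++ T) q' _ F hE ⟨p, S, q, T, hs, ht, hz, rfl⟩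
        ⟨T', p', S', ht', hs', rfl⟩ hF).perm ?_
      simp only [perm_iff_coe_eq, ← Multiset.coe_add, ← Multiset.cons_coe, ← Multiset.singleton_add]
      abel
    refine (TreeOn.cut_exchange (key p (Or.inl rfl)) (key q (Or.inr rfl))
      (hmem' p (Or.inl hs.mem.1)) (hmem' q (Or.inr ht.mem.1))).perm ?_
    refine List.Perm.cons _ ?_
    rw [perm_iff_coe_eq] at hp ⊢
    simp only [← Multiset.coe_add, ← Multiset.cons_coe, ← Multiset.singleton_add] at hp ⊢
    rw [hp]
    abel
  | atom C Γ Δ c a h i j k hc =>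
    obtain ⟨hv', ⟨hij, hav⟩, hV⟩ := hv.remove_cut hc (leaves_atom C a h i j k)
    rw [swCorrect_cut_iff hc] at hP
    intro r E F hE hF
    obtain ⟨r₀, E₀, o, S, A, ⟨rfl, rfl⟩, hC, -, hp⟩ := C.sw_of_sw_fill _ _ _ hE
    obtain ⟨E', hE', hp'⟩ := C.sw_fill (.par (.xa a h i) (.xa a j r₀))
      ⟨i, _, r₀, _, ⟨rfl, rfl⟩, ⟨rfl, rfl⟩, Or.inr rfl, rfl⟩ hC
    have hmem := fun x => (C.mem_names_fill_iff (.par (.xa a h i) (.xa a j r₀)) (x := x)).2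
    have hmem' := fun x => (C.mem_names_fill_iff (.xa a h r₀) (x := x)).2
    have h1 := hP _ _ i _ j _ F hE' ⟨rfl, rfl⟩ ⟨rfl, rfl⟩ hF
    rw [hV]
    refine (TreeOn.splice (u := i) (v := j) (q := r₀) (S := [h]) (B := star S r₀ ++ (A ++ F))
      (h1.perm ?_) ?_ ?_ hij ?_ ?_ ?_).perm ?_
    · rw [perm_iff_coe_eq] at hp' ⊢
      simp only [← Multiset.coe_add, ← Multiset.cons_coe, ← Multiset.singleton_add, star_cons,
        star_nil, Multiset.coe_nil] at hp' ⊢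
      rw [hp']
      abel
    · exact List.mem_toFinset.2 (hmem _ (Or.inl (by
        simp [Linking.names, Linking.toTree, OTree.leaves])))
    · exact List.mem_toFinset.2 (hmem _ (Or.inl (by
        simp [Linking.names, Linking.toTree, OTree.leaves])))
    · exact hav _ (hmem' _ (Or.inl (by simp [Linking.names, Linking.toTree, OTree.leaves])))
    · intro s hs
      obtain rfl := List.mem_singleton.1 hs
      exact hav _ (hmem' _ (Or.inl (by simp [Linking.names, Linking.toTree, OTree.leaves])))
    · intro x y hxy
      have : x ∈ (C.fill (.xa a h r₀)).names ∧ y ∈ (C.fill (.xa a h r₀)).names := by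
        simp only [List.mem_append, mem_star] at hxy
        rcases hxy with ⟨hx, rfl⟩ | hxy | hxy
        · exact ⟨hmem' _ (Or.inr (hC.mem.2.1 x hx)),
            hmem' _ (Or.inl (by simp [Linking.names, Linking.toTree, OTree.leaves]))⟩
        · exact ⟨hmem' _ (Or.inr (hC.mem.2.2 x y hxy).1), hmem' _ (Or.inr (hC.mem.2.2 x y hxy).2)⟩
        · exact ⟨hv'.mem_names.2 (hF.mem_seq x y hxy).1, hv'.mem_names.2 (hF.mem_seq x y hxy).2⟩
      exact ⟨hav _ this.1, hav _ this.2⟩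
    · rw [perm_iff_coe_eq] at hp ⊢
      simp only [← Multiset.coe_add, ← Multiset.cons_coe, ← Multiset.singleton_add, star_cons,
        star_nil, Multiset.coe_nil] at hp ⊢
      rw [hp]
      abel
  | unit C Q Γ Δ c i j hc =>
    obtain ⟨hv', ⟨hij, hav⟩, hV⟩ := hv.remove_cut hc (leaves_unit C Q i j)
    rw [swCorrect_cut_iff hc] at hP
    intro r E F hE hF
    obtain ⟨r₀, E₀, o, S, A, hQ, hC, -, hp⟩ := C.sw_of_sw_fill _ _ _ hE
    obtain ⟨E', hE', hp'⟩ := C.sw_fill (.par (.tensBot Q i) (.one j))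
      ⟨r₀, _, j, _, ⟨_, hQ, rfl⟩, ⟨rfl, rfl⟩, Or.inr rfl, rfl⟩ hC
    have hmem := fun x => (C.mem_names_fill_iff (.par (.tensBot Q i) (.one j)) (x := x)).2
    have hmem' := fun x => (C.mem_names_fill_iff Q (x := x)).2
    have h1 := (hP _ _ i _ j _ F hE' ⟨rfl, rfl⟩ ⟨rfl, rfl⟩ hF).swap
    rw [hV, Finset.erase_right_comm]
    have hav' : ∀ z ∈ (C.fill Q).names, z ≠ j ∧ z ≠ i := fun z hz => (hav z hz).symm
    refine (TreeOn.splice (u := j) (v := i) (q := r₀) (S := S) (B := E₀ ++ (A ++ F))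
      (h1.perm ?_) ?_ ?_ hij.symm ?_ ?_ ?_).perm ?_
    · rw [perm_iff_coe_eq] at hp' ⊢
      simp only [← Multiset.coe_add, ← Multiset.cons_coe, ← Multiset.singleton_add,
        Multiset.coe_nil] at hp' ⊢
      rw [hp']
      abel
    · exact List.mem_toFinset.2 (hmem _ (Or.inl (by
        simp [Linking.names, Linking.toTree, OTree.leaves])))
    · exact List.mem_toFinset.2 (hmem _ (Or.inl (by
        simp [Linking.names, Linking.toTree, OTree.leaves])))
    · exact hav' _ (hmem' _ (Or.inl hQ.root_mem))
    · exact fun s hs => hav' _ (hmem' _ (Or.inr (hC.mem.2.1 s hs)))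
    · intro x y hxy
      have : x ∈ (C.fill Q).names ∧ y ∈ (C.fill Q).names := by
        simp only [List.mem_append] at hxy
        rcases hxy with hxy | hxy | hxy
        · exact ⟨hmem' _ (Or.inl (hQ.mem x y hxy).1), hmem' _ (Or.inl (hQ.mem x y hxy).2)⟩
        · exact ⟨hmem' _ (Or.inr (hC.mem.2.2 x y hxy).1), hmem' _ (Or.inr (hC.mem.2.2 x y hxy).2)⟩
        · exact ⟨hv'.mem_names.2 (hF.mem_seq x y hxy).1, hv'.mem_names.2 (hF.mem_seq x y hxy).2⟩
      exact ⟨hav' _ this.1, hav' _ this.2⟩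
    · rw [perm_iff_coe_eq] at hp ⊢
      simp only [← Multiset.coe_add] at hp ⊢
      rw [hp]
      abel

end CutSteps


section Traces

variable {𝒜 : Type u} {X : Type v} {Γ : List (Item 𝒜 X)}

/-- The pairs of dual leaves (the positive one first) that face each other in a cut. -/
noncomputable def cutPairs : OTree 𝒜 X → OTree 𝒜 X → List (X × X)
  | .leaf l x, .leaf _ y => if l.IsNeg then [(y, x)] else [(x, y)]
  | .tens s₁ s₂, .par t₁ t₂ => cutPairs s₁ t₂ ++ cutPairs s₂ t₁
  | .par s₁ s₂, .tens t₁ t₂ => cutPairs s₁ t₂ ++ cutPairs s₂ t₁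
  | _, _ => []

theorem cutPairs_comm {s t : OTree 𝒜 X} (h : t.erase = s.erase.neg) :
    (cutPairs s t).Perm (cutPairs t s) := by
  induction s generalizing t with
  | leaf l x =>
    cases t with
    | leaf m y =>
      obtain rfl : m = l.dual := by simpa [OTree.erase, Formula.neg] using h
      have := Lit.isNeg_dual l
      by_cases hl : l.IsNeg <;> simp_all [cutPairs]
    | tens t₁ t₂ => simp [OTree.erase, Formula.neg] at h
    | par t₁ t₂ => simp [OTree.erase, Formula.neg] at h
  | tens s₁ s₂ ih ih' =>
    cases t with
    | leaf m y => simp [OTree.erase, Formula.neg] at h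
    | tens t₁ t₂ => simp [OTree.erase, Formula.neg] at h
    | par t₁ t₂ =>
      simp only [OTree.erase, Formula.neg, Formula.par.injEq] at h
      exact ((ih h.2).append (ih' h.1)).trans List.perm_append_comm
  | par s₁ s₂ ih ih' =>
    cases t with
    | leaf m y => simp [OTree.erase, Formula.neg] at h
    | par t₁ t₂ => simp [OTree.erase, Formula.neg] at h
    | tens t₁ t₂ =>
      simp only [OTree.erase, Formula.neg, Formula.tens.injEq] at h
      exact ((ih h.2).append (ih' h.1)).trans List.perm_append_comm

theorem cutPairs_types {s t : OTree 𝒜 X} (h : t.erase = s.erase.neg) {p n : X}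
    (hpn : (p, n) ∈ cutPairs s t) : ∃ l, ¬ l.IsNeg ∧ (l, p) ∈ s.leaves ++ t.leaves ∧
      (l.dual, n) ∈ s.leaves ++ t.leaves := by
  induction s generalizing t with
  | leaf l x =>
    cases t with
    | leaf m y =>
      obtain rfl : m = l.dual := by simpa [OTree.erase, Formula.neg] using h
      by_cases hl : l.IsNeg
      · obtain ⟨rfl, rfl⟩ : p = y ∧ n = x := by simpa [cutPairs, hl] using hpn
        exact ⟨l.dual, by simpa [Lit.isNeg_dual] using hl, by simp [OTree.leaves]⟩
      · obtain ⟨rfl, rfl⟩ : p = x ∧ n = y := by simpa [cutPairs, hl] using hpn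
        exact ⟨l, hl, by simp [OTree.leaves]⟩
    | tens t₁ t₂ => simp [OTree.erase, Formula.neg] at h
    | par t₁ t₂ => simp [OTree.erase, Formula.neg] at h
  | tens s₁ s₂ ih ih' =>
    cases t with
    | leaf m y => simp [OTree.erase, Formula.neg] at h
    | tens t₁ t₂ => simp [OTree.erase, Formula.neg] at h
    | par t₁ t₂ =>
      simp only [OTree.erase, Formula.neg, Formula.par.injEq] at h
      rcases List.mem_append.1 hpn with h1 | h1
      · obtain ⟨l, hl, h2, h3⟩ := ih h.2 h1
        refine ⟨l, hl, ?_⟩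
        simp only [OTree.leaves, List.mem_append] at h2 h3 ⊢
        tauto
      · obtain ⟨l, hl, h2, h3⟩ := ih' h.1 h1
        refine ⟨l, hl, ?_⟩
        simp only [OTree.leaves, List.mem_append] at h2 h3 ⊢
        tauto
  | par s₁ s₂ ih ih' =>
    cases t with
    | leaf m y => simp [OTree.erase, Formula.neg] at h
    | par t₁ t₂ => simp [OTree.erase, Formula.neg] at h
    | tens t₁ t₂ =>
      simp only [OTree.erase, Formula.neg, Formula.tens.injEq] at h
      rcases List.mem_append.1 hpn with h1 | h1
      · obtain ⟨l, hl, h2, h3⟩ := ih h.2 h1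
        refine ⟨l, hl, ?_⟩
        simp only [OTree.leaves, List.mem_append] at h2 h3 ⊢
        tauto
      · obtain ⟨l, hl, h2, h3⟩ := ih' h.1 h1
        refine ⟨l, hl, ?_⟩
        simp only [OTree.leaves, List.mem_append] at h2 h3 ⊢
        tauto

theorem cutPairs_fst_sublist (s t : OTree 𝒜 X) :
    ∃ L, ((cutPairs s t).map Prod.fst ++ L).Perm ((s.leaves ++ t.leaves).map Prod.snd) := by
  induction s generalizing t with
  | leaf l x =>
    cases t with
    | leaf m y =>
      by_cases hl : l.IsNeg
      · exact ⟨[x], by simpa [cutPairs, hl, OTree.leaves] using List.Perm.swap x y []⟩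
      · exact ⟨[y], by simp [cutPairs, hl, OTree.leaves]⟩
    | tens t₁ t₂ => exact ⟨_, List.Perm.refl _⟩
    | par t₁ t₂ => exact ⟨_, List.Perm.refl _⟩
  | tens s₁ s₂ ih ih' =>
    cases t with
    | leaf m y => exact ⟨_, List.Perm.refl _⟩
    | tens t₁ t₂ => exact ⟨_, List.Perm.refl _⟩
    | par t₁ t₂ =>
      obtain ⟨L, hL⟩ := ih t₂
      obtain ⟨L', hL'⟩ := ih' t₁
      refine ⟨L ++ L', ?_⟩
      rw [perm_iff_coe_eq] at hL hL' ⊢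
      simp only [cutPairs, OTree.leaves, List.map_append, ← Multiset.coe_add] at hL hL' ⊢
      rw [show ∀ a b c d : Multiset X, a + b + (c + d) = (a + c) + (b + d) by intros; abel, hL, hL']
      abel
  | par s₁ s₂ ih ih' =>
    cases t with
    | leaf m y => exact ⟨_, List.Perm.refl _⟩
    | par t₁ t₂ => exact ⟨_, List.Perm.refl _⟩
    | tens t₁ t₂ =>
      obtain ⟨L, hL⟩ := ih t₂
      obtain ⟨L', hL'⟩ := ih' t₁
      refine ⟨L ++ L', ?_⟩
      rw [perm_iff_coe_eq] at hL hL' ⊢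
      simp only [cutPairs, OTree.leaves, List.map_append, ← Multiset.coe_add] at hL hL' ⊢
      rw [show ∀ a b c d : Multiset X, a + b + (c + d) = (a + c) + (b + d) by intros; abel, hL, hL']
      abel

noncomputable def Item.pairs : Item 𝒜 X → List (X × X)
  | .formula _ => []
  | .cut s t => cutPairs s t

/-- The pairs of dual leaves of all the cuts of a sequent. -/
noncomputable def seqPairs (Γ : List (Item 𝒜 X)) : List (X × X) := Γ.flatMap Item.pairs

theorem seqPairs_middle (Γ : List (Item 𝒜 X)) (c : Item 𝒜 X) (Δ : List (Item 𝒜 X)) :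
    (seqPairs (Γ ++ c :: Δ)).Perm (c.pairs ++ seqPairs (Γ ++ Δ)) := by
  simp only [seqPairs, List.flatMap_append, List.flatMap_cons, perm_iff_coe_eq, ← Multiset.coe_add]
  abel

theorem Item.IsCut.pairs_perm {c : Item 𝒜 X} {s t : OTree 𝒜 X} (hc : c.IsCut s t)
    (hw : c.WellFormed) : c.pairs.Perm (cutPairs s t) := by
  have := hc.wellFormed hw
  rcases hc with rfl | rfl
  · exact List.Perm.refl _
  · exact (cutPairs_comm this).symm

theorem seqPairs_types (hw : ∀ i ∈ Γ, i.WellFormed) {p n : X} (h : (p, n) ∈ seqPairs Γ) :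
    ∃ l, ¬ l.IsNeg ∧ (l, p) ∈ seqLeaves Γ ∧ (l.dual, n) ∈ seqLeaves Γ := by
  obtain ⟨i, hi, hpn⟩ := List.mem_flatMap.1 h
  cases i with
  | formula t => simp [Item.pairs] at hpn
  | cut s t =>
    obtain ⟨l, hl, h1, h2⟩ := cutPairs_types (hw _ hi) hpn
    exact ⟨l, hl, List.mem_flatMap.2 ⟨_, hi, h1⟩, List.mem_flatMap.2 ⟨_, hi, h2⟩⟩

/-- The leaf belongs to a formula of the sequent, not to a cut. -/
def IsOuter (Γ : List (Item 𝒜 X)) (x : X) : Prop :=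
  ∃ t, Item.formula t ∈ Γ ∧ x ∈ t.leaves.map Prod.snd

/-- The names in a sequent split into those of the sources of cut pairs and others, among which
the outer ones. -/
theorem seqPairs_fst_sublist (Γ : List (Item 𝒜 X)) :
    ∃ L, ((seqPairs Γ).map Prod.fst ++ L).Perm ((seqLeaves Γ).map Prod.snd) ∧
      ∀ x, IsOuter Γ x → x ∈ L := by
  induction Γ with
  | nil => exact ⟨[], by simp [seqPairs, seqLeaves], fun x ⟨t, ht, _⟩ => by simp at ht⟩
  | cons i Γ ih =>
    obtain ⟨L, hL, ho⟩ := ih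
    cases i with
    | formula t =>
      refine ⟨t.leaves.map Prod.snd ++ L, ?_, ?_⟩
      · rw [perm_iff_coe_eq] at hL ⊢
        simp only [seqPairs, seqLeaves, List.flatMap_cons, Item.pairs, Item.toTree,
          List.map_append, ← Multiset.coe_add, List.nil_append] at hL ⊢
        rw [← hL]
        abel
      · rintro x ⟨s, hs, hx⟩
        rcases List.mem_cons.1 hs with h | h
        · cases h; exact List.mem_append_left _ hx
        · exact List.mem_append_right _ (ho x ⟨s, h, hx⟩)
    | cut s t =>
      obtain ⟨L', hL'⟩ := cutPairs_fst_sublist s t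
      refine ⟨L' ++ L, ?_, ?_⟩
      · rw [perm_iff_coe_eq] at hL hL' ⊢
        simp only [seqPairs, seqLeaves, List.flatMap_cons, Item.pairs, Item.toTree, OTree.leaves,
          List.map_append, ← Multiset.coe_add] at hL hL' ⊢
        rw [← hL, ← hL']
        abel
      · rintro x ⟨s, hs, hx⟩
        rcases List.mem_cons.1 hs with h | h
        · cases h
        · exact List.mem_append_right _ (ho x ⟨s, h, hx⟩)

theorem IsOuter.mem {x : X} (h : IsOuter Γ x) : x ∈ (seqLeaves Γ).map Prod.snd := by
  obtain ⟨t, ht, hx⟩ := h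
  obtain ⟨l, hl, rfl⟩ := List.mem_map.1 hx
  exact List.mem_map.2 ⟨l, List.mem_flatMap.2 ⟨_, ht, hl⟩, rfl⟩

/-- One step along a path in a proof graph: a wire of the linking, from a negative leaf to a
positive one, or a cut pair, from a positive leaf to its dual. -/
def PathStep (P : Linking 𝒜 X) (Γ : List (Item 𝒜 X)) (x y : X) : Prop :=
  (x, y) ∈ P.wires ∨ (x, y) ∈ seqPairs Γ

/-- Outer leaves are joined by a path. -/
def Trace (P : Linking 𝒜 X) (Γ : List (Item 𝒜 X)) (x y : X) : Prop :=
  IsOuter Γ x ∧ IsOuter Γ y ∧ TransGen (PathStep P Γ) x y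

theorem Valid.label_unique {P : Linking 𝒜 X} (hv : Valid P Γ) {l m : Lit 𝒜} {x : X}
    (h : (l, x) ∈ P.leaves) (h' : (m, x) ∈ seqLeaves Γ) : l = m :=
  MLL.label_unique hv.nodup h (hv.seq_perm.mem_iff.2 h')

theorem PathStep.unique {P : Linking 𝒜 X} (hv : Valid P Γ) {x y z : X} (h : PathStep P Γ x y)
    (h' : PathStep P Γ x z) : y = z := by
  have hex : ∀ {x y z : X}, (x, y) ∈ P.wires → (x, z) ∈ seqPairs Γ → False := by
    intro x y z h h'
    obtain ⟨l, -, hl, -, hneg, -⟩ := P.wires_types h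
    obtain ⟨m, hm, hm', -⟩ := seqPairs_types hv.wellFormed h'
    exact hm (hv.label_unique hl hm' ▸ hneg)
  rcases h with h | h <;> rcases h' with h' | h'
  · exact Linking.wires_unique hv.nodup h h'
  · exact (hex h h').elim
  · exact (hex h' h).elim
  · obtain ⟨L, hL, -⟩ := seqPairs_fst_sublist Γ
    have hn := (hL.nodup_iff.2 hv.seq_nodup).of_append_left
    exact congrArg Prod.snd (List.inj_on_of_nodup_map hn h h' rfl)

/-- There is no step from a positive outer leaf. -/
theorem PathStep.not_of_outer {P : Linking 𝒜 X} (hv : Valid P Γ) {x y : X} {l : Lit 𝒜}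
    (hl : ¬ l.IsNeg) (hx : (l, x) ∈ P.leaves) (ho : IsOuter Γ x) : ¬ PathStep P Γ x y := by
  rintro (h | h)
  · obtain ⟨m, -, hm, -, hneg, -⟩ := P.wires_types h
    exact hl (MLL.label_unique hv.nodup hx hm ▸ hneg)
  · obtain ⟨L, hL, ho'⟩ := seqPairs_fst_sublist Γ
    have hn := hL.nodup_iff.2 hv.seq_nodup
    exact List.disjoint_of_nodup_append hn (List.mem_map.2 ⟨_, h, rfl⟩) (ho' x ho)

theorem transGen_splice {R R' V : X → X → Prop} {S : X → Prop} {u v q : X}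
    (hR : ∀ x y, R x y ↔ V x y ∨ (S x ∧ y = u) ∨ (x = u ∧ y = v) ∨ (x = v ∧ y = q))
    (hR' : ∀ x y, R' x y ↔ V x y ∨ (S x ∧ y = q)) (hq : q ≠ u ∧ q ≠ v)
    (hS : ∀ x, S x → x ≠ u ∧ x ≠ v) (hV : ∀ x y, V x y → (x ≠ u ∧ x ≠ v) ∧ (y ≠ u ∧ y ≠ v))
    {x y : X} (hx : x ≠ u ∧ x ≠ v) (hy : y ≠ u ∧ y ≠ v) :
    TransGen R x y ↔ TransGen R' x y := by
  let f : X → X := fun x => if x = u ∨ x = v then q else x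
  have hf : ∀ x, x ≠ u ∧ x ≠ v → f x = x := fun x hx => by simp [f, hx.1, hx.2]
  have hfu : f u = q := by simp [f]
  have hfv : f v = q := by simp [f]
  constructor
  · have key : ∀ z, TransGen R x z → TransGen R' x (f z) := by
      intro z h
      induction h with
      | single h =>
        rename_i b
        rcases (hR _ _).1 h with h | ⟨h, rfl⟩ | ⟨rfl, rfl⟩ | ⟨rfl, rfl⟩
        · rw [hf _ (hV _ _ h).2]; exact .single ((hR' _ _).2 (Or.inl h))
        · rw [hfu]; exact .single ((hR' _ _).2 (Or.inr ⟨h, rfl⟩))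
        · exact absurd rfl hx.1
        · exact absurd rfl hx.2
      | tail _ h ih =>
        rename_i b c _
        rcases (hR _ _).1 h with h | ⟨h, rfl⟩ | ⟨rfl, rfl⟩ | ⟨rfl, rfl⟩
        · rw [hf _ (hV _ _ h).1] at ih
          rw [hf _ (hV _ _ h).2]; exact ih.tail ((hR' _ _).2 (Or.inl h))
        · rw [hf _ (hS _ h)] at ih
          rw [hfu]; exact ih.tail ((hR' _ _).2 (Or.inr ⟨h, rfl⟩))
        · rwa [hfv, ← hfu]
        · rwa [hf _ hq, ← hfv]
    intro h
    have := key y h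
    rwa [hf _ hy] at this
  · intro h
    clear hy
    have step : ∀ a b, R' a b → TransGen R a b := by
      intro a b h
      rcases (hR' _ _).1 h with h | ⟨h, rfl⟩
      · exact .single ((hR _ _).2 (Or.inl h))
      · exact ((TransGen.single ((hR a u).2 (Or.inr (Or.inl ⟨h, rfl⟩)))).tail
          ((hR u v).2 (by simp))).tail ((hR v b).2 (by simp))
    induction h with
    | single h => exact step _ _ h
    | tail _ h ih => exact ih.trans (step _ _ h)

theorem seqPairs_mem (hw : ∀ i ∈ Γ, i.WellFormed) {x y : X} (h : (x, y) ∈ seqPairs Γ) :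
    x ∈ (seqLeaves Γ).map Prod.snd ∧ y ∈ (seqLeaves Γ).map Prod.snd := by
  obtain ⟨l, -, h1, h2⟩ := seqPairs_types hw h
  exact ⟨List.mem_map.2 ⟨_, h1, rfl⟩, List.mem_map.2 ⟨_, h2, rfl⟩⟩

theorem isOuter_middle_iff {Γ Δ : List (Item 𝒜 X)} {c : Item 𝒜 X} {s t : OTree 𝒜 X}
    (hc : c.IsCut s t) {x : X} : IsOuter (Γ ++ c :: Δ) x ↔ IsOuter (Γ ++ Δ) x := by
  have : ∀ s : OTree 𝒜 X, Item.formula s ≠ c := by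
    rintro s rfl
    rcases hc with h | h <;> cases h
  simp only [IsOuter, List.mem_append, List.mem_cons, this, false_or]

/-- Cut reduction preserves traces. -/
theorem CutStep.trace_iff {P P' : Linking 𝒜 X} {Γ Γ' : List (Item 𝒜 X)} (h : CutStep P Γ P' Γ')
    (hv : Valid P Γ) (x y : X) : Trace P Γ x y ↔ Trace P' Γ' x y := by
  cases h with
  | binary _ Γ Δ i s t s' t' hi =>
    have hstep : ∀ x y, PathStep P (Γ ++ i :: Δ) x y ↔
        PathStep P (Γ ++ Item.cut s s' :: Item.cut t t' :: Δ) x y := by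
      intro x y
      refine or_congr Iff.rfl ?_
      rw [(seqPairs_middle Γ i Δ).mem_iff, (seqPairs_middle Γ (.cut s s') _).mem_iff,
        List.mem_append, List.mem_append, (seqPairs_middle Γ (.cut t t') _).mem_iff,
        List.mem_append, (hi.pairs_perm (hv.wellFormed i (by simp))).mem_iff]
      simp only [cutPairs, Item.pairs, List.mem_append]
      tauto
    have heq : PathStep P (Γ ++ i :: Δ) =
        PathStep P (Γ ++ Item.cut s s' :: Item.cut t t' :: Δ) :=
      funext fun x => funext fun y => propext (hstep x y)
    simp only [Trace, heq, isOuter_middle_iff hi, isOuter_middle_iff (Or.inl rfl :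
      (Item.cut s s').IsCut s s'), isOuter_middle_iff (Or.inl rfl : (Item.cut t t').IsCut t t')]
  | atom C Γ Δ c a h i j k hc =>
    obtain ⟨hv', ⟨hij, hav⟩, -⟩ := hv.remove_cut hc (leaves_atom C a h i j k)
    have hmem' := fun x => (C.mem_names_fill_iff (.xa a h k) (x := x)).2
    obtain ⟨o, S, A, hC, hW⟩ := C.exists_wires_fill
    have hk : k ∈ (C.fill (.xa a h k)).names :=
      hmem' _ (Or.inl (by simp [Linking.names, Linking.toTree, OTree.leaves]))
    have hh : h ∈ (C.fill (.xa a h k)).names :=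
      hmem' _ (Or.inl (by simp [Linking.names, Linking.toTree, OTree.leaves]))
    have hout : ∀ z, IsOuter (Γ ++ Δ) z → z ≠ i ∧ z ≠ j := fun z hz =>
      hav z (hv'.mem_names.2 hz.mem)
    unfold Trace
    rw [isOuter_middle_iff hc, isOuter_middle_iff hc]
    refine and_congr_right fun hx => and_congr_right fun hy => ?_
    refine transGen_splice (u := i) (v := j) (q := k) (S := fun z => z = h)
      (V := fun z w => (z, w) ∈ star S k ++ A ∨ (z, w) ∈ seqPairs (Γ ++ Δ))
      (fun z w => ?_) (fun z w => ?_) (hav _ hk) ?_ ?_ (hout x hx) (hout y hy)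
    · rw [PathStep, (hW _).2.1.mem_iff, (seqPairs_middle Γ c Δ).mem_iff, List.mem_append,
        List.mem_append (s := c.pairs), (hc.pairs_perm (hv.wellFormed c (by simp))).mem_iff]
      simp only [Linking.wires, Linking.lead, List.mem_append, List.mem_singleton, cutPairs,
        Lit.isNeg_pos, if_false, Prod.mk.injEq]
      tauto
    · rw [PathStep, (hW _).2.1.mem_iff]
      simp only [Linking.wires, Linking.lead, List.mem_append, List.mem_singleton, Prod.mk.injEq]
      tauto
    · rintro z rfl; exact hav _ hh
    · intro z w hzw
      have : z ∈ (C.fill (.xa a h k)).names ∧ w ∈ (C.fill (.xa a h k)).names := by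
        simp only [List.mem_append, mem_star] at hzw
        rcases hzw with (⟨hx, rfl⟩ | hxy) | hxy
        · exact ⟨hmem' _ (Or.inr (hC.mem.2.1 z hx)), hk⟩
        · exact ⟨hmem' _ (Or.inr (hC.mem.2.2 z w hxy).1), hmem' _ (Or.inr (hC.mem.2.2 z w hxy).2)⟩
        · have := seqPairs_mem hv'.wellFormed hxy
          exact ⟨hv'.mem_names.2 this.1, hv'.mem_names.2 this.2⟩
      exact ⟨hav _ this.1, hav _ this.2⟩
  | unit C Q Γ Δ c i j hc =>
    obtain ⟨hv', ⟨hij, hav⟩, -⟩ := hv.remove_cut hc (leaves_unit C Q i j)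
    have hmem' := fun x => (C.mem_names_fill_iff Q (x := x)).2
    have hav' : ∀ z ∈ (C.fill Q).names, z ≠ j ∧ z ≠ i := fun z hz => (hav z hz).symm
    obtain ⟨o, S, A, hC, hW⟩ := C.exists_wires_fill
    have hk : Q.lead ∈ (C.fill Q).names := hmem' _ (Or.inl Q.sw_wires.root_mem)
    have hout : ∀ z, IsOuter (Γ ++ Δ) z → z ≠ j ∧ z ≠ i := fun z hz =>
      hav' z (hv'.mem_names.2 hz.mem)
    unfold Trace
    rw [isOuter_middle_iff hc, isOuter_middle_iff hc]
    refine and_congr_right fun hx => and_congr_right fun hy => ?_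
    refine transGen_splice (u := j) (v := i) (q := Q.lead) (S := fun z => z ∈ S)
      (V := fun z w => (z, w) ∈ Q.wires ++ A ∨ (z, w) ∈ seqPairs (Γ ++ Δ))
      (fun z w => ?_) (fun z w => ?_) (hav' _ hk) ?_ ?_ (hout x hx) (hout y hy)
    · rw [PathStep, (hW _).2.1.mem_iff, (seqPairs_middle Γ c Δ).mem_iff, List.mem_append,
        List.mem_append (s := c.pairs), (hc.pairs_perm (hv.wellFormed c (by simp))).mem_iff]
      simp only [Linking.wires, Linking.lead, List.mem_append, cutPairs,
        Lit.isNeg_bot, if_true, Prod.mk.injEq, List.mem_cons, List.not_mem_nil, mem_star]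
      tauto
    · rw [PathStep, (hW _).2.1.mem_iff]
      simp only [List.mem_append, mem_star]
      tauto
    · exact fun z hz => hav' _ (hmem' _ (Or.inr (hC.mem.2.1 z hz)))
    · intro z w hzw
      have : z ∈ (C.fill Q).names ∧ w ∈ (C.fill Q).names := by
        simp only [List.mem_append] at hzw
        rcases hzw with (hxy | hxy) | hxy
        · have := Q.sw_wires.mem z w hxy
          exact ⟨hmem' _ (Or.inl this.1), hmem' _ (Or.inl this.2)⟩
        · exact ⟨hmem' _ (Or.inr (hC.mem.2.2 z w hxy).1), hmem' _ (Or.inr (hC.mem.2.2 z w hxy).2)⟩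
        · have := seqPairs_mem hv'.wellFormed hxy
          exact ⟨hv'.mem_names.2 this.1, hv'.mem_names.2 this.2⟩
      exact ⟨hav' _ this.1, hav' _ this.2⟩

end Traces


section Progress

variable {𝒜 : Type u} {X : Type v} {Γ : List (Item 𝒜 X)}

theorem Forest.exists_sw (F : List (OTree 𝒜 X)) : ∃ E, Forest.Sw F E :=
  ⟨_, (Forest.sw_iff F _).2 ⟨fun _ => false, rfl⟩⟩

theorem exists_ctx_parOn (m : List (Comp 𝒜 X)) (B : List X) :
    ∃ C : Ctx 𝒜 X, ∀ Q, C.fill Q = parOn m (botsOn B Q) := by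
  induction m with
  | nil =>
    induction B with
    | nil => exact ⟨.hole, fun Q => rfl⟩
    | cons x B ih =>
      obtain ⟨C, hC⟩ := ih
      exact ⟨.tensBot C x, fun Q => congrArg (Linking.tensBot · x) (hC Q)⟩
  | cons c m ih =>
    obtain ⟨C, hC⟩ := ih
    exact ⟨.parR c.link C, fun Q => congrArg (Linking.par c.link) (hC Q)⟩

/-- Two tensors whose distinguished leaves are connected by the sequent and themselves can be
brought next to each other. -/
theorem sim_glue {P : Linking 𝒜 X} (hv : Valid P Γ) (hc : SwCorrect P Γ) {m : List (Comp 𝒜 X)}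
    {B₁ B₂ : List X} {Q R : Linking 𝒜 X}
    (hw : P.wires.Perm (m.flatMap (fun c => c.link.wires) ++
      (star B₁ Q.lead ++ (star B₂ R.lead ++ (Q.wires ++ R.wires)))))
    (hl : (P.leaves : Multiset (Lit 𝒜 × X)) = ((m.flatMap fun c => c.link.leaves : List _) :
      Multiset (Lit 𝒜 × X)) + (Multiset.ofList ((B₁ ++ B₂).map fun x => (Lit.bot, x)) +
        ((Q.leaves : Multiset (Lit 𝒜 × X)) + (R.leaves : Multiset (Lit 𝒜 × X)))))
    (hQ : ∀ r E, Q.Sw r E → r = Q.lead ∧ E = Q.wires)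
    (hR : ∀ r E, R.Sw r E → r = R.lead ∧ E = R.wires)
    (hconn : ∀ F, Forest.Sw (Γ.map Item.toTree) F →
      Conn (Q.wires ++ (R.wires ++ F)) Q.lead R.lead) :
    Sim Γ P (parOn m (botsOn (B₁ ++ B₂) (.par Q R))) := by
  set W := parOn m (botsOn (B₁ ++ B₂) (.par Q R)) with hW
  have hWl : P.leaves.Perm W.leaves := by
    rw [perm_iff_coe_eq, hl, hW, leaves_parOn, ← Multiset.coe_add, coe_leaves_botsOn]
    rfl
  have hWw : W.wires = m.flatMap (fun c => c.link.wires) ++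
      (star (B₁ ++ B₂) R.lead ++ (Q.wires ++ R.wires)) := by
    rw [hW, wires_parOn, wires_botsOn]; rfl
  have hWv := hv.of_perm hWl
  refine Adjacent.sim ⟨Q.lead, R.lead, fun n p hnp => ?_⟩ hv hWv hc ?_
  · have := hw.mem_iff.1 hnp
    simp only [hWw, List.mem_append, mem_star] at this ⊢
    rcases this with h | ⟨h, rfl⟩ | h | h
    · exact Or.inl (Or.inl h)
    · refine Or.inr ⟨?_, rfl, Or.inr (Or.inl ⟨Or.inl h, trivial⟩)⟩
      rw [← Multiset.mem_coe, hl]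
      simp [h]
    · exact Or.inl (Or.inr (Or.inl ⟨Or.inr h.1, h.2⟩))
    · exact Or.inl (Or.inr (Or.inr h))
  · intro r E F hE hF
    have hV : W.names.toFinset = P.names.toFinset :=
      List.toFinset_eq_of_perm _ _ (hWl.map _).symm
    rw [hV]
    obtain ⟨r', E₁, h1, rfl⟩ := sw_parOn hE
    obtain ⟨E₂, ⟨r₁, E₃, r₂, E₄, h3, h4, hr, rfl⟩, rfl⟩ := sw_botsOn h1
    obtain ⟨rfl, rfl⟩ := hQ _ _ h3
    obtain ⟨rfl, rfl⟩ := hR _ _ h4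
    have htree := (hc _ _ F P.sw_wires hF).perm (hw.append_right F)
    refine htree.of_le (fun a b hab => ?_) (by simp; omega)
    have hc1 : ∀ L : List (X × X), Conn (L ++ (star (B₁ ++ B₂) r' ++ (Q.wires ++ R.wires)) ++ F)
        Q.lead R.lead := fun L => (hconn F hF).mono (by intro e he; simp at he ⊢; tauto)
    have hr1 : ∀ L : List (X × X), Conn (L ++ (star (B₁ ++ B₂) r' ++ (Q.wires ++ R.wires)) ++ F)
        r' Q.lead := by
      rcases hr with rfl | rfl
      · exact fun L => Conn.refl _ _
      · exact fun L => (hc1 L).symm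
    simp only [List.mem_append, mem_star] at hab
    rcases hab with (h | ⟨h, rfl⟩ | ⟨h, rfl⟩ | h) | h
    · exact Conn.of_mem (by simp only [List.mem_append]; tauto)
    · exact (Conn.of_mem (y := r') (by simp [h])).trans (hr1 _)
    · exact (Conn.of_mem (y := r') (by simp [h])).trans ((hr1 _).trans (hc1 _))
    · exact Conn.of_mem (by simp only [List.mem_append]; tauto)
    · exact Conn.of_mem (by simp only [List.mem_append]; tauto)

theorem SwCorrect.not_conn_wire {P : Linking 𝒜 X} (hc : SwCorrect P Γ) {x y : X}
    (h : (x, y) ∈ P.wires) {F : List (X × X)} (hF : Forest.Sw (Γ.map Item.toTree) F) :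
    ¬ Conn F x y := by
  obtain ⟨L₁, L₂, hL⟩ := List.append_of_mem h
  have h1 := hc _ _ F P.sw_wires hF
  rw [hL] at h1
  have h2 : TreeOn P.names.toFinset ((x, y) :: (L₁ ++ L₂ ++ F)) := h1.perm (by
    simp only [perm_iff_coe_eq, ← Multiset.coe_add, ← Multiset.cons_coe, ← Multiset.singleton_add]
    abel)
  exact fun hxy => h2.not_conn (hxy.mono (by intro e he; simp [he]))

theorem conn_leaf_cut {Γ Δ : List (Item 𝒜 X)} {c : Item 𝒜 X} {l m : Lit 𝒜} {x y : X}
    (hc : c.IsCut (.leaf l x) (.leaf m y)) {F : List (X × X)}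
    (hF : Forest.Sw ((Γ ++ c :: Δ).map Item.toTree) F) : Conn F x y := by
  rw [List.map_append, List.map_cons] at hF
  obtain ⟨r, E₁, E₂, h, -, hp⟩ := Forest.sw_of_sw_middle hF
  rcases hc with rfl | rfl
  · obtain ⟨S, q, T, ⟨rfl, rfl⟩, ⟨rfl, rfl⟩, rfl⟩ := h
    exact Conn.of_mem (hp.mem_iff.2 (by simp))
  · obtain ⟨S, q, T, ⟨rfl, rfl⟩, ⟨rfl, rfl⟩, rfl⟩ := h
    exact (Conn.of_mem (hp.mem_iff.2 (by simp))).symm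

/-- Moving `⊥`s along a path through a cut does not change the traces. -/
theorem trace_rewire {P W : Linking 𝒜 X} (hv : Valid P Γ) {B : List X} {L : List (X × X)}
    {i j k : X} (hP : P.wires.Perm (star B i ++ L)) (hW : W.wires.Perm (star B k ++ L))
    (hij : B ≠ [] → (i, j) ∈ seqPairs Γ) (hjk : B ≠ [] → (j, k) ∈ L) (ho : ¬ IsOuter Γ i)
    (ho' : ¬ IsOuter Γ j) (x y : X) : Trace P Γ x y ↔ Trace W Γ x y := by
  by_cases hB : B = []
  · subst hB
    have : PathStep P Γ = PathStep W Γ := by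
      funext x y
      simp only [PathStep, hP.mem_iff, hW.mem_iff, star_nil]
    rw [Trace, Trace, this]
  have hij := hij hB
  have hjk := hjk hB
  have hjkP : PathStep P Γ j k := Or.inl (hP.mem_iff.2 (List.mem_append_right _ hjk))
  have hjkW : PathStep W Γ j k := Or.inl (hW.mem_iff.2 (List.mem_append_right _ hjk))
  have hijP : PathStep P Γ i j := Or.inr hij
  refine and_congr_right fun _ => and_congr_right fun hy => ⟨fun h => ?_, fun h => ?_⟩
  · have key : ∀ z, TransGen (PathStep P Γ) x z → TransGen (PathStep W Γ) x z ∨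
        ((z = i ∨ z = j) ∧ TransGen (PathStep W Γ) x k) := by
      have step : ∀ z w, PathStep P Γ z w → PathStep W Γ z w ∨ (w = i ∧ PathStep W Γ z k) := by
        rintro z w (h | h)
        · rcases List.mem_append.1 (hP.mem_iff.1 h) with h | h
          · obtain ⟨hz, rfl⟩ := mem_star.1 h
            exact Or.inr ⟨rfl, Or.inl (hW.mem_iff.2 (by simp [hz]))⟩
          · exact Or.inl (Or.inl (hW.mem_iff.2 (by simp [h])))
        · exact Or.inl (Or.inr h)
      intro z h
      induction h with
      | single h =>
        rcases step _ _ h with h | ⟨rfl, h⟩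
        · exact Or.inl (.single h)
        · exact Or.inr ⟨Or.inl rfl, .single h⟩
      | tail _ h ih =>
        rcases ih with ih | ⟨rfl | rfl, ih⟩
        · rcases step _ _ h with h | ⟨rfl, h⟩
          · exact Or.inl (ih.tail h)
          · exact Or.inr ⟨Or.inl rfl, ih.tail h⟩
        · exact Or.inr ⟨Or.inr (PathStep.unique hv h hijP), ih⟩
        · rw [PathStep.unique hv h hjkP]; exact Or.inl ih
    rcases key y h with h | ⟨rfl | rfl, -⟩
    · exact h
    · exact absurd hy ho
    · exact absurd hy ho'
  · have step : ∀ z w, PathStep W Γ z w → TransGen (PathStep P Γ) z w := by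
      rintro z w (h | h)
      · rcases List.mem_append.1 (hW.mem_iff.1 h) with h | h
        · obtain ⟨hz, rfl⟩ := mem_star.1 h
          have hzi : PathStep P Γ z i := Or.inl (hP.mem_iff.2 (by simp [hz]))
          exact ((TransGen.single hzi).tail hijP).tail hjkP
        · exact .single (Or.inl (hP.mem_iff.2 (by simp [h])))
      · exact .single (Or.inr h)
    clear hy
    induction h with
    | single h => exact step _ _ h
    | tail _ h ih => exact ih.trans (step _ _ h)

theorem Item.IsCut.not_isOuter {Γ Δ : List (Item 𝒜 X)} {c : Item 𝒜 X} {s t : OTree 𝒜 X}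
    (hc : c.IsCut s t) {P : Linking 𝒜 X} (hv : Valid P (Γ ++ c :: Δ)) {x : X}
    (hx : x ∈ (s.leaves ++ t.leaves).map Prod.snd) : ¬ IsOuter (Γ ++ c :: Δ) x := by
  rw [isOuter_middle_iff hc]
  intro ho
  have hn := (((seqLeaves_middle Γ c Δ).map Prod.snd).nodup_iff).1 hv.seq_nodup
  rw [List.map_append] at hn
  exact List.disjoint_of_nodup_append hn ((hc.perm_leaves.map Prod.snd).mem_iff.2 hx) ho.mem

theorem exists_cutStep_atom {Γ Δ : List (Item 𝒜 X)} {c : Item 𝒜 X} {P : Linking 𝒜 X} {a : 𝒜}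
    {i j : X} (hv : Valid P (Γ ++ c :: Δ)) (hP : SwCorrect P (Γ ++ c :: Δ))
    (hc : c.IsCut (.leaf (.pos a) i) (.leaf (.neg a) j)) :
    ∃ W P' Γ', Sim (Γ ++ c :: Δ) P W ∧ CutStep W (Γ ++ c :: Δ) P' Γ' ∧
      ∀ x y, Trace P (Γ ++ c :: Δ) x y ↔ Trace W (Γ ++ c :: Δ) x y := by
  have hleaf : ∀ z, z ∈ [(Lit.pos a, i), (Lit.neg a, j)] → z ∈ P.leaves := by
    intro z hz
    rw [hv.seq_perm.mem_iff, (seqLeaves_middle Γ c Δ).mem_iff, List.mem_append,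
      hc.perm_leaves.mem_iff]
    exact Or.inl hz
  obtain ⟨l, c₀, h, -⟩ := exists_flat (Γ ++ c :: Δ) P
  obtain ⟨F, hF⟩ := Forest.exists_sw ((Γ ++ c :: Δ).map Item.toTree)
  obtain ⟨⟨kd, B₁⟩, hd, hdl, hdi⟩ := h.exists_comp (by simp) (hleaf (Lit.pos a, i) (by simp))
  obtain ⟨h', rfl⟩ : ∃ h', kd = .xa a h' i := by
    cases kd with
    | one x => simp [Core.link, Linking.leaves, Linking.toTree, OTree.leaves] at hdi
    | xa b x y =>
      obtain ⟨rfl, rfl⟩ : a = b ∧ i = y := by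
        simpa [Core.link, Linking.leaves, Linking.toTree, OTree.leaves] using hdi
      exact ⟨x, rfl⟩
  obtain ⟨⟨ke, B₂⟩, he, hej⟩ := h.mem_leaves.1 (hleaf (Lit.neg a, j) (by simp))
  obtain ⟨k, rfl⟩ : ∃ k, ke = .xa a j k := by
    have := (Comp.mem_leaves.1 hej).resolve_left (by simp)
    cases ke with
    | one x => simp [Core.link, Linking.leaves, Linking.toTree, OTree.leaves] at this
    | xa b x y =>
      obtain ⟨rfl, rfl⟩ : a = b ∧ j = x := by
        simpa [Core.link, Linking.leaves, Linking.toTree, OTree.leaves] using this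
      exact ⟨y, rfl⟩
  have hjk : (j, k) ∈ P.wires := h.mem_wires.2 ⟨_, he, Comp.mem_wires.2 (Or.inr (by
    simp [Core.link, Linking.wires]))⟩
  have hconn : ∀ F, Forest.Sw ((Γ ++ c :: Δ).map Item.toTree) F → Conn F i j := fun F hF =>
    conn_leaf_cut hc hF
  have hne : (⟨.xa a j k, B₂⟩ : Comp 𝒜 X) ≠ ⟨.xa a h' i, B₁⟩ := by
    intro heq
    have : k = i := by
      have := congrArg Comp.core heq
      simp only [Core.xa.injEq] at this
      exact this.2.2
    subst this
    exact hP.not_conn_wire hjk hF (hconn F hF).symm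
  obtain ⟨L, hL⟩ : ∃ L, (c₀ :: l).Perm (⟨.xa a h' i, B₁⟩ :: L) := ⟨_, List.perm_cons_erase hd⟩
  have heL := (List.mem_cons.1 (hL.mem_iff.1 he)).resolve_left hne
  obtain ⟨m, hm⟩ : ∃ m, L.Perm (⟨.xa a j k, B₂⟩ :: m) := ⟨_, List.perm_cons_erase heL⟩
  have hall := hL.trans (hm.cons _)
  have hw : P.wires.Perm (m.flatMap (fun c => c.link.wires) ++
      (star B₁.toList i ++ (star B₂.toList k ++ ([(h', i)] ++ [(j, k)])))) := by
    refine (h.wires'.trans (hall.flatMap_right _)).trans ?_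
    simp only [List.flatMap_cons, Comp.link, wires_botsOn, Core.link, Linking.wires, Linking.lead,
      perm_iff_coe_eq, ← Multiset.coe_add]
    abel
  have hsim : Sim (Γ ++ c :: Δ) P
      (parOn m (botsOn (B₁.toList ++ B₂.toList) (.par (.xa a h' i) (.xa a j k)))) := by
    refine sim_glue hv hP hw ?_ (fun r E h => h) (fun r E h => h) fun F hF => ?_
    · rw [perm_iff_coe_eq.1 (h.leaves'.trans (hall.flatMap_right _))]
      simp only [List.flatMap_cons, ← Multiset.coe_add, Comp.coe_leaves, List.map_append]
      rw [← Multiset.map_coe, ← Multiset.map_coe, Multiset.coe_toList, Multiset.coe_toList]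
      simp only [Core.link]
      abel
    · exact ((hconn F hF).mono (by intro e he; simp [he])).trans
        (Conn.of_mem (by simp [Linking.wires, Linking.lead]))
  obtain ⟨C, hC⟩ := exists_ctx_parOn m (B₁.toList ++ B₂.toList)
  refine ⟨_, C.fill (.xa a h' k), Γ ++ Δ, hsim, ?_, ?_⟩
  · rw [← hC]
    exact CutStep.atom C Γ Δ c a h' i j k hc
  · have hpairs : (i, j) ∈ seqPairs (Γ ++ c :: Δ) := by
      rw [(seqPairs_middle Γ c Δ).mem_iff, List.mem_append,
        (hc.pairs_perm (hv.wellFormed c (by simp))).mem_iff]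
      simp [cutPairs]
    refine fun x y => trace_rewire (i := i) (j := j) (k := k) (B := B₁.toList)
      (L := m.flatMap (fun c => c.link.wires) ++
        (star B₂.toList k ++ ([(h', i)] ++ [(j, k)]))) hv (hw.trans ?_) ?_ (fun _ => hpairs)
      (fun _ => by simp) (hc.not_isOuter hv (by simp [OTree.leaves]))
      (hc.not_isOuter hv (by simp [OTree.leaves])) x y
    · simp only [perm_iff_coe_eq, ← Multiset.coe_add]
      abel
    · rw [wires_parOn, wires_botsOn]
      simp only [star, List.map_append, Linking.wires, Linking.lead, perm_iff_coe_eq,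
        ← Multiset.coe_add]
      abel

theorem exists_cutStep_unit {Γ Δ : List (Item 𝒜 X)} {c : Item 𝒜 X} {P : Linking 𝒜 X}
    {i j : X} (hv : Valid P (Γ ++ c :: Δ)) (hP : SwCorrect P (Γ ++ c :: Δ))
    (hc : c.IsCut (.leaf .bot i) (.leaf .one j)) :
    ∃ W P' Γ', Sim (Γ ++ c :: Δ) P W ∧ CutStep W (Γ ++ c :: Δ) P' Γ' ∧
      ∀ x y, Trace P (Γ ++ c :: Δ) x y ↔ Trace W (Γ ++ c :: Δ) x y := by
  have hleaf : ∀ z, z ∈ [((Lit.bot : Lit 𝒜), i), (Lit.one, j)] → z ∈ P.leaves := by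
    intro z hz
    rw [hv.seq_perm.mem_iff, (seqLeaves_middle Γ c Δ).mem_iff, List.mem_append,
      hc.perm_leaves.mem_iff]
    exact Or.inl hz
  obtain ⟨l, c₀, h, -⟩ := exists_flat (Γ ++ c :: Δ) P
  obtain ⟨F, hF⟩ := Forest.exists_sw ((Γ ++ c :: Δ).map Item.toTree)
  obtain ⟨⟨kd, B₁⟩, hd, hdl, hdi⟩ := h.exists_comp (by simp) (hleaf (Lit.one, j) (by simp))
  obtain rfl : kd = .one j := by
    cases kd with
    | one x =>
      obtain rfl : j = x := by
        simpa [Core.link, Linking.leaves, Linking.toTree, OTree.leaves] using hdi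
      rfl
    | xa b x y => simp [Core.link, Linking.leaves, Linking.toTree, OTree.leaves] at hdi
  obtain ⟨⟨ke, B⟩, he, hej⟩ := h.mem_leaves.1 (hleaf (Lit.bot, i) (by simp))
  obtain ⟨B₂, rfl⟩ : ∃ B₂ : Multiset X, B = ([i] : List X) + B₂ := by
    rcases Comp.mem_leaves.1 hej with ⟨-, hi⟩ | hi
    · obtain ⟨B₂, rfl⟩ := Multiset.exists_cons_of_mem hi
      exact ⟨B₂, by simp⟩
    · exact absurd rfl (ke.pos_iff hi).2.1
  have hil : (i, ke.link.lead) ∈ P.wires :=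
    h.mem_wires.2 ⟨_, he, Comp.mem_wires.2 (Or.inl ⟨by simp, rfl⟩)⟩
  have hconn : ∀ F, Forest.Sw ((Γ ++ c :: Δ).map Item.toTree) F → Conn F i j := fun F hF =>
    conn_leaf_cut hc hF
  have hne : (⟨ke, ([i] : List X) + B₂⟩ : Comp 𝒜 X) ≠ ⟨.one j, B₁⟩ := by
    intro heq
    have : ke = .one j := congrArg Comp.core heq
    subst this
    exact hP.not_conn_wire hil hF (hconn F hF)
  obtain ⟨L, hL⟩ : ∃ L, (c₀ :: l).Perm (⟨.one j, B₁⟩ :: L) := ⟨_, List.perm_cons_erase hd⟩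
  have heL := (List.mem_cons.1 (hL.mem_iff.1 he)).resolve_left hne
  obtain ⟨m, hm⟩ : ∃ m, L.Perm (⟨ke, ([i] : List X) + B₂⟩ :: m) := ⟨_, List.perm_cons_erase heL⟩
  have hall := hL.trans (hm.cons _)
  set Q := Comp.link ⟨ke, B₂⟩ with hQ
  have hQl : Q.lead = ke.link.lead := Comp.lead_link _
  have hw : P.wires.Perm (m.flatMap (fun c => c.link.wires) ++ (star [] (Linking.tensBot Q i).lead ++
      (star B₁.toList (Linking.one (𝒜 := 𝒜) j).lead ++
        ((Linking.tensBot Q i).wires ++ (Linking.one (𝒜 := 𝒜) j).wires)))) := by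
    refine (h.wires'.trans (hall.flatMap_right _)).trans ?_
    simp only [List.flatMap_cons]
    have h1 := perm_iff_coe_eq.1 (Comp.wires_perm [i] ke B₂)
    have h2 : (Comp.link (𝒜 := 𝒜) ⟨.one j, B₁⟩).wires = star B₁.toList j := by
      simp [Comp.link, wires_botsOn, Core.link, Linking.lead, Linking.wires]
    rw [perm_iff_coe_eq, h2, ← Multiset.coe_add, ← Multiset.coe_add, h1]
    simp only [Linking.wires, Linking.lead, ← Multiset.coe_add, hQl, star_cons, star_nil,
      ← Multiset.cons_coe, ← Multiset.singleton_add, Multiset.coe_nil, ← hQ]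
    abel
  have hsim : Sim (Γ ++ c :: Δ) P
      (parOn m (botsOn ([] ++ B₁.toList) (.par (.tensBot Q i) (.one j)))) := by
    refine sim_glue hv hP hw ?_ ?_ (fun r E h => h) fun F hF => ?_
    · rw [perm_iff_coe_eq.1 (h.leaves'.trans (hall.flatMap_right _))]
      have h3 : ((Linking.tensBot Q i).leaves : Multiset (Lit 𝒜 × X)) =
          Q.leaves + ([(Lit.bot, i)] : List (Lit 𝒜 × X)) := (Multiset.coe_add _ _).symm
      have h4 : (Core.one j : Core 𝒜 X).link = .one j := rfl
      simp only [List.flatMap_cons, ← Multiset.coe_add, Comp.coe_leaves, h3, List.nil_append]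
      rw [← Multiset.map_coe, Multiset.coe_toList, hQ, Comp.coe_leaves]
      simp only [h4, Multiset.map_add, Multiset.map_coe, List.map_cons, List.map_nil]
      abel
    · rintro r _ ⟨E, hE, rfl⟩
      obtain ⟨rfl, rfl⟩ := Comp.sw_link hE
      exact ⟨hQl.symm, by simp [Linking.wires, hQ, Comp.lead_link]⟩
    · exact (Conn.of_mem (E := (Linking.tensBot Q i).wires ++ _) (x := i) (by
        simp [Linking.wires, Linking.lead])).symm.trans
          ((hconn F hF).mono (by intro e he; simp [he]))
  obtain ⟨C, hC⟩ := exists_ctx_parOn (𝒜 := 𝒜) m ([] ++ B₁.toList)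
  refine ⟨_, C.fill Q, Γ ++ Δ, hsim, ?_, ?_⟩
  · rw [← hC]
    exact CutStep.unit C Q Γ Δ c i j hc
  · refine fun x y => trace_rewire (i := i) (j := j) (k := j) (B := []) hv hw ?_ (by simp) (by simp)
      (hc.not_isOuter hv (by simp [OTree.leaves]))
      (hc.not_isOuter hv (by simp [OTree.leaves])) x y
    rw [wires_parOn, wires_botsOn]
    exact List.Perm.refl _

/-- In a correct graph with cuts, a cut can be reduced, up to equivalence. -/
theorem exists_cutStep {P : Linking 𝒜 X} (hv : Valid P Γ) (hP : SwCorrect P Γ)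
    (hcut : ∃ s t, Item.cut s t ∈ Γ) : ∃ W P' Γ', Sim Γ P W ∧ CutStep W Γ P' Γ' ∧
      ∀ x y, Trace P Γ x y ↔ Trace W Γ x y := by
  obtain ⟨s, t, hst⟩ := hcut
  obtain ⟨Γ, Δ, rfl⟩ := List.append_of_mem hst
  have hw : t.erase = s.erase.neg := hv.wellFormed _ hst
  cases s with
  | leaf l x =>
    cases t with
    | leaf m y =>
      obtain rfl : m = l.dual := by simpa [OTree.erase, Formula.neg] using hw
      cases l with
      | pos a => exact exists_cutStep_atom hv hP (Or.inl rfl)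
      | neg a => exact exists_cutStep_atom hv hP (Or.inr rfl)
      | one => exact exists_cutStep_unit hv hP (Or.inr rfl)
      | bot => exact exists_cutStep_unit hv hP (Or.inl rfl)
    | tens t₁ t₂ => simp [OTree.erase, Formula.neg] at hw
    | par t₁ t₂ => simp [OTree.erase, Formula.neg] at hw
  | tens s₁ s₂ =>
    cases t with
    | leaf m y => simp [OTree.erase, Formula.neg] at hw
    | tens t₁ t₂ => simp [OTree.erase, Formula.neg] at hw
    | par t₁ t₂ =>
      exact ⟨P, _, _, Sim.refl _ _, CutStep.binary P Γ Δ _ t₁ t₂ s₂ s₁ (Or.inr rfl),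
        fun _ _ => Iff.rfl⟩
  | par s₁ s₂ =>
    cases t with
    | leaf m y => simp [OTree.erase, Formula.neg] at hw
    | par t₁ t₂ => simp [OTree.erase, Formula.neg] at hw
    | tens t₁ t₂ =>
      exact ⟨P, _, _, Sim.refl _ _, CutStep.binary P Γ Δ _ s₁ s₂ t₂ t₁ (Or.inl rfl),
        fun _ _ => Iff.rfl⟩

end Progress


section NormalForms

variable {𝒜 : Type u} {X : Type v} {Γ : List (Item 𝒜 X)}

def OTree.size : OTree 𝒜 X → ℕ
  | .leaf _ _ => 1
  | .tens s t => size s + size t + 1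
  | .par s t => size s + size t + 1

def Item.size : Item 𝒜 X → ℕ
  | .formula _ => 0
  | .cut s t => s.size + t.size

/-- The total size of the cuts of a sequent. -/
def seqSize (Γ : List (Item 𝒜 X)) : ℕ := (Γ.map Item.size).sum

theorem Item.IsCut.size {c : Item 𝒜 X} {s t : OTree 𝒜 X} (hc : c.IsCut s t) :
    c.size = s.size + t.size := by
  rcases hc with rfl | rfl
  · rfl
  · exact Nat.add_comm _ _

theorem CutStep.size_lt {P P' : Linking 𝒜 X} {Γ Γ' : List (Item 𝒜 X)} (h : CutStep P Γ P' Γ') :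
    seqSize Γ' < seqSize Γ := by
  cases h with
  | binary _ Γ Δ i s t s' t' hi =>
    have h₁ : (Item.cut s s').size = s.size + s'.size := rfl
    have h₂ : (Item.cut t t').size = t.size + t'.size := rfl
    simp only [seqSize, List.map_append, List.map_cons, List.sum_append, List.sum_cons, hi.size,
      h₁, h₂, OTree.size]
    omega
  | atom C Γ Δ c a h i j k hc =>
    simp only [seqSize, List.map_append, List.map_cons, List.sum_append, List.sum_cons, hc.size,
      OTree.size]
    omega
  | unit C Q Γ Δ c i j hc =>
    simp only [seqSize, List.map_append, List.map_cons, List.sum_append, List.sum_cons, hc.size,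
      OTree.size]
    omega

def Item.IsFormula : Item 𝒜 X → Prop
  | .formula _ => True
  | .cut _ _ => False

/-- The formulas of a sequent with cuts. -/
noncomputable def formulas (Γ : List (Item 𝒜 X)) : List (Item 𝒜 X) :=
  Γ.filter fun i => decide i.IsFormula

theorem Item.IsCut.not_isFormula {c : Item 𝒜 X} {s t : OTree 𝒜 X} (hc : c.IsCut s t) :
    ¬ c.IsFormula := by
  rcases hc with rfl | rfl <;> exact id

theorem CutStep.formulas_eq {P P' : Linking 𝒜 X} {Γ Γ' : List (Item 𝒜 X)}
    (h : CutStep P Γ P' Γ') : formulas Γ' = formulas Γ := by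
  cases h with
  | binary _ Γ Δ i s t s' t' hi =>
    have h₁ : ¬ (Item.cut s s').IsFormula := id
    have h₂ : ¬ (Item.cut t t').IsFormula := id
    simp [formulas, hi.not_isFormula, h₁, h₂]
  | atom C Γ Δ c a h i j k hc => simp [formulas, hc.not_isFormula]
  | unit C Q Γ Δ c i j hc => simp [formulas, hc.not_isFormula]

theorem CutStep.exists_cut {P P' : Linking 𝒜 X} {Γ Γ' : List (Item 𝒜 X)}
    (h : CutStep P Γ P' Γ') : ∃ i ∈ Γ, ¬ i.IsFormula := by
  cases h with
  | binary _ Γ Δ i s t s' t' hi => exact ⟨i, by simp, hi.not_isFormula⟩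
  | atom C Γ Δ c a h i j k hc => exact ⟨c, by simp, hc.not_isFormula⟩
  | unit C Q Γ Δ c i j hc => exact ⟨c, by simp, hc.not_isFormula⟩

theorem isFormula_of_mem_formulas {i : Item 𝒜 X} (h : i ∈ formulas Γ) : i.IsFormula := by
  simpa using (List.mem_filter.1 h).2

/-- In a cut-free graph the traces are the wires. -/
theorem trace_iff_of_cutFree {P : Linking 𝒜 X} (hv : Valid P Γ) (hΓ : ∀ i ∈ Γ, i.IsFormula)
    (x y : X) : (x, y) ∈ P.wires ↔ Trace P Γ x y := by
  have hpairs : seqPairs Γ = [] := by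
    rw [seqPairs, List.flatMap_eq_nil_iff]
    intro i hi
    have := hΓ i hi
    cases i with
    | formula t => rfl
    | cut s t => exact absurd this id
  have hout : ∀ z ∈ P.names, IsOuter Γ z := by
    intro z hz
    obtain ⟨l, hl, rfl⟩ := List.mem_map.1 (hv.mem_names.1 hz)
    obtain ⟨i, hi, hl⟩ := List.mem_flatMap.1 hl
    have := hΓ i hi
    cases i with
    | formula t => exact ⟨t, hi, List.mem_map.2 ⟨l, hl, rfl⟩⟩
    | cut s t => exact absurd this id
  have hstep : ∀ a b, PathStep P Γ a b ↔ (a, b) ∈ P.wires := by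
    intro a b
    rw [PathStep, hpairs]
    simp
  constructor
  · intro h
    have := P.sw_wires.mem x y h
    exact ⟨hout _ this.1, hout _ this.2, .single ((hstep _ _).2 h)⟩
  · rintro ⟨-, -, h⟩
    cases h with
    | single h => exact (hstep _ _).1 h
    | tail h h' =>
      rename_i b
      exfalso
      have h1 : ∃ a, (a, b) ∈ P.wires := by
        cases h with
        | single h => exact ⟨_, (hstep _ _).1 h⟩
        | tail _ h => exact ⟨_, (hstep _ _).1 h⟩
      obtain ⟨a, h1⟩ := h1
      obtain ⟨-, m, -, hm, -, hm', -⟩ := P.wires_types h1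
      obtain ⟨l, -, hl, -, hl', -⟩ := P.wires_types ((hstep _ _).1 h')
      exact hm' (label_unique hv.nodup hl hm ▸ hl')

theorem formulas_eq_self (hΓ : ∀ i ∈ Γ, i.IsFormula) : formulas Γ = Γ := by
  rw [formulas, List.filter_eq_self]
  intro i hi
  simpa using hΓ i hi

/-- The linking `H` is the result of eliminating all the cuts of `P ▷ Γ`. -/
structure IsNormal (P : Linking 𝒜 X) (Γ : List (Item 𝒜 X)) (H : Linking 𝒜 X) : Prop where
  valid : Valid H (formulas Γ)
  correct : SwCorrect H (formulas Γ)
  wires : ∀ x y, (x, y) ∈ H.wires ↔ Trace P Γ x y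

theorem Valid.correct_iff {P : Linking 𝒜 X} (hv : Valid P Γ) :
    hv.graph.Correct ↔ SwCorrect P Γ :=
  PreGraph.correct_iff _

theorem exists_isNormal {P : Linking 𝒜 X} (hv : Valid P Γ) (hP : SwCorrect P Γ) :
    ∃ H, ∃ hH : IsNormal P Γ H,
      ReflTransGen PreNet.Red hv.graph.toNet hH.valid.graph.toNet := by
  induction hn : seqSize Γ using Nat.strong_induction_on generalizing P Γ with
  | _ n ih =>
    subst hn
    by_cases hcut : ∃ s t, Item.cut s t ∈ Γ
    · obtain ⟨W, P', Γ', hs, hstep, htr⟩ := exists_cutStep hv hP hcut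
      have hvW := hv.of_perm hs.perm
      have hW := (hs.swCorrect_iff hv.nodup).1 hP
      have hv' := hstep.valid hvW
      have hP' := hstep.swCorrect hvW hW
      obtain ⟨H, ⟨h1, h2, h3⟩, hred⟩ := ih _ hstep.size_lt hv' hP' rfl
      have hf := hstep.formulas_eq
      have h4 : IsNormal P Γ H := ⟨hf ▸ h1, hf ▸ h2, fun x y => by
        rw [h3, htr, hstep.trace_iff hvW]⟩
      have heq : h1.graph.toNet = h4.valid.graph.toNet := by
        congr 1
        simp only [Valid.graph, hf]
      refine ⟨H, h4, ReflTransGen.head ?_ (heq ▸ hred)⟩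
      exact ⟨hvW.graph, hv'.graph, (hs.toNet_eq hv hvW).symm, rfl, hvW.correct_iff.2 hW,
        hv'.correct_iff.2 hP', hstep⟩
    · have hΓ : ∀ i ∈ Γ, i.IsFormula := by
        intro i hi
        cases i with
        | formula t => trivial
        | cut s t => exact absurd ⟨s, t, hi⟩ hcut
      have hf := formulas_eq_self hΓ
      have h4 : IsNormal P Γ P := ⟨hf.symm ▸ hv, hf.symm ▸ hP, trace_iff_of_cutFree hv hΓ⟩
      have heq : hv.graph.toNet = h4.valid.graph.toNet := by
        congr 1
        simp only [Valid.graph, hf]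
      exact ⟨P, h4, heq ▸ .refl⟩

theorem PathStep.end_unique {P : Linking 𝒜 X} (hv : Valid P Γ) {q y z : X} {l m : Lit 𝒜}
    (hy : IsOuter Γ y) (hly : (l, y) ∈ P.leaves) (hl : ¬ l.IsNeg) (hz : IsOuter Γ z)
    (hmz : (m, z) ∈ P.leaves) (hm : ¬ m.IsNeg) (hqy : ReflTransGen (PathStep P Γ) q y)
    (hqz : ReflTransGen (PathStep P Γ) q z) : y = z := by
  have terminal : ∀ {a b : X}, (∀ w, ¬ PathStep P Γ a w) →
      ReflTransGen (PathStep P Γ) a b → a = b := by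
    intro a b ha h
    rcases ReflTransGen.cases_head h with h | ⟨c, hc, -⟩
    · exact h
    · exact absurd hc (ha c)
  rcases ReflTransGen.total_of_right_unique (r := PathStep P Γ)
    (fun a b c h h' => PathStep.unique hv h h') hqy hqz with h | h
  · exact terminal (fun w => PathStep.not_of_outer hv hl hly hy) h
  · exact (terminal (fun w => PathStep.not_of_outer hv hm hmz hz) h).symm

theorem IsNormal.leaves {P H : Linking 𝒜 X} (hH : IsNormal P Γ H) (hv : Valid P Γ)
    {l : Lit 𝒜} {x : X} (h : (l, x) ∈ H.leaves) : (l, x) ∈ P.leaves := by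
  rw [hH.valid.seq_perm.mem_iff] at h
  rw [hv.seq_perm.mem_iff]
  obtain ⟨i, hi, h⟩ := List.mem_flatMap.1 h
  exact List.mem_flatMap.2 ⟨i, List.mem_of_mem_filter hi, h⟩

/-- Cut elimination preserves adjacency. -/
theorem Adjacent.isNormal {P P' H H' : Linking 𝒜 X} (hA : Adjacent P P') (hv : Valid P Γ)
    (hv' : Valid P' Γ) (hH : IsNormal P Γ H) (hH' : IsNormal P' Γ H') : Adjacent H H' := by
  obtain ⟨q, q', hA⟩ := hA
  have hperm := hv.perm_leaves hv'
  have hpermH := hH.valid.perm_leaves hH'.valid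
  have : Nonempty X := ⟨q⟩
  let End (P : Linking 𝒜 X) (q y : X) : Prop := IsOuter Γ y ∧
    (∃ m, ¬ m.IsNeg ∧ (m, y) ∈ P.leaves) ∧ ReflTransGen (PathStep P Γ) q y
  have hEnd : ∀ P, Valid P Γ → ∀ q y, End P q y → y = Classical.epsilon (End P q) := by
    intro P hv q y hy
    obtain ⟨h1, ⟨m, hm, h2⟩, h3⟩ := hy
    obtain ⟨h1', ⟨m', hm', h2'⟩, h3'⟩ := Classical.epsilon_spec (p := End P q)
      ⟨y, h1, ⟨m, hm, h2⟩, h3⟩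
    exact PathStep.end_unique hv h1 h2 hm h1' h2' hm' h3 h3'
  refine ⟨Classical.epsilon (End P q), Classical.epsilon (End P' q'), fun n p hnp => ?_⟩
  obtain ⟨l, m, hl, hm, hneg, hpos, -⟩ := H.wires_types hnp
  obtain ⟨hn, hp, htr⟩ := (hH.wires _ _).1 hnp
  have key : ∀ z, TransGen (PathStep P Γ) n z → TransGen (PathStep P' Γ) n z ∨
      (∃ y, (Lit.bot, y) ∈ P.leaves ∧ ReflTransGen (PathStep P' Γ) n y) ∧
        TransGen (PathStep P' Γ) n q' ∧ ReflTransGen (PathStep P Γ) q z := by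
    have step : ∀ z w, PathStep P Γ z w → PathStep P' Γ z w ∨
        ((Lit.bot, z) ∈ P.leaves ∧ w = q ∧ PathStep P' Γ z q') := by
      rintro z w (h | h)
      · rcases hA _ _ h with h | ⟨h1, h2, h3⟩
        · exact Or.inl (Or.inl h)
        · exact Or.inr ⟨h1, h2, Or.inl h3⟩
      · exact Or.inl (Or.inr h)
    intro z h
    induction h with
    | single h =>
      rcases step _ _ h with h | ⟨h1, rfl, h3⟩
      · exact Or.inl (.single h)
      · exact Or.inr ⟨⟨n, h1, .refl⟩, .single h3, .refl⟩
    | tail _ h ih =>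
      rcases ih with ih | ⟨h4, h5, h6⟩
      · rcases step _ _ h with h | ⟨h1, rfl, h3⟩
        · exact Or.inl (ih.tail h)
        · exact Or.inr ⟨⟨_, h1, ih.to_reflTransGen⟩, ih.tail h3, .refl⟩
      · exact Or.inr ⟨h4, h5, h6.tail h⟩
  rcases key p htr with h | ⟨⟨y, hy, hny⟩, hnq, hqp⟩
  · exact Or.inl ((hH'.wires _ _).2 ⟨hn, hp, h⟩)
  · have hbot : l = .bot := by
      cases l with
      | pos a => exact absurd hneg id
      | one => exact absurd hneg id
      | bot => rfl
      | neg a =>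
        exfalso
        have inv : ∀ y, ReflTransGen (PathStep P' Γ) n y →
            (Lit.pos a, y) ∈ P'.leaves ∨ (Lit.neg a, y) ∈ P'.leaves := by
          intro y h
          induction h with
          | refl => exact Or.inr (hperm.mem_iff.1 (hH.leaves hv hl))
          | tail _ h ih =>
            rcases h with h | h
            · obtain ⟨l', m', h1, h2, h3, h4, h5⟩ := P'.wires_types h
              rcases ih with ih | ih
              · rw [← label_unique hv'.nodup ih h1] at h3
                exact absurd h3 id
              · rw [← label_unique hv'.nodup ih h1] at h5
                rcases h5 with h5 | ⟨b, h5, rfl⟩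
                · cases h5
                · cases h5; exact Or.inl h2
            · obtain ⟨l', h1, h2, h3⟩ := seqPairs_types hv'.wellFormed h
              rcases ih with ih | ih
              · rw [← hv'.label_unique ih h2] at h3
                exact Or.inr (hv'.seq_perm.mem_iff.2 h3)
              · rw [← hv'.label_unique ih h2] at h1
                exact absurd trivial h1
        rcases inv y hny with h | h
        · cases label_unique hv'.nodup h (hperm.mem_iff.1 hy)
        · cases label_unique hv'.nodup h (hperm.mem_iff.1 hy)
    subst hbot
    refine Or.inr ⟨hl, hEnd P hv q p ⟨hp, ⟨m, hpos, hH.leaves hv hm⟩, hqp⟩, ?_⟩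
    obtain ⟨p', hp'⟩ := Linking.exists_wire hneg (hpermH.mem_iff.1 hl)
    obtain ⟨-, hp'o, hp't⟩ := (hH'.wires _ _).1 hp'
    obtain ⟨-, m', -, hm', -, hpos', -⟩ := H'.wires_types hp'
    have hm'' := hH'.leaves hv' hm'
    have hend : End P' q' p' := by
      refine ⟨hp'o, ⟨m', hpos', hm''⟩, ?_⟩
      rcases ReflTransGen.total_of_right_unique (r := PathStep P' Γ)
        (fun a b c h h' => PathStep.unique hv' h h') hnq.to_reflTransGen
        hp't.to_reflTransGen with h | h
      · exact h
      · rcases ReflTransGen.cases_head h with h | ⟨c, hc, -⟩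
        · rw [h]
        · exact absurd hc (PathStep.not_of_outer hv' hpos' hm'' hp'o)
    rw [← hEnd P' hv' q' p' hend]
    exact hp'

theorem Sim.isNormal {P P' H H' : Linking 𝒜 X} (hs : Sim Γ P P') (hv : Valid P Γ)
    (hP : SwCorrect P Γ) (hH : IsNormal P Γ H) (hH' : IsNormal P' Γ H') :
    Sim (formulas Γ) H H' := by
  induction hs generalizing H H' with
  | rel P P' h =>
    exact (h.adjacent.isNormal hv (hv.of_perm h.perm) hH hH').sim hH.valid hH'.valid hH.correct
      hH'.correct
  | refl P =>
    exact sim_of_wires hH.valid hH'.valid hH.correct hH'.correct fun n p h =>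
      (hH'.wires _ _).2 ((hH.wires _ _).1 h)
  | symm P P' h ih =>
    exact (ih (hv.of_perm (Sim.perm h).symm)
      ((Sim.swCorrect_iff h ((hv.of_perm (Sim.perm h).symm)).nodup).2 hP) hH' hH).symm
  | trans P R P' h _ ih ih' =>
    have hvR := hv.of_perm (Sim.perm h)
    have hR := (Sim.swCorrect_iff h hv.nodup).1 hP
    obtain ⟨K, hK, -⟩ := exists_isNormal hvR hR
    exact (ih hv hP hH hK).trans (ih' hvR hR hK hH')

/-- The net `M` is represented by a linking that results from eliminating all the cuts of a
correct representative of `N`. -/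
def PreNet.Normalizes (N M : PreNet 𝒜 X) : Prop :=
  ∃ (P : Linking 𝒜 X) (Γ : List (Item 𝒜 X)) (hv : Valid P Γ) (H : Linking 𝒜 X)
    (hH : IsNormal P Γ H), SwCorrect P Γ ∧ hv.graph.toNet = N ∧ hH.valid.graph.toNet = M

theorem PreNet.Normalizes.unique {N M M' : PreNet 𝒜 X} (h : N.Normalizes M)
    (h' : N.Normalizes M') : M = M' := by
  obtain ⟨P, Γ, hv, H, hH, hP, hN, rfl⟩ := h
  obtain ⟨P', Γ', hv', H', hH', hP', hN', rfl⟩ := h'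
  obtain ⟨hΓ, hs⟩ := sim_of_toNet_eq (hN.trans hN'.symm)
  obtain rfl : Γ = Γ' := hΓ
  exact (Sim.isNormal hs hv hP hH hH').toNet_eq hH.valid hH'.valid

theorem PreNet.Red.normalizes {N N' M : PreNet 𝒜 X} (h : N.Red N') (h' : N'.Normalizes M) :
    N.Normalizes M := by
  obtain ⟨G, G', rfl, rfl, hG, hG', hstep⟩ := h
  obtain ⟨H, hH, -⟩ := exists_isNormal G'.valid ((PreGraph.correct_iff _).1 hG')
  obtain rfl := PreNet.Normalizes.unique h'
    ⟨_, _, G'.valid, H, hH, (PreGraph.correct_iff _).1 hG', rfl, rfl⟩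
  have hf := hstep.formulas_eq
  refine ⟨_, _, G.valid, H, ⟨hf ▸ hH.valid, hf ▸ hH.correct, fun x y => ?_⟩,
    (PreGraph.correct_iff _).1 hG, rfl, ?_⟩
  · rw [hH.wires, hstep.trace_iff G.valid]
  · congr 1
    simp only [Valid.graph, hf]

/-- Cut elimination in a correct net yields a unique normal form. -/
theorem PreNet.normalForm_iff {G : PreGraph 𝒜 X} (hG : G.Correct) {M : PreNet 𝒜 X} :
    G.toNet.NormalForm M ↔ G.toNet.Normalizes M := by
  obtain ⟨H, hH, hred⟩ := exists_isNormal G.valid ((PreGraph.correct_iff _).1 hG)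
  have hN : G.toNet.Normalizes hH.valid.graph.toNet :=
    ⟨_, _, G.valid, H, hH, (PreGraph.correct_iff _).1 hG, rfl, rfl⟩
  constructor
  · rintro ⟨h, hM⟩
    have hrep : ∃ K : PreGraph 𝒜 X, K.Correct ∧ K.toNet = M := by
      rcases ReflTransGen.cases_tail h with h | ⟨N', -, G', K, -, hK, -, hK', -⟩
      · exact ⟨G, hG, h.symm⟩
      · exact ⟨K, hK', hK⟩
    obtain ⟨K, hK, rfl⟩ := hrep
    have hK' := (PreGraph.correct_iff _).1 hK
    have hcf : ∀ i ∈ K.seq, i.IsFormula := by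
      intro i hi
      cases i with
      | formula t => trivial
      | cut s t =>
        exfalso
        obtain ⟨W, P', Γ', hs, hstep, -⟩ := exists_cutStep K.valid hK' ⟨s, t, hi⟩
        have hvW := K.valid.of_perm hs.perm
        have hW := (hs.swCorrect_iff K.valid.nodup).1 hK'
        exact hM _ ⟨hvW.graph, (hstep.valid hvW).graph, (hs.toNet_eq K.valid hvW).symm, rfl,
          hvW.correct_iff.2 hW, (hstep.valid hvW).correct_iff.2 (hstep.swCorrect hvW hW), hstep⟩
    have hf := formulas_eq_self hcf
    have hKn : K.toNet.Normalizes K.toNet :=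
      ⟨_, _, K.valid, K.link, ⟨hf.symm ▸ K.valid, hf.symm ▸ hK',
        trace_iff_of_cutFree K.valid hcf⟩, hK', rfl, by
          congr 1
          simp only [Valid.graph, hf]⟩
    clear hM hN hred hG
    generalize G.toNet = N at h
    induction h using ReflTransGen.head_induction_on with
    | refl => exact hKn
    | head h _ ih => exact h.normalizes ih
  · intro h
    obtain rfl := h.unique hN
    refine ⟨hred, ?_⟩
    rintro M' ⟨K, K', hK, -, -, -, hstep⟩
    obtain ⟨i, hi, hi'⟩ := hstep.exists_cut
    have hseq : K.seq = formulas G.seq := (sim_of_toNet_eq hK).1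
    rw [hseq] at hi
    exact hi' (isFormula_of_mem_formulas hi)

end NormalForms


section Renaming

variable {𝒜 : Type u} {X : Type v} {Y : Type w} {Γ Δ : List (Item 𝒜 X)}

theorem OTree.leaves_map (e : X → Y) (t : OTree 𝒜 X) :
    (t.map e).leaves = t.leaves.map (Prod.map id e) := by
  induction t with
  | leaf l x => rfl
  | tens s t ih ih' => simp [OTree.map, OTree.leaves, ih, ih']
  | par s t ih ih' => simp [OTree.map, OTree.leaves, ih, ih']

theorem OTree.map_map {Z : Type*} (e : X → Y) (d : Y → Z) (t : OTree 𝒜 X) :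
    (t.map e).map d = t.map (fun x => d (e x)) := by
  induction t with
  | leaf l x => rfl
  | tens s t ih ih' => simp [OTree.map, ih, ih']
  | par s t ih ih' => simp [OTree.map, ih, ih']

theorem OTree.map_id (t : OTree 𝒜 X) : t.map (fun x => x) = t := by
  induction t with
  | leaf l x => rfl
  | tens s t ih ih' => simp [OTree.map, ih, ih']
  | par s t ih ih' => simp [OTree.map, ih, ih']

theorem OTree.erase_map (e : X → Y) (t : OTree 𝒜 X) : (t.map e).erase = t.erase := by
  induction t with
  | leaf l x => rfl
  | tens s t ih ih' => simp [OTree.map, OTree.erase, ih, ih']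
  | par s t ih ih' => simp [OTree.map, OTree.erase, ih, ih']

theorem OTree.sw_of_sw_map {e : X → Y} {t : OTree 𝒜 X} {r : Y} {E : List (Y × Y)}
    (h : (t.map e).Sw r E) : ∃ r' E', t.Sw r' E' ∧ r = e r' ∧ E = E'.map (Prod.map e e) := by
  induction t generalizing r E with
  | leaf l x =>
    obtain ⟨rfl, rfl⟩ := h
    exact ⟨x, [], ⟨rfl, rfl⟩, rfl, rfl⟩
  | tens s t ih ih' =>
    obtain ⟨E₁, r₂, E₂, h₁, h₂, rfl⟩ := h
    obtain ⟨r, E₁, k₁, rfl, rfl⟩ := ih h₁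
    obtain ⟨r₂, E₂, k₂, rfl, rfl⟩ := ih' h₂
    exact ⟨r, _, ⟨E₁, r₂, E₂, k₁, k₂, rfl⟩, rfl, by simp⟩
  | par s t ih ih' =>
    obtain ⟨r₁, E₁, r₂, E₂, h₁, h₂, hr, rfl⟩ := h
    obtain ⟨r₁, E₁, k₁, rfl, rfl⟩ := ih h₁
    obtain ⟨r₂, E₂, k₂, rfl, rfl⟩ := ih' h₂
    rcases hr with rfl | rfl
    · exact ⟨r₁, _, ⟨r₁, E₁, r₂, E₂, k₁, k₂, Or.inl rfl, rfl⟩, rfl, by simp⟩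
    · exact ⟨r₂, _, ⟨r₁, E₁, r₂, E₂, k₁, k₂, Or.inr rfl, rfl⟩, rfl, by simp⟩

theorem Forest.sw_of_sw_map {e : X → Y} {F : List (OTree 𝒜 X)} {E : List (Y × Y)}
    (h : Forest.Sw (F.map (OTree.map e)) E) :
    ∃ E', Forest.Sw F E' ∧ E = E'.map (Prod.map e e) := by
  induction F generalizing E with
  | nil => exact ⟨[], rfl, h⟩
  | cons t F ih =>
    obtain ⟨r, E₁, E₂, h₁, h₂, rfl⟩ := h
    obtain ⟨r, E₁, k₁, rfl, rfl⟩ := OTree.sw_of_sw_map h₁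
    obtain ⟨E₂, k₂, rfl⟩ := ih h₂
    exact ⟨_, ⟨r, E₁, E₂, k₁, k₂, rfl⟩, by simp⟩

namespace Linking

theorem toTree_map (e : X → Y) (P : Linking 𝒜 X) : (P.map e).toTree = P.toTree.map e := by
  induction P with
  | one x => rfl
  | ax a x y => rfl
  | xa a x y => rfl
  | botTens x Q ih => simp [Linking.map, toTree, OTree.map, ih]
  | tensBot Q x ih => simp [Linking.map, toTree, OTree.map, ih]
  | par Q R ih ih' => simp [Linking.map, toTree, OTree.map, ih, ih']

theorem leaves_map (e : X → Y) (P : Linking 𝒜 X) :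
    (P.map e).leaves = P.leaves.map (Prod.map id e) := by
  rw [leaves, toTree_map, OTree.leaves_map]

theorem names_map (e : X → Y) (P : Linking 𝒜 X) : (P.map e).names = P.names.map e := by
  show (P.map e).leaves.map Prod.snd = (P.leaves.map Prod.snd).map e
  rw [leaves_map, List.map_map, List.map_map]
  rfl

theorem lead_map (e : X → Y) (P : Linking 𝒜 X) : (P.map e).lead = e P.lead := by
  induction P <;> simp_all [Linking.map, lead]

theorem wires_map (e : X → Y) (P : Linking 𝒜 X) :
    (P.map e).wires = P.wires.map (Prod.map e e) := by
  induction P <;> simp_all [Linking.map, wires, lead_map]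

theorem map_map {Z : Type*} (e : X → Y) (d : Y → Z) (P : Linking 𝒜 X) :
    (P.map e).map d = P.map (fun x => d (e x)) := by
  induction P <;> simp_all [Linking.map]

theorem map_id_of {e : X → X} (P : Linking 𝒜 X) (h : ∀ x ∈ P.names, e x = x) : P.map e = P := by
  induction P with
  | one x => simp_all [names, Linking.map, toTree, OTree.leaves]
  | ax a x y => simp_all [names, Linking.map, toTree, OTree.leaves]
  | xa a x y => simp_all [names, Linking.map, toTree, OTree.leaves]
  | botTens x Q ih =>
    simp only [names, toTree, OTree.leaves, List.map_append, List.mem_append] at h ih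
    simp [Linking.map, h x (Or.inl (by simp)), ih fun y hy => h y (Or.inr hy)]
  | tensBot Q x ih =>
    simp only [names, toTree, OTree.leaves, List.map_append, List.mem_append] at h ih
    simp [Linking.map, h x (Or.inr (by simp)), ih fun y hy => h y (Or.inl hy)]
  | par Q R ih ih' =>
    simp only [names, toTree, OTree.leaves, List.map_append, List.mem_append] at h ih ih'
    simp [Linking.map, ih fun y hy => h y (Or.inl hy), ih' fun y hy => h y (Or.inr hy)]

theorem sw_of_sw_map {e : X → Y} {P : Linking 𝒜 X} {r : Y} {E : List (Y × Y)}
    (h : (P.map e).Sw r E) : ∃ r' E', P.Sw r' E' ∧ r = e r' ∧ E = E'.map (Prod.map e e) := by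
  induction P generalizing r E with
  | one x => obtain ⟨rfl, rfl⟩ := h; exact ⟨x, [], ⟨rfl, rfl⟩, rfl, rfl⟩
  | ax a x y => obtain ⟨rfl, rfl⟩ := h; exact ⟨x, _, ⟨rfl, rfl⟩, rfl, rfl⟩
  | xa a x y => obtain ⟨rfl, rfl⟩ := h; exact ⟨y, _, ⟨rfl, rfl⟩, rfl, rfl⟩
  | botTens x Q ih =>
    obtain ⟨E, h, rfl⟩ := h
    obtain ⟨r, E, k, rfl, rfl⟩ := ih h
    exact ⟨r, _, ⟨E, k, rfl⟩, rfl, rfl⟩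
  | tensBot Q x ih =>
    obtain ⟨E, h, rfl⟩ := h
    obtain ⟨r, E, k, rfl, rfl⟩ := ih h
    exact ⟨r, _, ⟨E, k, rfl⟩, rfl, rfl⟩
  | par s t ih ih' =>
    obtain ⟨r₁, E₁, r₂, E₂, h₁, h₂, hr, rfl⟩ := h
    obtain ⟨r₁, E₁, k₁, rfl, rfl⟩ := ih h₁
    obtain ⟨r₂, E₂, k₂, rfl, rfl⟩ := ih' h₂
    rcases hr with rfl | rfl
    · exact ⟨r₁, _, ⟨r₁, E₁, r₂, E₂, k₁, k₂, Or.inl rfl, rfl⟩, rfl, by simp⟩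
    · exact ⟨r₂, _, ⟨r₁, E₁, r₂, E₂, k₁, k₂, Or.inr rfl, rfl⟩, rfl, by simp⟩

end Linking

theorem Item.toTree_map (e : X → Y) (i : Item 𝒜 X) : (i.map e).toTree = i.toTree.map e := by
  cases i <;> rfl

theorem Item.wellFormed_map (e : X → Y) {i : Item 𝒜 X} (h : i.WellFormed) :
    (i.map e).WellFormed := by
  cases i with
  | formula t => trivial
  | cut s t => simpa [Item.map, Item.WellFormed, OTree.erase_map] using h

theorem seqLeaves_map (e : X → Y) (Γ : List (Item 𝒜 X)) :
    seqLeaves (Γ.map (Item.map e)) = (seqLeaves Γ).map (Prod.map id e) := by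
  rw [seqLeaves, seqLeaves, List.flatMap_map, List.map_flatMap]
  simp only [Item.toTree_map, OTree.leaves_map]

/-- `P ▷ Γ` is a correct pre-proof graph. -/
def Good (P : Linking 𝒜 X) (Γ : List (Item 𝒜 X)) : Prop := Valid P Γ ∧ SwCorrect P Γ

theorem Good.map {P : Linking 𝒜 X} (h : Good P Γ) (e : X → Y)
    (he : ∀ x ∈ P.names, ∀ y ∈ P.names, e x = e y → x = y) :
    Good (P.map e) (Γ.map (Item.map e)) := by
  have hn : (P.map e).names.Nodup := by
    rw [Linking.names_map]
    exact List.Nodup.map_on he h.1.nodup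
  refine ⟨⟨?_, hn, ?_⟩, ?_⟩
  · intro i hi
    obtain ⟨j, hj, rfl⟩ := List.mem_map.1 hi
    exact Item.wellFormed_map e (h.1.wellFormed j hj)
  · rw [forest_leaves_map, seqLeaves_map, Linking.leaves_map]
    exact h.1.seq_perm.map _
  · intro r E F hE hF
    obtain ⟨r, E, kE, rfl, rfl⟩ := Linking.sw_of_sw_map hE
    rw [List.map_map, show Item.toTree ∘ Item.map e = OTree.map (𝒜 := 𝒜) e ∘ Item.toTree from
      funext fun i => Item.toTree_map e i, ← List.map_map] at hF
    obtain ⟨F, kF, rfl⟩ := Forest.sw_of_sw_map hF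
    have := (h.2 r E F kE kF).map e (fun x hx y hy => he x (by simpa using hx) y (by simpa using hy))
    rw [List.map_append] at this
    convert this using 1
    rw [Linking.names_map]
    ext x
    simp

theorem Good.perm {P : Linking 𝒜 X} (h : Good P Γ) (hp : Γ.Perm Δ) : Good P Δ := by
  refine ⟨⟨fun i hi => h.1.wellFormed i (hp.mem_iff.2 hi), h.1.nodup, ?_⟩, ?_⟩
  · rw [forest_leaves_map]
    exact h.1.seq_perm.trans (hp.flatMap_right _)
  · intro r E F hE hF
    have : ∀ {F G : List (OTree 𝒜 X)}, F.Perm G → ∀ E, Forest.Sw F E →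
        ∃ E', Forest.Sw G E' ∧ E.Perm E' := by
      intro F G hp
      induction hp with
      | nil => exact fun E h => ⟨E, h, List.Perm.refl _⟩
      | cons t _ ih =>
        rintro _ ⟨r, E₁, E₂, h₁, h₂, rfl⟩
        obtain ⟨E', h', hp'⟩ := ih _ h₂
        exact ⟨_, ⟨r, E₁, E', h₁, h', rfl⟩, hp'.append_left _⟩
      | swap s t F =>
        rintro _ ⟨r, E₁, _, h₁, ⟨r', E₂, E₃, h₂, h₃, rfl⟩, rfl⟩
        refine ⟨_, ⟨r', E₂, _, h₂, ⟨r, E₁, E₃, h₁, h₃, rfl⟩, rfl⟩, ?_⟩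
        simp only [perm_iff_coe_eq, ← Multiset.coe_add]
        abel
      | trans _ _ ih ih' =>
        intro E h
        obtain ⟨E', h', hp'⟩ := ih E h
        obtain ⟨E'', h'', hp''⟩ := ih' E' h'
        exact ⟨E'', h'', hp'.trans hp''⟩
    obtain ⟨F', hF', hp'⟩ := this (hp.symm.map Item.toTree) F hF
    exact (h.2 r E F' hE hF').perm (hp'.symm.append_left E)

theorem good_par_iff {P : Linking 𝒜 X} {s t : OTree 𝒜 X} :
    Good P (.formula (.par s t) :: Γ) ↔ Good P (.formula s :: .formula t :: Γ) := by
  have hl : seqLeaves (Item.formula (.par s t) :: Γ) =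
      seqLeaves (Item.formula s :: Item.formula t :: Γ) := by
    simp [seqLeaves_cons, Item.toTree, OTree.leaves]
  constructor
  · rintro ⟨hv, hc⟩
    refine ⟨⟨fun i hi => ?_, hv.nodup, ?_⟩, ?_⟩
    · rcases List.mem_cons.1 hi with rfl | hi
      · trivial
      · rcases List.mem_cons.1 hi with rfl | hi
        · trivial
        · exact hv.wellFormed i (List.mem_cons_of_mem _ hi)
    · rw [forest_leaves_map, ← hl]; exact hv.seq_perm
    · rintro r E _ hE ⟨r₁, E₁, _, h₁, ⟨r₂, E₂, F, h₂, hF, rfl⟩, rfl⟩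
      have := hc r E _ hE ⟨r₁, _, F, ⟨r₁, E₁, r₂, E₂, h₁, h₂, Or.inl rfl, rfl⟩, hF, rfl⟩
      simpa only [List.append_assoc] using this
  · rintro ⟨hv, hc⟩
    refine ⟨⟨fun i hi => ?_, hv.nodup, ?_⟩, ?_⟩
    · rcases List.mem_cons.1 hi with rfl | hi
      · trivial
      · exact hv.wellFormed i (List.mem_cons_of_mem _ (List.mem_cons_of_mem _ hi))
    · rw [forest_leaves_map, hl]; exact hv.seq_perm
    · rintro r E _ hE ⟨_, _, F, ⟨r₁, E₁, r₂, E₂, h₁, h₂, -, rfl⟩, hF, rfl⟩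
      have := hc r E _ hE ⟨r₁, E₁, _, h₁, ⟨r₂, E₂, F, h₂, hF, rfl⟩, rfl⟩
      simpa only [List.append_assoc] using this

theorem Forest.sw_append {F G : List (OTree 𝒜 X)} {E : List (X × X)} (h : Forest.Sw (F ++ G) E) :
    ∃ E₁ E₂, Forest.Sw F E₁ ∧ Forest.Sw G E₂ ∧ E = E₁ ++ E₂ := by
  induction F generalizing E with
  | nil => exact ⟨[], E, rfl, h, rfl⟩
  | cons t F ih =>
    obtain ⟨r, E₁, E₂, h₁, h₂, rfl⟩ := h
    obtain ⟨E₃, E₄, h₃, h₄, rfl⟩ := ih h₂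
    exact ⟨_, E₄, ⟨r, E₁, E₃, h₁, h₃, rfl⟩, h₄, by simp⟩

theorem good_join {P Q : Linking 𝒜 X} {s t : OTree 𝒜 X} {i : Item 𝒜 X}
    (hi : i.toTree = .tens s t) (hiw : i.WellFormed) (hP : Good P (.formula s :: Γ))
    (hQ : Good Q (.formula t :: Δ)) (hd : List.Disjoint P.names Q.names) :
    Good (.par P Q) (i :: (Γ ++ Δ)) := by
  have hnames : (Linking.par P Q).names = P.names ++ Q.names := List.map_append
  refine ⟨⟨fun j hj => ?_, ?_, ?_⟩, ?_⟩
  · rcases List.mem_cons.1 hj with rfl | hj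
    · exact hiw
    · rcases List.mem_append.1 hj with hj | hj
      · exact hP.1.wellFormed j (List.mem_cons_of_mem _ hj)
      · exact hQ.1.wellFormed j (List.mem_cons_of_mem _ hj)
  · rw [hnames]
    exact hP.1.nodup.append hQ.1.nodup hd
  · rw [forest_leaves_map]
    have h1 := hP.1.seq_perm.append hQ.1.seq_perm
    refine h1.trans ?_
    have hs : (Item.formula s).toTree = s := rfl
    have ht : (Item.formula t).toTree = t := rfl
    simp only [seqLeaves_cons, seqLeaves_append, hi, hs, ht, OTree.leaves, perm_iff_coe_eq,
      ← Multiset.coe_add]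
    abel
  · rintro r _ F₀ ⟨r₁, E₁, r₂, E₂, hE₁, hE₂, -, rfl⟩ hF₀
    rw [List.map_cons, hi] at hF₀
    obtain ⟨p, _, F, ⟨S, q, T, hs, ht, rfl⟩, hF, rfl⟩ := hF₀
    rw [List.map_append] at hF
    obtain ⟨F₁, F₂, hF₁, hF₂, rfl⟩ := Forest.sw_append hF
    have hp : p ∈ P.names := by
      rw [hP.1.mem_names, seqLeaves_cons, List.map_append, List.mem_append]
      exact Or.inl hs.mem.1
    have hq : q ∈ Q.names := by
      rw [hQ.1.mem_names, seqLeaves_cons, List.map_append, List.mem_append]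
      exact Or.inl ht.mem.1
    rw [hnames, List.toFinset_append]
    refine ((hP.2 r₁ E₁ _ hE₁ ⟨p, S, F₁, hs, hF₁, rfl⟩).join
      (hQ.2 r₂ E₂ _ hE₂ ⟨q, T, F₂, ht, hF₂, rfl⟩) ?_ (List.mem_toFinset.2 hp)
      (List.mem_toFinset.2 hq)).perm ?_
    · rw [Finset.disjoint_left]
      exact fun x hx hx' => hd (List.mem_toFinset.1 hx) (List.mem_toFinset.1 hx')
    · simp only [perm_iff_coe_eq, ← Multiset.coe_add, ← Multiset.cons_coe, ← Multiset.singleton_add]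
      abel

theorem Good.tens {P Q : Linking 𝒜 X} {s t : OTree 𝒜 X} (hP : Good P (.formula s :: Γ))
    (hQ : Good Q (.formula t :: Δ)) (hd : List.Disjoint P.names Q.names) :
    Good (.par P Q) (.formula (.tens s t) :: (Γ ++ Δ)) :=
  good_join rfl trivial hP hQ hd

theorem Good.cut {P Q : Linking 𝒜 X} {s t : OTree 𝒜 X} (hP : Good P (.formula s :: Γ))
    (hQ : Good Q (.formula t :: Δ)) (hd : List.Disjoint P.names Q.names)
    (hst : t.erase = s.erase.neg) : Good (.par P Q) (.cut s t :: (Γ ++ Δ)) :=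
  good_join (i := .cut s t) rfl hst hP hQ hd

theorem good_one (x : X) : Good (.one x : Linking 𝒜 X) [.formula (.leaf .one x)] := by
  refine ⟨⟨by simp [Item.WellFormed], by simp [Linking.names, Linking.toTree, OTree.leaves], by
    simp [Linking.leaves, Linking.toTree, Forest.leaves, Item.toTree]⟩, ?_⟩
  rintro r _ _ ⟨rfl, rfl⟩ ⟨r', _, _, ⟨rfl, rfl⟩, rfl, rfl⟩
  simpa [Linking.names, Linking.toTree, OTree.leaves] using treeOn_singleton _

theorem good_ax (a : 𝒜) {x y : X} (h : x ≠ y) :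
    Good (.ax a x y) [.formula (.leaf (.pos a) x), .formula (.leaf (.neg a) y)] := by
  refine ⟨⟨by simp [Item.WellFormed], by simp [Linking.names, Linking.toTree, OTree.leaves, h], by
    simp [Linking.leaves, Linking.toTree, OTree.leaves, Forest.leaves, Item.toTree]⟩, ?_⟩
  rintro r _ _ ⟨rfl, rfl⟩ ⟨r', _, _, ⟨rfl, rfl⟩, ⟨_, _, _, ⟨rfl, rfl⟩, rfl, rfl⟩, rfl⟩
  have := (treeOn_singleton _).join (treeOn_singleton _) (by simpa using h.symm)
    (Finset.mem_singleton_self _) (Finset.mem_singleton_self _)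
  simp only [Linking.names, Linking.toTree, OTree.leaves, List.append_nil] at this ⊢
  convert this using 1
  ext z
  simp [or_comm]

theorem Good.bot {P : Linking 𝒜 X} (hP : Good P Γ) {x : X} (hx : x ∉ P.names) :
    Good (.botTens x P) (.formula (.leaf .bot x) :: Γ) := by
  have hnames : (Linking.botTens x P).names = x :: P.names := rfl
  refine ⟨⟨fun j hj => ?_, ?_, ?_⟩, ?_⟩
  · rcases List.mem_cons.1 hj with rfl | hj
    · trivial
    · exact hP.1.wellFormed j hj
  · rw [hnames]
    exact List.nodup_cons.2 ⟨hx, hP.1.nodup⟩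
  · rw [forest_leaves_map, seqLeaves_cons]
    exact hP.1.seq_perm.append_left _
  · rintro r _ _ ⟨E, hE, rfl⟩ ⟨_, _, F', ⟨rfl, rfl⟩, hF, rfl⟩
    rw [hnames, List.toFinset_cons, Finset.insert_eq]
    exact (treeOn_singleton _).join (hP.2 r E _ hE hF) (by simpa using hx)
      (Finset.mem_singleton_self _) (List.mem_toFinset.2 hE.root_mem)

theorem Sim.eq_of_adjacent {T : Sort*} (Φ : Linking 𝒜 X → T)
    (hΦ : ∀ P P', Good P Γ → Good P' Γ → Adjacent P P' → Φ P = Φ P') {P P' : Linking 𝒜 X}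
    (hs : Sim Γ P P') (hP : Good P Γ) : Φ P = Φ P' := by
  have tr : ∀ {P P'}, Sim Γ P P' → Good P Γ → Good P' Γ := fun h hP =>
    ⟨hP.1.of_perm h.perm, (h.swCorrect_iff hP.1.nodup).1 hP.2⟩
  induction hs with
  | rel P P' h => exact hΦ P P' hP (tr h.sim hP) h.adjacent
  | refl => rfl
  | symm P P' h ih => exact (ih (tr (Sim.symm h) hP)).symm
  | trans P R P' h _ ih ih' => exact (ih hP).trans (ih' (tr h hP))

theorem Adjacent.map {P P' : Linking 𝒜 X} (h : Adjacent P P') (e : X → Y) :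
    Adjacent (P.map e) (P'.map e) := by
  obtain ⟨q, q', h⟩ := h
  refine ⟨e q, e q', fun n p hnp => ?_⟩
  rw [Linking.wires_map] at hnp
  obtain ⟨⟨m, o⟩, hmo, heq⟩ := List.mem_map.1 hnp
  obtain ⟨rfl, rfl⟩ := Prod.mk.inj heq
  rw [Linking.wires_map, Linking.leaves_map]
  rcases h m o hmo with h | ⟨h1, rfl, h2⟩
  · exact Or.inl (List.mem_map.2 ⟨_, h, rfl⟩)
  · exact Or.inr ⟨List.mem_map.2 ⟨_, h1, rfl⟩, rfl, List.mem_map.2 ⟨_, h2, rfl⟩⟩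

theorem Adjacent.par_left {P P' : Linking 𝒜 X} (h : Adjacent P P') (Q : Linking 𝒜 X) :
    Adjacent (.par P Q) (.par P' Q) := by
  obtain ⟨q, q', h⟩ := h
  refine ⟨q, q', fun n p hnp => ?_⟩
  rcases List.mem_append.1 hnp with hnp | hnp
  · rcases h n p hnp with h | ⟨h1, rfl, h2⟩
    · exact Or.inl (List.mem_append_left _ h)
    · exact Or.inr ⟨List.mem_append_left _ h1, rfl, List.mem_append_left _ h2⟩
  · exact Or.inl (List.mem_append_right _ hnp)

theorem Adjacent.par_right {P P' : Linking 𝒜 X} (h : Adjacent P P') (Q : Linking 𝒜 X) :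
    Adjacent (.par Q P) (.par Q P') := by
  obtain ⟨q, q', h⟩ := h
  refine ⟨q, q', fun n p hnp => ?_⟩
  rcases List.mem_append.1 hnp with hnp | hnp
  · exact Or.inl (List.mem_append_left _ hnp)
  · rcases h n p hnp with h | ⟨h1, rfl, h2⟩
    · exact Or.inl (List.mem_append_right _ h)
    · exact Or.inr ⟨List.mem_append_right _ h1, rfl, List.mem_append_right _ h2⟩

end Renaming


section Leaves

variable {𝒜 : Type u} {X : Type v} {Y : Type w}

namespace Formula

/-- The decoration of a leaf. -/
def label : (A : Formula 𝒜) → A.Leaf → Lit 𝒜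
  | lit l => fun _ => l
  | tens A B => Sum.elim (label A) (label B)
  | par A B => Sum.elim (label A) (label B)

/-- The inverse of `dualLeaf`. -/
def undual : (A : Formula 𝒜) → A.neg.Leaf → A.Leaf
  | lit _ => fun _ => ()
  | tens A B => Sum.elim (fun y => Sum.inr (undual B y)) (fun x => Sum.inl (undual A x))
  | par A B => Sum.elim (fun y => Sum.inr (undual B y)) (fun x => Sum.inl (undual A x))

theorem undual_dualLeaf (A : Formula 𝒜) (x : A.Leaf) : A.undual (A.dualLeaf x) = x := by
  induction A with
  | lit l => rfl
  | tens A B ih ih' =>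
    rcases x with x | x
    · exact congrArg Sum.inl (ih x)
    · exact congrArg Sum.inr (ih' x)
  | par A B ih ih' =>
    rcases x with x | x
    · exact congrArg Sum.inl (ih x)
    · exact congrArg Sum.inr (ih' x)

theorem dualLeaf_undual (A : Formula 𝒜) (x : A.neg.Leaf) : A.dualLeaf (A.undual x) = x := by
  induction A with
  | lit l => rfl
  | tens A B ih ih' =>
    rcases x with x | x
    · exact congrArg Sum.inl (ih' x)
    · exact congrArg Sum.inr (ih x)
  | par A B ih ih' =>
    rcases x with x | x
    · exact congrArg Sum.inl (ih' x)
    · exact congrArg Sum.inr (ih x)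

theorem undual_injective (A : Formula 𝒜) : Function.Injective A.undual :=
  Function.LeftInverse.injective (g := A.dualLeaf) A.dualLeaf_undual

theorem label_neg (A : Formula 𝒜) (x : A.neg.Leaf) : A.neg.label x = (A.label (A.undual x)).dual := by
  induction A with
  | lit l => rfl
  | tens A B ih ih' =>
    rcases x with x | x
    · exact ih' x
    · exact ih x
  | par A B ih ih' =>
    rcases x with x | x
    · exact ih' x
    · exact ih x

theorem mem_leaves_inl {X Y : Type*} (s : OTree 𝒜 X) (t : OTree 𝒜 Y) (l : Lit 𝒜) (x : X) :
    (l, Sum.inl x) ∈ (s.map (Sum.inl : X → X ⊕ Y)).leaves ++ (t.map Sum.inr).leaves ↔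
      (l, x) ∈ s.leaves := by
  simp [OTree.leaves_map]

theorem mem_leaves_inr {X Y : Type*} (s : OTree 𝒜 X) (t : OTree 𝒜 Y) (l : Lit 𝒜) (y : Y) :
    (l, Sum.inr y) ∈ (s.map (Sum.inl : X → X ⊕ Y)).leaves ++ (t.map Sum.inr).leaves ↔
      (l, y) ∈ t.leaves := by
  simp [OTree.leaves_map]

theorem mem_leaves_tree (A : Formula 𝒜) (l : Lit 𝒜) (x : A.Leaf) :
    (l, x) ∈ A.tree.leaves ↔ l = A.label x := by
  induction A with
  | lit m =>
    have h : ((l, ()) : Lit 𝒜 × Unit) ∈ [(m, ())] ↔ l = m := by simp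
    exact h
  | tens A B ih ih' =>
    rcases x with x | x
    · exact (mem_leaves_inl _ _ _ _).trans (ih x)
    · exact (mem_leaves_inr _ _ _ _).trans (ih' x)
  | par A B ih ih' =>
    rcases x with x | x
    · exact (mem_leaves_inl _ _ _ _).trans (ih x)
    · exact (mem_leaves_inr _ _ _ _).trans (ih' x)

theorem erase_tree (A : Formula 𝒜) : A.tree.erase = A := by
  induction A with
  | lit m => rfl
  | tens A B ih ih' =>
    exact congrArg₂ tens ((OTree.erase_map _ _).trans ih) ((OTree.erase_map _ _).trans ih')
  | par A B ih ih' =>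
    exact congrArg₂ par ((OTree.erase_map _ _).trans ih) ((OTree.erase_map _ _).trans ih')

theorem tree_neg_neg (A : Formula 𝒜) :
    A.neg.neg.tree = A.tree.map fun x => A.neg.dualLeaf (A.dualLeaf x) := by
  induction A with
  | lit m => cases m <;> rfl
  | tens A B ih ih' =>
    exact congrArg₂ OTree.tens
      ((congrArg (OTree.map Sum.inl) ih).trans ((OTree.map_map _ _ _).trans
        (OTree.map_map (Sum.inl : A.Leaf → A.Leaf ⊕ B.Leaf)
          (fun x => (tens A B).neg.dualLeaf ((tens A B).dualLeaf x)) _).symm))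
      ((congrArg (OTree.map Sum.inr) ih').trans ((OTree.map_map _ _ _).trans
        (OTree.map_map (Sum.inr : B.Leaf → A.Leaf ⊕ B.Leaf)
          (fun x => (tens A B).neg.dualLeaf ((tens A B).dualLeaf x)) _).symm))
  | par A B ih ih' =>
    exact congrArg₂ OTree.par
      ((congrArg (OTree.map Sum.inl) ih).trans ((OTree.map_map _ _ _).trans
        (OTree.map_map (Sum.inl : A.Leaf → A.Leaf ⊕ B.Leaf)
          (fun x => (par A B).neg.dualLeaf ((par A B).dualLeaf x)) _).symm))
      ((congrArg (OTree.map Sum.inr) ih').trans ((OTree.map_map _ _ _).trans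
        (OTree.map_map (Sum.inr : B.Leaf → A.Leaf ⊕ B.Leaf)
          (fun x => (par A B).neg.dualLeaf ((par A B).dualLeaf x)) _).symm))

end Formula

theorem mem_cutPairs_tree (A : Formula 𝒜) (d : A.Leaf → X) (e : A.neg.Leaf → X) (x y : X) :
    (x, y) ∈ cutPairs (A.tree.map d) (A.neg.tree.map e) ↔
      ∃ a, (¬ (A.label a).IsNeg ∧ x = d a ∧ y = e (A.dualLeaf a)) ∨
        ((A.label a).IsNeg ∧ x = e (A.dualLeaf a) ∧ y = d a) := by
  induction A with
  | lit l =>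
    have : ∀ p : (Formula.lit l).Leaf → Prop, (∃ a, p a) ↔ p () :=
      fun p => ⟨fun ⟨a, h⟩ => h, fun h => ⟨_, h⟩⟩
    rw [this]
    by_cases hl : l.IsNeg <;>
      simp [Formula.tree, Formula.neg, OTree.map, cutPairs, Formula.label, Formula.dualLeaf, hl]
  | tens A B ih ih' =>
    have h : cutPairs ((Formula.tens A B).tree.map d) ((Formula.tens A B).neg.tree.map e) =
        cutPairs (A.tree.map (d ∘ Sum.inl)) (A.neg.tree.map (e ∘ Sum.inr)) ++
          cutPairs (B.tree.map (d ∘ Sum.inr)) (B.neg.tree.map (e ∘ Sum.inl)) :=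
      congrArg₂ (· ++ ·) (congrArg₂ cutPairs (OTree.map_map _ _ _) (OTree.map_map _ _ _))
        (congrArg₂ cutPairs (OTree.map_map _ _ _) (OTree.map_map _ _ _))
    rw [h, List.mem_append, ih, ih']
    exact (Sum.exists (p := fun a : A.Leaf ⊕ B.Leaf =>
      (¬ ((Formula.tens A B).label a).IsNeg ∧ x = d a ∧ y = e ((Formula.tens A B).dualLeaf a)) ∨
        (((Formula.tens A B).label a).IsNeg ∧ x = e ((Formula.tens A B).dualLeaf a) ∧ y = d a))).symm
  | par A B ih ih' =>
    have h : cutPairs ((Formula.par A B).tree.map d) ((Formula.par A B).neg.tree.map e) =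
        cutPairs (A.tree.map (d ∘ Sum.inl)) (A.neg.tree.map (e ∘ Sum.inr)) ++
          cutPairs (B.tree.map (d ∘ Sum.inr)) (B.neg.tree.map (e ∘ Sum.inl)) :=
      congrArg₂ (· ++ ·) (congrArg₂ cutPairs (OTree.map_map _ _ _) (OTree.map_map _ _ _))
        (congrArg₂ cutPairs (OTree.map_map _ _ _) (OTree.map_map _ _ _))
    rw [h, List.mem_append, ih, ih']
    exact (Sum.exists (p := fun a : A.Leaf ⊕ B.Leaf =>
      (¬ ((Formula.par A B).label a).IsNeg ∧ x = d a ∧ y = e ((Formula.par A B).dualLeaf a)) ∨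
        (((Formula.par A B).label a).IsNeg ∧ x = e ((Formula.par A B).dualLeaf a) ∧ y = d a))).symm

end Leaves

section Arrows

variable {𝒜 : Type u} {X : Type v} {A B C D A' B' : Formula 𝒜}

theorem seqLeaves_seq₂ (A B : Formula 𝒜) : seqLeaves (seq₂ A B) =
    A.tree.leaves.map (Prod.map id Sum.inl) ++ B.tree.leaves.map (Prod.map id Sum.inr) := by
  simp [seq₂, seqLeaves, Item.toTree, OTree.leaves_map]

/-- Good linkings for the sequent `A^⊥, B`. -/
abbrev GoodFor (A B : Formula 𝒜) (P : Linking 𝒜 (A.neg.Leaf ⊕ B.Leaf)) : Prop :=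
  Good P (seq₂ A.neg B)

theorem GoodFor.mem_leaves {P : Linking 𝒜 (A.neg.Leaf ⊕ B.Leaf)} (h : GoodFor A B P) (l : Lit 𝒜)
    (x : A.neg.Leaf ⊕ B.Leaf) :
    (l, x) ∈ P.leaves ↔ l = Sum.elim A.neg.label B.label x := by
  rw [h.1.seq_perm.mem_iff, seqLeaves_seq₂]
  rcases x with x | x <;> simp [← Formula.mem_leaves_tree]

/-- The arrow given by a correct pre-proof graph. -/
def Hom.ofGood {P : Linking 𝒜 (A.neg.Leaf ⊕ B.Leaf)} (h : GoodFor A B P) : Hom A B :=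
  ⟨h.1.graph.toNet, h.1.graph, rfl, rfl, h.1.correct_iff.2 h.2⟩

theorem Hom.ofGood_rep {P : Linking 𝒜 (A.neg.Leaf ⊕ B.Leaf)} (h : GoodFor A B P) :
    (Hom.ofGood h).Rep P :=
  ⟨h.1.graph, rfl, rfl, rfl⟩

theorem Hom.Rep.good {f : Hom A B} {P : Linking 𝒜 (A.neg.Leaf ⊕ B.Leaf)} (h : f.Rep P) :
    GoodFor A B P := by
  obtain ⟨G, hG, rfl, hs⟩ := h
  obtain ⟨H, hH, hs', hc⟩ := f.2
  have hsim := (sim_of_toNet_eq (hH.trans hG.symm)).2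
  have h1 := (PreGraph.correct_iff H).1 hc
  have h2 := (hsim.swCorrect_iff H.valid.nodup).1 h1
  rw [hs'] at h2
  exact ⟨hs ▸ G.valid, h2⟩

theorem Hom.Rep.eq_ofGood {f : Hom A B} {P : Linking 𝒜 (A.neg.Leaf ⊕ B.Leaf)} (h : f.Rep P) :
    f = Hom.ofGood h.good := by
  obtain ⟨G, hG, hl, hs⟩ := id h
  refine Subtype.ext (hG.symm.trans ?_)
  show G.toNet = h.good.1.graph.toNet
  congr 1
  cases G
  cases hl
  cases hs
  rfl

theorem Hom.exists_rep (f : Hom A B) : ∃ P, f.Rep P := by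
  obtain ⟨G, hG, hs, -⟩ := f.2
  exact ⟨G.link, G, hG, rfl, hs⟩

theorem Hom.ofGood_eq_iff {P Q : Linking 𝒜 (A.neg.Leaf ⊕ B.Leaf)} (hP : GoodFor A B P)
    (hQ : GoodFor A B Q) : Hom.ofGood hP = Hom.ofGood hQ ↔ Sim (seq₂ A.neg B) P Q := by
  constructor
  · intro h
    exact (sim_of_toNet_eq (congrArg Subtype.val h)).2
  · intro h
    exact Subtype.ext (h.toNet_eq hP.1 hQ.1)

theorem Hom.Rep.sim {f : Hom A B} {P Q : Linking 𝒜 (A.neg.Leaf ⊕ B.Leaf)} (h : f.Rep P)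
    (h' : f.Rep Q) : Sim (seq₂ A.neg B) P Q :=
  (Hom.ofGood_eq_iff h.good h'.good).1 (h.eq_ofGood.symm.trans h'.eq_ofGood)

theorem Hom.eq_of_adjacent {f g : Hom A B} {P Q : Linking 𝒜 (A.neg.Leaf ⊕ B.Leaf)} (h : f.Rep P)
    (h' : g.Rep Q) (hA : Adjacent P Q) : f = g := by
  rw [h.eq_ofGood, h'.eq_ofGood, Hom.ofGood_eq_iff]
  exact hA.sim h.good.1 h'.good.1 h.good.2 h'.good.2

/-- An operation on good linkings that respects adjacency induces an operation on arrows. -/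
theorem Hom.lift (Φ : Linking 𝒜 (A.neg.Leaf ⊕ B.Leaf) → Linking 𝒜 (C.neg.Leaf ⊕ D.Leaf))
    (hg : ∀ P, GoodFor A B P → GoodFor C D (Φ P))
    (ha : ∀ P P', GoodFor A B P → GoodFor A B P' → Adjacent P P' → Adjacent (Φ P) (Φ P'))
    (f : Hom A B) : ∃ g : Hom C D, ∀ P, f.Rep P → g.Rep (Φ P) := by
  obtain ⟨P, hP⟩ := f.exists_rep
  refine ⟨Hom.ofGood (hg P hP.good), fun Q hQ => ?_⟩
  let Ψ (P : Linking 𝒜 (A.neg.Leaf ⊕ B.Leaf)) : Option (Hom C D) :=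
    if h : GoodFor A B P then some (Hom.ofGood (hg P h)) else none
  have key := (hP.sim hQ).eq_of_adjacent Ψ (fun P P' h h' hA => by
    simp only [Ψ, dif_pos h, dif_pos h']
    exact congrArg some (Hom.eq_of_adjacent (Hom.ofGood_rep _) (Hom.ofGood_rep _)
      (ha P P' h h' hA))) hP.good
  simp only [Ψ, dif_pos hP.good, dif_pos hQ.good] at key
  rw [Option.some.inj key]
  exact Hom.ofGood_rep _

/-- The version of `Hom.lift` for two arguments. -/
theorem Hom.lift₂ (Φ : Linking 𝒜 (A.neg.Leaf ⊕ B.Leaf) → Linking 𝒜 (A'.neg.Leaf ⊕ B'.Leaf) →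
      Linking 𝒜 (C.neg.Leaf ⊕ D.Leaf))
    (hg : ∀ P Q, GoodFor A B P → GoodFor A' B' Q → GoodFor C D (Φ P Q))
    (ha : ∀ P P' Q, GoodFor A B P → GoodFor A B P' → GoodFor A' B' Q → Adjacent P P' →
      Adjacent (Φ P Q) (Φ P' Q))
    (ha' : ∀ P Q Q', GoodFor A B P → GoodFor A' B' Q → GoodFor A' B' Q' → Adjacent Q Q' →
      Adjacent (Φ P Q) (Φ P Q'))
    (f : Hom A B) (g : Hom A' B') :
    ∃ h : Hom C D, ∀ P Q, f.Rep P → g.Rep Q → h.Rep (Φ P Q) := by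
  obtain ⟨Q, hQ⟩ := g.exists_rep
  obtain ⟨P, hP⟩ := f.exists_rep
  obtain ⟨h, hh⟩ := Hom.lift (fun P => Φ P Q) (fun P hP => hg P Q hP hQ.good)
    (fun P P' hP hP' => ha P P' Q hP hP' hQ.good) f
  refine ⟨h, fun P' Q' hP' hQ' => ?_⟩
  obtain ⟨k, hk⟩ := Hom.lift (Φ P') (fun Q hQ => hg P' Q hP'.good hQ)
    (fun Q Q' hQ hQ' => ha' P' Q Q' hP'.good hQ hQ') g
  rw [(hh P' hP').eq_ofGood, ← (hk Q hQ).eq_ofGood]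
  exact hk Q' hQ'

end Arrows


section Composition

variable {𝒜 : Type u} {A B C D : Formula 𝒜}

theorem good_cutSeq {P : Linking 𝒜 (A.neg.Leaf ⊕ B.Leaf)} {Q : Linking 𝒜 (B.neg.Leaf ⊕ C.Leaf)}
    (hP : GoodFor A B P) (hQ : GoodFor B C Q) :
    Good (.par (P.map Sum.inl) (Q.map Sum.inr)) (cutSeq A B C) := by
  have h1 := hP.map (Sum.inl : _ → CutLeaf A B C) (fun x _ y _ h => Sum.inl.inj h)
  have h2 := hQ.map (Sum.inr : _ → CutLeaf A B C) (fun x _ y _ h => Sum.inr.inj h)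
  simp only [seq₂, List.map_cons, List.map_nil, Item.map, OTree.map_map] at h1 h2
  refine ((h1.perm (List.Perm.swap _ _ _)).cut h2 ?_ ?_).perm (List.Perm.swap _ _ _)
  · intro x hx hx'
    rw [Linking.names_map] at hx hx'
    obtain ⟨y, -, rfl⟩ := List.mem_map.1 hx
    obtain ⟨z, -, h⟩ := List.mem_map.1 hx'
    cases h
  · rw [OTree.erase_map, OTree.erase_map, Formula.erase_tree, Formula.erase_tree]

theorem formulas_cutSeq (A B C : Formula 𝒜) :
    formulas (cutSeq A B C) = (seq₂ A.neg C).map (Item.map (outer A B C)) := by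
  have h : formulas (cutSeq A B C) =
      [Item.formula (A.neg.tree.map fun x => Sum.inl (Sum.inl x)),
        Item.formula (C.tree.map fun x => Sum.inr (Sum.inr x))] := by
    have hf : ∀ t : OTree 𝒜 (CutLeaf A B C), (Item.formula t).IsFormula := fun _ => trivial
    have hc : ∀ s t : OTree 𝒜 (CutLeaf A B C), ¬ (Item.cut s t).IsFormula := fun _ _ => id
    simp [formulas, cutSeq, hf, hc]
  rw [h]
  simp only [seq₂, List.map_cons, List.map_nil, Item.map, OTree.map_map]
  rfl

theorem outer_injective (A B C : Formula 𝒜) : Function.Injective (outer A B C) :=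
  Function.Injective.sumMap Sum.inl_injective Sum.inr_injective

theorem Good.of_map {X Y : Type*} {P : Linking 𝒜 Y} {Γ : List (Item 𝒜 X)} {e : X → Y}
    (he : Function.Injective e) (h : Good P (Γ.map (Item.map e))) :
    ∃ R : Linking 𝒜 X, R.map e = P ∧ Good R Γ := by
  have hr : ∀ x ∈ P.names, ∃ y, e y = x := by
    intro x hx
    rw [h.1.mem_names, seqLeaves_map, List.map_map] at hx
    obtain ⟨l, -, hl⟩ := List.mem_map.1 hx
    exact ⟨l.2, hl⟩
  have : Nonempty X := by
    obtain ⟨l, -, hl⟩ := P.lead_mem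
    obtain ⟨y, -⟩ := hr _ (List.mem_map.2 ⟨_, hl, rfl⟩)
    exact ⟨y⟩
  have hinv := Function.leftInverse_invFun he
  have hinv' : ∀ x ∈ P.names, e (Function.invFun e x) = x := by
    intro x hx
    obtain ⟨y, rfl⟩ := hr x hx
    rw [hinv y]
  refine ⟨P.map (Function.invFun e), ?_, ?_⟩
  · rw [Linking.map_map]
    exact P.map_id_of hinv'
  · have h' := h.map (Function.invFun e) (fun x hx y hy hxy => by
      rw [← hinv' x hx, ← hinv' y hy, hxy])
    rw [List.map_map] at h'
    convert h'
    refine (List.map_id' _).symm.trans (List.map_congr_left fun i _ => ?_)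
    have hid : (fun x => Function.invFun e (e x)) = fun x : X => x := funext hinv
    cases i <;> simp [Item.map, OTree.map_map, hid, OTree.map_id]

/-- The composite of two linkings. -/
theorem exists_compLink {P : Linking 𝒜 (A.neg.Leaf ⊕ B.Leaf)}
    {Q : Linking 𝒜 (B.neg.Leaf ⊕ C.Leaf)} (hP : GoodFor A B P) (hQ : GoodFor B C Q) :
    ∃ R, GoodFor A C R ∧
      IsNormal (.par (P.map Sum.inl) (Q.map Sum.inr)) (cutSeq A B C) (R.map (outer A B C)) := by
  have hg := good_cutSeq hP hQ
  obtain ⟨H, hH, -⟩ := exists_isNormal hg.1 hg.2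
  have hgood : Good H ((seq₂ A.neg C).map (Item.map (outer A B C))) := by
    rw [← formulas_cutSeq]
    exact ⟨hH.valid, hH.correct⟩
  obtain ⟨R, rfl, hR⟩ := hgood.of_map (outer_injective A B C)
  exact ⟨R, hR, hH⟩

theorem Adjacent.of_map {X Y : Type*} {P Q : Linking 𝒜 X} {e : X → Y} (he : Function.Injective e)
    (h : Adjacent (P.map e) (Q.map e)) : Adjacent P Q := by
  have hmem : ∀ (P : Linking 𝒜 X) a b, (e a, e b) ∈ (P.map e).wires ↔ (a, b) ∈ P.wires := by
    intro P a b
    rw [Linking.wires_map]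
    exact List.mem_map_of_injective (Function.Injective.prodMap he he) (a := (a, b))
  obtain ⟨q, q', h⟩ := h
  have : Nonempty X := ⟨P.lead⟩
  refine ⟨Function.invFun e q, Function.invFun e q', fun n p hnp => ?_⟩
  rcases h _ _ ((hmem _ _ _).2 hnp) with h | ⟨h1, rfl, h2⟩
  · exact Or.inl ((hmem _ _ _).1 h)
  · rw [Function.leftInverse_invFun he]
    refine Or.inr ⟨?_, rfl, ?_⟩
    · rw [Linking.leaves_map] at h1
      obtain ⟨⟨l, x⟩, h1, h3⟩ := List.mem_map.1 h1
      obtain ⟨rfl, h4⟩ := Prod.mk.inj h3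
      rwa [he h4] at h1
    · rw [Linking.wires_map] at h2
      obtain ⟨⟨a, b⟩, h5, h3⟩ := List.mem_map.1 h2
      obtain ⟨h4, rfl⟩ := Prod.mk.inj h3
      rw [Function.leftInverse_invFun he, ← he h4]
      exact h5

/-- A linking is a composite of `P` and `Q` if it results from eliminating the cut. -/
def IsCompLink (P : Linking 𝒜 (A.neg.Leaf ⊕ B.Leaf)) (Q : Linking 𝒜 (B.neg.Leaf ⊕ C.Leaf))
    (R : Linking 𝒜 (A.neg.Leaf ⊕ C.Leaf)) : Prop :=
  GoodFor A C R ∧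
    IsNormal (.par (P.map Sum.inl) (Q.map Sum.inr)) (cutSeq A B C) (R.map (outer A B C))

theorem exists_comp (f : Hom A B) (g : Hom B C) : ∃ h : Hom A C,
    ∀ P Q, f.Rep P → g.Rep Q → ∃ R, h.Rep R ∧ IsCompLink P Q R := by
  obtain ⟨P₀, hP₀⟩ := f.exists_rep
  obtain ⟨Q₀, hQ₀⟩ := g.exists_rep
  obtain ⟨R₀, -⟩ := exists_compLink hP₀.good hQ₀.good
  let Φ (P : Linking 𝒜 (A.neg.Leaf ⊕ B.Leaf)) (Q : Linking 𝒜 (B.neg.Leaf ⊕ C.Leaf)) :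
      Linking 𝒜 (A.neg.Leaf ⊕ C.Leaf) :=
    if h : ∃ R, IsCompLink P Q R then h.choose else R₀
  have hΦ : ∀ P Q, GoodFor A B P → GoodFor B C Q → IsCompLink P Q (Φ P Q) := by
    intro P Q hP hQ
    have h : ∃ R, IsCompLink P Q R := exists_compLink hP hQ
    simp only [Φ, dif_pos h]
    exact h.choose_spec
  obtain ⟨h, hh⟩ := Hom.lift₂ Φ (fun P Q hP hQ => (hΦ P Q hP hQ).1)
    (fun P P' Q hP hP' hQ hA => Adjacent.of_map (outer_injective A B C)
      (((hA.map Sum.inl).par_left _).isNormal (good_cutSeq hP hQ).1 (good_cutSeq hP' hQ).1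
        (hΦ P Q hP hQ).2 (hΦ P' Q hP' hQ).2))
    (fun P Q Q' hP hQ hQ' hA => Adjacent.of_map (outer_injective A B C)
      (((hA.map Sum.inr).par_right _).isNormal (good_cutSeq hP hQ).1 (good_cutSeq hP hQ').1
        (hΦ P Q hP hQ).2 (hΦ P Q' hP hQ').2)) f g
  exact ⟨h, fun P Q hP hQ => ⟨_, hh P Q hP hQ, hΦ P Q hP.good hQ.good⟩⟩

/-- The composite of two arrows, by cut elimination. -/
noncomputable def Hom.comp (f : Hom A B) (g : Hom B C) : Hom A C := (exists_comp f g).choose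

theorem Hom.comp_spec (f : Hom A B) (g : Hom B C) {P : Linking 𝒜 (A.neg.Leaf ⊕ B.Leaf)}
    {Q : Linking 𝒜 (B.neg.Leaf ⊕ C.Leaf)} (hP : f.Rep P) (hQ : g.Rep Q) :
    ∃ R, (f.comp g).Rep R ∧ IsCompLink P Q R :=
  (exists_comp f g).choose_spec P Q hP hQ

theorem PreNet.Rep.eq_toNet {X : Type*} {N : PreNet 𝒜 X} {P : Linking 𝒜 X} {Γ : List (Item 𝒜 X)}
    (h : N.Rep P Γ) (hv : Valid P Γ) : N = hv.graph.toNet := by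
  obtain ⟨G, rfl, hl, hs⟩ := h
  congr 1
  cases G
  cases hl
  cases hs
  rfl

theorem Hom.isComposite_comp (f : Hom A B) (g : Hom B C) : IsComposite f g (f.comp g) := by
  intro P Q hP hQ
  have hg := good_cutSeq hP.good hQ.good
  obtain ⟨R, hR, hR', hN⟩ := f.comp_spec g hP hQ
  refine ⟨hg.1.graph.toNet, ⟨hg.1.graph, rfl, rfl, rfl⟩, fun M => ?_⟩
  rw [PreNet.normalForm_iff (hg.1.correct_iff.2 hg.2)]
  have hnorm : hg.1.graph.toNet.Normalizes hN.valid.graph.toNet :=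
    ⟨_, _, hg.1, _, hN, hg.2, rfl, rfl⟩
  have hval : ∀ R', GoodFor A C R' →
      Good (R'.map (outer A B C)) ((seq₂ A.neg C).map (Item.map (outer A B C))) :=
    fun R' h => h.map _ fun x _ y _ hxy => outer_injective A B C hxy
  have hnet : hN.valid.graph.toNet = (hval R hR').1.graph.toNet := by
    congr 1
    simp only [Valid.graph, formulas_cutSeq]
  constructor
  · intro hM
    refine ⟨R, hR, ?_⟩
    rw [hM.unique hnorm, hnet]
    exact ⟨_, rfl, rfl, rfl⟩
  · rintro ⟨R', hR'', hM⟩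
    obtain rfl := hM.eq_toNet (hval R' hR''.good).1
    convert hnorm using 1
    rw [hnet]
    let Ψ (R : Linking 𝒜 (A.neg.Leaf ⊕ C.Leaf)) : Option (PreNet 𝒜 (CutLeaf A B C)) :=
      if h : GoodFor A C R then some (hval R h).1.graph.toNet else none
    have key := (hR''.sim hR).eq_of_adjacent Ψ (fun R R' h h' hA => by
      simp only [Ψ, dif_pos h, dif_pos h']
      exact congrArg some (((hA.map _).sim (hval R h).1 (hval R' h').1 (hval R h).2
        (hval R' h').2).toNet_eq _ _)) hR''.good
    simp only [Ψ, dif_pos hR''.good, dif_pos hR'] at key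
    exact Option.some.inj key

end Composition


section Drawings

variable {𝒜 : Type u} {A B C D : Formula 𝒜} {Z : Type v}

/-- The decorations in `A^⊥, B`, the leaves of `A^⊥` being named by those of `A`. -/
def portLabel (A B : Formula 𝒜) : A.Leaf ⊕ B.Leaf → Lit 𝒜 :=
  Sum.elim (fun a => (A.label a).dual) B.label

/-- The names in `Z` of the leaves of `A^⊥, B`, where `A` and `B` are named by `e` and `d`. -/
def portMap (e : A.Leaf → Z) (d : B.Leaf → Z) : A.neg.Leaf ⊕ B.Leaf → Z :=
  Sum.elim (fun x => e (A.undual x)) d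

/-- `R` consists of the wires of a linking that represents `f`, when the leaves of the source and
the target of `f` are named by `e` and `d`. -/
def Draws (f : Hom A B) (e : A.Leaf → Z) (d : B.Leaf → Z) (R : Z → Z → Prop) : Prop :=
  ∃ P, f.Rep P ∧ ∀ x y, R x y ↔ (x, y) ∈ (P.map (portMap e d)).wires

theorem exists_draws (f : Hom A B) (e : A.Leaf → Z) (d : B.Leaf → Z) : ∃ R, Draws f e d R := by
  obtain ⟨P, hP⟩ := f.exists_rep
  exact ⟨_, P, hP, fun _ _ => Iff.rfl⟩

theorem Draws.congr {f : Hom A B} {e : A.Leaf → Z} {d : B.Leaf → Z} {R R' : Z → Z → Prop}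
    (h : Draws f e d R) (hR : ∀ x y, R' x y ↔ R x y) : Draws f e d R' := by
  obtain ⟨P, hP, h⟩ := h
  exact ⟨P, hP, fun x y => (hR x y).trans (h x y)⟩

theorem mem_wires_map {X Y : Type*} (P : Linking 𝒜 X) (m : X → Y) (x y : Y) :
    (x, y) ∈ (P.map m).wires ↔ ∃ p q, (p, q) ∈ P.wires ∧ x = m p ∧ y = m q := by
  rw [Linking.wires_map, List.mem_map]
  constructor
  · rintro ⟨⟨p, q⟩, h, h'⟩
    obtain ⟨rfl, rfl⟩ := Prod.mk.inj h'
    exact ⟨p, q, h, rfl, rfl⟩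
  · rintro ⟨p, q, h, rfl, rfl⟩
    exact ⟨(p, q), h, rfl⟩

/-- Every drawing of `f` is the image of a drawing in which all the leaves are distinct. -/
theorem Draws.exists_lift {f : Hom A B} {e : A.Leaf → Z} {d : B.Leaf → Z} {R : Z → Z → Prop}
    (h : Draws f e d R) : ∃ W, Draws f Sum.inl Sum.inr W ∧
      ∀ x y, R x y ↔ ∃ p q, W p q ∧ x = Sum.elim e d p ∧ y = Sum.elim e d q := by
  obtain ⟨P, hP, h⟩ := h
  refine ⟨_, ⟨P, hP, fun _ _ => Iff.rfl⟩, fun x y => ?_⟩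
  rw [h, ← mem_wires_map, Linking.map_map]
  have : (fun x => Sum.elim e d (portMap Sum.inl Sum.inr x)) = portMap e d := by
    funext x
    rcases x with x | x <;> rfl
  rw [this]

theorem Draws.push {Y : Type*} {f : Hom A B} {e : A.Leaf → Z} {d : B.Leaf → Z}
    {R : Z → Z → Prop} (h : Draws f e d R) (m : Z → Y) :
    Draws f (fun a => m (e a)) (fun b => m (d b)) fun x y => ∃ p q, R p q ∧ x = m p ∧ y = m q := by
  obtain ⟨P, hP, h⟩ := h
  refine ⟨P, hP, fun x y => ?_⟩
  have : portMap (fun a => m (e a)) (fun b => m (d b)) = fun x => m (portMap e d x) := by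
    funext x
    rcases x with x | x <;> rfl
  rw [this, ← Linking.map_map, mem_wires_map]
  simp only [h]

theorem portMap_eq (e : A.Leaf → Z) (d : B.Leaf → Z) (x : A.neg.Leaf ⊕ B.Leaf) :
    portMap e d x = Sum.elim e d (Sum.map A.undual id x) := by
  rcases x with x | x <;> rfl

theorem portLabel_undual (x : A.neg.Leaf ⊕ B.Leaf) :
    portLabel A B (Sum.map A.undual id x) = Sum.elim A.neg.label B.label x := by
  rcases x with x | x
  · exact (A.label_neg x).symm
  · rfl

theorem undual_port_surjective (p : A.Leaf ⊕ B.Leaf) : ∃ x, Sum.map A.undual id x = p := by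
  rcases p with a | b
  · exact ⟨Sum.inl (A.dualLeaf a), congrArg Sum.inl (A.undual_dualLeaf a)⟩
  · exact ⟨Sum.inr b, rfl⟩

theorem portMap_injective {e : A.Leaf → Z} {d : B.Leaf → Z}
    (hi : Function.Injective (Sum.elim e d)) : Function.Injective (portMap e d) := by
  intro x y h
  rw [portMap_eq, portMap_eq] at h
  exact Function.Injective.sumMap A.undual_injective Function.injective_id (hi h)

theorem Draws.types {f : Hom A B} {e : A.Leaf → Z} {d : B.Leaf → Z} {R : Z → Z → Prop}
    (h : Draws f e d R) {x y : Z} (hxy : R x y) : ∃ p q, x = Sum.elim e d p ∧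
      y = Sum.elim e d q ∧ (portLabel A B p).IsNeg ∧ ¬ (portLabel A B q).IsNeg := by
  obtain ⟨P, hP, h⟩ := h
  obtain ⟨p, q, hpq, rfl, rfl⟩ := (mem_wires_map _ _ _ _).1 ((h x y).1 hxy)
  obtain ⟨l, m, hl, hm, hl', hm', -⟩ := P.wires_types hpq
  refine ⟨_, _, portMap_eq _ _ _, portMap_eq _ _ _, ?_, ?_⟩
  · rwa [portLabel_undual, ← (hP.good.mem_leaves _ _).1 hl]
  · rwa [portLabel_undual, ← (hP.good.mem_leaves _ _).1 hm]

theorem Draws.unique {f : Hom A B} {e : A.Leaf → Z} {d : B.Leaf → Z} {R : Z → Z → Prop}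
    (h : Draws f e d R) (hi : Function.Injective (Sum.elim e d)) {x y z : Z} (hy : R x y)
    (hz : R x z) : y = z := by
  obtain ⟨P, hP, h⟩ := h
  obtain ⟨p, q, hpq, rfl, rfl⟩ := (mem_wires_map _ _ _ _).1 ((h x y).1 hy)
  obtain ⟨p', q', hpq', hp, rfl⟩ := (mem_wires_map _ _ _ _).1 ((h _ z).1 hz)
  obtain rfl := portMap_injective hi hp
  rw [Linking.wires_unique hP.good.1.nodup hpq hpq']

theorem Draws.of_subset {f : Hom A B} {e : A.Leaf → Z} {d : B.Leaf → Z} {R R' : Z → Z → Prop}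
    (h : Draws f e d R) (hi : Function.Injective (Sum.elim e d)) (hR : ∀ x y, R' x y → R x y)
    (ht : ∀ x y, R x y → ∃ z, R' x z) : Draws f e d R' := by
  refine h.congr fun x y => ⟨hR x y, fun hxy => ?_⟩
  obtain ⟨z, hz⟩ := ht x y hxy
  rwa [h.unique hi hxy (hR _ _ hz)]

/-- Arrows are equal if they have drawings that differ at most at one occurrence of `⊥`. -/
theorem Draws.ext_bot {f g : Hom A B} {e : A.Leaf → Z} {d : B.Leaf → Z} {R R' : Z → Z → Prop}
    (h : Draws f e d R) (h' : Draws g e d R') (hi : Function.Injective (Sum.elim e d))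
    {p : A.Leaf ⊕ B.Leaf} (hp : portLabel A B p = .bot)
    (hR : ∀ x y, R x y → x = Sum.elim e d p ∨ R' x y) : f = g := by
  have h₀ := id h
  obtain ⟨P, hP, h⟩ := h
  obtain ⟨Q, hQ, h'⟩ := h'
  obtain ⟨z, rfl⟩ := undual_port_surjective p
  rw [portLabel_undual] at hp
  have hb : (Lit.bot, z) ∈ P.leaves := (hP.good.mem_leaves _ z).2 hp.symm
  have hb' : (Lit.bot, z) ∈ Q.leaves := (hQ.good.mem_leaves _ z).2 hp.symm
  obtain ⟨q, hq⟩ := Linking.exists_wire (l := .bot) trivial hb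
  obtain ⟨q', hq'⟩ := Linking.exists_wire (l := .bot) trivial hb'
  have hinj := portMap_injective hi
  refine Hom.eq_of_adjacent hP hQ ⟨q, q', fun n p hnp => ?_⟩
  rcases hR _ _ ((h _ _).2 ((mem_wires_map _ _ _ _).2 ⟨n, p, hnp, rfl, rfl⟩)) with h1 | h1
  · rw [← portMap_eq] at h1
    obtain rfl := hinj h1
    exact Or.inr ⟨hb, Linking.wires_unique hP.good.1.nodup hnp hq, hq'⟩
  · obtain ⟨n', p', hnp', h2, h3⟩ := (mem_wires_map _ _ _ _).1 ((h' _ _).1 h1)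
    obtain rfl := hinj h2
    obtain rfl := hinj h3
    exact Or.inl hnp'

theorem Draws.ext {f g : Hom A B} {e : A.Leaf → Z} {d : B.Leaf → Z} {R R' : Z → Z → Prop}
    (h : Draws f e d R) (h' : Draws g e d R') (hi : Function.Injective (Sum.elim e d))
    (hR : ∀ x y, R x y → R' x y) : f = g := by
  obtain ⟨P, hP, h⟩ := h
  obtain ⟨Q, hQ, h'⟩ := h'
  have hinj := portMap_injective hi
  refine Hom.eq_of_adjacent hP hQ (Adjacent.of_subset fun n p hnp => ?_)
  obtain ⟨n', p', hnp', h2, h3⟩ := (mem_wires_map _ _ _ _).1 ((h' _ _).1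
    (hR _ _ ((h _ _).2 ((mem_wires_map _ _ _ _).2 ⟨n, p, hnp, rfl, rfl⟩))))
  obtain rfl := hinj h2
  obtain rfl := hinj h3
  exact hnp'

end Drawings

section Paths

/-- Paths whose steps are alternately in `W` and in `J` correspond to paths in the image of `W`
under a map that contracts the steps in `J`. -/
theorem transGen_contract {X Z : Type*} {W J : X → X → Prop} {m : X → Z} {N : X → Prop}
    (hW : ∀ x y, W x y → N x ∧ ¬ N y) (hJ : ∀ x y, J x y → ¬ N x ∧ m x = m y)
    (hJ' : ∀ x y, ¬ N x → N y → m x = m y → J x y)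
    (hm : ∀ x y, (N x ↔ N y) → m x = m y → x = y) {x y : X} (hx : N x) (hy : ¬ N y) :
    TransGen (fun x y => W x y ∨ J x y) x y ↔
      TransGen (fun u v => ∃ p q, W p q ∧ u = m p ∧ v = m q) (m x) (m y) := by
  constructor
  · intro h
    clear hy
    induction h with
    | single h =>
      rcases h with h | h
      · exact .single ⟨_, _, h, rfl, rfl⟩
      · exact absurd hx (hJ _ _ h).1
    | tail _ h ih =>
      rcases h with h | h
      · exact ih.tail ⟨_, _, h, rfl, rfl⟩
      · rwa [← (hJ _ _ h).2]
  · intro h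
    have key : ∀ v, TransGen (fun u v => ∃ p q, W p q ∧ u = m p ∧ v = m q) (m x) v →
        ∃ z, m z = v ∧ ¬ N z ∧ TransGen (fun x y => W x y ∨ J x y) x z := by
      intro v hv
      induction hv with
      | single h =>
        obtain ⟨p, q, hpq, hp, rfl⟩ := h
        have hp' := hW _ _ hpq
        obtain rfl := hm x p (iff_of_true hx hp'.1) hp
        exact ⟨q, rfl, hp'.2, .single (Or.inl hpq)⟩
      | tail _ h ih =>
        obtain ⟨z, rfl, hz, hxz⟩ := ih
        obtain ⟨p, q, hpq, hp, rfl⟩ := h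
        have hp' := hW _ _ hpq
        exact ⟨q, rfl, hp'.2, (hxz.tail (Or.inr (hJ' _ _ hz hp'.1 hp))).tail (Or.inl hpq)⟩
    obtain ⟨z, hz, hz', hxz⟩ := key _ h
    rwa [← hm z y (iff_of_false hz' hy) hz]

/-- Names that belong to the outer two of three formulas. -/
def Visible {X Y Z : Type*} (e : X → Z) (k : Y → Z) (z : Z) : Prop := ∃ p, z = Sum.elim e k p

/-- The composite of two drawings. -/
def compDraw {X Y Z : Type*} (e : X → Z) (k : Y → Z) (R : Z → Z → Prop) (x y : Z) : Prop :=
  Visible e k x ∧ Visible e k y ∧ TransGen R x y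

end Paths

section CompositeDrawing

variable {𝒜 : Type u} {A B C D : Formula 𝒜} {Z : Type v}

theorem isOuter_cutSeq (x : CutLeaf A B C) :
    IsOuter (cutSeq A B C) x ↔ ∃ z, x = outer A B C z := by
  constructor
  · rintro ⟨t, ht, hx⟩
    simp only [cutSeq, List.mem_cons, List.not_mem_nil, or_false, reduceCtorEq, false_or] at ht
    rcases ht with h | h
    · cases h
      rw [OTree.leaves_map, List.map_map] at hx
      obtain ⟨l, -, rfl⟩ := List.mem_map.1 hx
      exact ⟨Sum.inl l.2, rfl⟩
    · cases h
      rw [OTree.leaves_map, List.map_map] at hx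
      obtain ⟨l, -, rfl⟩ := List.mem_map.1 hx
      exact ⟨Sum.inr l.2, rfl⟩
  · rintro ⟨z, rfl⟩
    rcases z with z | z
    · refine ⟨_, List.mem_cons_self, ?_⟩
      rw [OTree.leaves_map, List.map_map]
      exact List.mem_map.2 ⟨_, (A.neg.mem_leaves_tree _ z).2 rfl, rfl⟩
    · refine ⟨_, List.mem_cons_of_mem _ (List.mem_cons_of_mem _ List.mem_cons_self), ?_⟩
      rw [OTree.leaves_map, List.map_map]
      exact List.mem_map.2 ⟨_, (C.mem_leaves_tree _ z).2 rfl, rfl⟩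

theorem mem_seqPairs_cutSeq (x y : CutLeaf A B C) :
    (x, y) ∈ seqPairs (cutSeq A B C) ↔
      ∃ b, (¬ (B.label b).IsNeg ∧ x = Sum.inl (Sum.inr b) ∧ y = Sum.inr (Sum.inl (B.dualLeaf b))) ∨
        ((B.label b).IsNeg ∧ x = Sum.inr (Sum.inl (B.dualLeaf b)) ∧ y = Sum.inl (Sum.inr b)) := by
  rw [← mem_cutPairs_tree B (fun b => (Sum.inl (Sum.inr b) : CutLeaf A B C))
    (fun b => Sum.inr (Sum.inl b))]
  simp [seqPairs, cutSeq, Item.pairs]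

theorem Draws.comp {f : Hom A B} {g : Hom B C} {e : A.Leaf → Z} {d : B.Leaf → Z} {k : C.Leaf → Z}
    {R R' : Z → Z → Prop} (hf : Draws f e d R) (hg : Draws g d k R')
    (hi : Function.Injective (Sum.elim e (Sum.elim d k))) :
    Draws (f.comp g) e k (compDraw e k fun x y => R x y ∨ R' x y) := by
  obtain ⟨P, hP, hR⟩ := hf
  obtain ⟨Q, hQ, hR'⟩ := hg
  obtain ⟨S, hS, -, hN⟩ := f.comp_spec g hP hQ
  refine ⟨S, hS, fun x y => ?_⟩
  let m : CutLeaf A B C → Z := Sum.elim (portMap e d) (portMap d k)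
  let lab : CutLeaf A B C → Lit 𝒜 :=
    Sum.elim (Sum.elim A.neg.label B.label) (Sum.elim B.neg.label C.label)
  let N : CutLeaf A B C → Prop := fun x => (lab x).IsNeg
  let W : CutLeaf A B C → CutLeaf A B C → Prop := fun x y =>
    (x, y) ∈ (Linking.par (P.map Sum.inl) (Q.map Sum.inr)).wires
  let J : CutLeaf A B C → CutLeaf A B C → Prop := fun x y => (x, y) ∈ seqPairs (cutSeq A B C)
  have hW : ∀ x y, W x y → N x ∧ ¬ N y := by
    intro x y h
    rcases List.mem_append.1 h with h | h
    · obtain ⟨p, q, hpq, rfl, rfl⟩ := (mem_wires_map _ _ _ _).1 h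
      obtain ⟨l, l', hl, hl', h1, h2, -⟩ := P.wires_types hpq
      rw [(hP.good.mem_leaves _ _).1 hl] at h1
      rw [(hP.good.mem_leaves _ _).1 hl'] at h2
      exact ⟨h1, h2⟩
    · obtain ⟨p, q, hpq, rfl, rfl⟩ := (mem_wires_map _ _ _ _).1 h
      obtain ⟨l, l', hl, hl', h1, h2, -⟩ := Q.wires_types hpq
      rw [(hQ.good.mem_leaves _ _).1 hl] at h1
      rw [(hQ.good.mem_leaves _ _).1 hl'] at h2
      exact ⟨h1, h2⟩
  have hlab : ∀ b, (lab (Sum.inr (Sum.inl (B.dualLeaf b)))).IsNeg ↔ ¬ (B.label b).IsNeg := by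
    intro b
    show (B.neg.label (B.dualLeaf b)).IsNeg ↔ _
    rw [B.label_neg, B.undual_dualLeaf, Lit.isNeg_dual]
  have hmid : ∀ b, m (Sum.inr (Sum.inl (B.dualLeaf b))) = d b := by
    intro b
    show d (B.undual (B.dualLeaf b)) = d b
    rw [B.undual_dualLeaf]
  have hmm : ∀ x y, m x = m y → x = y ∨ ∃ b,
      (x = Sum.inl (Sum.inr b) ∧ y = Sum.inr (Sum.inl (B.dualLeaf b))) ∨
        (x = Sum.inr (Sum.inl (B.dualLeaf b)) ∧ y = Sum.inl (Sum.inr b)) := by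
    have hA := A.undual_injective
    have hB := B.undual_injective
    rintro ((x | x) | (x | x)) ((y | y) | (y | y)) h
    · exact Or.inl (congrArg _ (congrArg _ (hA (Sum.inl.inj (@hi (.inl _) (.inl _) h)))))
    · cases @hi (.inl _) (.inr (.inl _)) h
    · cases @hi (.inl _) (.inr (.inl _)) h
    · cases @hi (.inl _) (.inr (.inr _)) h
    · cases @hi (.inr (.inl _)) (.inl _) h
    · exact Or.inl (congrArg _ (congrArg _
        (Sum.inl.inj (Sum.inr.inj (@hi (.inr (.inl _)) (.inr (.inl _)) h)))))
    · have := Sum.inl.inj (Sum.inr.inj (@hi (.inr (.inl _)) (.inr (.inl _)) h))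
      exact Or.inr ⟨x, Or.inl ⟨rfl, by rw [this, B.dualLeaf_undual]⟩⟩
    · cases @hi (.inr (.inl _)) (.inr (.inr _)) h
    · cases @hi (.inr (.inl _)) (.inl _) h
    · have := Sum.inl.inj (Sum.inr.inj (@hi (.inr (.inl _)) (.inr (.inl _)) h))
      exact Or.inr ⟨y, Or.inr ⟨by rw [← this, B.dualLeaf_undual], rfl⟩⟩
    · exact Or.inl (congrArg _ (congrArg _
        (hB (Sum.inl.inj (Sum.inr.inj (@hi (.inr (.inl _)) (.inr (.inl _)) h))))))
    · cases @hi (.inr (.inl _)) (.inr (.inr _)) h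
    · cases @hi (.inr (.inr _)) (.inl _) h
    · cases @hi (.inr (.inr _)) (.inr (.inl _)) h
    · cases @hi (.inr (.inr _)) (.inr (.inl _)) h
    · exact Or.inl (congrArg _ (congrArg _
        (Sum.inr.inj (Sum.inr.inj (@hi (.inr (.inr _)) (.inr (.inr _)) h)))))
  have hS' : (fun u v => ∃ p q, W p q ∧ u = m p ∧ v = m q) = fun x y => R x y ∨ R' x y := by
    funext u v
    refine propext ?_
    rw [← mem_wires_map, hR, hR']
    show (u, v) ∈ ((P.map Sum.inl).map m).wires ++ ((Q.map Sum.inr).map m).wires ↔ _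
    rw [List.mem_append, Linking.map_map, Linking.map_map]
    rfl
  have hcon := @transGen_contract _ _ W J m N hW
    (by
      intro x y h
      obtain ⟨b, ⟨hb, rfl, rfl⟩ | ⟨hb, rfl, rfl⟩⟩ := (mem_seqPairs_cutSeq x y).1 h
      · exact ⟨hb, (hmid b).symm⟩
      · exact ⟨fun h => (hlab b).1 h hb, hmid b⟩)
    (by
      intro x y hx hy h
      rcases hmm x y h with rfl | ⟨b, ⟨rfl, rfl⟩ | ⟨rfl, rfl⟩⟩
      · exact absurd hy hx
      · exact (mem_seqPairs_cutSeq _ _).2 ⟨b, Or.inl ⟨hx, rfl, rfl⟩⟩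
      · exact (mem_seqPairs_cutSeq _ _).2 ⟨b, Or.inr ⟨hy, rfl, rfl⟩⟩)
    (by
      intro x y hxy h
      rcases hmm x y h with rfl | ⟨b, ⟨rfl, rfl⟩ | ⟨rfl, rfl⟩⟩
      · rfl
      · exact absurd (hxy.trans (hlab b)) (by show ¬ ((B.label b).IsNeg ↔ _); tauto)
      · exact absurd ((hlab b).symm.trans hxy) (by show ¬ (_ ↔ (B.label b).IsNeg); tauto))
  rw [hS'] at hcon
  have hout : ∀ z, portMap e k z = m (outer A B C z) := by
    rintro (z | z) <;> rfl
  have hmout : ∀ z x, m (outer A B C z) = m x → outer A B C z = x := by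
    intro z x h
    rcases hmm _ _ h with h | ⟨b, ⟨h, -⟩ | ⟨h, -⟩⟩
    · exact h
    · rcases z with z | z <;> cases h
    · rcases z with z | z <;> cases h
  have hvis : ∀ z, Visible e k z ↔ ∃ p, z = m (outer A B C p) := by
    intro z
    constructor
    · rintro ⟨p, rfl⟩
      obtain ⟨x, rfl⟩ := undual_port_surjective p
      exact ⟨x, by rw [← hout, portMap_eq]⟩
    · rintro ⟨p, rfl⟩
      exact ⟨_, (hout p).symm.trans (portMap_eq _ _ _)⟩
  have hwire : ∀ p q, (p, q) ∈ S.wires ↔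
      Trace (.par (P.map Sum.inl) (Q.map Sum.inr)) (cutSeq A B C) (outer A B C p)
        (outer A B C q) := by
    intro p q
    rw [← hN.wires, Linking.wires_map]
    exact (List.mem_map_of_injective (Function.Injective.prodMap (outer_injective A B C)
      (outer_injective A B C)) (a := (p, q))).symm
  rw [mem_wires_map]
  constructor
  · rintro ⟨hx, hy, h⟩
    obtain ⟨p, rfl⟩ := (hvis x).1 hx
    obtain ⟨q, rfl⟩ := (hvis y).1 hy
    have hp : N (outer A B C p) := by
      obtain ⟨c, hc, -⟩ := TransGen.head'_iff.1 h
      have := congrFun (congrFun hS' (m (outer A B C p))) c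
      obtain ⟨p', q', hpq, hp', -⟩ := this.symm ▸ hc
      rw [hmout _ _ hp']
      exact (hW _ _ hpq).1
    have hq : ¬ N (outer A B C q) := by
      obtain ⟨c, -, hc⟩ := TransGen.tail'_iff.1 h
      have := congrFun (congrFun hS' c) (m (outer A B C q))
      obtain ⟨p', q', hpq, -, hq'⟩ := this.symm ▸ hc
      rw [hmout _ _ hq']
      exact (hW _ _ hpq).2
    exact ⟨p, q, (hwire p q).2 ⟨(isOuter_cutSeq _).2 ⟨p, rfl⟩, (isOuter_cutSeq _).2 ⟨q, rfl⟩,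
      (hcon hp hq).2 h⟩, (hout p).symm, (hout q).symm⟩
  · rintro ⟨p, q, hpq, rfl, rfl⟩
    obtain ⟨-, -, h⟩ := (hwire p q).1 hpq
    obtain ⟨l, l', hl, hl', h1, h2, -⟩ := S.wires_types hpq
    have hlabS : ∀ z, lab (outer A B C z) = Sum.elim A.neg.label C.label z := by
      rintro (z | z) <;> rfl
    rw [(hS.good.mem_leaves _ _).1 hl, ← hlabS] at h1
    rw [(hS.good.mem_leaves _ _).1 hl', ← hlabS] at h2
    rw [hout, hout]
    exact ⟨(hvis _).2 ⟨p, rfl⟩, (hvis _).2 ⟨q, rfl⟩, (hcon h1 h2).1 h⟩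

end CompositeDrawing


section Structural

variable {𝒜 : Type u} {A B C D : Formula 𝒜} {Z : Type v}

theorem Formula.tree_tens_map (A B : Formula 𝒜) (d : (A.tens B).Leaf → Z) :
    (A.tens B).tree.map d = .tens (A.tree.map fun x => d (Sum.inl x))
      (B.tree.map fun x => d (Sum.inr x)) :=
  congrArg₂ OTree.tens (OTree.map_map _ _ _) (OTree.map_map _ _ _)

theorem Formula.tree_par_map (A B : Formula 𝒜) (d : (A.par B).Leaf → Z) :
    (A.par B).tree.map d = .par (A.tree.map fun x => d (Sum.inl x))
      (B.tree.map fun x => d (Sum.inr x)) :=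
  congrArg₂ OTree.par (OTree.map_map _ _ _) (OTree.map_map _ _ _)

theorem Formula.tree_neg_tens_map (A B : Formula 𝒜) (d : (A.tens B).neg.Leaf → Z) :
    (A.tens B).neg.tree.map d = .par (B.neg.tree.map fun x => d (Sum.inl x))
      (A.neg.tree.map fun x => d (Sum.inr x)) :=
  Formula.tree_par_map _ _ d

theorem Formula.tree_neg_par_map (A B : Formula 𝒜) (d : (A.par B).neg.Leaf → Z) :
    (A.par B).neg.tree.map d = .tens (B.neg.tree.map fun x => d (Sum.inl x))
      (A.neg.tree.map fun x => d (Sum.inr x)) :=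
  Formula.tree_tens_map _ _ d

theorem Good.of_linkStep {X : Type*} {Γ : List (Item 𝒜 X)} {P Q : Linking 𝒜 X} (h : Good P Γ)
    (hs : LinkStep Γ P Q) : Good Q Γ :=
  ⟨h.1.of_perm hs.perm, (hs.sim.swCorrect_iff h.1.nodup).1 h.2⟩

theorem Good.par_comm {X : Type*} {Γ : List (Item 𝒜 X)} {P Q : Linking 𝒜 X}
    (h : Good (.par P Q) Γ) : Good (.par Q P) Γ :=
  h.of_linkStep (.parComm .hole P Q)

theorem Good.swap {X : Type*} {P : Linking 𝒜 X} {i j : Item 𝒜 X} {Γ : List (Item 𝒜 X)}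
    (h : Good P (i :: j :: Γ)) : Good P (j :: i :: Γ) :=
  h.perm (List.Perm.swap _ _ _)

theorem idLink_map {X : Type*} (A : Formula 𝒜) (e : A.neg.Leaf → X) (d : A.Leaf → X) (m : X → Z) :
    (idLink A e d).map m = idLink A (fun x => m (e x)) (fun x => m (d x)) := by
  induction A with
  | lit l => cases l <;> rfl
  | tens A B ih ih' => exact congrArg₂ Linking.par (ih _ _) (ih' _ _)
  | par A B ih ih' => exact congrArg₂ Linking.par (ih _ _) (ih' _ _)

theorem mem_names_idLink {e : A.neg.Leaf → Z} {d : A.Leaf → Z} {x : Z}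
    (h : x ∈ (idLink A e d).names) : ∃ p, x = Sum.elim e d p := by
  have := idLink_map A Sum.inl Sum.inr (Sum.elim e d)
  rw [show idLink A e d = _ from this.symm, Linking.names_map] at h
  obtain ⟨p, -, rfl⟩ := List.mem_map.1 h
  exact ⟨p, rfl⟩

theorem disjoint_idLink {e : A.neg.Leaf → Z} {d : A.Leaf → Z} {e' : B.neg.Leaf → Z}
    {d' : B.Leaf → Z} (h : ∀ p q, Sum.elim e d p ≠ Sum.elim e' d' q) :
    List.Disjoint (idLink A e d).names (idLink B e' d').names := by
  intro x hx hx'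
  obtain ⟨p, rfl⟩ := mem_names_idLink hx
  obtain ⟨q, hq⟩ := mem_names_idLink hx'
  exact h p q hq

theorem injective_split {X Y X' Y' : Type*} {e : X ⊕ Y → Z} {d : Y' ⊕ X' → Z}
    (hi : Function.Injective (Sum.elim e d)) :
    Function.Injective (Sum.elim (fun x => e (.inr x)) fun x => d (.inl x)) ∧
      Function.Injective (Sum.elim (fun x => e (.inl x)) fun x => d (.inr x)) ∧
        ∀ p q, Sum.elim (fun x => e (.inr x)) (fun x => d (.inl x)) p ≠
          Sum.elim (fun x => e (.inl x)) (fun x => d (.inr x)) q := by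
  have h1 : ∀ p : Y ⊕ Y', Sum.elim (fun x => e (.inr x)) (fun x => d (.inl x)) p =
      Sum.elim e d (Sum.map .inr .inl p) := by rintro (p | p) <;> rfl
  have h2 : ∀ p : X ⊕ X', Sum.elim (fun x => e (.inl x)) (fun x => d (.inr x)) p =
      Sum.elim e d (Sum.map .inl .inr p) := by rintro (p | p) <;> rfl
  simp only [Function.Injective, h1, h2, hi.eq_iff, ne_eq]
  refine ⟨?_, ?_, ?_⟩ <;> rintro (x | x) (y | y) h <;> cases h <;> rfl

theorem good_idLink (A : Formula 𝒜) {e : A.neg.Leaf → Z} {d : A.Leaf → Z}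
    (hi : Function.Injective (Sum.elim e d)) :
    Good (idLink A e d) [.formula (A.neg.tree.map e), .formula (A.tree.map d)] := by
  induction A with
  | lit l =>
    have hne : e () ≠ d () := fun h => by cases @hi (.inl ()) (.inr ()) h
    cases l with
    | pos a => exact (good_ax a hne.symm).swap
    | neg a => exact good_ax a hne
    | one =>
      refine (good_one (d ())).bot fun h => hne ?_
      simpa [Linking.names, Linking.toTree, OTree.leaves] using h
    | bot =>
      refine ((good_one (e ())).bot fun h => hne.symm ?_).swap
      simpa [Linking.names, Linking.toTree, OTree.leaves] using h
  | tens A B ih ih' =>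
    rw [Formula.tree_tens_map, Formula.tree_neg_tens_map]
    obtain ⟨hA, hB, hd⟩ := injective_split hi
    exact good_par_iff.2 (((ih hA).swap.tens (ih' hB).swap (disjoint_idLink hd)).perm
      (List.reverse_perm _).symm)
  | par A B ih ih' =>
    rw [Formula.tree_par_map, Formula.tree_neg_par_map]
    obtain ⟨hA, hB, hd⟩ := injective_split hi
    exact Good.swap (good_par_iff.2 (((ih' hB).tens (ih hA) (disjoint_idLink fun p q h =>
      hd q p h.symm)).par_comm.perm (List.reverse_perm _).symm))

/-- The wires of an identity linking between two occurrences of `A`, named by `e` and `d`. -/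
def injRel (A : Formula 𝒜) (e d : A.Leaf → Z) (x y : Z) : Prop :=
  ∃ a, (¬ (A.label a).IsNeg ∧ x = e a ∧ y = d a) ∨ ((A.label a).IsNeg ∧ x = d a ∧ y = e a)

theorem injRel_tens (e d : (A.tens B).Leaf → Z) (x y : Z) : injRel (A.tens B) e d x y ↔
    injRel A (fun a => e (Sum.inl a)) (fun a => d (Sum.inl a)) x y ∨
      injRel B (fun b => e (Sum.inr b)) (fun b => d (Sum.inr b)) x y :=
  Sum.exists (p := fun a : A.Leaf ⊕ B.Leaf => (¬ ((A.tens B).label a).IsNeg ∧ x = e a ∧ y = d a) ∨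
    (((A.tens B).label a).IsNeg ∧ x = d a ∧ y = e a))

theorem injRel_par (e d : (A.par B).Leaf → Z) (x y : Z) : injRel (A.par B) e d x y ↔
    injRel A (fun a => e (Sum.inl a)) (fun a => d (Sum.inl a)) x y ∨
      injRel B (fun b => e (Sum.inr b)) (fun b => d (Sum.inr b)) x y :=
  injRel_tens (A := A) (B := B) e d x y

theorem mem_wires_idLink (A : Formula 𝒜) (e d : A.Leaf → Z) (x y : Z) :
    (x, y) ∈ (idLink A (fun a => e (A.undual a)) d).wires ↔ injRel A e d x y := by
  induction A with
  | lit l =>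
    have : injRel (.lit l) e d x y ↔ (¬ l.IsNeg ∧ x = e () ∧ y = d ()) ∨
        (l.IsNeg ∧ x = d () ∧ y = e ()) := ⟨fun ⟨_, h⟩ => h, fun h => ⟨_, h⟩⟩
    rw [this]
    cases l <;> simp [idLink, Linking.wires, Linking.lead, Formula.undual]
  | tens A B ih ih' =>
    rw [injRel_tens, ← ih, ← ih']
    exact List.mem_append
  | par A B ih ih' =>
    rw [injRel_par, ← ih, ← ih']
    exact List.mem_append

/-- The wires of `f` join each leaf `a` of the source to the leaf `s a` of the target. -/
def IsInj (f : Hom A B) (s : A.Leaf → B.Leaf) : Prop :=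
  Draws f Sum.inl Sum.inr (injRel A Sum.inl fun a => Sum.inr (s a))

theorem IsInj.draws {f : Hom A B} {s : A.Leaf → B.Leaf} (h : IsInj f s) (e : A.Leaf → Z)
    (d : B.Leaf → Z) : Draws f e d (injRel A e fun a => d (s a)) := by
  refine (h.push (Sum.elim e d)).congr fun x y => ?_
  constructor
  · rintro ⟨a, ⟨h, rfl, rfl⟩ | ⟨h, rfl, rfl⟩⟩
    · exact ⟨_, _, ⟨a, Or.inl ⟨h, rfl, rfl⟩⟩, rfl, rfl⟩
    · exact ⟨_, _, ⟨a, Or.inr ⟨h, rfl, rfl⟩⟩, rfl, rfl⟩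
  · rintro ⟨_, _, ⟨a, ⟨h, rfl, rfl⟩ | ⟨h, rfl, rfl⟩⟩, rfl, rfl⟩
    · exact ⟨a, Or.inl ⟨h, rfl, rfl⟩⟩
    · exact ⟨a, Or.inr ⟨h, rfl, rfl⟩⟩

theorem IsInj.isNeg_label {f : Hom A B} {s : A.Leaf → B.Leaf} (h : IsInj f s) (a : A.Leaf) :
    (B.label (s a)).IsNeg ↔ (A.label a).IsNeg := by
  by_cases ha : (A.label a).IsNeg
  · obtain ⟨p, q, hp, -, hn, -⟩ := h.types ⟨a, Or.inr ⟨ha, rfl, rfl⟩⟩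
    rw [Sum.elim_inl_inr] at hp
    obtain rfl : Sum.inr (s a) = p := hp
    exact iff_of_true hn ha
  · obtain ⟨p, q, -, hq, -, hn⟩ := h.types ⟨a, Or.inl ⟨ha, rfl, rfl⟩⟩
    rw [Sum.elim_inl_inr] at hq
    obtain rfl : Sum.inr (s a) = q := hq
    exact iff_of_false hn ha

theorem IsInj.ext {f g : Hom A B} {s t : A.Leaf → B.Leaf} (h : IsInj f s) (h' : IsInj g t)
    (hst : ∀ a, s a = t a) : f = g := by
  obtain rfl : s = t := funext hst
  exact Draws.ext h h' (by rw [Sum.elim_inl_inr]; exact Function.injective_id) fun _ _ => id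

/-- The identity arrow. -/
def Hom.id (A : Formula 𝒜) : Hom A A :=
  Hom.ofGood (P := idLink A Sum.inl Sum.inr)
    (good_idLink A (by rw [Sum.elim_inl_inr]; exact Function.injective_id))

theorem Hom.id_rep (A : Formula 𝒜) : (Hom.id A).Rep (idLink A Sum.inl Sum.inr) :=
  Hom.ofGood_rep _

theorem isInj_id (A : Formula 𝒜) : IsInj (Hom.id A) fun a => a := by
  refine ⟨_, Hom.id_rep A, fun x y => ?_⟩
  rw [idLink_map, ← mem_wires_idLink]
  rfl

theorem Draws.comp_inj {f : Hom A B} {g : Hom B C} {s : B.Leaf → C.Leaf} {e : A.Leaf → Z}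
    {d : C.Leaf → Z} {R : Z → Z → Prop} (hf : Draws f e (fun b => d (s b)) R) (hg : IsInj g s)
    (hi : Function.Injective (Sum.elim e d)) : Draws (f.comp g) e d R := by
  obtain ⟨W, hW, hR⟩ := hf.exists_lift
  let m : A.Leaf ⊕ B.Leaf ⊕ C.Leaf → Z := Sum.elim e (Sum.elim (fun b => d (s b)) d)
  have h := ((hW.push (Sum.elim Sum.inl fun b => Sum.inr (Sum.inl b))).comp
    (hg.draws (fun b => (Sum.inr (Sum.inl b) : A.Leaf ⊕ B.Leaf ⊕ C.Leaf))
      fun c => Sum.inr (Sum.inr c)) (by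
      rintro (x | x | x) (y | y | y) h <;> cases h <;> rfl)).push m
  refine h.of_subset hi ?_ ?_
  · intro x y hxy
    obtain ⟨p, q, hpq, rfl, rfl⟩ := (hR x y).1 hxy
    obtain ⟨p', q', hp, hq, hpn, hqn⟩ := hW.types hpq
    rw [Sum.elim_inl_inr] at hp hq
    obtain rfl : p = p' := hp
    obtain rfl : q = q' := hq
    let T : A.Leaf ⊕ B.Leaf ⊕ C.Leaf → A.Leaf ⊕ B.Leaf ⊕ C.Leaf → Prop := fun x y =>
      (∃ p q, W p q ∧ x = Sum.elim Sum.inl (fun b => Sum.inr (Sum.inl b)) p ∧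
        y = Sum.elim Sum.inl (fun b => Sum.inr (Sum.inl b)) q) ∨
      injRel B (fun b => Sum.inr (Sum.inl b)) (fun b => Sum.inr (Sum.inr (s b))) x y
    have hp : ∃ p', Sum.elim e (fun b => d (s b)) p = Sum.elim e d p' ∧
        ReflTransGen T (Sum.elim Sum.inl (fun c => Sum.inr (Sum.inr c)) p')
          (Sum.elim Sum.inl (fun b => Sum.inr (Sum.inl b)) p) := by
      rcases p with a | b
      · exact ⟨Sum.inl a, rfl, .refl⟩
      · exact ⟨Sum.inr (s b), rfl, .single (Or.inr ⟨b, Or.inr ⟨hpn, rfl, rfl⟩⟩)⟩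
    have hq : ∃ q', Sum.elim e (fun b => d (s b)) q = Sum.elim e d q' ∧
        ReflTransGen T (Sum.elim Sum.inl (fun b => Sum.inr (Sum.inl b)) q)
          (Sum.elim Sum.inl (fun c => Sum.inr (Sum.inr c)) q') := by
      rcases q with a | b
      · exact ⟨Sum.inl a, rfl, .refl⟩
      · exact ⟨Sum.inr (s b), rfl, .single (Or.inr ⟨b, Or.inl ⟨hqn, rfl, rfl⟩⟩)⟩
    obtain ⟨p', hp', hp⟩ := hp
    obtain ⟨q', hq', hq⟩ := hq
    refine ⟨_, _, ⟨⟨p', rfl⟩, ⟨q', rfl⟩, (TransGen.tail' hp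
      (Or.inl ⟨p, q, hpq, rfl, rfl⟩)).trans_left hq⟩, ?_, ?_⟩
    · rw [hp']; rcases p' with a | c <;> rfl
    · rw [hq']; rcases q' with a | c <;> rfl
  · rintro x y ⟨_, _, ⟨⟨p, rfl⟩, ⟨q, rfl⟩, hpq⟩, rfl, rfl⟩
    have hm : ∀ p, m (Sum.elim Sum.inl (fun b => Sum.inr (Sum.inl b)) p) =
        Sum.elim e (fun b => d (s b)) p := by
      rintro (a | b) <;> rfl
    obtain ⟨c, hc, hcq⟩ := TransGen.head'_iff.1 hpq
    rcases hc with ⟨p', q', hW', h1, rfl⟩ | ⟨b, ⟨-, h1, -⟩ | ⟨hb, h1, rfl⟩⟩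
    · exact ⟨_, (hR _ _).2 ⟨p', q', hW', by rw [h1, hm], rfl⟩⟩
    · rcases p with a | c <;> cases h1
    · rcases ReflTransGen.cases_head hcq with h2 | ⟨c', hc', -⟩
      · rcases q with a | c <;> cases h2
      · rcases hc' with ⟨p', q', hW', h3, rfl⟩ | ⟨b', ⟨hb', h3, -⟩ | ⟨-, h3, -⟩⟩
        · refine ⟨_, (hR _ _).2 ⟨p', q', hW', ?_, rfl⟩⟩
          rw [h1, ← hm, ← h3]
          rfl
        · cases h3; exact absurd hb hb'
        · cases h3

theorem Draws.inj_comp {f : Hom A B} {g : Hom B C} {s : A.Leaf → B.Leaf} {e : B.Leaf → Z}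
    {d : C.Leaf → Z} {R R' : Z → Z → Prop} (hg : Draws g e d R) (hf : IsInj f s)
    (hi : Function.Injective (Sum.elim e d)) (hs : Function.Injective s)
    (hR' : ∀ x y, R' x y ↔ R x y ∧ Visible (fun a => e (s a)) d x ∧
      Visible (fun a => e (s a)) d y) :
    Draws (f.comp g) (fun a => e (s a)) d R' := by
  obtain ⟨W, hW, hR⟩ := hg.exists_lift
  let m : A.Leaf ⊕ B.Leaf ⊕ C.Leaf → Z := Sum.elim (fun a => e (s a)) (Sum.elim e d)
  have h := ((hf.draws Sum.inl (fun b => (Sum.inr (Sum.inl b) : A.Leaf ⊕ B.Leaf ⊕ C.Leaf))).comp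
    (hW.push Sum.inr) (by rintro (x | x | x) (y | y | y) h <;> cases h <;> rfl)).push m
  have hWt : ∀ {p q}, W p q → (portLabel B C p).IsNeg ∧ ¬ (portLabel B C q).IsNeg := by
    intro p q hpq
    obtain ⟨p', q', hp, hq, hpn, hqn⟩ := hW.types hpq
    rw [Sum.elim_inl_inr] at hp hq
    exact ⟨(show p = p' from hp) ▸ hpn, (show q = q' from hq) ▸ hqn⟩
  have hm : ∀ p, m (Sum.elim Sum.inl (fun c => Sum.inr (Sum.inr c)) p) =
      Sum.elim (fun a => e (s a)) d p := by
    rintro (a | c) <;> rfl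
  have hm' : ∀ p, m (Sum.inr p) = Sum.elim e d p := fun _ => rfl
  let T : A.Leaf ⊕ B.Leaf ⊕ C.Leaf → A.Leaf ⊕ B.Leaf ⊕ C.Leaf → Prop := fun x y =>
    injRel A Sum.inl (fun a => Sum.inr (Sum.inl (s a))) x y ∨
      ∃ p q, W p q ∧ x = Sum.inr p ∧ y = Sum.inr q
  refine h.of_subset ?_ ?_ ?_
  · rintro (x | x) (y | y) h
    · exact congrArg _ (hs (Sum.inl.inj (@hi (.inl _) (.inl _) h)))
    · cases @hi (.inl _) (.inr _) h
    · cases @hi (.inr _) (.inl _) h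
    · exact congrArg _ (Sum.inr.inj (@hi (.inr _) (.inr _) h))
  · intro x y hxy
    obtain ⟨hxy, ⟨p', hp'⟩, ⟨q', hq'⟩⟩ := (hR' _ _).1 hxy
    obtain ⟨p, q, hpq, rfl, rfl⟩ := (hR x y).1 hxy
    have hp : ReflTransGen T (Sum.elim Sum.inl (fun c => Sum.inr (Sum.inr c)) p')
        (Sum.inr p) := by
      rcases p' with a | c
      · obtain rfl := @hi p (.inl _) hp'
        have h1 : (B.label (s a)).dual.IsNeg := (hWt hpq).1
        rw [Lit.isNeg_dual, hf.isNeg_label] at h1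
        exact .single (Or.inl ⟨a, Or.inl ⟨h1, rfl, rfl⟩⟩)
      · obtain rfl := @hi p (.inr _) hp'
        exact .refl
    have hq : ReflTransGen T (Sum.inr q)
        (Sum.elim Sum.inl (fun c => Sum.inr (Sum.inr c)) q') := by
      rcases q' with a | c
      · obtain rfl := @hi q (.inl _) hq'
        have h1 : ¬ (B.label (s a)).dual.IsNeg := (hWt hpq).2
        rw [Lit.isNeg_dual, hf.isNeg_label, not_not] at h1
        exact .single (Or.inl ⟨a, Or.inr ⟨h1, rfl, rfl⟩⟩)
      · obtain rfl := @hi q (.inr _) hq'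
        exact .refl
    exact ⟨_, _, ⟨⟨p', rfl⟩, ⟨q', rfl⟩, (TransGen.tail' hp
      (Or.inr ⟨p, q, hpq, rfl, rfl⟩)).trans_left hq⟩, hp'.trans (hm _).symm, hq'.trans (hm _).symm⟩
  · rintro x y ⟨_, _, ⟨⟨p, rfl⟩, ⟨q, rfl⟩, hpq⟩, rfl, rfl⟩
    have hvis : ∀ p' q', W p' q' → ReflTransGen T (Sum.inr q')
        (Sum.elim Sum.inl (fun c => Sum.inr (Sum.inr c)) q) →
        Visible (fun a => e (s a)) d (m (Sum.inr q')) := by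
      intro p' q' hW' h1
      rcases ReflTransGen.cases_head h1 with h1 | ⟨c', ⟨a, h1⟩ | ⟨p₂, q₂, h1, h2, -⟩, -⟩
      · exact ⟨q, by rw [h1, hm]⟩
      · rcases h1 with ⟨-, h1, -⟩ | ⟨-, h1, -⟩
        · cases h1
        · exact ⟨Sum.inl a, congrArg m h1⟩
      · cases h2; exact absurd (hWt h1).1 (hWt hW').2
    obtain ⟨c, hc, hcq⟩ := TransGen.head'_iff.1 hpq
    rcases hc with ⟨a, ⟨ha, h1, rfl⟩ | ⟨-, h1, -⟩⟩ | ⟨p', q', hW', h1, rfl⟩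
    · rcases ReflTransGen.cases_head hcq with h2 | ⟨c', hc', hcq'⟩
      · rcases q with a | c <;> cases h2
      · rcases hc' with ⟨a', ⟨-, h2, -⟩ | ⟨ha', h2, -⟩⟩ | ⟨p', q', hW', h2, rfl⟩
        · cases h2
        · rw [← hf.isNeg_label, ← Sum.inl.inj (Sum.inr.inj h2), hf.isNeg_label] at ha'
          exact absurd ha' ha
        · refine ⟨_, (hR' _ _).2 ⟨(hR _ _).2 ⟨p', q', hW', ?_, rfl⟩, ⟨p, hm p⟩, hvis _ _ hW' hcq'⟩⟩
          rw [← hm', ← h2, h1]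
          rfl
    · rcases p with a | c <;> cases h1
    · refine ⟨_, (hR' _ _).2 ⟨(hR _ _).2 ⟨p', q', hW', ?_, rfl⟩, ⟨p, hm p⟩, hvis _ _ hW' hcq⟩⟩
      rw [← hm', ← h1]

end Structural


section Laws

variable {𝒜 : Type u} {A B C D A' B' C' D' : Formula 𝒜} {Z : Type v}

theorem injective_inl_inr {X Y : Type*} :
    Function.Injective (Sum.elim Sum.inl Sum.inr : X ⊕ Y → X ⊕ Y) := by
  rw [Sum.elim_inl_inr]
  exact Function.injective_id

theorem Draws.cast {f : Hom A B} {e e' : A.Leaf → Z} {d d' : B.Leaf → Z} {R : Z → Z → Prop}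
    (h : Draws f e d R) (he : ∀ a, e' a = e a) (hd : ∀ b, d' b = d b) : Draws f e' d' R := by
  rwa [funext he, funext hd]

theorem Draws.visible {f : Hom A B} {e : A.Leaf → Z} {d : B.Leaf → Z} {R : Z → Z → Prop}
    (h : Draws f e d R) {x y : Z} (hxy : R x y) : Visible e d x ∧ Visible e d y := by
  obtain ⟨p, q, hp, hq, -⟩ := h.types hxy
  exact ⟨⟨p, hp⟩, ⟨q, hq⟩⟩

/-- A criterion for the commutativity of a square two sides of which are structural. -/
theorem comp_eq_comp_of_draws {f : Hom A B} {g : Hom C D} {h : Hom B D} {k : Hom A C}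
    {s : B.Leaf → D.Leaf} {t : A.Leaf → C.Leaf} {R : C.Leaf ⊕ D.Leaf → C.Leaf ⊕ D.Leaf → Prop}
    {R' : C.Leaf ⊕ D.Leaf → C.Leaf ⊕ D.Leaf → Prop}
    (hf : Draws f (fun a => Sum.inl (t a)) (fun b => Sum.inr (s b)) R)
    (hg : Draws g Sum.inl Sum.inr R') (hh : IsInj h s) (hk : IsInj k t)
    (ht : Function.Injective t) (hR : ∀ x y, R x y → R' x y) : f.comp h = k.comp g := by
  have hi : Function.Injective
      (Sum.elim (fun a => Sum.inl (t a)) Sum.inr : A.Leaf ⊕ D.Leaf → C.Leaf ⊕ D.Leaf) := by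
    rintro (x | x) (y | y) hxy
    · exact congrArg _ (ht (Sum.inl.inj hxy))
    · cases hxy
    · cases hxy
    · exact congrArg _ (Sum.inr.inj hxy)
  have h1 := Draws.comp_inj (d := Sum.inr) hf hh hi
  exact h1.ext (hg.inj_comp hk injective_inl_inr ht fun _ _ => Iff.rfl) hi
    fun x y hxy => ⟨hR x y hxy, h1.visible hxy⟩

theorem IsInj.comp {f : Hom A B} {g : Hom B C} {s : A.Leaf → B.Leaf} {t : B.Leaf → C.Leaf}
    (hf : IsInj f s) (hg : IsInj g t) : IsInj (f.comp g) fun a => t (s a) :=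
  Draws.comp_inj (d := Sum.inr) (hf.draws Sum.inl fun b => Sum.inr (t b)) hg injective_inl_inr

theorem Hom.comp_id (f : Hom A B) : f.comp (Hom.id B) = f := by
  obtain ⟨R, hR⟩ := exists_draws f (Sum.inl : _ → A.Leaf ⊕ B.Leaf) Sum.inr
  exact (Draws.comp_inj (d := Sum.inr) hR (isInj_id B) injective_inl_inr).ext hR injective_inl_inr
    fun _ _ => _root_.id

theorem Hom.id_comp (f : Hom A B) : (Hom.id A).comp f = f := by
  obtain ⟨R, hR⟩ := exists_draws f (Sum.inl : _ → A.Leaf ⊕ B.Leaf) Sum.inr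
  rw [← comp_eq_comp_of_draws hR hR (isInj_id B) (isInj_id A) Function.injective_id
    fun _ _ => _root_.id, Hom.comp_id]

theorem transGen_of_compDraw {X Y : Type*} {e : X → Z} {k : Y → Z} {R S T : Z → Z → Prop}
    (hR : ∀ x y, R x y → T x y) (hS : ∀ x y, S x y → T x y) {x y : Z}
    (h : TransGen (fun x y => S x y ∨ compDraw e k R x y) x y) :
    TransGen T x y := by
  refine TransGen.trans_induction_on h (fun h => ?_) fun _ _ h h' => h.trans h'
  rcases h with h | ⟨-, -, h⟩
  · exact .single (hS _ _ h)
  · exact TransGen.mono hR _ _ h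

/-- Paths can be cut into segments that avoid the hidden points and composite steps through
them. -/
theorem transGen_compDraw {X Y : Type*} {e : X → Z} {k : Y → Z} {R S T : Z → Z → Prop}
    {H : Z → Prop} (hT : ∀ x y, T x y → R x y ∨ S x y) (hS : ∀ x y, S x y → ¬ H x ∧ ¬ H y)
    (hR : ∀ x y, R x y → (H x ∨ Visible e k x) ∧ (H y ∨ Visible e k y)) {x y : Z}
    (hx : ¬ H x) (hy : ¬ H y) (h : TransGen T x y) :
    TransGen (fun x y => S x y ∨ compDraw e k R x y) x y := by
  have key : ∀ z, TransGen T x z →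
      (¬ H z → TransGen (fun x y => S x y ∨ compDraw e k R x y) x z) ∧
      (H z → ∃ w, ReflTransGen (fun x y => S x y ∨ compDraw e k R x y) x w ∧
        Visible e k w ∧ TransGen R w z) := by
    intro z hz
    have step : ∀ w z, ReflTransGen (fun x y => S x y ∨ compDraw e k R x y) x w → ¬ H w →
        T w z → (¬ H z → TransGen (fun x y => S x y ∨ compDraw e k R x y) x z) ∧
          (H z → ∃ w, ReflTransGen (fun x y => S x y ∨ compDraw e k R x y) x w ∧
            Visible e k w ∧ TransGen R w z) := by
      intro w z hw hHw hwz
      rcases hT _ _ hwz with h | h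
      · have h' := hR _ _ h
        have hv := h'.1.resolve_left hHw
        exact ⟨fun hz => .tail' hw (Or.inr ⟨hv, h'.2.resolve_left hz, .single h⟩),
          fun _ => ⟨w, hw, hv, .single h⟩⟩
      · exact ⟨fun _ => .tail' hw (Or.inl h), fun hz => absurd hz (hS _ _ h).2⟩
    induction hz with
    | single h => exact step _ _ .refl hx h
    | @tail b c _ h ih =>
      by_cases hb : H b
      · obtain ⟨w, hw, hv, hwb⟩ := ih.2 hb
        have hbc : R b c := (hT _ _ h).resolve_right fun h => (hS _ _ h).1 hb
        exact ⟨fun hc => .tail' hw (Or.inr ⟨hv, (hR _ _ hbc).2.resolve_left hc, hwb.tail hbc⟩),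
          fun _ => ⟨w, hw, hv, hwb.tail hbc⟩⟩
      · exact step _ _ (ih.1 hb).to_reflTransGen hb h
  exact (key y h).1 hy

theorem Hom.comp_assoc (f : Hom A B) (g : Hom B C) (h : Hom C D) :
    (f.comp g).comp h = f.comp (g.comp h) := by
  let eA : A.Leaf → A.Leaf ⊕ B.Leaf ⊕ C.Leaf ⊕ D.Leaf := Sum.inl
  let eB : B.Leaf → A.Leaf ⊕ B.Leaf ⊕ C.Leaf ⊕ D.Leaf := fun b => Sum.inr (Sum.inl b)
  let eC : C.Leaf → A.Leaf ⊕ B.Leaf ⊕ C.Leaf ⊕ D.Leaf := fun c => Sum.inr (Sum.inr (Sum.inl c))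
  let eD : D.Leaf → A.Leaf ⊕ B.Leaf ⊕ C.Leaf ⊕ D.Leaf := fun d => Sum.inr (Sum.inr (Sum.inr d))
  obtain ⟨R, hR⟩ := exists_draws f eA eB
  obtain ⟨S, hS⟩ := exists_draws g eB eC
  obtain ⟨T, hT⟩ := exists_draws h eC eD
  refine ((hR.comp hS ?_).comp hT ?_).ext (hR.comp (hS.comp hT ?_) ?_) ?_ ?_
  any_goals (rintro (x | x | x) (y | y | y) h <;> cases h <;> rfl)
  · rintro (x | x) (y | y) h <;> cases h <;> rfl
  · rintro x y ⟨⟨p, rfl⟩, ⟨q, rfl⟩, h⟩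
    refine ⟨⟨p, rfl⟩, ⟨q, rfl⟩, transGen_compDraw (H := fun z => ∃ c, z = eC c)
      (T := fun x y => R x y ∨ S x y ∨ T x y) (fun x y h => h.symm) ?_ ?_ ?_ ?_
      (transGen_of_compDraw (R := fun x y => R x y ∨ S x y) (S := T) (e := eA) (k := eC) ?_
        (fun x y h => Or.inr (Or.inr h)) (TransGen.mono (fun x y h => h.symm) _ _ h))⟩
    · intro x y h
      obtain ⟨⟨p, rfl⟩, ⟨q, rfl⟩⟩ := hR.visible h
      constructor
      · rintro ⟨c, hc⟩; rcases p with p | p <;> cases hc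
      · rintro ⟨c, hc⟩; rcases q with q | q <;> cases hc
    · have h1 : ∀ p, (∃ c, Sum.elim eB eC p = eC c) ∨ Visible eB eD (Sum.elim eB eC p) := by
        rintro (p | p)
        exacts [Or.inr ⟨.inl p, rfl⟩, Or.inl ⟨p, rfl⟩]
      have h2 : ∀ p, (∃ c, Sum.elim eC eD p = eC c) ∨ Visible eB eD (Sum.elim eC eD p) := by
        rintro (p | p)
        exacts [Or.inl ⟨p, rfl⟩, Or.inr ⟨.inr p, rfl⟩]
      rintro x y (h | h)
      · obtain ⟨⟨p, rfl⟩, ⟨q, rfl⟩⟩ := hS.visible h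
        exact ⟨h1 p, h1 q⟩
      · obtain ⟨⟨p, rfl⟩, ⟨q, rfl⟩⟩ := hT.visible h
        exact ⟨h2 p, h2 q⟩
    · rintro ⟨c, hc⟩; rcases p with p | p <;> cases hc
    · rintro ⟨c, hc⟩; rcases q with q | q <;> cases hc
    · rintro x y (h | h)
      exacts [Or.inl h, Or.inr (Or.inl h)]

variable (𝒜) in
/-- The category of proof nets. -/
noncomputable def netCategory : CategoryOnNets 𝒜 where
  id := Hom.id
  comp := Hom.comp
  id_comp := Hom.id_comp
  comp_id := Hom.comp_id
  assoc := Hom.comp_assoc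

theorem Hom.exists_rename (m : A.neg.Leaf ⊕ B.Leaf → C.neg.Leaf ⊕ D.Leaf)
    (hm : Function.Injective m)
    (hg : ∀ P, Good P [.formula (A.neg.tree.map fun x => m (Sum.inl x)),
      .formula (B.tree.map fun x => m (Sum.inr x))] → GoodFor C D P) (f : Hom A B) :
    ∃ g : Hom C D, ∀ P, f.Rep P → g.Rep (P.map m) := by
  refine Hom.lift (Linking.map m) (fun P hP => hg _ ?_) (fun P P' _ _ h => h.map m) f
  have := hP.map m fun x _ y _ h => hm h
  simpa only [seq₂, List.map_cons, List.map_nil, Item.map, OTree.map_map] using this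

theorem exists_tens (f : Hom A B) (g : Hom C D) : ∃ h : Hom (A.tens C) (B.tens D),
    ∀ P Q, f.Rep P → g.Rep Q → h.Rep (tensLink P Q) := by
  refine Hom.lift₂ tensLink (fun P Q hP hQ => ?_) (fun P P' Q _ _ _ h => (h.map _).par_left _)
    (fun P Q Q' _ _ _ h => (h.map _).par_right _) f g
  have h1 := hP.map (Sum.map Sum.inr Sum.inl : _ → (A.tens C).neg.Leaf ⊕ (B.tens D).Leaf)
    (by rintro (x | x) - (y | y) - h <;> cases h <;> rfl)
  have h2 := hQ.map (Sum.map Sum.inl Sum.inr : _ → (A.tens C).neg.Leaf ⊕ (B.tens D).Leaf)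
    (by rintro (x | x) - (y | y) - h <;> cases h <;> rfl)
  simp only [seq₂, List.map_cons, List.map_nil, Item.map, OTree.map_map] at h1 h2
  have := h1.swap.tens h2.swap (fun x hx hx' => by
    rw [Linking.names_map] at hx hx'
    obtain ⟨y | y, -, rfl⟩ := List.mem_map.1 hx <;>
    obtain ⟨z | z, -, h⟩ := List.mem_map.1 hx' <;> cases h)
  rw [GoodFor, seq₂, Formula.tree_neg_tens_map, Formula.tree_tens_map]
  exact good_par_iff.2 (this.perm (List.reverse_perm _).symm)

theorem exists_neg (f : Hom A B) : ∃ g : Hom B.neg A.neg, ∀ P, f.Rep P → g.Rep (negLink P) := by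
  refine Hom.exists_rename _ ?_ (fun P hP => ?_) f
  · rintro (x | x) (y | y) h
    · exact congrArg _ (Sum.inr.inj h)
    · cases h
    · cases h
    · exact congrArg _ (Function.LeftInverse.injective B.undual_dualLeaf
        (Function.LeftInverse.injective B.neg.undual_dualLeaf (Sum.inl.inj h)))
  · rw [GoodFor, seq₂, Formula.tree_neg_neg, OTree.map_map]
    exact hP.swap

theorem exists_curry (f : Hom (A.tens B) C) :
    ∃ g : Hom A (C.par B.neg), ∀ P, f.Rep P → g.Rep (curryLink P) := by
  refine Hom.exists_rename _ ?_ (fun P hP => ?_) f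
  · rintro ((x | x) | x) ((y | y) | y) h <;> cases h <;> rfl
  · rw [Formula.tree_neg_tens_map] at hP
    rw [GoodFor, seq₂, Formula.tree_par_map]
    exact (good_par_iff.2 ((good_par_iff.1 hP).swap.perm (List.reverse_perm _).symm)).swap

theorem exists_uncurry (g : Hom A (C.par B.neg)) :
    ∃ f : Hom (A.tens B) C, ∀ P, g.Rep P → f.Rep (P.map (Sum.elim (fun x => Sum.inl (Sum.inr x))
      (Sum.elim Sum.inr fun y => Sum.inl (Sum.inl y)))) := by
  refine Hom.exists_rename _ ?_ (fun P hP => ?_) g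
  · rintro (x | x | x) (y | y | y) h <;> cases h <;> rfl
  · rw [Formula.tree_par_map] at hP
    rw [GoodFor, seq₂, Formula.tree_neg_tens_map]
    exact good_par_iff.2 ((good_par_iff.1 hP.swap).swap.perm ((List.Perm.swap _ _ _).cons _))

/-- The tensor product of two arrows. -/
noncomputable def Hom.tens (f : Hom A B) (g : Hom C D) : Hom (A.tens C) (B.tens D) :=
  (exists_tens f g).choose

theorem Hom.tens_rep {f : Hom A B} {g : Hom C D} {P : Linking 𝒜 (A.neg.Leaf ⊕ B.Leaf)}
    {Q : Linking 𝒜 (C.neg.Leaf ⊕ D.Leaf)} (hP : f.Rep P) (hQ : g.Rep Q) :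
    (f.tens g).Rep (tensLink P Q) :=
  (exists_tens f g).choose_spec P Q hP hQ

/-- The dual of an arrow. -/
noncomputable def Hom.neg (f : Hom A B) : Hom B.neg A.neg := (exists_neg f).choose

theorem Hom.neg_rep {f : Hom A B} {P : Linking 𝒜 (A.neg.Leaf ⊕ B.Leaf)} (hP : f.Rep P) :
    f.neg.Rep (negLink P) :=
  (exists_neg f).choose_spec P hP

theorem Hom.Rep.unique {f g : Hom A B} {P : Linking 𝒜 (A.neg.Leaf ⊕ B.Leaf)} (h : f.Rep P)
    (h' : g.Rep P) : f = g :=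
  h.eq_ofGood.trans h'.eq_ofGood.symm

theorem Hom.eq_of_rename_inverse {f f' : Hom A B} {g : Hom C D}
    {m : A.neg.Leaf ⊕ B.Leaf → C.neg.Leaf ⊕ D.Leaf} {n : C.neg.Leaf ⊕ D.Leaf → A.neg.Leaf ⊕ B.Leaf}
    (hm : ∀ P, f.Rep P → g.Rep (P.map m)) (hn : ∀ P, g.Rep P → f'.Rep (P.map n))
    (hnm : ∀ x, n (m x) = x) : f' = f := by
  obtain ⟨P, hP⟩ := f.exists_rep
  have := hn _ (hm P hP)
  rw [Linking.map_map, Linking.map_id_of P fun x _ => hnm x] at this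
  exact this.unique hP

theorem Draws.rename {f : Hom A B} {g : Hom C D} {m : A.neg.Leaf ⊕ B.Leaf → C.neg.Leaf ⊕ D.Leaf}
    (hm : ∀ P, f.Rep P → g.Rep (P.map m)) {e : A.Leaf → Z} {d : B.Leaf → Z} {e' : C.Leaf → Z}
    {d' : D.Leaf → Z} {R : Z → Z → Prop} (hf : Draws f e d R)
    (hed : ∀ x, portMap e' d' (m x) = portMap e d x) : Draws g e' d' R := by
  obtain ⟨P, hP, hR⟩ := hf
  refine ⟨_, hm P hP, fun x y => ?_⟩
  rw [hR, Linking.map_map, funext hed]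

theorem Draws.rename₂ {f : Hom A B} {g : Hom C D} {h : Hom A' B'}
    {m : A.neg.Leaf ⊕ B.Leaf → A'.neg.Leaf ⊕ B'.Leaf}
    {n : C.neg.Leaf ⊕ D.Leaf → A'.neg.Leaf ⊕ B'.Leaf}
    (hmn : ∀ P Q, f.Rep P → g.Rep Q → h.Rep (.par (P.map m) (Q.map n)))
    {e : A.Leaf → Z} {d : B.Leaf → Z} {e' : C.Leaf → Z} {d' : D.Leaf → Z} {e'' : A'.Leaf → Z}
    {d'' : B'.Leaf → Z} {R R' : Z → Z → Prop} (hf : Draws f e d R) (hg : Draws g e' d' R')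
    (hed : ∀ x, portMap e'' d'' (m x) = portMap e d x)
    (hed' : ∀ x, portMap e'' d'' (n x) = portMap e' d' x) :
    Draws h e'' d'' fun x y => R x y ∨ R' x y := by
  obtain ⟨P, hP, hR⟩ := hf
  obtain ⟨Q, hQ, hR'⟩ := hg
  refine ⟨_, hmn P Q hP hQ, fun x y => ?_⟩
  show R x y ∨ R' x y ↔ _
  rw [hR, hR', Linking.map, Linking.map_map, Linking.map_map, funext hed, funext hed']
  exact List.mem_append.symm

/-- Currying of arrows. -/
noncomputable def Hom.curry : Hom (A.tens B) C ≃ Hom A (C.par B.neg) where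
  toFun f := (exists_curry f).choose
  invFun g := (exists_uncurry g).choose
  left_inv f := Hom.eq_of_rename_inverse (exists_curry f).choose_spec
    (exists_uncurry _).choose_spec (by rintro ((x | x) | x) <;> rfl)
  right_inv g := Hom.eq_of_rename_inverse (exists_uncurry g).choose_spec
    (exists_curry _).choose_spec (by rintro (x | x | x) <;> rfl)

theorem Hom.curry_rep {f : Hom (A.tens B) C} {P : Linking 𝒜 ((A.tens B).neg.Leaf ⊕ C.Leaf)}
    (hP : f.Rep P) : (Hom.curry f).Rep (curryLink P) :=
  (exists_curry f).choose_spec P hP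

theorem Draws.tens {f : Hom A B} {g : Hom C D} {e : (A.tens C).Leaf → Z} {d : (B.tens D).Leaf → Z}
    {R R' : Z → Z → Prop} (hf : Draws f (fun a => e (Sum.inl a)) (fun b => d (Sum.inl b)) R)
    (hg : Draws g (fun a => e (Sum.inr a)) (fun b => d (Sum.inr b)) R') :
    Draws (f.tens g) e d fun x y => R x y ∨ R' x y :=
  Draws.rename₂ (fun _ _ hP hQ => Hom.tens_rep hP hQ) hf hg (by rintro (x | x) <;> rfl)
    (by rintro (x | x) <;> rfl)

theorem Draws.neg {f : Hom A B} {e : A.Leaf → Z} {d : B.Leaf → Z} {R : Z → Z → Prop}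
    (hf : Draws f e d R) :
    Draws f.neg (fun b => d (B.undual b)) (fun a => e (A.undual a)) R := by
  refine Draws.rename (fun _ hP => Hom.neg_rep hP) hf ?_
  rintro (x | x)
  · rfl
  · show d (B.undual (B.neg.undual (B.neg.dualLeaf (B.dualLeaf x)))) = d x
    rw [Formula.undual_dualLeaf, Formula.undual_dualLeaf]

theorem Draws.curry {f : Hom (A.tens B) C} {e : (A.tens B).Leaf → Z} {d : C.Leaf → Z}
    {d' : (C.par B.neg).Leaf → Z} {R : Z → Z → Prop} (hf : Draws f e d R)
    (hd : ∀ c, d' (Sum.inl c) = d c) (hd' : ∀ b, d' (Sum.inr b) = e (Sum.inr (B.undual b))) :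
    Draws (Hom.curry f) (fun a => e (Sum.inl a)) d' R := by
  refine Draws.rename (fun _ hP => Hom.curry_rep hP) hf ?_
  rintro ((x | x) | x)
  exacts [hd' x, rfl, hd x]

end Laws


section StructuralArrows

variable {𝒜 : Type u} {A B C D A' B' C' D' : Formula 𝒜} {Z : Type v}

theorem mem_wires_idLink_map {X : Type*} {e : A.neg.Leaf → X} {d : A.Leaf → X} {m : X → Z}
    {e' d' : A.Leaf → Z} (he : ∀ a, m (e a) = e' (A.undual a)) (hd : ∀ a, m (d a) = d' a) (x y : Z) :
    injRel A e' d' x y ↔ (x, y) ∈ ((idLink A e d).map m).wires := by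
  rw [idLink_map, ← mem_wires_idLink, funext he, funext hd]

theorem Linking.names_par {X : Type*} (P Q : Linking 𝒜 X) :
    (Linking.par P Q).names = P.names ++ Q.names :=
  List.map_append

theorem Linking.mem_wires_par_map {X : Type*} {P Q : Linking 𝒜 X} {m : X → Z} {x y : Z} :
    ((x, y) ∈ (P.map m).wires ∨ (x, y) ∈ (Q.map m).wires) ↔
      (x, y) ∈ ((Linking.par P Q).map m).wires :=
  List.mem_append.symm

theorem IsInj.tens {f : Hom A B} {g : Hom C D} {s : A.Leaf → B.Leaf} {t : C.Leaf → D.Leaf}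
    (hf : IsInj f s) (hg : IsInj g t) : IsInj (f.tens g) (Sum.map s t) :=
  (Draws.tens (hf.draws _ _) (hg.draws _ _)).congr fun x y => injRel_tens _ _ x y

theorem Hom.id_tens_id (A B : Formula 𝒜) : (Hom.id A).tens (Hom.id B) = Hom.id (A.tens B) :=
  ((isInj_id A).tens (isInj_id B)).ext (isInj_id _) (by rintro (x | x) <;> rfl)

theorem Hom.tens_comp_tens (f : Hom A B) (f' : Hom A' B') (g : Hom B C) (g' : Hom B' C') :
    (f.tens f').comp (g.tens g') = (f.comp g).tens (f'.comp g') := by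
  let e : (A.tens A').Leaf → (A.tens A').Leaf ⊕ (B.tens B').Leaf ⊕ (C.tens C').Leaf := Sum.inl
  let d : (B.tens B').Leaf → (A.tens A').Leaf ⊕ (B.tens B').Leaf ⊕ (C.tens C').Leaf :=
    fun b => Sum.inr (Sum.inl b)
  let k : (C.tens C').Leaf → (A.tens A').Leaf ⊕ (B.tens B').Leaf ⊕ (C.tens C').Leaf :=
    fun b => Sum.inr (Sum.inr b)
  obtain ⟨R, hR⟩ := exists_draws f (fun a => e (Sum.inl a)) (fun b => d (Sum.inl b))
  obtain ⟨S, hS⟩ := exists_draws g (fun a => d (Sum.inl a)) (fun b => k (Sum.inl b))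
  obtain ⟨R', hR'⟩ := exists_draws f' (fun a => e (Sum.inr a)) (fun b => d (Sum.inr b))
  obtain ⟨S', hS'⟩ := exists_draws g' (fun a => d (Sum.inr a)) (fun b => k (Sum.inr b))
  refine (Draws.ext (Draws.tens (hR.comp hS ?_) (hR'.comp hS' ?_))
    ((hR.tens hR').comp (hS.tens hS') ?_) (e := e) (d := k) ?_ ?_).symm
  · rintro (x | x | x) (y | y | y) h <;> cases h <;> rfl
  · rintro (x | x | x) (y | y | y) h <;> cases h <;> rfl
  · rintro (x | x | x) (y | y | y) h <;> cases h <;> rfl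
  · rintro (x | x) (y | y) h <;> cases h <;> rfl
  · rintro x y (⟨⟨p, rfl⟩, ⟨q, rfl⟩, h⟩ | ⟨⟨p, rfl⟩, ⟨q, rfl⟩, h⟩)
    · refine ⟨?_, ?_, TransGen.mono ?_ _ _ h⟩
      · rcases p with p | p
        exacts [⟨.inl (.inl p), rfl⟩, ⟨.inr (.inl p), rfl⟩]
      · rcases q with p | p
        exacts [⟨.inl (.inl p), rfl⟩, ⟨.inr (.inl p), rfl⟩]
      · rintro x y (h | h)
        exacts [Or.inl (Or.inl h), Or.inr (Or.inl h)]
    · refine ⟨?_, ?_, TransGen.mono ?_ _ _ h⟩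
      · rcases p with p | p
        exacts [⟨.inl (.inr p), rfl⟩, ⟨.inr (.inr p), rfl⟩]
      · rcases q with p | p
        exacts [⟨.inl (.inr p), rfl⟩, ⟨.inr (.inr p), rfl⟩]
      · rintro x y (h | h)
        exacts [Or.inl (Or.inr h), Or.inr (Or.inr h)]

theorem Hom.neg_id (A : Formula 𝒜) : (Hom.id A).neg = Hom.id A.neg := by
  have h := ((isInj_id A).draws (fun a => (Sum.inr (A.dualLeaf a) : A.neg.Leaf ⊕ A.neg.Leaf))
    (fun a => Sum.inl (A.dualLeaf a))).neg.cast (e' := Sum.inl) (d' := Sum.inr)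
      (fun a => congrArg _ (A.dualLeaf_undual a).symm)
      (fun a => congrArg _ (A.dualLeaf_undual a).symm)
  refine h.ext (isInj_id A.neg) injective_inl_inr ?_
  have hl : ∀ a, (A.neg.label (A.dualLeaf a)).IsNeg ↔ ¬ (A.label a).IsNeg := fun a => by
    rw [A.label_neg, A.undual_dualLeaf, Lit.isNeg_dual]
  rintro x y ⟨a, ⟨h, rfl, rfl⟩ | ⟨h, rfl, rfl⟩⟩
  · exact ⟨_, Or.inr ⟨(hl a).2 h, rfl, rfl⟩⟩
  · exact ⟨_, Or.inl ⟨fun h' => (hl a).1 h' h, rfl, rfl⟩⟩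

theorem Hom.neg_comp (f : Hom A B) (g : Hom B C) : (f.comp g).neg = g.neg.comp f.neg := by
  obtain ⟨R, hR⟩ := exists_draws f (Sum.inl : _ → A.Leaf ⊕ B.Leaf ⊕ C.Leaf)
    (fun b => Sum.inr (Sum.inl b))
  obtain ⟨S, hS⟩ := exists_draws g (fun b => (Sum.inr (Sum.inl b) : A.Leaf ⊕ B.Leaf ⊕ C.Leaf))
    (fun c => Sum.inr (Sum.inr c))
  have hA := A.undual_injective
  have hB := B.undual_injective
  have hC := C.undual_injective
  refine (hR.comp hS ?_).neg.ext (hS.neg.comp hR.neg ?_) ?_ ?_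
  · rintro (x | x | x) (y | y | y) h <;> cases h <;> rfl
  · rintro (x | x | x) (y | y | y) h <;> simp_all [hA.eq_iff, hB.eq_iff, hC.eq_iff]
  · rintro (x | x) (y | y) h <;> simp_all [hA.eq_iff, hC.eq_iff]
  · have hv : ∀ z, Visible (Sum.inl : _ → A.Leaf ⊕ B.Leaf ⊕ C.Leaf) (fun c => Sum.inr (Sum.inr c)) z →
        Visible (fun c => (Sum.inr (Sum.inr (C.undual c)) : A.Leaf ⊕ B.Leaf ⊕ C.Leaf))
          (fun a => Sum.inl (A.undual a)) z := by
      rintro z ⟨a | c, rfl⟩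
      · exact ⟨.inr (A.dualLeaf a), by simp [A.undual_dualLeaf]⟩
      · exact ⟨.inl (C.dualLeaf c), by simp [C.undual_dualLeaf]⟩
    rintro x y ⟨hx, hy, h⟩
    exact ⟨hv x hx, hv y hy, TransGen.mono (fun x y h => h.symm) _ _ h⟩

theorem good_symmLink (A B : Formula 𝒜) : GoodFor (A.tens B) (B.tens A) (symmLink A B) := by
  rw [GoodFor, seq₂, Formula.tree_neg_tens_map, Formula.tree_tens_map]
  have hA := good_idLink (Z := (A.tens B).neg.Leaf ⊕ (B.tens A).Leaf) A
    (e := fun x => Sum.inl (Sum.inr x)) (d := fun x => Sum.inr (Sum.inr x))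
    (by rintro (x | x) (y | y) h <;> cases h <;> rfl)
  have hB := good_idLink (Z := (A.tens B).neg.Leaf ⊕ (B.tens A).Leaf) B
    (e := fun x => Sum.inl (Sum.inl x)) (d := fun x => Sum.inr (Sum.inl x))
    (by rintro (x | x) (y | y) h <;> cases h <;> rfl)
  exact good_par_iff.2 ((hB.swap.tens hA.swap (disjoint_idLink (by
    rintro (x | x) (y | y) h <;> cases h))).par_comm.perm ((List.Perm.swap _ _ _).trans
      ((List.Perm.swap _ _ _).cons _)))

theorem good_assocLink (A B C : Formula 𝒜) :
    GoodFor (A.tens (B.tens C)) ((A.tens B).tens C) (assocLink A B C) := by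
  rw [GoodFor, seq₂, Formula.tree_neg_tens_map, Formula.tree_neg_tens_map, Formula.tree_tens_map,
    Formula.tree_tens_map]
  have hA := good_idLink (Z := (A.tens (B.tens C)).neg.Leaf ⊕ ((A.tens B).tens C).Leaf) A
    (e := fun x => Sum.inl (Sum.inr x)) (d := fun x => Sum.inr (Sum.inl (Sum.inl x)))
    (by rintro (x | x) (y | y) h <;> cases h <;> rfl)
  have hB := good_idLink (Z := (A.tens (B.tens C)).neg.Leaf ⊕ ((A.tens B).tens C).Leaf) B
    (e := fun x => Sum.inl (Sum.inl (Sum.inr x))) (d := fun x => Sum.inr (Sum.inl (Sum.inr x)))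
    (by rintro (x | x) (y | y) h <;> cases h <;> rfl)
  have hC := good_idLink (Z := (A.tens (B.tens C)).neg.Leaf ⊕ ((A.tens B).tens C).Leaf) C
    (e := fun x => Sum.inl (Sum.inl (Sum.inl x))) (d := fun x => Sum.inr (Sum.inr x))
    (by rintro (x | x) (y | y) h <;> cases h <;> rfl)
  have hAB := hA.swap.tens hB.swap (disjoint_idLink (by rintro (x | x) (y | y) h <;> cases h))
  have h := hAB.tens hC.swap (by
    rw [Linking.names_par, List.disjoint_append_left]
    exact ⟨disjoint_idLink (by rintro (x | x) (y | y) h <;> cases h),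
      disjoint_idLink (by rintro (x | x) (y | y) h <;> cases h)⟩)
  exact (good_par_iff.2 (good_par_iff.2 (h.perm (List.reverse_perm _).symm))).of_linkStep
    (.parAssoc .hole _ _ _)

theorem good_leftUnitLink (A : Formula 𝒜) : GoodFor (unitObj.tens A) A (leftUnitLink A) := by
  rw [GoodFor, seq₂, Formula.tree_neg_tens_map]
  have hA := good_idLink (Z := (unitObj.tens A).neg.Leaf ⊕ A.Leaf) A
    (e := fun x => Sum.inl (Sum.inl x)) (d := Sum.inr)
    (by rintro (x | x) (y | y) h <;> cases h <;> rfl)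
  refine good_par_iff.2 (Good.swap (hA.bot fun h => ?_))
  obtain ⟨p | p, h⟩ := mem_names_idLink h <;> cases h

theorem good_rightUnitLink (A : Formula 𝒜) : GoodFor (A.tens unitObj) A (rightUnitLink A) := by
  rw [GoodFor, seq₂, Formula.tree_neg_tens_map]
  have hA := good_idLink (Z := (A.tens unitObj).neg.Leaf ⊕ A.Leaf) A
    (e := fun x => Sum.inl (Sum.inr x)) (d := Sum.inr)
    (by rintro (x | x) (y | y) h <;> cases h <;> rfl)
  refine good_par_iff.2 (hA.bot fun h => ?_)
  obtain ⟨p | p, h⟩ := mem_names_idLink h <;> cases h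

/-- The linking of the inverse of the left unitor. -/
def leftUnitInvLink (A : Formula 𝒜) : Linking 𝒜 (A.neg.Leaf ⊕ (unitObj.tens A).Leaf) :=
  .par (.one (Sum.inr (Sum.inl ()))) (idLink A Sum.inl fun x => Sum.inr (Sum.inr x))

theorem good_leftUnitInvLink (A : Formula 𝒜) : GoodFor A (unitObj.tens A) (leftUnitInvLink A) := by
  rw [GoodFor, seq₂, Formula.tree_tens_map]
  have hA := good_idLink (Z := A.neg.Leaf ⊕ (unitObj.tens A).Leaf) A
    (e := Sum.inl) (d := fun x => Sum.inr (Sum.inr x))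
    (by rintro (x | x) (y | y) h <;> cases h <;> rfl)
  refine ((good_one (Sum.inr (Sum.inl ()))).tens hA.swap fun x hx hx' => ?_).swap
  obtain rfl := List.mem_singleton.1 hx
  obtain ⟨p | p, h⟩ := mem_names_idLink hx' <;> cases h

def Hom.symm (A B : Formula 𝒜) : Hom (A.tens B) (B.tens A) := Hom.ofGood (good_symmLink A B)

def Hom.assoc (A B C : Formula 𝒜) : Hom (A.tens (B.tens C)) ((A.tens B).tens C) :=
  Hom.ofGood (good_assocLink A B C)

def Hom.leftUnit (A : Formula 𝒜) : Hom (unitObj.tens A) A := Hom.ofGood (good_leftUnitLink A)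

def Hom.rightUnit (A : Formula 𝒜) : Hom (A.tens unitObj) A := Hom.ofGood (good_rightUnitLink A)

def Hom.leftUnitInv (A : Formula 𝒜) : Hom A (unitObj.tens A) :=
  Hom.ofGood (good_leftUnitInvLink A)

theorem isInj_symm (A B : Formula 𝒜) :
    IsInj (Hom.symm A B) (Sum.elim Sum.inr Sum.inl : A.Leaf ⊕ B.Leaf → B.Leaf ⊕ A.Leaf) :=
  ⟨_, Hom.ofGood_rep _, fun x y => (injRel_tens _ _ x y).trans ((or_congr
    (mem_wires_idLink_map (by intro; rfl) (by intro; rfl) x y)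
    (mem_wires_idLink_map (by intro; rfl) (by intro; rfl) x y)).trans Linking.mem_wires_par_map)⟩

theorem isInj_assoc (A B C : Formula 𝒜) : IsInj (Hom.assoc A B C)
    (Sum.elim (fun a => Sum.inl (Sum.inl a)) (Sum.elim (fun b => Sum.inl (Sum.inr b)) Sum.inr) :
      A.Leaf ⊕ B.Leaf ⊕ C.Leaf → (A.Leaf ⊕ B.Leaf) ⊕ C.Leaf) :=
  ⟨_, Hom.ofGood_rep _, fun x y => (injRel_tens _ _ x y).trans ((or_congr
    (mem_wires_idLink_map (by intro; rfl) (by intro; rfl) x y)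
    ((injRel_tens _ _ x y).trans ((or_congr
      (mem_wires_idLink_map (by intro; rfl) (by intro; rfl) x y)
      (mem_wires_idLink_map (by intro; rfl) (by intro; rfl) x y)).trans
        Linking.mem_wires_par_map))).trans Linking.mem_wires_par_map)⟩

theorem isInj_leftUnitInv (A : Formula 𝒜) :
    IsInj (Hom.leftUnitInv A) (Sum.inr : A.Leaf → Unit ⊕ A.Leaf) :=
  by
  refine ⟨_, Hom.ofGood_rep _, fun x y => Iff.trans ?_ Linking.mem_wires_par_map⟩
  exact (mem_wires_idLink_map (by intro; rfl) (by intro; rfl) x y).trans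
    (or_iff_right List.not_mem_nil).symm

/-- Two arrows between `A` and `A` with a further unit are inverse to each other if both are
identical on the leaves of `A`. -/
theorem unit_comp_eq_id {U : Formula 𝒜} {f : Hom U A} {g : Hom A U} {i : A.Leaf → U.Leaf}
    {u : U.Leaf} {R : U.Leaf ⊕ A.Leaf → U.Leaf ⊕ A.Leaf → Prop} (hi : Function.Injective i)
    (hu : ∀ a, i a ≠ u) (hl : U.label u = .one) (hg : IsInj g i)
    (hf : Draws f Sum.inl Sum.inr R)
    (hR : ∀ x y, R x y → x = Sum.inl u ∨ injRel A (fun a => Sum.inl (i a)) Sum.inr x y) :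
    f.comp g = Hom.id U ∧ g.comp f = Hom.id A := by
  constructor
  · have h := (hf.push (Sum.map _root_.id i)).comp_inj (d := Sum.inr) hg injective_inl_inr
    refine h.ext_bot (isInj_id U) injective_inl_inr (p := Sum.inl u)
      (by show (U.label u).dual = _; rw [hl]; rfl) ?_
    rintro _ _ ⟨p, q, hpq, rfl, rfl⟩
    rcases hR _ _ hpq with rfl | ⟨a, ⟨ha, rfl, rfl⟩ | ⟨ha, rfl, rfl⟩⟩
    · exact Or.inl rfl
    · exact Or.inr ⟨i a, Or.inl ⟨fun h => ha ((hg.isNeg_label a).1 h), rfl, rfl⟩⟩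
    · exact Or.inr ⟨i a, Or.inr ⟨(hg.isNeg_label a).2 ha, rfl, rfl⟩⟩
  · refine (hf.inj_comp hg injective_inl_inr hi fun _ _ => Iff.rfl).ext
      ((isInj_id A).draws _ _) ?_ ?_
    · rintro (x | x) (y | y) h
      · exact congrArg _ (hi (Sum.inl.inj h))
      · cases h
      · cases h
      · exact congrArg _ (Sum.inr.inj h)
    · rintro x y ⟨h, ⟨p, rfl⟩, -⟩
      refine (hR _ _ h).resolve_left fun h => ?_
      rcases p with p | p
      · exact hu p (Sum.inl.inj h)
      · cases h

theorem unit_wires {U : Formula 𝒜} {f : Hom U A} {i : A.Leaf → U.Leaf} {u : U.neg.Leaf}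
    {e : A.neg.Leaf → U.neg.Leaf} (hf : f.Rep (.botTens (Sum.inl u)
      (idLink A (fun a => Sum.inl (e a)) Sum.inr)))
    (he : ∀ a, U.undual (e a) = i (A.undual a)) : ∃ R, Draws f Sum.inl Sum.inr R ∧
      ∀ x y, R x y → x = Sum.inl (U.undual u) ∨
        injRel A (fun a => Sum.inl (i a)) Sum.inr x y := by
  refine ⟨_, ⟨_, hf, fun _ _ => Iff.rfl⟩, fun x y h => ?_⟩
  rcases List.mem_cons.1 h with h | h
  · exact Or.inl (congrArg Prod.fst h)
  · exact Or.inr ((mem_wires_idLink_map (by intro a; exact congrArg Sum.inl (he a))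
      (by intro; rfl) x y).2 h)

theorem leftUnit_iso (A : Formula 𝒜) :
    (Hom.leftUnit A).comp (Hom.leftUnitInv A) = Hom.id _ ∧
      (Hom.leftUnitInv A).comp (Hom.leftUnit A) = Hom.id _ := by
  obtain ⟨R, hR, hR'⟩ := unit_wires (f := Hom.leftUnit A) (Hom.ofGood_rep _)
    (i := (Sum.inr : A.Leaf → Unit ⊕ A.Leaf)) fun _ => rfl
  exact unit_comp_eq_id Sum.inr_injective (fun a h => by cases h) rfl (isInj_leftUnitInv A) hR hR'

noncomputable def Hom.rightUnitInv (A : Formula 𝒜) : Hom A (A.tens unitObj) :=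
  (Hom.leftUnitInv A).comp (Hom.symm _ _)

theorem isInj_rightUnitInv (A : Formula 𝒜) :
    IsInj (Hom.rightUnitInv A) (Sum.inl : A.Leaf → A.Leaf ⊕ Unit) :=
  (isInj_leftUnitInv A).comp (isInj_symm _ _)

theorem rightUnit_iso (A : Formula 𝒜) :
    (Hom.rightUnit A).comp (Hom.rightUnitInv A) = Hom.id _ ∧
      (Hom.rightUnitInv A).comp (Hom.rightUnit A) = Hom.id _ := by
  obtain ⟨R, hR, hR'⟩ := unit_wires (f := Hom.rightUnit A) (Hom.ofGood_rep _)
    (i := (Sum.inl : A.Leaf → A.Leaf ⊕ Unit)) fun _ => rfl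
  exact unit_comp_eq_id Sum.inl_injective (fun a h => by cases h) rfl (isInj_rightUnitInv A) hR hR'

noncomputable def Hom.assocInv (A B C : Formula 𝒜) :
    Hom ((A.tens B).tens C) (A.tens (B.tens C)) :=
  (Hom.symm _ _).comp ((Hom.assoc _ _ _).comp ((Hom.symm _ _).comp ((Hom.assoc _ _ _).comp
    (Hom.symm _ _))))

theorem isInj_assocInv (A B C : Formula 𝒜) : IsInj (Hom.assocInv A B C)
    (Sum.elim (Sum.elim Sum.inl fun b => Sum.inr (Sum.inl b)) fun c => Sum.inr (Sum.inr c) :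
      (A.Leaf ⊕ B.Leaf) ⊕ C.Leaf → A.Leaf ⊕ B.Leaf ⊕ C.Leaf) := by
  have h := (isInj_symm (A.tens B) C).comp ((isInj_assoc _ _ _).comp ((isInj_symm _ B).comp
    ((isInj_assoc _ _ _).comp (isInj_symm _ A))))
  refine Eq.subst (motive := IsInj _) (funext ?_) h
  rintro ((x | x) | x) <;> rfl

theorem Hom.assocInv_natural (f : Hom A A') (g : Hom B B') (h : Hom C C') :
    ((f.tens g).tens h).comp (Hom.assocInv A' B' C') =
      (Hom.assocInv A B C).comp (f.tens (g.tens h)) := by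
  let e : (A.tens (B.tens C)).Leaf → (A.tens (B.tens C)).Leaf ⊕ (A'.tens (B'.tens C')).Leaf :=
    Sum.inl
  let d : (A'.tens (B'.tens C')).Leaf →
      (A.tens (B.tens C)).Leaf ⊕ (A'.tens (B'.tens C')).Leaf := Sum.inr
  obtain ⟨R, hR⟩ := exists_draws f (fun a => e (Sum.inl a)) (fun b => d (Sum.inl b))
  obtain ⟨S, hS⟩ := exists_draws g (fun a => e (Sum.inr (Sum.inl a)))
    (fun b => d (Sum.inr (Sum.inl b)))
  obtain ⟨T, hT⟩ := exists_draws h (fun a => e (Sum.inr (Sum.inr a)))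
    (fun b => d (Sum.inr (Sum.inr b)))
  refine comp_eq_comp_of_draws (Draws.tens (Draws.tens hR hS) hT) (Draws.tens hR (Draws.tens hS hT))
    (isInj_assocInv _ _ _) (isInj_assocInv _ _ _) ?_ fun x y => or_assoc.1
  rintro ((x | x) | x) ((y | y) | y) h <;> cases h <;> rfl

theorem Hom.symm_natural (f : Hom A A') (g : Hom B B') :
    (f.tens g).comp (Hom.symm A' B') = (Hom.symm A B).comp (g.tens f) := by
  let e : (B.tens A).Leaf → (B.tens A).Leaf ⊕ (B'.tens A').Leaf := Sum.inl
  let d : (B'.tens A').Leaf → (B.tens A).Leaf ⊕ (B'.tens A').Leaf := Sum.inr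
  obtain ⟨R, hR⟩ := exists_draws f (fun a => e (Sum.inr a)) (fun b => d (Sum.inr b))
  obtain ⟨S, hS⟩ := exists_draws g (fun a => e (Sum.inl a)) (fun b => d (Sum.inl b))
  refine comp_eq_comp_of_draws (Draws.tens hR hS) (Draws.tens hS hR) (isInj_symm _ _)
    (isInj_symm _ _) ?_ fun x y => Or.symm
  rintro (x | x) (y | y) h <;> cases h <;> rfl

theorem Hom.leftUnitInv_natural (f : Hom A B) :
    f.comp (Hom.leftUnitInv B) = (Hom.leftUnitInv A).comp ((Hom.id unitObj).tens f) := by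
  let e : (unitObj.tens A).Leaf → (unitObj.tens A).Leaf ⊕ (unitObj.tens B).Leaf := Sum.inl
  let d : (unitObj.tens B).Leaf → (unitObj.tens A).Leaf ⊕ (unitObj.tens B).Leaf := Sum.inr
  obtain ⟨R, hR⟩ := exists_draws f (fun a => e (Sum.inr a)) (fun b => d (Sum.inr b))
  exact comp_eq_comp_of_draws hR (Draws.tens ((isInj_id _).draws _ _) hR) (isInj_leftUnitInv _)
    (isInj_leftUnitInv _) Sum.inr_injective fun x y => Or.inr

theorem Hom.rightUnitInv_natural (f : Hom A B) :
    f.comp (Hom.rightUnitInv B) = (Hom.rightUnitInv A).comp (f.tens (Hom.id unitObj)) := by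
  rw [Hom.rightUnitInv, Hom.rightUnitInv, ← Hom.comp_assoc, Hom.leftUnitInv_natural,
    Hom.comp_assoc, Hom.comp_assoc, Hom.symm_natural]

end StructuralArrows


section DoubleDual

variable {𝒜 : Type u} {A B C D A' B' D' : Formula 𝒜}

theorem heq_inl {X X' Y Y' : Type} (hX : X = X') (hY : Y = Y') {x : X} {x' : X'} (h : HEq x x') :
    HEq (Sum.inl x : X ⊕ Y) (Sum.inl x' : X' ⊕ Y') := by
  subst hX hY
  rw [eq_of_heq h]

theorem heq_inr {X X' Y Y' : Type} (hX : X = X') (hY : Y = Y') {y : Y} {y' : Y'} (h : HEq y y') :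
    HEq (Sum.inr y : X ⊕ Y) (Sum.inr y' : X' ⊕ Y') := by
  subst hX hY
  rw [eq_of_heq h]

theorem Formula.heq_undual_undual (A : Formula 𝒜) (a : A.neg.neg.Leaf) :
    HEq (A.undual (A.neg.undual a)) a := by
  induction A with
  | lit l => cases l <;> exact HEq.rfl
  | tens A B ih ih' =>
    rcases a with a | a
    · exact heq_inl (congrArg _ A.neg_neg).symm (congrArg _ B.neg_neg).symm (ih a)
    · exact heq_inr (congrArg _ A.neg_neg).symm (congrArg _ B.neg_neg).symm (ih' a)
  | par A B ih ih' =>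
    rcases a with a | a
    · exact heq_inl (congrArg _ A.neg_neg).symm (congrArg _ B.neg_neg).symm (ih a)
    · exact heq_inr (congrArg _ A.neg_neg).symm (congrArg _ B.neg_neg).symm (ih' a)

theorem Formula.heq_dualLeaf_dualLeaf (A : Formula 𝒜) (a : A.Leaf) :
    HEq (A.neg.dualLeaf (A.dualLeaf a)) a := by
  have h := A.heq_undual_undual (A.neg.dualLeaf (A.dualLeaf a))
  rw [A.neg.undual_dualLeaf, A.undual_dualLeaf] at h
  exact h.symm

/-- The identity as an arrow between two equal formulas. -/
def Hom.cast (h : A = B) : Hom A B := h ▸ Hom.id A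

theorem isInj_cast (h : A = B) {s : A.Leaf → B.Leaf} (hs : ∀ a, HEq (s a) a) :
    IsInj (Hom.cast h) s := by
  subst h
  obtain rfl : s = fun a => a := funext fun a => eq_of_heq (hs a)
  exact isInj_id A

theorem Hom.comp_cast_heq (f : Hom A B) (h : B = C) : HEq (f.comp (Hom.cast h)) f := by
  subst h
  exact heq_of_eq f.comp_id

theorem Hom.neg_neg_comp_cast (f : Hom A B) :
    f.neg.neg.comp (Hom.cast B.neg_neg) = (Hom.cast A.neg_neg).comp f := by
  obtain ⟨R, hR⟩ := exists_draws f (Sum.inl : _ → A.Leaf ⊕ B.Leaf) Sum.inr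
  exact comp_eq_comp_of_draws hR.neg.neg hR (isInj_cast _ B.heq_undual_undual)
    (isInj_cast _ A.heq_undual_undual) (A.undual_injective.comp A.neg.undual_injective)
    fun _ _ => _root_.id

theorem Formula.par_eq (A B : Formula 𝒜) : A.par B = (B.neg.tens A.neg).neg :=
  (congrArg₂ Formula.par A.neg_neg B.neg_neg).symm

/-- The leaves of `(B^⊥ ⊗ A^⊥)^⊥` as leaves of `A ⅋ B`. -/
def parLeaf (A B : Formula 𝒜) (x : (B.neg.tens A.neg).neg.Leaf) : A.Leaf ⊕ B.Leaf :=
  Sum.map (fun x => A.undual (A.neg.undual x)) (fun x => B.undual (B.neg.undual x)) x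

theorem parLeaf_injective (A B : Formula 𝒜) : Function.Injective (parLeaf A B) :=
  Function.Injective.sumMap (A.undual_injective.comp A.neg.undual_injective)
    (B.undual_injective.comp B.neg.undual_injective)

theorem exists_isInj_par (A B : Formula 𝒜) : ∃ s : (A.par B).Leaf → (B.neg.tens A.neg).neg.Leaf,
    IsInj (Hom.cast (Formula.par_eq A B)) s ∧ ∀ x, parLeaf A B (s x) = x := by
  refine ⟨Sum.map (fun x => A.neg.dualLeaf (A.dualLeaf x)) (fun x => B.neg.dualLeaf (B.dualLeaf x)),
    isInj_cast _ ?_, ?_⟩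
  · rintro (x | x)
    · exact heq_inl (congrArg _ A.neg_neg) (congrArg _ B.neg_neg) (A.heq_dualLeaf_dualLeaf x)
    · exact heq_inr (congrArg _ A.neg_neg) (congrArg _ B.neg_neg) (B.heq_dualLeaf_dualLeaf x)
  · rintro (x | x)
    · exact congrArg Sum.inl ((congrArg A.undual (A.neg.undual_dualLeaf _)).trans
        (A.undual_dualLeaf x))
    · exact congrArg Sum.inr ((congrArg B.undual (B.neg.undual_dualLeaf _)).trans
        (B.undual_dualLeaf x))

theorem Hom.comp_cast_cast (f : Hom A B) (h : B = C) (h' : C = B) :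
    (f.comp (Hom.cast h)).comp (Hom.cast h') = f := by
  subst h
  exact (Hom.comp_id _).trans (Hom.comp_id _)

/-- Currying with values in `Hom(A, (B^⊥⊥ ⊗ C^⊥)^⊥)`. -/
noncomputable def Hom.curryCast : Hom (A.tens B) C ≃ Hom A (B.neg.neg.tens C.neg).neg where
  toFun f := (Hom.curry f).comp (Hom.cast (Formula.par_eq C B.neg))
  invFun g := Hom.curry.symm (g.comp (Hom.cast (Formula.par_eq C B.neg).symm))
  left_inv _ := (congrArg Hom.curry.symm (Hom.comp_cast_cast _ _ _)).trans
    (Equiv.symm_apply_apply _ _)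
  right_inv g := (congrArg (fun k => Hom.comp k _) (Equiv.apply_symm_apply _ _)).trans
    (g.comp_cast_cast _ _)

theorem Draws.curryCast {Z : Type v} {f : Hom (A.tens B) C} {e : (A.tens B).Leaf → Z}
    {d : C.Leaf → Z} {k : C.Leaf ⊕ B.neg.Leaf → Z} {R : Z → Z → Prop} (hf : Draws f e d R)
    (hd : ∀ c, k (Sum.inl c) = d c) (hd' : ∀ b, k (Sum.inr b) = e (Sum.inr (B.undual b)))
    (hi : Function.Injective (Sum.elim (fun a => e (Sum.inl a))
      fun x => k (parLeaf C B.neg x))) :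
    Draws (Hom.curryCast f) (fun a => e (Sum.inl a)) (fun x => k (parLeaf C B.neg x)) R := by
  obtain ⟨s, hs, hs'⟩ := exists_isInj_par C B.neg
  exact ((hf.curry (d' := k) hd hd').cast (fun _ => rfl)
    fun x => congrArg k (hs' x)).comp_inj (d := fun x => k (parLeaf C B.neg x)) hs hi

theorem Hom.curryCast_natural (h : Hom A' A) (m : Hom B' B) (l : Hom D D')
    (f : Hom (A.tens B) D) : Hom.curryCast ((h.tens m).comp (f.comp l)) =
      h.comp ((Hom.curryCast f).comp (m.neg.neg.tens l.neg).neg) := by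
  let Z := A'.Leaf ⊕ A.Leaf ⊕ (D.Leaf ⊕ B.Leaf) ⊕ (D'.Leaf ⊕ B'.Leaf)
  let q : D.Leaf ⊕ B.Leaf → Z := fun x => Sum.inr (Sum.inr (Sum.inl x))
  let q' : D'.Leaf ⊕ B'.Leaf → Z := fun x => Sum.inr (Sum.inr (Sum.inr x))
  let eA' : A'.Leaf → Z := Sum.inl
  let eA : A.Leaf → Z := fun a => Sum.inr (Sum.inl a)
  let eD : D.Leaf → Z := fun x => q (Sum.inl x)
  let eB : B.Leaf → Z := fun x => q (Sum.inr x)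
  let eD' : D'.Leaf → Z := fun x => q' (Sum.inl x)
  let eB' : B'.Leaf → Z := fun x => q' (Sum.inr x)
  let k : D.Leaf ⊕ B.neg.Leaf → Z := Sum.elim eD fun b => eB (B.undual b)
  let k' : D'.Leaf ⊕ B'.neg.Leaf → Z := Sum.elim eD' fun b => eB' (B'.undual b)
  let n : (B.neg.neg.tens D.neg).neg.Leaf → Z := fun x => k (parLeaf D B.neg x)
  let n' : (B'.neg.neg.tens D'.neg).neg.Leaf → Z := fun x => k' (parLeaf D' B'.neg x)
  have hk : ∀ x, k x = q (Sum.map _root_.id B.undual x) := by rintro (x | x) <;> rfl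
  have hk' : ∀ x, k' x = q' (Sum.map _root_.id B'.undual x) := by rintro (x | x) <;> rfl
  have hn : Function.Injective fun x => Sum.map _root_.id B.undual (parLeaf D B.neg x) :=
    (Function.Injective.sumMap Function.injective_id B.undual_injective).comp
      (parLeaf_injective D B.neg)
  have hn' : Function.Injective fun x => Sum.map _root_.id B'.undual (parLeaf D' B'.neg x) :=
    (Function.Injective.sumMap Function.injective_id B'.undual_injective).comp
      (parLeaf_injective D' B'.neg)
  have hnq : n = fun x => q (Sum.map _root_.id B.undual (parLeaf D B.neg x)) := funext fun x => hk _
  have hnq' : n' = fun x => q' (Sum.map _root_.id B'.undual (parLeaf D' B'.neg x)) :=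
    funext fun x => hk' _
  have inj2 : ∀ {X Y W : Type} {a : X → Z} {m : Y → W} {b : W → Z}, Function.Injective m →
      Function.Injective (Sum.elim a b) → Function.Injective (Sum.elim a fun y => b (m y)) := by
    intro X Y W a m b hm hab
    have := hab.comp (Function.Injective.sumMap Function.injective_id hm)
    rwa [Sum.elim_comp_map] at this
  have inj3 : ∀ {X Y W Y' W' : Type} {a : X → Z} {m : Y → W} {b : W → Z} {m' : Y' → W'}
      {b' : W' → Z}, Function.Injective m → Function.Injective m' →
      Function.Injective (Sum.elim a (Sum.elim b b')) →
      Function.Injective (Sum.elim a (Sum.elim (fun y => b (m y)) fun y => b' (m' y))) := by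
    intro X Y W Y' W' a m b m' b' hm hm' hab
    have := hab.comp (Function.Injective.sumMap Function.injective_id
      (Function.Injective.sumMap hm hm'))
    rwa [Sum.elim_comp_map, Sum.elim_comp_map] at this
  obtain ⟨R, hR⟩ := exists_draws h eA' eA
  obtain ⟨M, hM⟩ := exists_draws m eB' eB
  obtain ⟨L, hL⟩ := exists_draws l eD eD'
  obtain ⟨F, hF⟩ := exists_draws f (Sum.elim eA eB : (A.tens B).Leaf → Z) eD
  have h1 := ((Draws.tens (e := (Sum.elim eA' eB' : (A'.tens B').Leaf → Z))
    (d := (Sum.elim eA eB : (A.tens B).Leaf → Z)) hR hM).comp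
    (hF.comp hL (by rintro ((x | x) | x | x) ((y | y) | y | y) h <;> cases h <;> rfl)) (by
      rintro ((x | x) | (x | x) | x) ((y | y) | (y | y) | y) h <;> cases h <;> rfl)).curryCast
    (k := k') (fun _ => rfl) (fun _ => rfl) (by
      show Function.Injective (Sum.elim eA' n')
      rw [hnq']
      exact inj2 hn' (by rintro (x | x) (y | y) h <;> cases h <;> rfl))
  have hc : Draws (Hom.curryCast f) eA n F := hF.curryCast (k := k) (fun _ => rfl) (fun _ => rfl) (by
      show Function.Injective (Sum.elim eA n)
      rw [hnq]
      exact inj2 hn (by rintro (x | x) (y | y) h <;> cases h <;> rfl))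
  have hp : Draws (m.neg.neg.tens l.neg).neg n n' fun x y => M x y ∨ L x y := by
    refine (Draws.tens (e := Sum.elim (fun b => eB' (B'.undual (B'.neg.undual b)))
      fun x => eD' (D'.undual x)) (d := Sum.elim (fun b => eB (B.undual (B.neg.undual b)))
      fun x => eD (D.undual x)) hM.neg.neg hL.neg).neg.cast ?_ ?_
    · rintro (x | x) <;> rfl
    · rintro (x | x) <;> rfl
  have h2 := hR.comp (hc.comp hp (by
      rw [hnq, hnq']
      exact inj3 hn hn' (by rintro (x | x | x) (y | y | y) h <;> cases h <;> rfl))) (by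
      rw [hnq']
      exact inj3 (a := eA') (m := _root_.id) (b := eA) Function.injective_id hn' (by
        rintro (x | x | x) (y | y | y) h <;> cases h <;> rfl))
  refine h1.ext h2 (by
      show Function.Injective (Sum.elim eA' n')
      rw [hnq']
      exact inj2 hn' (by rintro (x | x) (y | y) h <;> cases h <;> rfl)) fun x y hxy => ?_
  obtain ⟨hx, hy⟩ := h1.visible hxy
  obtain ⟨-, -, hxy⟩ := hxy
  have hH : ∀ z, (∃ w, z = q w) → ¬ Visible eA' n' z := by
    rintro _ ⟨w, rfl⟩ ⟨p | p, hp⟩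
    · cases hp
    · cases hp.trans (congrFun hnq' p)
  refine ⟨hx, hy, transGen_compDraw (H := fun z => ∃ w, z = q w)
    (T := fun x y => (F x y ∨ M x y ∨ L x y) ∨ R x y) (fun _ _ h => h) ?_ ?_
    (fun h => hH _ h hx) (fun h => hH _ h hy) (transGen_of_compDraw ?_ ?_ hxy)⟩
  · intro x y h
    have hv : ∀ z, Visible eA' eA z → ¬ ∃ w, z = q w := by
      rintro _ ⟨p | p, rfl⟩ ⟨w, hw⟩ <;> cases hw
    exact ⟨hv x (hR.visible h).1, hv y (hR.visible h).2⟩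
  · have hv : ∀ z, Visible eA n z → (∃ w, z = q w) ∨ Visible eA n' z := by
      rintro _ ⟨p | p, rfl⟩
      · exact Or.inr ⟨.inl p, rfl⟩
      · exact Or.inl ⟨_, congrFun hnq p⟩
    have hv' : ∀ z, Visible n n' z → (∃ w, z = q w) ∨ Visible eA n' z := by
      rintro _ ⟨p | p, rfl⟩
      · exact Or.inl ⟨_, congrFun hnq p⟩
      · exact Or.inr ⟨.inr p, rfl⟩
    rintro x y (h | h)
    · exact ⟨hv x (hc.visible h).1, hv y (hc.visible h).2⟩
    · exact ⟨hv' x (hp.visible h).1, hv' y (hp.visible h).2⟩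
  · rintro x y (h | h)
    exacts [Or.inl (Or.inl h), Or.inl (Or.inr (Or.inr h))]
  · rintro x y (h | h)
    exacts [Or.inr h, Or.inl (Or.inr (Or.inl h))]

end DoubleDual


section Coherence

variable {𝒜 : Type u} {A B C D A' B' : Formula 𝒜}

theorem Hom.natural_of_inverse {f : Hom A B} {f' : Hom A' B'} {i : Hom A' A} {j : Hom A A'}
    {i' : Hom B' B} {j' : Hom B B'} (hi : i.comp j = Hom.id A') (hj : j'.comp i' = Hom.id B)
    (h : f.comp j' = j.comp f') : f'.comp i' = i.comp f := by
  rw [← f'.id_comp, ← hi, Hom.comp_assoc i, ← h, Hom.comp_assoc, Hom.comp_assoc, hj, Hom.comp_id]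

theorem Hom.leftUnit_natural (f : Hom A B) : ((Hom.id unitObj).tens f).comp (Hom.leftUnit B) =
    (Hom.leftUnit A).comp f :=
  Hom.natural_of_inverse (leftUnit_iso A).1 (leftUnit_iso B).2 f.leftUnitInv_natural

theorem Hom.rightUnit_natural (f : Hom A B) : (f.tens (Hom.id unitObj)).comp (Hom.rightUnit B) =
    (Hom.rightUnit A).comp f :=
  Hom.natural_of_inverse (rightUnit_iso A).1 (rightUnit_iso B).2 f.rightUnitInv_natural

theorem Hom.assoc_comp_assocInv (A B C : Formula 𝒜) :
    (Hom.assoc A B C).comp (Hom.assocInv A B C) = Hom.id _ :=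
  ((isInj_assoc A B C).comp (isInj_assocInv A B C)).ext (isInj_id _)
    (by rintro (x | x | x) <;> rfl)

theorem Hom.assocInv_comp_assoc (A B C : Formula 𝒜) :
    (Hom.assocInv A B C).comp (Hom.assoc A B C) = Hom.id _ :=
  ((isInj_assocInv A B C).comp (isInj_assoc A B C)).ext (isInj_id _)
    (by rintro ((x | x) | x) <;> rfl)

theorem Hom.symm_comp_symm (A B : Formula 𝒜) :
    (Hom.symm A B).comp (Hom.symm B A) = Hom.id _ :=
  ((isInj_symm A B).comp (isInj_symm B A)).ext (isInj_id _) (by rintro (x | x) <;> rfl)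

theorem Hom.pentagon (A B C D : Formula 𝒜) :
    ((Hom.assocInv A B C).tens (Hom.id D)).comp ((Hom.assocInv A (B.tens C) D).comp
      ((Hom.id A).tens (Hom.assocInv B C D))) =
    (Hom.assocInv (A.tens B) C D).comp (Hom.assocInv A B (C.tens D)) :=
  (((isInj_assocInv A B C).tens (isInj_id D)).comp ((isInj_assocInv A (B.tens C) D).comp
    ((isInj_id A).tens (isInj_assocInv B C D)))).ext
    ((isInj_assocInv (A.tens B) C D).comp (isInj_assocInv A B (C.tens D)))
    (by rintro (((x | x) | x) | x) <;> rfl)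

theorem Hom.triangle (A B : Formula 𝒜) :
    (Hom.assocInv A unitObj B).comp ((Hom.id A).tens (Hom.leftUnit B)) =
      (Hom.rightUnit A).tens (Hom.id B) := by
  have h : ((Hom.rightUnitInv A).tens (Hom.id B)).comp (Hom.assocInv A unitObj B) =
      (Hom.id A).tens (Hom.leftUnitInv B) :=
    (((isInj_rightUnitInv A).tens (isInj_id B)).comp (isInj_assocInv A unitObj B)).ext
      ((isInj_id A).tens (isInj_leftUnitInv B)) (by rintro (x | x) <;> rfl)
  have h' : ((Hom.rightUnit A).tens (Hom.id B)).comp ((Hom.rightUnitInv A).tens (Hom.id B)) =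
      Hom.id _ := by
    rw [Hom.tens_comp_tens, (rightUnit_iso A).1, Hom.comp_id, Hom.id_tens_id]
  rw [← Hom.id_comp (Hom.comp _ _), ← h', Hom.comp_assoc,
    ← Hom.comp_assoc (Hom.tens (Hom.rightUnitInv A) _), h, Hom.tens_comp_tens, (leftUnit_iso B).2,
    Hom.comp_id, Hom.id_tens_id, Hom.comp_id]

theorem Hom.hexagon_forward (A B C : Formula 𝒜) :
    (Hom.assocInv A B C).comp ((Hom.symm A (B.tens C)).comp (Hom.assocInv B C A)) =
      ((Hom.symm A B).tens (Hom.id C)).comp ((Hom.assocInv B A C).comp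
        ((Hom.id B).tens (Hom.symm A C))) :=
  ((isInj_assocInv A B C).comp ((isInj_symm A (B.tens C)).comp (isInj_assocInv B C A))).ext
    (((isInj_symm A B).tens (isInj_id C)).comp ((isInj_assocInv B A C).comp
        ((isInj_id B).tens (isInj_symm A C))))
    (by rintro ((x | x) | x) <;> rfl)

theorem Hom.hexagon_reverse (A B C : Formula 𝒜) :
    (Hom.assoc A B C).comp ((Hom.symm (A.tens B) C).comp (Hom.assoc C A B)) =
      ((Hom.id A).tens (Hom.symm B C)).comp ((Hom.assoc A C B).comp
        ((Hom.symm A C).tens (Hom.id B))) :=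
  ((isInj_assoc A B C).comp ((isInj_symm (A.tens B) C).comp (isInj_assoc C A B))).ext
    (((isInj_id A).tens (isInj_symm B C)).comp ((isInj_assoc A C B).comp
        ((isInj_symm A C).tens (isInj_id B))))
    (by rintro (x | x | x) <;> rfl)

end Coherence

section Structures

variable (𝒜 : Type u)

/-- The category structure on the formulas whose arrows are the proof nets. -/
@[reducible]
noncomputable def formulaCategory : Category.{u} (Formula 𝒜) := (netCategory 𝒜).toCategory

attribute [local instance] formulaCategory

/-- The monoidal structure on the category of proof nets. -/
@[reducible]
noncomputable def formulaMonoidalStruct : MonoidalCategoryStruct (Formula 𝒜) where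
  tensorObj := Formula.tens
  whiskerLeft X _ _ f := Hom.tens (Hom.id X) f
  whiskerRight f Y := Hom.tens f (Hom.id Y)
  tensorHom f g := Hom.tens f g
  tensorUnit := unitObj
  associator A B C :=
    ⟨Hom.assocInv A B C, Hom.assoc A B C, Hom.assocInv_comp_assoc A B C,
      Hom.assoc_comp_assocInv A B C⟩
  leftUnitor A := ⟨Hom.leftUnit A, Hom.leftUnitInv A, (leftUnit_iso A).1, (leftUnit_iso A).2⟩
  rightUnitor A := ⟨Hom.rightUnit A, Hom.rightUnitInv A, (rightUnit_iso A).1, (rightUnit_iso A).2⟩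

attribute [local instance] formulaMonoidalStruct

@[reducible]
noncomputable def formulaMonoidal : MonoidalCategory (Formula 𝒜) :=
  MonoidalCategory.ofTensorHom
    (id_tensorHom_id := Hom.id_tens_id)
    (id_tensorHom := fun _ _ _ _ => rfl)
    (tensorHom_id := fun _ _ => rfl)
    (tensorHom_comp_tensorHom := fun f f' g g' => Hom.tens_comp_tens f f' g g')
    (associator_naturality := fun f g h => Hom.assocInv_natural f g h)
    (leftUnitor_naturality := fun f => Hom.leftUnit_natural f)
    (rightUnitor_naturality := fun f => Hom.rightUnit_natural f)
    (pentagon := Hom.pentagon)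
    (triangle := Hom.triangle)

attribute [local instance] formulaMonoidal

@[reducible]
noncomputable def formulaSymmetric : SymmetricCategory (Formula 𝒜) where
  braiding A B := ⟨Hom.symm A B, Hom.symm B A, Hom.symm_comp_symm A B, Hom.symm_comp_symm B A⟩
  braiding_naturality_right A _ _ f := Hom.symm_natural (Hom.id A) f
  braiding_naturality_left f A := Hom.symm_natural f (Hom.id A)
  hexagon_forward := Hom.hexagon_forward
  hexagon_reverse := Hom.hexagon_reverse
  symmetry := Hom.symm_comp_symm

attribute [local instance] formulaSymmetric

/-- Negation as a contravariant functor. -/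
noncomputable def formulaNeg : (Formula 𝒜)ᵒᵖ ⥤ Formula 𝒜 where
  obj A := A.unop.neg
  map f := Hom.neg f.unop
  map_id A := Hom.neg_id A.unop
  map_comp f g := Hom.neg_comp g.unop f.unop

theorem eqToHom_eq_cast {A B : Formula 𝒜} (h : A = B) : eqToHom h = Hom.cast h := by
  subst h
  rfl

/-- The *-autonomous structure on the category of proof nets. -/
noncomputable def formulaStarAutonomous : StarAutonomous (Formula 𝒜) where
  neg := formulaNeg 𝒜
  doubleNeg := NatIso.ofComponents (fun A => eqToIso A.neg_neg) fun {A B} f => by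
    show Hom.comp (Hom.neg (Hom.neg f)) (eqToHom B.neg_neg) = Hom.comp (eqToHom A.neg_neg) f
    rw [eqToHom_eq_cast, eqToHom_eq_cast]
    exact Hom.neg_neg_comp_cast f
  curry _ _ _ := Hom.curryCast
  curry_natural h m l f := Hom.curryCast_natural h m l f

end Structures

end MLL

theorem mainTheorem5 (𝒜 : Type u) :
    ∃ K : CategoryOnNets 𝒜,
      (∀ A, (K.id A).Rep (idLink A Sum.inl Sum.inr)) ∧
      (∀ {A B C : Formula 𝒜} (f : Hom A B) (g : Hom B C), IsComposite f g (K.comp f g)) ∧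
      letI : Category.{u} (Formula 𝒜) := K.toCategory
      ∃ (_ : MonoidalCategory (Formula 𝒜)) (_ : SymmetricCategory (Formula 𝒜))
        (S : StarAutonomous (Formula 𝒜)),
        S.IsStrict ∧
        (∀ A B : Formula 𝒜, A ⊗ B = A.tens B) ∧
        (𝟙_ (Formula 𝒜) = unitObj) ∧
        (∀ (A B C D : Formula 𝒜) (f : A ⟶ B) (g : C ⟶ D) (P : Linking 𝒜 (A.neg.Leaf ⊕ B.Leaf))
          (Q : Linking 𝒜 (C.neg.Leaf ⊕ D.Leaf)), Hom.Rep f P → Hom.Rep g Q →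
          IsNet (f ⊗ₘ g) (A.tens C) (B.tens D) (tensLink P Q)) ∧
        (∀ A B C : Formula 𝒜,
          IsNet (α_ A B C).inv (A.tens (B.tens C)) ((A.tens B).tens C) (assocLink A B C)) ∧
        (∀ A : Formula 𝒜, IsNet (ρ_ A).hom (A.tens unitObj) A (rightUnitLink A)) ∧
        (∀ A : Formula 𝒜, IsNet (λ_ A).hom (unitObj.tens A) A (leftUnitLink A)) ∧
        (∀ A B : Formula 𝒜, IsNet (β_ A B).hom (A.tens B) (B.tens A) (symmLink A B)) ∧
        (∀ A : Formula 𝒜, S.neg.obj (op A) = A.neg) ∧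
        (∀ (A B : Formula 𝒜) (f : A ⟶ B) (P : Linking 𝒜 (A.neg.Leaf ⊕ B.Leaf)), Hom.Rep f P →
          IsNet (S.neg.map f.op) B.neg A.neg (negLink P)) ∧
        (∀ A B : Formula 𝒜, parObj S.neg A B = A.par B) ∧
        (∀ A : Formula 𝒜, A.neg.neg = A) ∧
        (∀ (A B C : Formula 𝒜) (f : A ⊗ B ⟶ C) (P : Linking 𝒜 ((A.tens B).neg.Leaf ⊕ C.Leaf)),
          IsNet f (A.tens B) C P →
          IsNet (S.curry A B C f) A (C.par B.neg) (curryLink P)) := by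
  refine ⟨netCategory 𝒜, Hom.id_rep, fun f g => Hom.isComposite_comp f g, formulaMonoidal 𝒜,
    formulaSymmetric 𝒜, formulaStarAutonomous 𝒜, fun A => ⟨A.neg_neg, rfl⟩, fun _ _ => rfl, rfl,
    fun _ _ _ _ _ _ _ _ hP hQ => ⟨rfl, rfl, _, HEq.rfl, Hom.tens_rep hP hQ⟩,
    fun A B C => ⟨rfl, rfl, _, HEq.rfl, Hom.ofGood_rep (good_assocLink A B C)⟩,
    fun A => ⟨rfl, rfl, _, HEq.rfl, Hom.ofGood_rep (good_rightUnitLink A)⟩,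
    fun A => ⟨rfl, rfl, _, HEq.rfl, Hom.ofGood_rep (good_leftUnitLink A)⟩,
    fun A B => ⟨rfl, rfl, _, HEq.rfl, Hom.ofGood_rep (good_symmLink A B)⟩, fun _ => rfl,
    fun _ _ _ _ hP => ⟨rfl, rfl, _, HEq.rfl, Hom.neg_rep hP⟩,
    fun A B => (Formula.par_eq A B).symm, Formula.neg_neg, ?_⟩
  rintro A B C f P ⟨-, -, g, hg, hP⟩
  obtain rfl := eq_of_heq hg
  exact ⟨rfl, (Formula.par_eq C B.neg).symm, _, Hom.comp_cast_heq _ _, Hom.curry_rep hP⟩
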